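/- **Spaces.** Let $d\ge 1$ and let $\Phi$ be either $\mathcal D$, the space of smooth compactly supported functions $\mathbb R^d\to\mathbb C$, or $\mathcal S$, the Schwartz space of rapidly decreasing smooth functions $\mathbb R^d\to\mathbb C$. Write $\Phi=\operatorname{proj\,lim}_{\tau\in T}\mathcal H_\tau$ with Sobolev spaces: for $\mathcal D$, $T$ is the set of pairs $\tau=(m,w)$ with $m\in\mathbb N_0$, $w\in C^\infty(\mathbb R^d)$, $w\ge 1$, and $\mathcal H_\tau=W^{m,2}(\mathbb R^d,w(x)\,dx)$; for $\mathcal S$, $T=\mathbb N_0$ and $\mathcal H_m=W^{m,2}(\mathbb R^d,(1+|x|^2)^m dx)$. Let $\mathcal H_{-\tau}$ be the dual of $\mathcal H_\tau$ and $\Phi'=\bigcup_\tau\mathcal H_{-\tau}$ the dual of $\Phi$ (denoted $\mathcal D'$, $\mathcal S'$). Let $\Phi^{\odot n}=\operatorname{proj\,lim}_\tau\mathcal H_\tau^{\odot n}$ and $\Phi'^{\odot n}=\operatorname{ind\,lim}_\tau\mathcal H_{-\tau}^{\odot n}$ be the symmetric Hilbert tensor powers ($\mathbb C$ for $n=0$),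 $\mathcal L(E,F)$ the continuous linear operators, $\|\cdot\|_\tau$, $\|\cdot\|_{-\tau}$ the Hilbert norms. For $\alpha>0$, $\mathcal E^\alpha_{\min}(\Phi')$ is the space of functions $f:\Phi'\to\mathbb C$ whose restriction to each $\mathcal H_{-\tau}$ is entire and satisfies $\mathbf n_{\tau,l,\alpha}(f)=\sup_{\omega\in\mathcal H_{-\tau}}|f(\omega)|\exp(-2^{-l}\|\omega\|_{-\tau}^\alpha)<\infty$ for all $\tau\in T$, $l\in\mathbb N_0$, with the topology given by all these norms; $\mathcal E^0_{\min}(\Phi')=\operatorname{proj\,lim}_{\alpha>0}\mathcal E^\alpha_{\min}(\Phi')$. **Sheffer sequences on $\Phi'$.** A sequence of maps $S^{(n)}:\Phi'\to\Phi'^{\odot n}$, $n\in\mathbb N_0$, of the form $S^{(n)}(\omega)=\sum_{k=0}^n U_{n,k}\,\omega^{\otimes k}$ with $U_{n,k}\in\mathcal L(\Phi'^{\odot k},\Phi'^{\odot n})$, $U_{n,n}=\mathbf 1$, is a *Sheffer sequence* if, as formal power series in $\xi\in\Phi$, $$\sum_{n=0}^\infty\frac1{n!}\langle S^{(n)}(\omega),\xi^{\otimes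 n}\rangle=\frac{\exp[\langle\omega,A(\xi)\rangle]}{\rho(A(\xi))},\qquad \omega\in\Phi',$$ where $A(\xi)=\sum_{k\ge1}A_k\xi^{\otimes k}$, $A_k\in\mathcal L(\Phi^{\odot k},\Phi)$, $A_1=\mathbf 1$, and $\rho(\xi)=\sum_{n\ge0}\langle\rho^{(n)},\xi^{\otimes n}\rangle$, $\rho^{(n)}\in\Phi'^{\odot n}$, $\rho^{(0)}=1$. Its *Sheffer operator* $\mathfrak S$ is the linear bijection of the space $\mathcal P(\Phi')$ of polynomials $\sum_{k\le n}\langle\omega^{\otimes k},\varphi^{(k)}\rangle$, $\varphi^{(k)}\in\Phi^{\odot k}$, given by $\mathfrak S\langle\omega^{\otimes n},\varphi^{(n)}\rangle=\langle S^{(n)}(\omega),\varphi^{(n)}\rangle$. A formal power series $\sum_{n\ge1} A_n\xi^{\otimes n}$ is *quasi-holomorphic on a neighborhood of zero* if for each $\tau\in T$ there are $\tau'\in T$ and $C\ge0$ with $\|A_n\|_{\mathcal L(\mathcal H_{\tau'}^{\odot n},\mathcal H_\tau)}\le C^n$ for all $n\ge1$. **Lifting.** Let $(s_n)_{n\ge0}$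 be a Sheffer sequence on $\mathbb C$: monic polynomials, $\deg s_n=n$, with $\sum_n\frac{u^n}{n!}s_n(z)=\exp[za(u)]/r(a(u))$ for formal power series $a(u)=\sum_{k\ge1}a_ku^k$, $a_1=1$, and $r(u)=1+\sum_{k\ge1}r_ku^k$. Put $c(u)=\log r(u)=\sum_{k\ge1}c_ku^k$. The *lifting* of $(s_n)$ to $\Phi'$ is the Sheffer sequence $(S^{(n)})$ on $\Phi'$ with $A(\xi)=\sum_{k\ge1}a_k\xi^k$ and $\rho(\xi)=\exp[C(\xi)]$, $C(\xi)=\sum_{k\ge1}c_k\int_{\mathbb R^d}\xi(x)^k\,dx$, where $\xi^k$ is the pointwise power. **Proposition 4.1.** Assume that $a(u)$ and $r(u)$ are holomorphic on a neighborhood of zero in $\mathbb C$. Then, both for $\Phi=\mathcal D$ and for $\Phi=\mathcal S$, the lifting $(S^{(n)})$ of $(s_n)$ to $\Phi'$ exists, is unique, and has the following properties. (1) $\rho$ is holomorphic on a neighborhood of zero in $\Phi$, and $A(\xi)$ and its compositional inverse $B(\xi)$ are quasi-holomorphic on a neighborhood of zero in $\Phi$. (2) For each $\alpha\in[0,1]$,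 the Sheffer operator $\mathfrak S$ of $(S^{(n)})$ extends by continuity (uniquely) to a linear self-homeomorphism of $\mathcal E^\alpha_{\min}(\Phi')$. The assumption holds in particular for the falling factorials $z(z-1)\cdots(z-n+1)$, the rising factorials $z(z+1)\cdots(z+n-1)$, the monic Charlier polynomials ($\sum_n\frac{u^n}{n!}s_n(z)=\exp[z\log(1+u)-u]$), and the monic Laguerre polynomials ($\sum_n\frac{u^n}{n!}s_n(z)=\exp[\frac{zu}{1+u}](1+u)^{-(k+1)}$) with any real parameter $k\ge-1$: each of these is a Sheffer sequence on $\mathbb C$ with $a$ and $r$ holomorphic near zero. -/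

import Mathlib

open scoped Topology Distributions SchwartzMap

noncomputable section

namespace Sheffer

/-! ### Locally convex topologies and holomorphic functions -/

/-- The locally convex topology generated by a family of seminorms. -/
@[reducible] def seminormTopology {ι E : Type*} [AddCommGroup E] [Module ℂ E]
    (p : ι → Seminorm ℂ E) : TopologicalSpace E :=
  ⨅ i, (p i).toSeminormedAddCommGroup.toUniformSpace.toTopologicalSpace

/-- A complex-valued function is holomorphic on `U` if it is continuous on `U` and Gateaux
holomorphic: for all `ξ ∈ U` and all directions `η`, the function `z ↦ f (ξ + z η)` is holomorphic
on a neighbourhood of `0`. -/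
def HolomorphicOn {E : Type*} [AddCommGroup E] [Module ℂ E] [TopologicalSpace E]
    (f : E → ℂ) (U : Set E) : Prop :=
  ContinuousOn f U ∧ ∀ ξ ∈ U, ∀ η : E, AnalyticAt ℂ (fun z : ℂ => f (ξ + z • η)) 0

/-! ### Projective limits of Hilbert spaces and their duals -/

/-- A directed family of Hilbertian norms on a complex vector space `Φ`. The Hilbert space of
index `τ` is the completion of `Φ` in the norm of index `τ`. -/
structure HilbertScale (T Φ : Type) [AddCommGroup Φ] [Module ℂ Φ] where
  core : T → InnerProductSpace.Core ℂ Φ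
  nonempty : Nonempty T
  directed : ∀ τ₁ τ₂ : T, ∃ τ₃ : T, ∃ C : ℝ, ∀ ξ : Φ,
    ((core τ₁).inner ξ ξ).re ≤ C * ((core τ₃).inner ξ ξ).re ∧
      ((core τ₂).inner ξ ξ).re ≤ C * ((core τ₃).inner ξ ξ).re

variable {T Φ : Type} [AddCommGroup Φ] [Module ℂ Φ]

/-- `Φ` with the inner product of index `τ`. -/
def Level (_H : HilbertScale T Φ) (_τ : T) : Type := Φ

instance (H : HilbertScale T Φ) (τ : T) : NormedAddCommGroup (Level H τ) :=
  @InnerProductSpace.Core.toNormedAddCommGroup ℂ Φ _ _ _ (H.core τ)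

instance (H : HilbertScale T Φ) (τ : T) : InnerProductSpace ℂ (Level H τ) :=
  InnerProductSpace.ofCore (H.core τ).toCore

/-- The Hilbert space `H_τ`. -/
abbrev Hilb (H : HilbertScale T Φ) (τ : T) : Type := UniformSpace.Completion (Level H τ)

/-- The Hilbert space `H_{-τ}` (with the dual norm): the dual of `H_τ`. A functional is identified
with the element of the dual space that represents it in the bilinear pairing extending
`⟨ω, ξ⟩ = (ω, conj ξ)` on the centre space. -/
abbrev HilbDual (H : HilbertScale T Φ) (τ : T) : Type := StrongDual ℂ (Hilb H τ)

/-- `Φ` with the projective limit topology of the `H_τ`. -/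
def Nuc (_H : HilbertScale T Φ) : Type := Φ

instance (H : HilbertScale T Φ) : AddCommGroup (Nuc H) := inferInstanceAs (AddCommGroup Φ)

instance (H : HilbertScale T Φ) : Module ℂ (Nuc H) := inferInstanceAs (Module ℂ Φ)

/-- The underlying element of `Φ`. -/
def Nuc.val {H : HilbertScale T Φ} (ξ : Nuc H) : Φ := ξ

/-- The norm `‖·‖_τ` on `Φ`. -/
def nucNorm (H : HilbertScale T Φ) (τ : T) : Seminorm ℂ (Nuc H) :=
  normSeminorm ℂ (Level H τ)

instance (H : HilbertScale T Φ) : TopologicalSpace (Nuc H) := seminormTopology (nucNorm H)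

lemma le_topology_of_seminorm {ι E : Type*} [AddCommGroup E] [Module ℂ E]
    (p : ι → Seminorm ℂ E) (i : ι) :
    seminormTopology p ≤ (p i).toSeminormedAddCommGroup.toUniformSpace.toTopologicalSpace :=
  iInf_le _ i

/-- A linear functional dominated by one of the defining seminorms is continuous. -/
lemma continuous_of_le_seminorm {ι E F : Type*} [AddCommGroup E] [Module ℂ E]
    [SeminormedAddCommGroup F] [Module ℂ F]
    (p : ι → Seminorm ℂ E) (i : ι) (f : E →ₗ[ℂ] F) (C : ℝ) (hf : ∀ x, ‖f x‖ ≤ C * p i x) :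
    Continuous[seminormTopology p, _] f := by
  refine continuous_le_dom (le_topology_of_seminorm p i) ?_
  let := (p i).toSeminormedAddCommGroup
  exact AddMonoidHomClass.continuous_of_bound f.toAddMonoidHom C hf

/-- The embedding `Φ → H_τ`. -/
def embed (H : HilbertScale T Φ) (τ : T) : Nuc H →L[ℂ] Hilb H τ where
  toLinearMap := (UniformSpace.Completion.toComplₗᵢ (𝕜 := ℂ) (E := Level H τ)).toLinearMap
  cont := continuous_of_le_seminorm (nucNorm H) τ _ 1 (fun x => by
    rw [one_mul]
    exact (UniformSpace.Completion.norm_coe (E := Level H τ) x).le)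

/-- The dual space `Φ'`. The topology that Mathlib puts on this type is never used. -/
abbrev CoNuc (H : HilbertScale T Φ) : Type := StrongDual ℂ (Nuc H)

/-- The inclusion `H_{-τ} → Φ'`. -/
def incl (H : HilbertScale T Φ) (τ : T) : HilbDual H τ →ₗ[ℂ] CoNuc H where
  toFun ω := ω.comp (embed H τ)
  map_add' _ _ := rfl
  map_smul' _ _ := rfl

lemma incl_apply (H : HilbertScale T Φ) (τ : T) (ω : HilbDual H τ) (ξ : Nuc H) :
    incl H τ ω ξ = ω (embed H τ ξ) := rfl

/-! ### Symmetric tensor powers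

The Hilbert tensor power `H_τ^{⊗n}` is realized as the space of Hilbert-Schmidt `n`-linear forms
on `H_{-τ}`, and `Φ^{⊙n}`, the intersection of the `H_τ^{⊙n}`, as the space of symmetric `n`-linear
forms on `Φ'` whose restriction to each `H_{-τ}` is Hilbert-Schmidt. -/

/-- Finite orthonormal families in `H_τ`, equivalently (by the Riesz isomorphism) in `H_{-τ}`. -/
def OrthoFam (H : HilbertScale T Φ) (τ : T) : Type :=
  Σ N : ℕ, {e : Fin N → Hilb H τ // Orthonormal ℂ e}

/-- The `k`-th member of the family, as an element of `H_{-τ} ⊆ Φ'`. -/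
def OrthoFam.dual {H : HilbertScale T Φ} {τ : T} (e : OrthoFam H τ) (k : Fin e.1) : CoNuc H :=
  incl H τ (InnerProductSpace.toDual ℂ (Hilb H τ) (e.2.1 k))

/-- The coefficients of an `n`-linear form on an orthonormal family, as a vector of `ℓ²`. -/
def coeffs {H : HilbertScale T Φ} {τ : T} (n : ℕ) (e : OrthoFam H τ) :
    MultilinearMap ℂ (fun _ : Fin n => CoNuc H) ℂ →ₗ[ℂ]
      EuclideanSpace ℂ (Fin n → Fin e.1) where
  toFun G := WithLp.toLp 2 fun i => G fun j => e.dual (i j)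
  map_add' _ _ := rfl
  map_smul' _ _ := rfl

/-- The `n`-linear forms on `Φ'` whose restriction to `H_{-τ}` is Hilbert-Schmidt. -/
def hilbertSchmidt (H : HilbertScale T Φ) (n : ℕ) (τ : T) :
    Submodule ℂ (MultilinearMap ℂ (fun _ : Fin n => CoNuc H) ℂ) where
  carrier := {G | BddAbove (Set.range fun e : OrthoFam H τ => ‖coeffs n e G‖)}
  add_mem' := by
    rintro F G ⟨a, ha⟩ ⟨b, hb⟩
    refine ⟨a + b, ?_⟩
    rintro _ ⟨e, rfl⟩
    have h1 := ha ⟨e, rfl⟩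
    have h2 := hb ⟨e, rfl⟩
    simp only [map_add]
    exact (norm_add_le _ _).trans (add_le_add h1 h2)
  zero_mem' := ⟨0, by rintro _ ⟨e, rfl⟩; simp⟩
  smul_mem' := by
    rintro c F ⟨a, ha⟩
    refine ⟨‖c‖ * a, ?_⟩
    rintro _ ⟨e, rfl⟩
    have h1 := ha ⟨e, rfl⟩
    simp only [map_smul, norm_smul]
    exact mul_le_mul_of_nonneg_left h1 (norm_nonneg c)

/-- The symmetric `n`-linear forms on `Φ'`. -/
def symmetricForms (H : HilbertScale T Φ) (n : ℕ) :
    Submodule ℂ (MultilinearMap ℂ (fun _ : Fin n => CoNuc H) ℂ) where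
  carrier := {G | ∀ (σ : Equiv.Perm (Fin n)) (ω : Fin n → CoNuc H), G (ω ∘ σ) = G ω}
  add_mem' := by
    intro F G hF hG σ ω
    simp [hF σ ω, hG σ ω]
  zero_mem' := by intro σ ω; rfl
  smul_mem' := by
    intro c F hF σ ω
    simp [hF σ ω]

def symPowSubmodule (H : HilbertScale T Φ) (n : ℕ) :
    Submodule ℂ (MultilinearMap ℂ (fun _ : Fin n => CoNuc H) ℂ) :=
  symmetricForms H n ⊓ ⨅ τ, hilbertSchmidt H n τ

/-- The symmetric tensor power `Φ^{⊙n}`. -/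
def SymPow (H : HilbertScale T Φ) (n : ℕ) : Type := symPowSubmodule H n

instance (H : HilbertScale T Φ) (n : ℕ) : AddCommGroup (SymPow H n) :=
  inferInstanceAs (AddCommGroup (symPowSubmodule H n))

instance (H : HilbertScale T Φ) (n : ℕ) : Module ℂ (SymPow H n) :=
  inferInstanceAs (Module ℂ (symPowSubmodule H n))

/-- The `n`-linear form underlying an element of `Φ^{⊙n}`. -/
def SymPow.form {H : HilbertScale T Φ} {n : ℕ} :
    SymPow H n →ₗ[ℂ] MultilinearMap ℂ (fun _ : Fin n => CoNuc H) ℂ :=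
  (symPowSubmodule H n).subtype

/-- The Hilbert space norm `‖·‖_τ` of `H_τ^{⊙n}`, restricted to `Φ^{⊙n}`: the Hilbert-Schmidt norm,
i.e. the supremum over finite orthonormal families of the `ℓ²` norm of the coefficients. -/
def symNorm (H : HilbertScale T Φ) (n : ℕ) (τ : T) : Seminorm ℂ (SymPow H n) :=
  ⨆ e : OrthoFam H τ, (normSeminorm ℂ _).comp ((coeffs n e).comp SymPow.form)

lemma symNorm_bddAbove (H : HilbertScale T Φ) (n : ℕ) (τ : T) :
    BddAbove (Set.range fun e : OrthoFam H τ =>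
      ((normSeminorm ℂ _).comp ((coeffs n e).comp (SymPow.form (H := H) (n := n))) :
        Seminorm ℂ (SymPow H n))) := by
  rw [Seminorm.bddAbove_range_iff]
  intro φ
  have h := (Submodule.mem_inf.1 φ.2).2
  exact (Submodule.mem_iInf _).1 h τ

lemma symNorm_apply (H : HilbertScale T Φ) (n : ℕ) (τ : T) (φ : SymPow H n) :
    symNorm H n τ φ = ⨆ e : OrthoFam H τ, ‖coeffs n e φ.form‖ :=
  Seminorm.iSup_apply (symNorm_bddAbove H n τ)

lemma coeffs_le_symNorm (H : HilbertScale T Φ) (n : ℕ) (τ : T) (φ : SymPow H n)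
    (e : OrthoFam H τ) : ‖coeffs n e φ.form‖ ≤ symNorm H n τ φ := by
  rw [symNorm_apply]
  exact le_ciSup ((Submodule.mem_iInf _).1 (Submodule.mem_inf.1 φ.2).2 τ) e

/-- The projective limit topology on `Φ^{⊙n}`. -/
instance (H : HilbertScale T Φ) (n : ℕ) : TopologicalSpace (SymPow H n) :=
  seminormTopology (symNorm H n)

/-- Evaluation of functionals at `ξ`. -/
def evalAt {H : HilbertScale T Φ} (ξ : Nuc H) : CoNuc H →ₗ[ℂ] ℂ where
  toFun ω := ω ξ
  map_add' _ _ := rfl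
  map_smul' _ _ := rfl

/-- The elementary tensor `ξ₁ ⊗ ⋯ ⊗ ξₙ`, as the form `(ω₁, …, ωₙ) ↦ ∏ ⟨ωⱼ, ξⱼ⟩`. -/
def elemForm {H : HilbertScale T Φ} {n : ℕ} (ξ : Fin n → Nuc H) :
    MultilinearMap ℂ (fun _ : Fin n => CoNuc H) ℂ :=
  (MultilinearMap.mkPiAlgebra ℂ (Fin n) ℂ).compLinearMap fun j => evalAt (ξ j)

lemma elemForm_apply {H : HilbertScale T Φ} {n : ℕ} (ξ : Fin n → Nuc H) (ω : Fin n → CoNuc H) :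
    elemForm ξ ω = ∏ j, ω j (ξ j) := by
  simp [elemForm, evalAt]

lemma elemForm_mem (H : HilbertScale T Φ) {n : ℕ} (ξ : Fin n → Nuc H) (τ : T) :
    elemForm ξ ∈ hilbertSchmidt H n τ := by
  refine ⟨√(∏ j, ‖embed H τ (ξ j)‖ ^ 2), ?_⟩
  rintro _ ⟨e, rfl⟩
  simp only
  rw [EuclideanSpace.norm_eq]
  apply Real.sqrt_le_sqrt
  have h : ∀ i : Fin n → Fin e.1, ‖coeffs n e (elemForm ξ) i‖ ^ 2 =
      ∏ j, ‖inner ℂ (e.2.1 (i j)) (embed H τ (ξ j))‖ ^ 2 := by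
    intro i
    change ‖elemForm ξ fun j => e.dual (i j)‖ ^ 2 = _
    rw [elemForm_apply, norm_prod, ← Finset.prod_pow]
    rfl
  rw [Finset.sum_congr rfl fun i _ => h i]
  have h2 := (Finset.prod_univ_sum (fun _ : Fin n => (Finset.univ : Finset (Fin e.1)))
    (fun j k => ‖inner ℂ (e.2.1 k) (embed H τ (ξ j))‖ ^ 2))
  rw [Fintype.piFinset_univ] at h2
  rw [← h2]
  refine Finset.prod_le_prod (fun j _ => Finset.sum_nonneg fun k _ => by positivity) ?_
  intro j _
  exact e.2.2.sum_inner_products_le _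

/-- The symmetric tensor product `ξ₁ ⊙ ⋯ ⊙ ξₙ`, the symmetrization of `ξ₁ ⊗ ⋯ ⊗ ξₙ`. -/
def symProd {H : HilbertScale T Φ} {n : ℕ} (ξ : Fin n → Nuc H) : SymPow H n :=
  ⟨((n.factorial : ℂ)⁻¹) • ∑ σ : Equiv.Perm (Fin n), elemForm (ξ ∘ σ), by
    refine Submodule.mem_inf.2 ⟨?_, ?_⟩
    · intro π ω
      simp only [smul_apply, sum_apply, elemForm_apply]
      congr 1
      refine Fintype.sum_equiv (Equiv.mulRight π⁻¹) _ _ fun σ => ?_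
      refine Fintype.prod_equiv π _ _ fun j => ?_
      simp
    · refine (Submodule.mem_iInf _).2 fun τ => ?_
      exact Submodule.smul_mem _ _ (Submodule.sum_mem _ fun σ _ => elemForm_mem H _ τ)⟩

/-- The tensor power `ξ^{⊗n}`. -/
def tensorPow {H : HilbertScale T Φ} (ξ : Nuc H) (n : ℕ) : SymPow H n := symProd fun _ => ξ

lemma tensorPow_form {H : HilbertScale T Φ} (ξ : Nuc H) (n : ℕ) (ω : Fin n → CoNuc H) :
    (tensorPow ξ n).form ω = ∏ j, ω j ξ := by
  change (((n.factorial : ℂ)⁻¹) • ∑ σ : Equiv.Perm (Fin n), elemForm ((fun _ => ξ) ∘ σ)) ω = _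
  simp only [smul_apply, elemForm_apply,
    Function.comp_def, Finset.sum_const, Finset.card_univ, Fintype.card_perm, Fintype.card_fin,
    nsmul_eq_mul, smul_eq_mul]
  rw [← mul_assoc, inv_mul_cancel₀ (by exact_mod_cast n.factorial_ne_zero), one_mul]

/-! ### Duals of symmetric tensor powers -/

/-- `Φ^{⊙n}` with the norm of `H_τ^{⊙n}`. -/
def SymLevel (H : HilbertScale T Φ) (n : ℕ) (_τ : T) : Type := SymPow H n

instance (H : HilbertScale T Φ) (n : ℕ) (τ : T) : SeminormedAddCommGroup (SymLevel H n τ) :=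
  (symNorm H n τ).toSeminormedAddCommGroup

instance (H : HilbertScale T Φ) (n : ℕ) (τ : T) : NormedSpace ℂ (SymLevel H n τ) where
  toModule := inferInstanceAs (Module ℂ (SymPow H n))
  norm_smul_le c x := (map_smul_eq_mul (symNorm H n τ) c x).le

/-- The identity `Φ^{⊙n} → H_τ^{⊙n}`. -/
def toSymLevel (H : HilbertScale T Φ) (n : ℕ) (τ : T) : SymPow H n →L[ℂ] SymLevel H n τ where
  toFun φ := φ
  map_add' _ _ := rfl
  map_smul' _ _ := rfl
  cont := le_topology_of_seminorm (symNorm H n) τ |> continuous_id_of_le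

/-- The dual `Φ'^{⊙n}` of `Φ^{⊙n}`. -/
def SymDual (H : HilbertScale T Φ) (n : ℕ) : Type := StrongDual ℂ (SymPow H n)

instance (H : HilbertScale T Φ) (n : ℕ) : AddCommGroup (SymDual H n) :=
  inferInstanceAs (AddCommGroup (StrongDual ℂ (SymPow H n)))

instance (H : HilbertScale T Φ) (n : ℕ) : Module ℂ (SymDual H n) :=
  inferInstanceAs (Module ℂ (StrongDual ℂ (SymPow H n)))

instance (H : HilbertScale T Φ) (n : ℕ) : FunLike (SymDual H n) (SymPow H n) ℂ :=
  inferInstanceAs (FunLike (StrongDual ℂ (SymPow H n)) (SymPow H n) ℂ)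

/-- The inclusion `H_{-τ}^{⊙n} → Φ'^{⊙n}`. -/
def symIncl (H : HilbertScale T Φ) (n : ℕ) (τ : T) :
    StrongDual ℂ (SymLevel H n τ) → SymDual H n :=
  fun F => F.comp (toSymLevel H n τ)

/-- The locally convex inductive limit topology of the `H_{-τ}^{⊙n}` on `Φ'^{⊙n}`: it is generated
by all seminorms whose restriction to each `H_{-τ}^{⊙n}` is continuous. -/
instance (H : HilbertScale T Φ) (n : ℕ) : TopologicalSpace (SymDual H n) :=
  seminormTopology
    (fun p : {p : Seminorm ℂ (SymDual H n) // ∀ τ, Continuous fun F => p (symIncl H n τ F)} => p.1)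

/-! ### Tensor powers of functionals -/

instance (H : HilbertScale T Φ) : IsTopologicalAddGroup (Nuc H) := by
  refine topologicalAddGroup_iInf fun τ => ?_
  exact @SeminormedAddCommGroup.toIsTopologicalAddGroup (Nuc H)
    (nucNorm H τ).toSeminormedAddCommGroup

lemma nucNorm_eq (H : HilbertScale T Φ) (τ : T) (ξ : Nuc H) :
    nucNorm H τ ξ = √((H.core τ).inner ξ.val ξ.val).re := rfl

lemma nucNorm_directed (H : HilbertScale T Φ) (τ₁ τ₂ : T) : ∃ τ₃ : T, ∃ C : ℝ, 0 ≤ C ∧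
    ∀ ξ : Nuc H, nucNorm H τ₁ ξ ≤ C * nucNorm H τ₃ ξ ∧ nucNorm H τ₂ ξ ≤ C * nucNorm H τ₃ ξ := by
  obtain ⟨τ₃, C, h⟩ := H.directed τ₁ τ₂
  have key : ∀ ξ : Nuc H, √(C * ((H.core τ₃).inner ξ.val ξ.val).re) ≤
      √(max C 0) * √((H.core τ₃).inner ξ.val ξ.val).re := by
    intro ξ
    rw [← Real.sqrt_mul (le_max_right _ _)]
    exact Real.sqrt_le_sqrt (mul_le_mul_of_nonneg_right (le_max_left _ _)
      ((H.core τ₃).re_inner_nonneg ξ.val))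
  refine ⟨τ₃, √(max C 0), Real.sqrt_nonneg _, fun ξ => ⟨?_, ?_⟩⟩
  · simp only [nucNorm_eq]
    exact (Real.sqrt_le_sqrt (h ξ.val).1).trans (key ξ)
  · simp only [nucNorm_eq]
    exact (Real.sqrt_le_sqrt (h ξ.val).2).trans (key ξ)

/-- Every continuous functional on `Φ` belongs to some `H_{-τ}`. -/
lemma exists_incl_eq (H : HilbertScale T Φ) (ω : CoNuc H) :
    ∃ τ : T, ∃ ω' : HilbDual H τ, incl H τ ω' = ω := by
  have := H.nonempty
  have hs : WithSeminorms (nucNorm H) :=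
    (SeminormFamily.withSeminorms_iff_topologicalSpace_eq_iInf (nucNorm H)).2 rfl
  obtain ⟨s, C, -, hC⟩ := Seminorm.bound_of_continuous hs
    ((normSeminorm ℂ ℂ).comp ω.toLinearMap) (continuous_norm.comp ω.continuous)
  have hsup : ∃ τ : T, ∃ D : ℝ, 0 ≤ D ∧ ∀ ξ : Nuc H,
      s.sup (nucNorm H) ξ ≤ D * nucNorm H τ ξ := by
    classical
    induction s using Finset.induction_on with
    | empty => exact ⟨this.some, 0, le_rfl, fun ξ => by simp⟩
    | insert a s _ ih =>
      have aux : ∀ t : Finset T, ∃ τ : T, ∃ D : ℝ, 0 ≤ D ∧ ∀ ξ : Nuc H,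
          t.sup (nucNorm H) ξ ≤ D * nucNorm H τ ξ := by
        intro t
        induction t using Finset.induction_on with
        | empty => exact ⟨this.some, 0, le_rfl, fun ξ => by simp⟩
        | insert b t _ iht =>
          obtain ⟨τ, D, hD, h⟩ := iht
          obtain ⟨τ₃, E, hE, h3⟩ := nucNorm_directed H b τ
          refine ⟨τ₃, E + D * E, by positivity, fun ξ => ?_⟩
          have h0 := apply_nonneg (nucNorm H τ₃) ξ
          rw [Finset.sup_insert, Seminorm.sup_apply]
          refine sup_le ((h3 ξ).1.trans ?_) ((h ξ).trans ?_)
          · nlinarith [mul_nonneg (mul_nonneg hD hE) h0]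
          · nlinarith [mul_le_mul_of_nonneg_left (h3 ξ).2 hD, mul_nonneg hE h0]
      exact aux _
  obtain ⟨τ, D, -, hD⟩ := hsup
  have hb : ∀ ξ : Level H τ, ‖ω ξ‖ ≤ (C * D) * ‖ξ‖ := by
    intro ξ
    have h1 : ‖ω ξ‖ ≤ C * s.sup (nucNorm H) ξ := hC ξ
    rw [mul_assoc]
    exact h1.trans (mul_le_mul_of_nonneg_left (hD ξ) C.2)
  let f : Level H τ →L[ℂ] ℂ := LinearMap.mkContinuous
    { toFun := fun ξ => ω ξ
      map_add' := fun x y => ω.map_add x y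
      map_smul' := fun c x => ω.map_smul c x } (C * D) hb
  refine ⟨τ, f.extend (UniformSpace.Completion.toComplL (𝕜 := ℂ) (E := Level H τ)), ?_⟩
  ext ξ
  exact ContinuousLinearMap.extend_eq f (UniformSpace.Completion.denseRange_coe)
    (UniformSpace.Completion.isUniformInducing_coe _) ξ

/-- The value of `φ ∈ Φ^{⊙n}` on `ω^{⊗n}`, for `ω ∈ H_{-τ}`. -/
lemma norm_form_incl_le (H : HilbertScale T Φ) (n : ℕ) (τ : T) (ω : HilbDual H τ)
    (φ : SymPow H n) : ‖φ.form fun _ => incl H τ ω‖ ≤ ‖ω‖ ^ n * symNorm H n τ φ := by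
  obtain ⟨x, rfl⟩ := (InnerProductSpace.toDual ℂ (Hilb H τ)).surjective ω
  rw [LinearIsometryEquiv.norm_map]
  have key : ∀ e : Hilb H τ, ‖e‖ = 1 →
      ‖φ.form fun _ => incl H τ (InnerProductSpace.toDual ℂ (Hilb H τ) e)‖ ≤ symNorm H n τ φ := by
    intro e he
    have ho : Orthonormal ℂ (fun _ : Fin 1 => e) :=
      ⟨fun _ => he, fun i j hij => absurd (Subsingleton.elim i j) hij⟩
    have h1 := coeffs_le_symNorm H n τ φ ⟨1, _, ho⟩
    exact (EuclideanSpace.norm_eq (coeffs n (⟨1, _, ho⟩ : OrthoFam H τ) φ.form) ▸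
      Real.le_sqrt_of_sq_le (Finset.single_le_sum (f := fun i : Fin n → Fin 1 =>
        ‖coeffs n (⟨1, _, ho⟩ : OrthoFam H τ) φ.form i‖ ^ 2) (fun i _ => by positivity)
        (Finset.mem_univ (fun _ => 0)))).trans h1
  rcases eq_or_ne x 0 with rfl | hx
  · rcases n with _ | n
    · have ho : Orthonormal ℂ (fun i : Fin 0 => (i.elim0 : Hilb H τ)) :=
        ⟨fun i => i.elim0, fun i => i.elim0⟩
      have h1 := coeffs_le_symNorm H 0 τ φ ⟨0, _, ho⟩
      rw [EuclideanSpace.norm_eq] at h1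
      simp only [Finset.univ_unique, Finset.sum_singleton] at h1
      rw [Real.sqrt_sq (norm_nonneg _)] at h1
      rw [pow_zero, one_mul]
      refine le_trans (le_of_eq ?_) h1
      change _ = ‖φ.form _‖
      congr 2
      exact Subsingleton.elim _ _
    · have h0 : (φ.form fun _ => incl H τ (InnerProductSpace.toDual ℂ (Hilb H τ) 0)) = 0 := by
        simp only [map_zero]
        exact φ.form.map_coord_zero 0 rfl
      rw [h0]
      simp
  · have hx' : ‖x‖ ≠ 0 := norm_ne_zero_iff.2 hx
    have h1 := key ((‖x‖⁻¹ : ℂ) • x) (by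
      rw [norm_smul, norm_inv, Complex.norm_real, norm_norm, inv_mul_cancel₀ hx'])
    have h2 : (φ.form fun _ => incl H τ (InnerProductSpace.toDual ℂ (Hilb H τ) x)) =
        (‖x‖ : ℂ) ^ n * φ.form fun _ =>
          incl H τ (InnerProductSpace.toDual ℂ (Hilb H τ) ((‖x‖⁻¹ : ℂ) • x)) := by
      have h3 : (fun _ : Fin n => incl H τ (InnerProductSpace.toDual ℂ (Hilb H τ) x)) =
          fun _ => (‖x‖ : ℂ) •
            incl H τ (InnerProductSpace.toDual ℂ (Hilb H τ) ((‖x‖⁻¹ : ℂ) • x)) := by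
        funext _
        rw [map_smulₛₗ, map_smul, smul_smul]
        simp [hx']
      rw [h3, φ.form.map_smul_univ]
      simp
    rw [h2, norm_mul, norm_pow, Complex.norm_real, norm_norm]
    exact mul_le_mul_of_nonneg_left h1 (by positivity)

/-- The tensor power `ω^{⊗n} ∈ Φ'^{⊙n}` of `ω ∈ Φ'`: the functional `φ ↦ φ (ω, …, ω)`. -/
def dualPow {H : HilbertScale T Φ} (ω : CoNuc H) (n : ℕ) : SymDual H n :=
  ({ toFun := fun φ => φ.form fun _ => ω
     map_add' := fun φ ψ => by simp
     map_smul' := fun c φ => by simp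
     cont := by
      obtain ⟨τ, ω', rfl⟩ := exists_incl_eq H ω
      exact continuous_of_le_seminorm (symNorm H n) τ
        { toFun := fun φ : SymPow H n => φ.form fun _ => incl H τ ω'
          map_add' := fun φ ψ => by simp
          map_smul' := fun c φ => by simp } (‖ω'‖ ^ n) (norm_form_incl_le H n τ ω') } :
    StrongDual ℂ (SymPow H n))

/-! ### Sheffer sequences on `Φ'` -/

/-- A sequence of monic polynomials `Φ' → Φ'^{⊙n}`:
`S⁽ⁿ⁾(ω) = ∑_{k ≤ n} U_{n,k} ω^{⊗k}` with continuous linear `U_{n,k}` and `U_{n,n} = 1`. -/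
def IsMonicSequence (H : HilbertScale T Φ) (S : (n : ℕ) → CoNuc H → SymDual H n) : Prop :=
  ∃ U : (n k : ℕ) → SymDual H k →L[ℂ] SymDual H n,
    (∀ n F, U n n F = F) ∧
    ∀ n ω, S n ω = ∑ k ∈ Finset.range (n + 1), U n k (dualPow ω k)

/-- The coefficient of `z^N` in `L(A(zξ))`, where `L(η) = ∑ₙ Lₙ η^{⊗n}` and
`A(ξ) = ∑_{k ≥ 1} A_k ξ^{⊗k}` are formal power series:
`∑_{k₁ + ⋯ + kₙ = N} Lₙ (A_{k₁} ξ^{⊗k₁} ⊙ ⋯ ⊙ A_{kₙ} ξ^{⊗kₙ})` with all `kᵢ ≥ 1`. -/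
def compCoeff {H : HilbertScale T Φ} {W : Type} [AddCommMonoid W] (L : (n : ℕ) → SymPow H n → W)
    (A : (n : ℕ) → SymPow H n →L[ℂ] Nuc H) (N : ℕ) (ξ : Nuc H) : W :=
  ∑ c : Composition N,
    L c.length (symProd fun i => A (c.blocksFun i) (tensorPow ξ (c.blocksFun i)))

/-- `S` is the Sheffer sequence with generating function
`∑ₙ (1/n!) ⟨S⁽ⁿ⁾(ω), ξ^{⊗n}⟩ = exp ⟨ω, A(ξ)⟩ / ρ(A(ξ))`, where
`A(ξ) = ∑_{k ≥ 1} A_k ξ^{⊗k}`, `A₁ = 1`, and `ρ(ξ) = ∑ₙ ⟨ρ⁽ⁿ⁾, ξ^{⊗n}⟩`, `ρ⁽⁰⁾ = 1`. The equality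
is one of formal power series: with `ξ` replaced by `zξ`, both sides are formal power series
in `z ∈ ℂ`. -/
structure IsShefferWith (H : HilbertScale T Φ) (A : (n : ℕ) → SymPow H n →L[ℂ] Nuc H)
    (ρ : (n : ℕ) → SymDual H n) (S : (n : ℕ) → CoNuc H → SymDual H n) : Prop where
  monic : IsMonicSequence H S
  zero_coeff : A 0 = 0
  one_coeff : ∀ ξ, A 1 (tensorPow ξ 1) = ξ
  rho_zero : ρ 0 (tensorPow 0 0) = 1
  generating : ∀ (ω : CoNuc H) (ξ : Nuc H),
    PowerSeries.mk (fun n => S n ω (tensorPow ξ n) / (n.factorial : ℂ)) *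
        PowerSeries.mk (fun N => compCoeff (fun n => ρ n) A N ξ) =
      (PowerSeries.exp ℂ).subst (PowerSeries.mk fun k => ω (A k (tensorPow ξ k)))

/-- The formal power series `A` and `B` are compositional inverses: `A(B(ξ)) = B(A(ξ)) = ξ`. -/
def IsCompInverse {H : HilbertScale T Φ} (A B : (n : ℕ) → SymPow H n →L[ℂ] Nuc H) : Prop :=
  A 0 = 0 ∧ B 0 = 0 ∧
    (∀ N ξ, compCoeff (fun n => A n) B N ξ = if N = 1 then ξ else 0) ∧
    ∀ N ξ, compCoeff (fun n => B n) A N ξ = if N = 1 then ξ else 0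

/-- The formal power series `A(ξ) = A₀ + ∑_{n ≥ 1} Aₙ ξ^{⊗n}` is quasi-holomorphic on a
neighbourhood of zero: for each `τ` there are `τ'` and `C ≥ 0` with
`‖Aₙ‖_{L(H_{τ'}^{⊙n}, H_τ)} ≤ Cⁿ` for all `n ≥ 1`. -/
def QuasiHolomorphic (H : HilbertScale T Φ) (A : (n : ℕ) → SymPow H n →L[ℂ] Nuc H) : Prop :=
  ∀ τ : T, ∃ τ' : T, ∃ C : ℝ, 0 ≤ C ∧
    ∀ n : ℕ, 1 ≤ n → ∀ φ : SymPow H n, nucNorm H τ (A n φ) ≤ C ^ n * symNorm H n τ' φ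

/-- The formal power series `ρ(ξ) = ∑ₙ ⟨ρ⁽ⁿ⁾, ξ^{⊗n}⟩` is (the expansion of) a holomorphic function
on a neighbourhood of zero in `Φ`. -/
def HolomorphicNearZero (H : HilbertScale T Φ) (ρ : (n : ℕ) → SymDual H n) : Prop :=
  ∃ U : Set (Nuc H), IsOpen U ∧ 0 ∈ U ∧ ∃ f : Nuc H → ℂ, HolomorphicOn f U ∧
    ∀ ξ ∈ U, HasSum (fun n => ρ n (tensorPow ξ n)) (f ξ)

/-- `S` is a Sheffer sequence whose `ρ` is holomorphic on a neighbourhood of zero and for which both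
`A` and its compositional inverse `B` are quasi-holomorphic on a neighbourhood of zero. -/
def IsRegularSheffer (H : HilbertScale T Φ) (S : (n : ℕ) → CoNuc H → SymDual H n) : Prop :=
  ∃ (A B : (n : ℕ) → SymPow H n →L[ℂ] Nuc H) (ρ : (n : ℕ) → SymDual H n),
    IsShefferWith H A ρ S ∧ HolomorphicNearZero H ρ ∧ IsCompInverse A B ∧
      QuasiHolomorphic H A ∧ QuasiHolomorphic H B

/-! ### Polynomials on `Φ'` and the Sheffer operator -/

/-- The function `ω ↦ ⟨ω^{⊗n}, φ⟩` on `Φ'`. -/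
def monomialFun {H : HilbertScale T Φ} {n : ℕ} (φ : SymPow H n) : CoNuc H → ℂ :=
  fun ω => dualPow ω n φ

/-- The space `P(Φ')` of polynomials `ω ↦ ∑_{k ≤ n} ⟨ω^{⊗k}, φ⁽ᵏ⁾⟩` with `φ⁽ᵏ⁾ ∈ Φ^{⊙k}`. -/
def polynomials (H : HilbertScale T Φ) : Submodule ℂ (CoNuc H → ℂ) :=
  Submodule.span ℂ {p | ∃ (n : ℕ) (φ : SymPow H n), p = monomialFun φ}

/-- `𝔖 : P(Φ') → P(Φ')` is the (bijective, linear) Sheffer operator of the sequence `S`: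
`𝔖 ⟨ω^{⊗n}, φ⟩ = ⟨S⁽ⁿ⁾(ω), φ⟩`. -/
def IsShefferOperator (H : HilbertScale T Φ) (S : (n : ℕ) → CoNuc H → SymDual H n)
    (𝔖 : polynomials H ≃ₗ[ℂ] polynomials H) : Prop :=
  ∀ (n : ℕ) (φ : SymPow H n) (ω : CoNuc H),
    (𝔖 ⟨monomialFun φ, Submodule.subset_span ⟨n, φ, rfl⟩⟩ : CoNuc H → ℂ) ω = S n ω φ

/-! ### Entire functions of order at most `α` and minimal type -/

/-- The orders entering the definition of the space of index `α`: only `α` itself if `α > 0`,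
and all `β > 0` if `α = 0`. -/
def orders (α : ℝ) : Set ℝ := {β | 0 < β ∧ (α = 0 ∨ β = α)}

/-- The functions `f : Φ' → ℂ` whose restriction to each `H_{-τ}` is entire, with
`sup |f(ω)| exp(-2^{-l} ‖ω‖_{-τ}^β) < ∞` for all `l` and all `β ∈ orders α`. -/
def eminSubmodule (H : HilbertScale T Φ) (α : ℝ) : Submodule ℂ (CoNuc H → ℂ) where
  carrier := {f | ∀ β ∈ orders α, ∀ τ : T, HolomorphicOn (fun ω => f (incl H τ ω)) Set.univ ∧
    ∀ l : ℕ, BddAbove (Set.range fun ω : HilbDual H τ =>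
      Real.exp (-((2 : ℝ) ^ l)⁻¹ * ‖ω‖ ^ β) * ‖f (incl H τ ω)‖)}
  add_mem' := by
    intro f g hf hg β hβ τ
    refine ⟨⟨(hf β hβ τ).1.1.add (hg β hβ τ).1.1, fun ξ hξ η =>
      ((hf β hβ τ).1.2 ξ hξ η).add ((hg β hβ τ).1.2 ξ hξ η)⟩, fun l => ?_⟩
    obtain ⟨a, ha⟩ := (hf β hβ τ).2 l
    obtain ⟨b, hb⟩ := (hg β hβ τ).2 l
    refine ⟨a + b, ?_⟩
    rintro _ ⟨ω, rfl⟩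
    have h1 := ha ⟨ω, rfl⟩
    have h2 := hb ⟨ω, rfl⟩
    simp only at h1 h2 ⊢
    refine le_trans ?_ (add_le_add h1 h2)
    rw [← mul_add]
    exact mul_le_mul_of_nonneg_left (norm_add_le _ _) (Real.exp_pos _).le
  zero_mem' := by
    intro β _ τ
    refine ⟨⟨continuousOn_const, fun _ _ _ => analyticAt_const⟩, fun l => ⟨0, ?_⟩⟩
    rintro _ ⟨ω, rfl⟩
    simp
  smul_mem' := by
    intro c f hf β hβ τ
    refine ⟨⟨continuousOn_const.mul (hf β hβ τ).1.1, fun ξ hξ η =>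
      analyticAt_const.mul ((hf β hβ τ).1.2 ξ hξ η)⟩, fun l => ?_⟩
    obtain ⟨a, ha⟩ := (hf β hβ τ).2 l
    refine ⟨‖c‖ * a, ?_⟩
    rintro _ ⟨ω, rfl⟩
    have h1 := ha ⟨ω, rfl⟩
    simp only [Pi.smul_apply, norm_smul] at h1 ⊢
    rw [mul_left_comm]
    exact mul_le_mul_of_nonneg_left h1 (norm_nonneg c)

/-- The space `E^α_min(Φ')`. -/
def Emin (H : HilbertScale T Φ) (α : ℝ) : Type := eminSubmodule H α

instance (H : HilbertScale T Φ) (α : ℝ) : AddCommGroup (Emin H α) :=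
  inferInstanceAs (AddCommGroup (eminSubmodule H α))

instance (H : HilbertScale T Φ) (α : ℝ) : Module ℂ (Emin H α) :=
  inferInstanceAs (Module ℂ (eminSubmodule H α))

/-- The underlying function on `Φ'`. -/
def Emin.toFun {H : HilbertScale T Φ} {α : ℝ} : Emin H α →ₗ[ℂ] (CoNuc H → ℂ) :=
  (eminSubmodule H α).subtype

/-- The weight `exp(-2^{-l} ‖ω‖_{-τ}^β)`. -/
def growthWeight (H : HilbertScale T Φ) (β : ℝ) (τ : T) (l : ℕ) (ω : HilbDual H τ) : NNReal :=
  ⟨Real.exp (-((2 : ℝ) ^ l)⁻¹ * ‖ω‖ ^ β), (Real.exp_pos _).le⟩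

/-- The weighted value `|f(ω)| exp(-2^{-l} ‖ω‖_{-τ}^β)`, for `ω ∈ H_{-τ}`. -/
def weightedEval (H : HilbertScale T Φ) (α β : ℝ) (τ : T) (l : ℕ) (ω : HilbDual H τ) :
    Seminorm ℂ (Emin H α) :=
  growthWeight H β τ l ω • (normSeminorm ℂ ℂ).comp
    ((LinearMap.proj (R := ℂ) (φ := fun _ : CoNuc H => ℂ) (incl H τ ω)).comp Emin.toFun)

/-- The norm `𝐧_{τ,l,β}(f) = sup_{ω ∈ H_{-τ}} |f(ω)| exp(-2^{-l} ‖ω‖_{-τ}^β)`. -/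
def growthNorm (H : HilbertScale T Φ) (α : ℝ) (i : orders α × T × ℕ) : Seminorm ℂ (Emin H α) :=
  ⨆ ω : HilbDual H i.2.1, weightedEval H α i.1 i.2.1 i.2.2 ω

lemma growthNorm_apply (H : HilbertScale T Φ) (α : ℝ) (i : orders α × T × ℕ) (f : Emin H α) :
    growthNorm H α i f = ⨆ ω : HilbDual H i.2.1,
      Real.exp (-((2 : ℝ) ^ i.2.2)⁻¹ * ‖ω‖ ^ (i.1 : ℝ)) * ‖Emin.toFun f (incl H i.2.1 ω)‖ := by
  refine Seminorm.iSup_apply ?_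
  rw [Seminorm.bddAbove_range_iff]
  intro g
  exact (g.2 i.1 i.1.2 i.2.1).2 i.2.2

/-- The projective limit topology on `E^α_min(Φ')`. -/
instance (H : HilbertScale T Φ) (α : ℝ) : TopologicalSpace (Emin H α) :=
  seminormTopology (growthNorm H α)

/-- The operator `𝔖` on polynomials extends by continuity to a linear self-homeomorphism of
`E^α_min(Φ')`: polynomials belong to `E^α_min(Φ')`, and exactly one linear self-homeomorphism
coincides with `𝔖` on them. -/
def ExtendsToSelfHomeomorphism (H : HilbertScale T Φ) (α : ℝ)
    (𝔖 : polynomials H ≃ₗ[ℂ] polynomials H) : Prop :=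
  ∃ hP : polynomials H ≤ eminSubmodule H α, ∃! Ψ : Emin H α ≃L[ℂ] Emin H α,
    ∀ p : polynomials H,
      Emin.toFun (Ψ (⟨p, hP p.2⟩ : eminSubmodule H α)) = (𝔖 p : CoNuc H → ℂ)

/-! ### Sheffer sequences on `ℂ` -/

/-- `s` is the Sheffer sequence of monic polynomials on `ℂ` with generating function
`∑ₙ (uⁿ/n!) sₙ(z) = exp(z a(u)) / r(a(u))`, where `a₀ = 0`, `a₁ = 1`, `r₀ = 1`. -/
structure IsScalarSheffer (a r : PowerSeries ℂ) (s : ℕ → Polynomial ℂ) : Prop where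
  monic : ∀ n, (s n).Monic ∧ (s n).natDegree = n
  a_zero : PowerSeries.coeff 0 a = 0
  a_one : PowerSeries.coeff 1 a = 1
  r_zero : PowerSeries.coeff 0 r = 1
  generating : ∀ z : ℂ,
    PowerSeries.mk (fun n => (s n).eval z / (n.factorial : ℂ)) * r.subst a =
      (PowerSeries.exp ℂ).subst (z • a)

/-- The power series converges to a holomorphic function on a neighbourhood of zero in `ℂ`. -/
def IsHolomorphicSeries (p : PowerSeries ℂ) : Prop :=
  ∃ R : ℝ, 0 < R ∧ ∃ f : ℂ → ℂ, DifferentiableOn ℂ f (Metric.ball 0 R) ∧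
    ∀ u ∈ Metric.ball (0 : ℂ) R, HasSum (fun n => PowerSeries.coeff n p * u ^ n) (f u)

/-! ### The test function spaces `𝒟` and `𝒮` on `ℝ^d` -/

/-- `ℝ^d`. -/
abbrev RSpace (d : ℕ) : Type := EuclideanSpace ℝ (Fin d)

/-- The partial derivative `∂_{i₁} ⋯ ∂_{iⱼ} f`. -/
def partialD {d : ℕ} (f : RSpace d → ℂ) (j : ℕ) (i : Fin j → Fin d) (x : RSpace d) : ℂ :=
  iteratedFDeriv ℝ j f x fun l => EuclideanSpace.single (i l) 1

/-- The inner product of the weighted Sobolev space `W^{m,2}(ℝ^d, w(x) dx)`, conjugate linear in the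
first variable: `∑_{j ≤ m} ∑_{i₁, …, iⱼ} ∫ conj(∂_{i₁} ⋯ ∂_{iⱼ} f) (∂_{i₁} ⋯ ∂_{iⱼ} g) w dx`. -/
def sobolevInner {d : ℕ} (m : ℕ) (w : RSpace d → ℝ) (f g : RSpace d → ℂ) : ℂ :=
  ∑ j ∈ Finset.range (m + 1), ∑ i : Fin j → Fin d,
    ∫ x, starRingEnd ℂ (partialD f j i x) * partialD g j i x * (w x : ℂ)

section Sobolev

variable {d : ℕ}

lemma partialD_add {f g : RSpace d → ℂ} (hf : ContDiff ℝ (⊤ : ℕ∞) f) (hg : ContDiff ℝ (⊤ : ℕ∞) g)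
    (j : ℕ) (i : Fin j → Fin d) (x : RSpace d) :
    partialD (f + g) j i x = partialD f j i x + partialD g j i x := by
  have hj : ((j : ℕ) : WithTop ℕ∞) ≤ ((⊤ : ℕ∞) : WithTop ℕ∞) := by exact_mod_cast le_top
  unfold partialD
  rw [iteratedFDeriv_add_apply (hf.of_le hj).contDiffAt (hg.of_le hj).contDiffAt]
  rfl

lemma partialD_smul {f : RSpace d → ℂ} (hf : ContDiff ℝ (⊤ : ℕ∞) f) (c : ℂ)
    (j : ℕ) (i : Fin j → Fin d) (x : RSpace d) :
    partialD (c • f) j i x = c * partialD f j i x := by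
  have hj : ((j : ℕ) : WithTop ℕ∞) ≤ ((⊤ : ℕ∞) : WithTop ℕ∞) := by exact_mod_cast le_top
  unfold partialD
  rw [iteratedFDeriv_const_smul_apply (hf.of_le hj).contDiffAt]
  rfl

lemma partialD_continuous {f : RSpace d → ℂ} (hf : ContDiff ℝ (⊤ : ℕ∞) f) (j : ℕ)
    (i : Fin j → Fin d) : Continuous (partialD f j i) := by
  have hj : ((j : ℕ) : WithTop ℕ∞) ≤ ((⊤ : ℕ∞) : WithTop ℕ∞) := by exact_mod_cast le_top
  exact (ContinuousMultilinearMap.apply ℝ (fun _ : Fin j => RSpace d) ℂ _).continuous.comp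
    (hf.continuous_iteratedFDeriv hj)

lemma partialD_norm_le (f : RSpace d → ℂ) (j : ℕ) (i : Fin j → Fin d) (x : RSpace d) :
    ‖partialD f j i x‖ ≤ ‖iteratedFDeriv ℝ j f x‖ := by
  refine ((iteratedFDeriv ℝ j f x).le_opNorm _).trans ?_
  simp

lemma sobolevInner_self (m : ℕ) (w : RSpace d → ℝ) (f : RSpace d → ℂ) :
    sobolevInner m w f f = ((∑ j ∈ Finset.range (m + 1), ∑ i : Fin j → Fin d,
      ∫ x, ‖partialD f j i x‖ ^ 2 * w x : ℝ) : ℂ) := by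
  unfold sobolevInner
  push_cast
  refine Finset.sum_congr rfl fun j _ => Finset.sum_congr rfl fun i _ => ?_
  rw [← integral_complex_ofReal]
  congr 1
  funext x
  rw [Complex.conj_mul']
  push_cast
  rfl

lemma integrable_sq {w : RSpace d → ℝ} {f : RSpace d → ℂ} {j : ℕ} {i : Fin j → Fin d}
    (h : MeasureTheory.Integrable fun x =>
      starRingEnd ℂ (partialD f j i x) * partialD f j i x * (w x : ℂ)) :
    MeasureTheory.Integrable fun x => ‖partialD f j i x‖ ^ 2 * w x := by
  have h2 := h.re
  refine h2.congr (Filter.Eventually.of_forall fun x => ?_)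
  simp only [Complex.conj_mul']
  rw [← Complex.ofReal_pow, ← Complex.ofReal_mul]
  exact Complex.ofReal_re _

/-- The Sobolev inner product on a space of smooth functions for which all integrals converge. -/
@[reducible] def sobolevCore {V : Type} [AddCommGroup V] [Module ℂ V] (κ : V →ₗ[ℂ] (RSpace d → ℂ))
    (hκ : Function.Injective κ) (hs : ∀ f, ContDiff ℝ (⊤ : ℕ∞) (κ f)) (m : ℕ) (w : RSpace d → ℝ)
    (hw : ∀ x, 1 ≤ w x)
    (hint : ∀ f g (j : ℕ) (i : Fin j → Fin d), MeasureTheory.Integrable fun x =>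
      starRingEnd ℂ (partialD (κ f) j i x) * partialD (κ g) j i x * (w x : ℂ)) :
    InnerProductSpace.Core ℂ V where
  inner f g := sobolevInner m w (κ f) (κ g)
  conj_inner_symm f g := by
    unfold sobolevInner
    simp only [map_sum]
    refine Finset.sum_congr rfl fun j _ => Finset.sum_congr rfl fun i _ => ?_
    rw [← integral_conj]
    congr 1
    funext x
    simp only [map_mul, Complex.conj_conj, Complex.conj_ofReal]
    ring
  re_inner_nonneg f := by
    suffices h : 0 ≤ (sobolevInner m w (κ f) (κ f)).re from h
    rw [sobolevInner_self, Complex.ofReal_re]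
    refine Finset.sum_nonneg fun j _ => Finset.sum_nonneg fun i _ => ?_
    refine MeasureTheory.integral_nonneg fun x => ?_
    have := hw x
    change 0 ≤ ‖partialD (κ f) j i x‖ ^ 2 * w x
    positivity
  add_left f g h := by
    unfold sobolevInner
    rw [← Finset.sum_add_distrib]
    refine Finset.sum_congr rfl fun j _ => ?_
    rw [← Finset.sum_add_distrib]
    refine Finset.sum_congr rfl fun i _ => ?_
    rw [← MeasureTheory.integral_add (hint f h j i) (hint g h j i)]
    congr 1
    funext x
    rw [map_add, partialD_add (hs f) (hs g), map_add]
    ring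
  smul_left f g c := by
    unfold sobolevInner
    rw [Finset.mul_sum]
    refine Finset.sum_congr rfl fun j _ => ?_
    rw [Finset.mul_sum]
    refine Finset.sum_congr rfl fun i _ => ?_
    rw [← MeasureTheory.integral_const_mul]
    congr 1
    funext x
    rw [map_smul, partialD_smul (hs f), map_mul]
    ring
  definite f hf := by
    rw [sobolevInner_self] at hf
    have hnn : ∀ (j : ℕ) (i : Fin j → Fin d), 0 ≤ ∫ x, ‖partialD (κ f) j i x‖ ^ 2 * w x :=
      fun j i => MeasureTheory.integral_nonneg fun x => by
        have := hw x
        change 0 ≤ ‖partialD (κ f) j i x‖ ^ 2 * w x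
        positivity
    have h0 := (Finset.sum_eq_zero_iff_of_nonneg fun j _ =>
      Finset.sum_nonneg fun i _ => hnn j i).1 (Complex.ofReal_eq_zero.1 hf) 0 (by simp)
    have h1 := (Finset.sum_eq_zero_iff_of_nonneg fun i _ => hnn 0 i).1 h0 Fin.elim0
      (Finset.mem_univ _)
    rw [MeasureTheory.integral_eq_zero_iff_of_nonneg (fun x => by
        have := hw x
        change 0 ≤ ‖partialD (κ f) 0 _ x‖ ^ 2 * w x
        positivity) (integrable_sq (hint f f 0 _))] at h1
    have h2 : κ f =ᵐ[MeasureTheory.volume] (0 : RSpace d → ℂ) := by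
      filter_upwards [h1] with x hx
      have hwx := hw x
      have h3 : ‖partialD (κ f) 0 Fin.elim0 x‖ ^ 2 * w x = 0 := hx
      have h4 : partialD (κ f) 0 Fin.elim0 x = 0 := by
        rcases mul_eq_zero.1 h3 with h | h
        · simpa using h
        · linarith
      simpa [partialD] using h4
    have h3 := MeasureTheory.Measure.eq_of_ae_eq h2 (hs f).continuous continuous_const
    exact hκ (h3.trans (map_zero κ).symm)

lemma sobolevInner_mono {m m' : ℕ} (hm : m ≤ m') {w w' : RSpace d → ℝ} (hw0 : ∀ x, 1 ≤ w x)
    (hw : ∀ x, w x ≤ w' x) {f : RSpace d → ℂ}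
    (h : ∀ (j : ℕ) (i : Fin j → Fin d), MeasureTheory.Integrable fun x =>
      starRingEnd ℂ (partialD f j i x) * partialD f j i x * (w x : ℂ))
    (h' : ∀ (j : ℕ) (i : Fin j → Fin d), MeasureTheory.Integrable fun x =>
      starRingEnd ℂ (partialD f j i x) * partialD f j i x * (w' x : ℂ)) :
    (sobolevInner m w f f).re ≤ (sobolevInner m' w' f f).re := by
  rw [sobolevInner_self, sobolevInner_self, Complex.ofReal_re, Complex.ofReal_re]
  have h1 : ∀ (j : ℕ) (i : Fin j → Fin d), (∫ x, ‖partialD f j i x‖ ^ 2 * w x) ≤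
      ∫ x, ‖partialD f j i x‖ ^ 2 * w' x := fun j i =>
    MeasureTheory.integral_mono (integrable_sq (h j i)) (integrable_sq (h' j i)) fun x =>
      mul_le_mul_of_nonneg_left (hw x) (by positivity)
  refine (Finset.sum_le_sum fun j _ => Finset.sum_le_sum fun i _ => h1 j i).trans ?_
  refine Finset.sum_le_sum_of_subset_of_nonneg (Finset.range_mono (by omega)) fun j _ _ => ?_
  refine Finset.sum_nonneg fun i _ => MeasureTheory.integral_nonneg fun x => ?_
  have h3 := (hw0 x).trans (hw x)
  change 0 ≤ ‖partialD f j i x‖ ^ 2 * w' x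
  positivity

end Sobolev

/-- The smooth compactly supported functions `ℝ^d → ℂ`. -/
abbrev TestSpace (d : ℕ) : Type := 𝓓((⊤ : TopologicalSpace.Opens (RSpace d)), ℂ)

/-- The index set of `𝒟`: pairs `(m, w)` with `m ∈ ℕ₀` and `w` a smooth weight with `w ≥ 1`. -/
abbrev TestIndex (d : ℕ) : Type :=
  {τ : ℕ × (RSpace d → ℝ) // ContDiff ℝ (⊤ : ℕ∞) τ.2 ∧ ∀ x, 1 ≤ τ.2 x}

/-- A test function, as a function. -/
def testCoe (d : ℕ) : TestSpace d →ₗ[ℂ] (RSpace d → ℂ) where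
  toFun f := f
  map_add' _ _ := rfl
  map_smul' _ _ := rfl

lemma test_integrable {d : ℕ} {w : RSpace d → ℝ} (hw : Continuous w) (f g : TestSpace d) (j : ℕ)
    (i : Fin j → Fin d) : MeasureTheory.Integrable fun x =>
      starRingEnd ℂ (partialD (testCoe d f) j i x) * partialD (testCoe d g) j i x * (w x : ℂ) := by
  have hf := partialD_continuous f.contDiff j i
  have hg := partialD_continuous g.contDiff j i
  refine Continuous.integrable_of_hasCompactSupport
    (((Complex.continuous_conj.comp hf).mul hg).mul (Complex.continuous_ofReal.comp hw)) ?_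
  have h1 : HasCompactSupport (partialD (testCoe d g) j i) :=
    (g.hasCompactSupport.iteratedFDeriv (𝕜 := ℝ) j).comp_left
      (g := fun L : ContinuousMultilinearMap ℝ (fun _ : Fin j => RSpace d) ℂ =>
        L fun l => EuclideanSpace.single (i l) 1) rfl
  exact (h1.mul_left (f := fun x => starRingEnd ℂ (partialD (testCoe d f) j i x))).mul_right

/-- The space `𝒟` of smooth compactly supported functions on `ℝ^d`, as the projective limit of the
Sobolev spaces `W^{m,2}(ℝ^d, w(x) dx)`; its dual `𝒟'` is the union of their duals. -/
def testScale (d : ℕ) : HilbertScale (TestIndex d) (TestSpace d) where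
  core τ := sobolevCore (testCoe d) DFunLike.coe_injective (fun f => f.contDiff) τ.1.1 τ.1.2 τ.2.2
    (test_integrable τ.2.1.continuous)
  nonempty := ⟨⟨(0, fun _ => 1), contDiff_const, fun _ => le_rfl⟩⟩
  directed τ₁ τ₂ := by
    have hw : ∀ x, 1 ≤ τ₁.1.2 x + τ₂.1.2 x := fun x => by
      linarith [τ₁.2.2 x, τ₂.2.2 x]
    refine ⟨⟨(max τ₁.1.1 τ₂.1.1, fun x => τ₁.1.2 x + τ₂.1.2 x), τ₁.2.1.add τ₂.2.1, hw⟩, 1,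
      fun f => ?_⟩
    rw [one_mul]
    have hc := (τ₁.2.1.add τ₂.2.1).continuous
    exact ⟨sobolevInner_mono (le_max_left _ _) τ₁.2.2 (fun x => by linarith [τ₂.2.2 x])
        (test_integrable τ₁.2.1.continuous f f) (test_integrable hc f f),
      sobolevInner_mono (le_max_right _ _) τ₂.2.2 (fun x => by linarith [τ₁.2.2 x])
        (test_integrable τ₂.2.1.continuous f f) (test_integrable hc f f)⟩

/-- A Schwartz function, as a function. -/
def schwartzCoe (d : ℕ) : 𝓢(RSpace d, ℂ) →ₗ[ℂ] (RSpace d → ℂ) where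
  toFun f := f
  map_add' _ _ := rfl
  map_smul' _ _ := rfl

lemma schwartz_integrable {d : ℕ} (m : ℕ) (f g : 𝓢(RSpace d, ℂ)) (j : ℕ)
    (i : Fin j → Fin d) : MeasureTheory.Integrable fun x =>
      starRingEnd ℂ (partialD (schwartzCoe d f) j i x) * partialD (schwartzCoe d g) j i x *
        (((1 + ‖x‖ ^ 2) ^ m : ℝ) : ℂ) := by
  have hf : Continuous (partialD (schwartzCoe d f) j i) := partialD_continuous (f.smooth ⊤) j i
  have hg : Continuous (partialD (schwartzCoe d g) j i) := partialD_continuous (g.smooth ⊤) j i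
  obtain ⟨C, hC⟩ : ∃ C : ℝ, ∀ x, ‖partialD (schwartzCoe d f) j i x‖ ≤ C :=
    ⟨_, fun x => (partialD_norm_le _ j i x).trans (f.norm_iteratedFDeriv_le_seminorm ℝ j x)⟩
  have h0 := g.integrable_pow_mul_iteratedFDeriv (MeasureTheory.volume) 0 j
  have h1 := g.integrable_pow_mul_iteratedFDeriv (MeasureTheory.volume) (2 * m) j
  have h2 := ((h0.add h1).const_mul (C * 2 ^ m))
  refine h2.mono' (((Complex.continuous_conj.comp hf).mul hg).mul
    (Complex.continuous_ofReal.comp (by fun_prop))).aestronglyMeasurable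
    (Filter.Eventually.of_forall fun x => ?_)
  have hC0 : 0 ≤ C := (norm_nonneg _).trans (hC x)
  have hw : (1 + ‖x‖ ^ 2) ^ m ≤ 2 ^ m * (1 + ‖x‖ ^ (2 * m)) := by
    have h := add_pow_le (zero_le_one (α := ℝ)) (sq_nonneg ‖x‖) m
    rw [one_pow, ← pow_mul] at h
    refine h.trans (mul_le_mul_of_nonneg_right ?_ (by positivity))
    exact pow_le_pow_right₀ (by norm_num) (by omega)
  have hng := partialD_norm_le (schwartzCoe d g) j i x
  rw [norm_mul, norm_mul, RCLike.norm_conj, Complex.norm_real, Real.norm_of_nonneg (by positivity)]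
  simp only [Pi.add_apply, pow_zero, one_mul]
  calc ‖partialD (schwartzCoe d f) j i x‖ * ‖partialD (schwartzCoe d g) j i x‖ *
        (1 + ‖x‖ ^ 2) ^ m
      ≤ C * ‖iteratedFDeriv ℝ j (schwartzCoe d g) x‖ * (2 ^ m * (1 + ‖x‖ ^ (2 * m))) := by
        gcongr
        exact hC x
    _ = C * 2 ^ m * (‖iteratedFDeriv ℝ j g x‖ + ‖x‖ ^ (2 * m) * ‖iteratedFDeriv ℝ j g x‖) := by
        change C * ‖iteratedFDeriv ℝ j g x‖ * _ = _
        ring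

/-- The Schwartz space `𝒮` on `ℝ^d`, as the projective limit of the Sobolev spaces
`W^{m,2}(ℝ^d, (1 + |x|²)^m dx)`, `m ∈ ℕ₀`. -/
def schwartzScale (d : ℕ) : HilbertScale ℕ 𝓢(RSpace d, ℂ) where
  core m := sobolevCore (schwartzCoe d) DFunLike.coe_injective (fun f => f.smooth ⊤) m
    (fun x => (1 + ‖x‖ ^ 2) ^ m) (fun x => one_le_pow₀ (by nlinarith [sq_nonneg ‖x‖]))
    (schwartz_integrable m)
  nonempty := ⟨0⟩
  directed m₁ m₂ := by
    refine ⟨max m₁ m₂, 1, fun f => ?_⟩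
    rw [one_mul]
    have key : ∀ m : ℕ, m ≤ max m₁ m₂ →
        (sobolevInner m (fun x => (1 + ‖x‖ ^ 2) ^ m) (schwartzCoe d f) (schwartzCoe d f)).re ≤
        (sobolevInner (max m₁ m₂) (fun x => (1 + ‖x‖ ^ 2) ^ (max m₁ m₂)) (schwartzCoe d f)
          (schwartzCoe d f)).re := fun m hm =>
      sobolevInner_mono hm (fun x => one_le_pow₀ (by nlinarith [sq_nonneg ‖x‖]))
        (fun x => pow_le_pow_right₀ (by nlinarith [sq_nonneg ‖x‖]) hm)
        (schwartz_integrable m f f) (schwartz_integrable _ f f)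
    exact ⟨key m₁ (le_max_left _ _), key m₂ (le_max_right _ _)⟩

/-! ### Lifted Sheffer sequences -/

/-- `S` is the lifting, to the dual of a space `Φ` of functions on `ℝ^d` (with `κ` sending an
element of `Φ` to the corresponding function), of the Sheffer sequence on `ℂ` given by the series
`a` and `r`: with `c = log r`, the sequence `S` is a Sheffer sequence with generating function
`exp[⟨ω, A(ξ)⟩ - C(A(ξ))]`, where `A(ξ) = ∑_k a_k ξ^k` and `C(ξ) = ∑_k c_k ∫ ξ(x)^k dx`,
that is, `ρ(ξ) = exp[C(ξ)]`. The operator `A_k : Φ^{⊙k} → Φ` is `a_k` times the restriction to the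
diagonal, the continuous linear operator that sends `ξ^{⊗k}` to `ξ^k`. -/
def IsLifting {d : ℕ} (H : HilbertScale T Φ) (κ : Φ →ₗ[ℂ] (RSpace d → ℂ)) (a r : PowerSeries ℂ)
    (S : (n : ℕ) → CoNuc H → SymDual H n) : Prop :=
  ∃ (A : (n : ℕ) → SymPow H n →L[ℂ] Nuc H) (ρ : (n : ℕ) → SymDual H n),
    IsShefferWith H A ρ S ∧
    (∀ (k : ℕ) (ξ : Nuc H) (x : RSpace d),
      κ (A k (tensorPow ξ k)).val x = PowerSeries.coeff k a * κ ξ.val x ^ k) ∧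
    ∀ ξ : Nuc H, PowerSeries.mk (fun n => ρ n (tensorPow ξ n)) =
      (PowerSeries.exp ℂ).subst (PowerSeries.mk fun k =>
        PowerSeries.coeff k (PowerSeries.logOf r) * ∫ x, κ ξ.val x ^ k)

/-- The Sheffer sequence on `ℂ` given by the series `a` and `r` has exactly one lifting `S` to
`Φ'`; this `S` is regular, and its Sheffer operator extends by continuity to a linear
self-homeomorphism of `E^α_min(Φ')` for each `α ∈ [0, 1]`. -/
def LiftsRegularly {d : ℕ} (H : HilbertScale T Φ) (κ : Φ →ₗ[ℂ] (RSpace d → ℂ))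
    (a r : PowerSeries ℂ) : Prop :=
  (∃! S : (n : ℕ) → CoNuc H → SymDual H n, IsLifting H κ a r S) ∧
    ∀ S : (n : ℕ) → CoNuc H → SymDual H n, IsLifting H κ a r S →
      IsRegularSheffer H S ∧
      ∃ 𝔖 : polynomials H ≃ₗ[ℂ] polynomials H, IsShefferOperator H S 𝔖 ∧
        ∀ α ∈ Set.Icc (0 : ℝ) 1, ExtendsToSelfHomeomorphism H α 𝔖

/-! ### Classical examples on `ℂ` -/

/-- The monic Charlier polynomials `∑ₖ C(n,k) (-1)^{n-k} (z)ₖ`, with `(z)ₖ` the falling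
factorials; generating function `exp[z log(1+u) - u]`. -/
def charlier (n : ℕ) : Polynomial ℂ :=
  ∑ k ∈ Finset.range (n + 1),
    Polynomial.C ((n.choose k : ℂ) * (-1) ^ (n - k)) * descPochhammer ℂ k

/-- The monic Laguerre polynomials of parameter `κ`,
`∑ⱼ C(n,j) (-1)^{n-j} (κ+1+j)(κ+2+j)⋯(κ+n) z^j`; generating function
`exp[zu/(1+u)] (1+u)^{-(κ+1)}`. -/
def laguerre (κ : ℝ) (n : ℕ) : Polynomial ℂ :=
  ∑ j ∈ Finset.range (n + 1),
    Polynomial.C ((n.choose j : ℂ) * (-1) ^ (n - j) *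
      (ascPochhammer ℂ (n - j)).eval ((κ : ℂ) + 1 + j)) * Polynomial.X ^ j

end Sheffer

end

/-! The generating function dictates the Sheffer operator. Writing `S⁽ⁿ⁾(ω) = ∑ₖ U_{n,k} ω^{⊗k}`
with `U_{n,k}` the adjoint of `V_{n,k} : Φ^{⊙n} → Φ^{⊙k}`, comparison of coefficients in `exp[⟨ω,
A(ξ)⟩ - C(A(ξ))]` forces `⟨ω^{⊗k}, V_{n,k} ξ^{⊗n}⟩ = (n!/k!) [zⁿ] ⟨ω, A(zξ)⟩ᵏ exp(-C(A(zξ)))`. Since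
tensor powers are total in `Φ^{⊙n}`, this gives uniqueness; existence and the analytic statements
are a matter of bounds.

The scale is nuclear, so up to a change of index bounded forms and Hilbert-Schmidt forms are the
same. Hence a symmetric form bounded on every `H_{-τ}` belongs to `Φ^{⊙n}` (`mem_symPow`), and a
bounded `n`-linear form on `Φ` defines a functional on `Φ^{⊙n}` (`HSLE.exists_functional`). Combined
in `exists_kernel`, these two facts turn the displayed formula into operators. The coefficients of
`a` and `c = log r` grow at most geometrically and `A` starts in degree one, so on a small enough
ball each factor `⟨ω, A(ξ)⟩` is as small as desired. The kernels therefore have size `D^{n+1}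
(n!/k!) sᵏ` with arbitrarily small `s` (`KernelBound`, `exists_kernels`).

A function of order `β ≤ 1` and minimal type has Taylor coefficients of size `εⁿ (n!)^{-1/β}` with
arbitrarily small `ε` (`taylorCoeff_growth`). In the product with the kernel bound `εⁿ` absorbs
`Dⁿ`, and `(n!)^{1-1/β} ≤ (k!)^{1-1/β}` for `k ≤ n`. What remains is `2^{-n} ∑ₖ (s‖ω‖)ᵏ
(k!)^{-1/β}`, which grows like an exponential of small multiples of `‖ω‖^β` (`kernelTerm_growth`).
So the kernels define a continuous operator on `E^α_min`; for `α = 0` the orders above one follow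
from order one.

The inverse is of the same kind: it is built from the compositional inverse `b` of `a` and from `c`
instead of `(a, -c∘a)`. Formal substitution shows that the two operators are inverse on polynomials
(`kernelInverse`), and polynomials are dense because Taylor series converge in `E^α_min`.

For the spaces `𝒟` and `𝒮` the required facts (nuclearity, products of `n` functions bounded by
`Cⁿ`, integrability, reflexivity) all follow from one weighted Sobolev inequality,
`exists_partialD_bound`. The classical polynomial sequences are treated by differential equations
for formal power series. -/

noncomputable section

namespace Sheffer

/-! ### Hilbert norms, nuclear embeddings and Hilbert-Schmidt forms -/

section Basics

variable {T Φ : Type} [AddCommGroup Φ] [Module ℂ Φ] {H : HilbertScale T Φ}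

/-- The identity, from `Φ` with its projective limit topology to `Φ` with the norm of index `τ`. -/
def toLevel (H : HilbertScale T Φ) (τ : T) : Nuc H ≃ₗ[ℂ] Level H τ := LinearEquiv.refl ℂ Φ

lemma nucNorm_eq_norm (τ : T) (ξ : Nuc H) : nucNorm H τ ξ = ‖toLevel H τ ξ‖ := rfl

lemma norm_embed (τ : T) (ξ : Nuc H) : ‖embed H τ ξ‖ = nucNorm H τ ξ :=
  UniformSpace.Completion.norm_coe (E := Level H τ) _

lemma eq_zero_of_nucNorm_eq_zero {τ : T} {ξ : Nuc H} (h : nucNorm H τ ξ = 0) : ξ = 0 := by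
  rw [nucNorm_eq_norm, norm_eq_zero] at h
  exact (toLevel H τ).map_eq_zero_iff.1 h

/-- Finitely many vectors lie in the span of a finite orthonormal family. -/
lemma exists_orthonormal_expansion {E : Type*} [NormedAddCommGroup E] [InnerProductSpace ℂ E]
    {ι : Type*} [Finite ι] (x : ι → E) :
    ∃ (N : ℕ) (f : Fin N → E), Orthonormal ℂ f ∧
      (∀ i, x i = ∑ j, inner ℂ (f j) (x i) • f j) ∧
      ∀ i, ∑ j, ‖inner ℂ (f j) (x i)‖ ^ 2 = ‖x i‖ ^ 2 := by
  set S := Submodule.span ℂ (Set.range x)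
  have : FiniteDimensional ℂ S := FiniteDimensional.span_of_finite ℂ (Set.finite_range x)
  let b := stdOrthonormalBasis ℂ S
  have hx : ∀ i, x i ∈ S := fun i => Submodule.subset_span ⟨i, rfl⟩
  refine ⟨_, fun j => (b j : E), b.orthonormal.comp_linearIsometry S.subtypeₗᵢ,
    fun i => ?_, fun i => ?_⟩
  · have h := congrArg (S.subtype) (b.sum_repr ⟨x i, hx i⟩)
    simp only [b.repr_apply_apply, map_sum, map_smul, Submodule.subtype_apply,
      Submodule.coe_inner] at h
    exact h.symm
  · have h := b.sum_sq_norm_inner_right ⟨x i, hx i⟩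
    simpa [Submodule.coe_inner] using h

/-- The component orthogonal to a finite orthonormal family, normalized, extends the family. -/
lemma _root_.Orthonormal.residual {E : Type*} [NormedAddCommGroup E] [InnerProductSpace ℂ E]
    {N : ℕ} {f : Fin N → E} (hf : Orthonormal ℂ f) (η : E) :
    ‖η - ∑ k, inner ℂ (f k) η • f k‖ ≤ ‖η‖ ∧
    (‖η - ∑ k, inner ℂ (f k) η • f k‖ ≠ 0 → Orthonormal ℂ
      (Fin.cons (((‖η - ∑ k, inner ℂ (f k) η • f k‖⁻¹ : ℝ) : ℂ) • (η - ∑ k, inner ℂ (f k) η • f k))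
        f : Fin (N + 1) → E)) := by
  set ζ := η - ∑ k, inner ℂ (f k) η • f k with hζ
  have horth : ∀ j, inner ℂ (f j) ζ = 0 := by
    intro j
    rw [hζ, inner_sub_right, hf.inner_right_fintype, sub_self]
  refine ⟨?_, fun h0 => ?_⟩
  · have h1 : η = ζ + ∑ k, inner ℂ (f k) η • f k := by rw [hζ]; abel
    have h2 : inner ℂ ζ (∑ k, inner ℂ (f k) η • f k) = 0 := by
      rw [inner_sum]
      refine Finset.sum_eq_zero fun k _ => ?_
      rw [inner_smul_right, ← inner_conj_symm ζ, horth]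
      simp
    have h3 := norm_add_sq_eq_norm_sq_add_norm_sq_of_inner_eq_zero _ _ h2
    rw [← h1] at h3
    nlinarith [norm_nonneg ζ, norm_nonneg η, norm_nonneg (∑ k, inner ℂ (f k) η • f k)]
  · constructor
    · intro i
      refine Fin.cases ?_ (fun i => ?_) i
      · rw [Fin.cons_zero, norm_smul, Complex.norm_real, norm_inv, norm_norm, inv_mul_cancel₀ h0]
      · rw [Fin.cons_succ]; exact hf.1 i
    · intro i j
      refine Fin.cases ?_ (fun i => ?_) i <;> refine Fin.cases ?_ (fun j => ?_) j
      · exact fun h => absurd rfl h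
      · intro _
        rw [Fin.cons_zero, Fin.cons_succ, ← inner_conj_symm, inner_smul_right, horth]
        simp
      · intro _
        rw [Fin.cons_zero, Fin.cons_succ, inner_smul_right, horth]
        simp
      · intro hij
        rw [Fin.cons_succ, Fin.cons_succ]
        exact hf.2 fun h => hij (by rw [h])

/-- `ω` has norm at most `C` in `H_{-τ}`. -/
def DualLE (H : HilbertScale T Φ) (τ : T) (C : ℝ) (ω : CoNuc H) : Prop :=
  0 ≤ C ∧ ∀ ξ, ‖ω ξ‖ ≤ C * nucNorm H τ ξ

lemma DualLE.mono {τ : T} {C C' : ℝ} {ω : CoNuc H} (h : DualLE H τ C ω) (hC : C ≤ C') :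
    DualLE H τ C' ω :=
  ⟨h.1.trans hC, fun ξ => (h.2 ξ).trans (mul_le_mul_of_nonneg_right hC (apply_nonneg _ _))⟩

lemma DualLE.smul {τ : T} {C : ℝ} {ω : CoNuc H} (h : DualLE H τ C ω) (z : ℂ) :
    DualLE H τ (‖z‖ * C) (z • ω) :=
  ⟨mul_nonneg (norm_nonneg _) h.1, fun ξ => by
    rw [smul_apply, norm_smul, mul_assoc]
    exact mul_le_mul_of_nonneg_left (h.2 ξ) (norm_nonneg _)⟩

lemma DualLE.of_le {τ τ' : T} {C D : ℝ} {ω : CoNuc H} (h : DualLE H τ C ω) (hD : 0 ≤ D)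
    (hle : ∀ ξ, nucNorm H τ ξ ≤ D * nucNorm H τ' ξ) : DualLE H τ' (C * D) ω :=
  ⟨mul_nonneg h.1 hD, fun ξ => (h.2 ξ).trans (by
    rw [mul_assoc]; exact mul_le_mul_of_nonneg_left (hle ξ) h.1)⟩

lemma dualLE_incl (τ : T) (ω : HilbDual H τ) : DualLE H τ ‖ω‖ (incl H τ ω) :=
  ⟨norm_nonneg ω, fun ξ => by rw [incl_apply, ← norm_embed]; exact ω.le_opNorm _⟩

lemma continuous_of_bound (τ : T) (f : Nuc H →ₗ[ℂ] ℂ) (C : ℝ)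
    (hf : ∀ ξ, ‖f ξ‖ ≤ C * nucNorm H τ ξ) : Continuous f :=
  continuous_of_le_seminorm (nucNorm H) τ f C hf

/-- A functional bounded in the norm of index `τ` on the dense subspace `Φ` extends by continuity to
the completion, with the same bound. -/
lemma DualLE.exists_incl {τ : T} {C : ℝ} {ω : CoNuc H} (h : DualLE H τ C ω) :
    ∃ ω' : HilbDual H τ, incl H τ ω' = ω ∧ ‖ω'‖ ≤ C := by
  let f : Level H τ →L[ℂ] ℂ := LinearMap.mkContinuous
    (ω.toLinearMap ∘ₗ (toLevel H τ).symm.toLinearMap) C (fun x => h.2 ((toLevel H τ).symm x))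
  let e := UniformSpace.Completion.toComplL (𝕜 := ℂ) (E := Level H τ)
  have he : ∀ x, f.extend e (e x) = f x := fun x =>
    ContinuousLinearMap.extend_eq f (UniformSpace.Completion.denseRange_coe)
      (UniformSpace.Completion.isUniformInducing_coe _) x
  refine ⟨f.extend e, ?_, ?_⟩
  · ext ξ
    exact he (toLevel H τ ξ)
  · refine ContinuousLinearMap.opNorm_le_bound _ h.1 fun y => ?_
    induction y using UniformSpace.Completion.induction_on with
    | hp => exact isClosed_le (by fun_prop) (by fun_prop)
    | ih x =>
      rw [UniformSpace.Completion.norm_coe]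
      have := he x
      change f.extend e ((x : Level H τ) : Hilb H τ) = f x at this
      rw [this]
      exact h.2 ((toLevel H τ).symm x)

lemma exists_dualLE (ω : CoNuc H) : ∃ τ C, DualLE H τ C ω := by
  obtain ⟨τ, ω', rfl⟩ := exists_incl_eq H ω
  exact ⟨τ, _, dualLE_incl τ ω'⟩

lemma incl_injective (τ : T) : Function.Injective (incl H τ) := by
  intro a b hab
  refine ContinuousLinearMap.ext fun y => ?_
  induction y using UniformSpace.Completion.induction_on with
  | hp => exact isClosed_eq a.continuous b.continuous
  | ih x => exact DFunLike.congr_fun hab ((toLevel H τ).symm x)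

/-- The norm of `Φ` in terms of functionals. -/
lemma nucNorm_le_of_dual {τ : T} {ξ : Nuc H} {K : ℝ} (hK : 0 ≤ K)
    (h : ∀ ω : CoNuc H, DualLE H τ 1 ω → ‖ω ξ‖ ≤ K) : nucNorm H τ ξ ≤ K := by
  rw [← norm_embed]
  refine NormedSpace.norm_le_dual_bound ℂ _ hK fun f => ?_
  rcases eq_or_ne f 0 with rfl | hf
  · simp
  have hf' : ‖f‖ ≠ 0 := norm_ne_zero_iff.2 hf
  -- The hypothesis concerns the unit ball of `H_{-τ}`, hence the normalization.
  have h1 := h (((‖f‖ : ℂ)⁻¹) • incl H τ f) (by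
    have := (dualLE_incl τ f).smul ((‖f‖ : ℂ)⁻¹)
    rwa [norm_inv, Complex.norm_real, norm_norm, inv_mul_cancel₀ hf'] at this)
  rw [smul_apply, norm_smul, norm_inv, Complex.norm_real, norm_norm,
    inv_mul_le_iff₀ (by positivity), incl_apply, mul_comm] at h1
  exact h1

/-- The scale is nuclear: for each `τ` there is `τ'` such that the embedding of `H_{τ'}` into `H_τ`
is a Hilbert-Schmidt operator. -/
def IsNuclear (H : HilbertScale T Φ) : Prop :=
  ∀ τ, ∃ τ', ∃ κ : ℝ, 1 ≤ κ ∧ ∀ (N : ℕ) (f : Fin N → Nuc H),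
    Orthonormal ℂ (fun j => toLevel H τ' (f j)) → ∑ j, nucNorm H τ (f j) ^ 2 ≤ κ ^ 2

/-- The embedding of `H_{τ'}` into `H_τ` has Hilbert-Schmidt norm at most `κ`. -/
def HSLE (H : HilbertScale T Φ) (τ τ' : T) (κ : ℝ) : Prop :=
  1 ≤ κ ∧ ∀ (N : ℕ) (f : Fin N → Nuc H),
    Orthonormal ℂ (fun j => toLevel H τ' (f j)) → ∑ j, nucNorm H τ (f j) ^ 2 ≤ κ ^ 2

/-- A normalized vector is an orthonormal family of length one, so the operator norm is at most the
Hilbert-Schmidt norm. -/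
lemma HSLE.nucNorm_le {τ τ' : T} {κ : ℝ} (h : HSLE H τ τ' κ) (ξ : Nuc H) :
    nucNorm H τ ξ ≤ κ * nucNorm H τ' ξ := by
  have hκ : 0 ≤ κ := zero_le_one.trans h.1
  rcases eq_or_ne (nucNorm H τ' ξ) 0 with h0 | h0
  · rw [eq_zero_of_nucNorm_eq_zero h0]; simp
  set c := nucNorm H τ' ξ
  have hc : 0 < c := lt_of_le_of_ne (apply_nonneg _ _) h0.symm
  have ho : Orthonormal ℂ (fun _ : Fin 1 => toLevel H τ' ((c⁻¹ : ℂ) • ξ)) := by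
    refine ⟨fun _ => ?_, fun i j hij => absurd (Subsingleton.elim i j) hij⟩
    rw [← nucNorm_eq_norm, map_smul_eq_mul, norm_inv, Complex.norm_real, Real.norm_of_nonneg hc.le,
      inv_mul_cancel₀ h0]
  have h1 := h.2 1 _ ho
  rw [Finset.sum_const, Finset.card_univ, Fintype.card_fin, one_smul, map_smul_eq_mul, norm_inv,
    Complex.norm_real, Real.norm_of_nonneg hc.le] at h1
  have h2 := (abs_le_of_sq_le_sq' h1 hκ).2
  rwa [inv_mul_le_iff₀ hc, mul_comm] at h2

lemma HSLE.dualLE {τ τ' : T} {κ C : ℝ} (h : HSLE H τ τ' κ) {ω : CoNuc H} (hω : DualLE H τ C ω) :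
    DualLE H τ' (C * κ) ω := hω.of_le (zero_le_one.trans h.1) h.nucNorm_le

/-- Sums of squares of the `H_{-τ'}`-norms of an orthonormal family of `H_{-τ}`. -/
lemma HSLE.exists_dualLE {τ τ' : T} {κ : ℝ} (h : HSLE H τ τ' κ) (e : OrthoFam H τ) :
    ∃ C : Fin e.1 → ℝ, (∀ k, DualLE H τ' (C k) (e.dual k)) ∧ ∑ k, C k ^ 2 ≤ κ ^ 2 := by
  have hκ : 0 ≤ κ := zero_le_one.trans h.1
  have hb : ∀ k, DualLE H τ' (1 * κ) (e.dual k) := fun k => by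
    have h1 := dualLE_incl τ (InnerProductSpace.toDual ℂ (Hilb H τ) (e.2.1 k))
    rw [LinearIsometryEquiv.norm_map, e.2.2.1 k] at h1
    exact h.dualLE h1
  let f : Fin e.1 → (Level H τ' →L[ℂ] ℂ) := fun k => LinearMap.mkContinuous
    ((e.dual k).toLinearMap ∘ₗ (toLevel H τ').symm.toLinearMap) (1 * κ)
    (fun x => (hb k).2 ((toLevel H τ').symm x))
  refine ⟨fun k => ‖f k‖, fun k => ⟨norm_nonneg _, fun ξ => (f k).le_opNorm (toLevel H τ' ξ)⟩, ?_⟩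
  -- An operator and its adjoint have the same Hilbert-Schmidt norm. The norm of `f k` need not be
  -- attained, so unit vectors reaching the fraction `t < 1` of it are used. They are expanded in
  -- one orthonormal family `g`, and Bessel's inequality for the family `e` bounds the double sum of
  -- `‖f k (g j)‖ ^ 2` by the Hilbert-Schmidt sum of `g`.
  have key : ∀ t : ℝ, 0 ≤ t → t < 1 → t ^ 2 * ∑ k, ‖f k‖ ^ 2 ≤ κ ^ 2 := by
    intro t ht0 ht
    have hη : ∀ k, ∃ η : Level H τ', ‖η‖ ≤ 1 ∧ t * ‖f k‖ ≤ ‖f k η‖ := by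
      intro k
      rcases eq_or_lt_of_le (norm_nonneg (f k)) with h0 | h0
      · exact ⟨0, by simp, by rw [← h0]; simp⟩
      · obtain ⟨η, h1, h2⟩ := (f k).exists_lt_apply_of_lt_opNorm (r := t * ‖f k‖) (by nlinarith)
        exact ⟨η, h1.le, h2.le⟩
    choose η hη1 hη2 using hη
    obtain ⟨N, g, hg, hexp, hsq⟩ := exists_orthonormal_expansion η
    have h1 : ∀ k, (t * ‖f k‖) ^ 2 ≤ ∑ j, ‖f k (g j)‖ ^ 2 := by
      intro k
      have h2 : ‖f k (η k)‖ ≤ ∑ j, ‖inner ℂ (g j) (η k)‖ * ‖f k (g j)‖ := by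
        conv_lhs => rw [hexp k, map_sum]
        refine (norm_sum_le _ _).trans (Finset.sum_le_sum fun j _ => ?_)
        rw [map_smul, norm_smul]
      calc (t * ‖f k‖) ^ 2 ≤ (∑ j, ‖inner ℂ (g j) (η k)‖ * ‖f k (g j)‖) ^ 2 :=
            pow_le_pow_left₀ (by positivity) ((hη2 k).trans h2) 2
        _ ≤ (∑ j, ‖inner ℂ (g j) (η k)‖ ^ 2) * ∑ j, ‖f k (g j)‖ ^ 2 :=
            Finset.sum_mul_sq_le_sq_mul_sq _ _ _
        _ ≤ 1 * ∑ j, ‖f k (g j)‖ ^ 2 := by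
            refine mul_le_mul_of_nonneg_right ?_ (Finset.sum_nonneg fun _ _ => by positivity)
            rw [hsq k]
            exact pow_le_one₀ (norm_nonneg _) (hη1 k)
        _ = _ := one_mul _
    calc t ^ 2 * ∑ k, ‖f k‖ ^ 2 = ∑ k, (t * ‖f k‖) ^ 2 := by
          rw [Finset.mul_sum]; exact Finset.sum_congr rfl fun k _ => by ring
      _ ≤ ∑ k, ∑ j, ‖f k (g j)‖ ^ 2 := Finset.sum_le_sum fun k _ => h1 k
      _ = ∑ j, ∑ k, ‖f k (g j)‖ ^ 2 := Finset.sum_comm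
      _ ≤ ∑ j, nucNorm H τ ((toLevel H τ').symm (g j)) ^ 2 := by
          refine Finset.sum_le_sum fun j _ => ?_
          rw [← norm_embed]
          exact e.2.2.sum_inner_products_le (embed H τ ((toLevel H τ').symm (g j)))
      _ ≤ κ ^ 2 := h.2 N _ (by simpa using hg)
  have hlim : Filter.Tendsto (fun t : ℝ => t ^ 2 * ∑ k, ‖f k‖ ^ 2) (𝓝[<] 1)
      (𝓝 (1 ^ 2 * ∑ k, ‖f k‖ ^ 2)) :=
    (Continuous.tendsto (by fun_prop) 1).mono_left nhdsWithin_le_nhds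
  rw [one_pow, one_mul] at hlim
  refine le_of_tendsto hlim ?_
  filter_upwards [Ioo_mem_nhdsLT (show (0 : ℝ) < 1 by norm_num)] with t ht
  exact key t ht.1.le ht.2

/-- The restriction of the `n`-linear form `G` to `H_{-τ}` is bounded with constant `K`. -/
def OpBound {n : ℕ} (τ : T) (K : ℝ) (G : MultilinearMap ℂ (fun _ : Fin n => CoNuc H) ℂ) : Prop :=
  ∀ (ω : Fin n → CoNuc H) (C : Fin n → ℝ), (∀ i, DualLE H τ (C i) (ω i)) → ‖G ω‖ ≤ K * ∏ i, C i

/-- A form that is bounded on `H_{-τ'}` is Hilbert-Schmidt on `H_{-τ}`. -/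
lemma OpBound.norm_coeffs_le {n : ℕ} {τ τ' : T} {κ K : ℝ}
    {G : MultilinearMap ℂ (fun _ : Fin n => CoNuc H) ℂ} (hG : OpBound τ' K G) (hK : 0 ≤ K)
    (h : HSLE H τ τ' κ) (e : OrthoFam H τ) : ‖coeffs n e G‖ ≤ K * κ ^ n := by
  have hκ : 0 ≤ κ := zero_le_one.trans h.1
  obtain ⟨C, hC, hsum⟩ := h.exists_dualLE e
  rw [EuclideanSpace.norm_eq]
  refine Real.sqrt_le_iff.2 ⟨by positivity, ?_⟩
  calc ∑ i, ‖coeffs n e G i‖ ^ 2 ≤ ∑ i : Fin n → Fin e.1, K ^ 2 * ∏ j, C (i j) ^ 2 := by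
        refine Finset.sum_le_sum fun i _ => ?_
        rw [Finset.prod_pow, ← mul_pow]
        exact pow_le_pow_left₀ (norm_nonneg _) (hG _ (fun j => C (i j)) fun j => hC _) 2
    _ = K ^ 2 * (∑ k, C k ^ 2) ^ n := by
        rw [← Finset.mul_sum]
        congr 1
        have h2 := (Finset.prod_univ_sum (fun _ : Fin n => (Finset.univ : Finset (Fin e.1)))
          (fun _ k => C k ^ 2))
        rw [Fintype.piFinset_univ] at h2
        rw [← h2, Finset.prod_const, Finset.card_univ, Fintype.card_fin]
    _ ≤ K ^ 2 * (κ ^ 2) ^ n := by gcongr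
    _ = (K * κ ^ n) ^ 2 := by ring

/-- A Hilbert-Schmidt form is bounded. -/
lemma opBound_of_coeffs {n : ℕ} {τ : T} {K : ℝ}
    {G : MultilinearMap ℂ (fun _ : Fin n => CoNuc H) ℂ} (hG : ∀ e : OrthoFam H τ, ‖coeffs n e G‖ ≤ K) :
    OpBound τ K G := by
  intro ω C hC
  choose ω' h1 h2 using fun i => (hC i).exists_incl
  obtain ⟨x, hx⟩ : ∃ x : Fin n → Hilb H τ, ∀ i, InnerProductSpace.toDual ℂ (Hilb H τ) (x i) = ω' i :=
    ⟨fun i => (InnerProductSpace.toDual ℂ (Hilb H τ)).symm (ω' i), fun i => by simp⟩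
  obtain ⟨N, g, hg, hexp, hsq⟩ := exists_orthonormal_expansion x
  let e : OrthoFam H τ := ⟨N, g, hg⟩
  -- The conjugates come from the Riesz isomorphism, which is conjugate linear.
  have hω : ω = fun i => ∑ j, (starRingEnd ℂ (inner ℂ (g j) (x i))) • e.dual j := by
    funext i
    rw [← h1 i, ← hx i]
    conv_lhs => rw [hexp i]
    simp only [map_sum, map_smulₛₗ]
    rfl
  have hx' : ∀ i, ‖x i‖ ≤ C i := fun i => by
    rw [← LinearIsometryEquiv.norm_map (InnerProductSpace.toDual ℂ (Hilb H τ)), hx i]; exact h2 i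
  have hK : 0 ≤ K := (norm_nonneg _).trans (hG e)
  rw [hω, MultilinearMap.map_sum]
  simp only [MultilinearMap.map_smul_univ]
  have hcs : ‖∑ r : Fin n → Fin N, (∏ i, starRingEnd ℂ (inner ℂ (g (r i)) (x i))) •
      G fun i => e.dual (r i)‖ ^ 2 ≤ (∏ i, ‖x i‖ ^ 2) * ‖coeffs n e G‖ ^ 2 := by
    calc _ ≤ (∑ r : Fin n → Fin N, (∏ i, ‖inner ℂ (g (r i)) (x i)‖) *
            ‖G fun i => e.dual (r i)‖) ^ 2 := by
          refine pow_le_pow_left₀ (norm_nonneg _) ((norm_sum_le _ _).trans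
            (Finset.sum_le_sum fun r _ => ?_)) 2
          rw [norm_smul, norm_prod]
          simp only [RCLike.norm_conj, le_refl]
      _ ≤ (∑ r : Fin n → Fin N, (∏ i, ‖inner ℂ (g (r i)) (x i)‖) ^ 2) *
            ∑ r : Fin n → Fin N, ‖G fun i => e.dual (r i)‖ ^ 2 :=
          Finset.sum_mul_sq_le_sq_mul_sq _ _ _
      _ = _ := by
          rw [EuclideanSpace.norm_sq_eq]
          congr 1
          simp only [← hsq, ← Finset.prod_pow]
          have h2 := (Finset.prod_univ_sum (fun _ : Fin n => (Finset.univ : Finset (Fin N)))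
            (fun i k => ‖inner ℂ (g k) (x i)‖ ^ 2))
          rw [Fintype.piFinset_univ] at h2
          exact h2.symm
  refine abs_le_of_sq_le_sq' (hcs.trans ?_) (mul_nonneg hK (Finset.prod_nonneg fun i _ => (hC i).1))
    |>.2
  rw [Finset.prod_pow, mul_comm, ← mul_pow]
  have h3 : ∏ i, ‖x i‖ ≤ ∏ i, C i := Finset.prod_le_prod (fun _ _ => norm_nonneg _) fun i _ => hx' i
  have h4 := hG e
  have h5 : 0 ≤ ∏ i, ‖x i‖ := Finset.prod_nonneg fun _ _ => norm_nonneg _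
  gcongr

lemma opBound_form {n : ℕ} (τ : T) (φ : SymPow H n) : OpBound τ (symNorm H n τ φ) φ.form :=
  opBound_of_coeffs fun e => coeffs_le_symNorm H n τ φ e

/-- A converse to `opBound_form` at the price of a Hilbert-Schmidt embedding: each of the `n`
arguments contributes one factor `κ`. Estimates are therefore made for operator bounds and converted
to Hilbert space norms only at the end. -/
lemma symNorm_le {n : ℕ} {τ τ' : T} {κ K : ℝ} {φ : SymPow H n} (hG : OpBound τ' K φ.form)
    (hK : 0 ≤ K) (h : HSLE H τ τ' κ) : symNorm H n τ φ ≤ K * κ ^ n := by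
  have : Nonempty (OrthoFam H τ) := ⟨⟨0, Fin.elim0, ⟨fun i => i.elim0, fun i => i.elim0⟩⟩⟩
  rw [symNorm_apply]
  exact ciSup_le fun e => hG.norm_coeffs_le hK h e

/-- Symmetric forms that are bounded on each `H_{-τ}` belong to `Φ^{⊙n}`. -/
lemma mem_symPow (hH : IsNuclear H) {n : ℕ} {G : MultilinearMap ℂ (fun _ : Fin n => CoNuc H) ℂ}
    (hs : ∀ (σ : Equiv.Perm (Fin n)) (ω : Fin n → CoNuc H), G (ω ∘ σ) = G ω)
    (hb : ∀ τ, ∃ K, 0 ≤ K ∧ OpBound τ K G) : G ∈ symPowSubmodule H n := by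
  refine Submodule.mem_inf.2 ⟨hs, (Submodule.mem_iInf _).2 fun τ => ?_⟩
  obtain ⟨τ', κ, hκ⟩ := hH τ
  obtain ⟨K, hK, hG⟩ := hb τ'
  refine ⟨K * κ ^ n, ?_⟩
  rintro _ ⟨e, rfl⟩
  exact hG.norm_coeffs_le hK hκ e

/-- The embedding of `H_{τ'}` into `H_τ` is approximated by operators of finite rank. -/
lemma HSLE.exists_finite_rank {τ τ' : T} {κ : ℝ} (h : HSLE H τ τ' κ) {ε : ℝ} (hε : 0 < ε) :
    ∃ (N : ℕ) (ξ : Fin N → Nuc H) (ω : Fin N → CoNuc H), ∀ η : Nuc H,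
      nucNorm H τ (η - ∑ k, ω k η • ξ k) ≤ ε * nucNorm H τ' η := by
  let S : Set ℝ := {s | ∃ (N : ℕ) (f : Fin N → Nuc H),
    Orthonormal ℂ (fun j => toLevel H τ' (f j)) ∧ s = ∑ j, nucNorm H τ (f j) ^ 2}
  have hSb : BddAbove S := ⟨κ ^ 2, by rintro _ ⟨N, f, hf, rfl⟩; exact h.2 N f hf⟩
  have hSn : S.Nonempty :=
    ⟨_, 0, Fin.elim0, ⟨fun i => i.elim0, fun i => i.elim0⟩, rfl⟩
  -- The family `f` comes within `ε ^ 2` of the supremum of the Hilbert-Schmidt sums. Adjoining the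
  -- normalized component of `η` orthogonal to `f` can raise the sum by at most `ε ^ 2`, which
  -- bounds the `τ`-norm of this component by `ε` times its `τ'`-norm.
  obtain ⟨_, ⟨N, f, hf, rfl⟩, hlt⟩ := exists_lt_of_lt_csSup hSn
    (show sSup S - ε ^ 2 < sSup S by linarith [pow_pos hε 2])
  refine ⟨N, f, fun k => incl H τ' (InnerProductSpace.toDual ℂ (Hilb H τ') (embed H τ' (f k))),
    fun η => ?_⟩
  have hval : ∀ k, incl H τ' (InnerProductSpace.toDual ℂ (Hilb H τ') (embed H τ' (f k))) η =
      inner ℂ (toLevel H τ' (f k)) (toLevel H τ' η) := fun k => by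
    rw [incl_apply, InnerProductSpace.toDual_apply_apply]
    exact UniformSpace.Completion.inner_coe _ _
  simp only [hval]
  set ζ : Nuc H := η - ∑ k, inner ℂ (toLevel H τ' (f k)) (toLevel H τ' η) • f k with hζ
  have hζl : toLevel H τ' η - ∑ k, inner ℂ (toLevel H τ' (f k)) (toLevel H τ' η) •
      toLevel H τ' (f k) = toLevel H τ' ζ := by
    simp [hζ, map_sub, map_sum]
  obtain ⟨hnorm, hcons⟩ := hf.residual (toLevel H τ' η)
  rw [hζl, ← nucNorm_eq_norm] at hnorm hcons
  refine le_trans ?_ (mul_le_mul_of_nonneg_left hnorm hε.le)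
  rcases eq_or_ne (nucNorm H τ' ζ) 0 with h0 | h0
  · rw [eq_zero_of_nucNorm_eq_zero h0]; simp
  set c := nucNorm H τ' ζ with hc
  have hc0 : 0 < c := lt_of_le_of_ne (apply_nonneg _ _) h0.symm
  have ho : Orthonormal ℂ (fun j : Fin (N + 1) => toLevel H τ'
      ((Fin.cons (((c⁻¹ : ℝ) : ℂ) • ζ) f : Fin (N + 1) → Nuc H) j)) := by
    have h1 := hcons h0
    convert h1 using 1
    funext j
    refine Fin.cases ?_ (fun j => ?_) j
    · rfl
    · rfl
  have h1 := le_csSup hSb ⟨_, _, ho, rfl⟩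
  rw [Fin.sum_univ_succ] at h1
  simp only [Fin.cons_zero, Fin.cons_succ] at h1
  rw [map_smul_eq_mul, Complex.norm_real, norm_inv, Real.norm_of_nonneg hc0.le] at h1
  have h2 := (abs_le_of_sq_le_sq' (show (c⁻¹ * nucNorm H τ ζ) ^ 2 ≤ ε ^ 2 by linarith) hε.le).2
  rwa [inv_mul_le_iff₀ hc0, mul_comm] at h2

end Basics

/-! ### Polarization of multilinear maps -/

section Polarization

variable {E W : Type*} [AddCommGroup E] [Module ℂ E] [AddCommGroup W] [Module ℂ W] {n : ℕ}

/-- The polarization identity. -/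
lemma sum_perm_eq_sum_diag (M : MultilinearMap ℂ (fun _ : Fin n => E) W) (ξ : Fin n → E) :
    ∑ σ : Equiv.Perm (Fin n), M (ξ ∘ σ) =
      ∑ u : Finset (Fin n), ((-1 : ℤ) ^ u.card) • M fun _ => ∑ i ∈ uᶜ, ξ i := by
  classical
  simp only [MultilinearMap.map_sum_finset, Finset.smul_sum]
  -- Inclusion-exclusion: after expansion of the diagonal values, an index function `r` occurs for
  -- all `u` disjoint from its range. The signs cancel unless the range is everything, that is,
  -- unless `r` is a permutation.
  have h1 : ∀ u : Finset (Fin n), (∑ r ∈ Fintype.piFinset fun _ : Fin n => uᶜ,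
      ((-1 : ℤ) ^ u.card) • M fun i => ξ (r i)) =
      ∑ r : Fin n → Fin n, if u ∈ (Finset.univ.image r)ᶜ.powerset then
        ((-1 : ℤ) ^ u.card) • M fun i => ξ (r i) else 0 := by
    intro u
    rw [← Finset.sum_filter]
    refine Finset.sum_congr ?_ fun _ _ => rfl
    ext r
    simp only [Fintype.mem_piFinset, Finset.mem_compl, Finset.mem_filter, Finset.mem_univ,
      true_and, Finset.mem_powerset, Finset.subset_iff, Finset.mem_image, not_exists]
    exact ⟨fun h x hx y hy => h y (hy ▸ hx), fun h y hy => h hy y rfl⟩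
  simp only [h1]
  rw [Finset.sum_comm]
  have h2 : ∀ r : Fin n → Fin n, (∑ u : Finset (Fin n), if u ∈ (Finset.univ.image r)ᶜ.powerset then
        ((-1 : ℤ) ^ u.card) • M fun i => ξ (r i) else 0) =
      if Function.Surjective r then M fun i => ξ (r i) else 0 := by
    intro r
    rw [← Finset.sum_filter, Finset.filter_mem_eq_inter, Finset.univ_inter, ← Finset.sum_smul,
      Finset.sum_powerset_neg_one_pow_card]
    by_cases hr : Function.Surjective r
    · rw [if_pos hr, if_pos (by rw [Finset.image_univ_of_surjective hr, Finset.compl_univ]), one_smul]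
    · rw [if_neg hr, if_neg, zero_smul]
      intro h
      apply hr
      rw [Finset.compl_eq_empty_iff, Finset.eq_univ_iff_forall] at h
      intro y
      obtain ⟨x, -, hx⟩ := Finset.mem_image.1 (h y)
      exact ⟨x, hx⟩
  simp only [h2]
  rw [← Finset.sum_filter]
  refine Finset.sum_bij (fun σ _ => ⇑σ) (fun σ _ => by simp [σ.surjective])
    (fun σ _ π _ h => DFunLike.coe_injective h) (fun r hr => ?_) (fun σ _ => rfl)
  have hr' : Function.Surjective r := (Finset.mem_filter.1 hr).2
  exact ⟨Equiv.ofBijective r ⟨Finite.injective_iff_surjective.2 hr', hr'⟩, Finset.mem_univ _, rfl⟩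

/-- Two multilinear maps with the same diagonal have the same symmetrization. -/
lemma sum_perm_eq_of_diag {M M' : MultilinearMap ℂ (fun _ : Fin n => E) W}
    (h : ∀ x, M (fun _ => x) = M' fun _ => x) (ξ : Fin n → E) :
    ∑ σ : Equiv.Perm (Fin n), M (ξ ∘ σ) = ∑ σ : Equiv.Perm (Fin n), M' (ξ ∘ σ) := by
  rw [sum_perm_eq_sum_diag, sum_perm_eq_sum_diag]
  simp only [h]

/-- Two symmetric multilinear maps with the same diagonal are equal. -/
lemma eq_of_diag {M M' : MultilinearMap ℂ (fun _ : Fin n => E) W}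
    (hM : ∀ (σ : Equiv.Perm (Fin n)) (ξ : Fin n → E), M (ξ ∘ σ) = M ξ)
    (hM' : ∀ (σ : Equiv.Perm (Fin n)) (ξ : Fin n → E), M' (ξ ∘ σ) = M' ξ)
    (h : ∀ x, M (fun _ => x) = M' fun _ => x) : M = M' := by
  ext ξ
  have h1 := sum_perm_eq_of_diag h ξ
  simp only [hM, hM', Finset.sum_const, Finset.card_univ, Fintype.card_perm, Fintype.card_fin,
    ← Nat.cast_smul_eq_nsmul ℂ] at h1
  exact smul_right_injective W (Nat.cast_ne_zero.2 n.factorial_ne_zero) h1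

end Polarization

/-! ### The kernel theorem and the density of tensor powers -/

section Kernel

variable {T Φ : Type} [AddCommGroup Φ] [Module ℂ Φ] {H : HilbertScale T Φ}

lemma SymPow.ext {n : ℕ} {φ ψ : SymPow H n} (h : ∀ ω, φ.form ω = ψ.form ω) : φ = ψ :=
  Subtype.ext (MultilinearMap.ext h)

lemma form_perm {n : ℕ} (φ : SymPow H n) (σ : Equiv.Perm (Fin n)) (ω : Fin n → CoNuc H) :
    φ.form (ω ∘ σ) = φ.form ω := (Submodule.mem_inf.1 φ.2).1 σ ω

/-- By polarization a symmetric form is determined by its diagonal, so identities in `Φ^{⊙n}` need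
only be checked on the powers `ω^{⊗n}`. -/
lemma SymPow.ext_diag {n : ℕ} {φ ψ : SymPow H n}
    (h : ∀ ω : CoNuc H, φ.form (fun _ => ω) = ψ.form fun _ => ω) : φ = ψ :=
  Subtype.ext (eq_of_diag (form_perm φ) (form_perm ψ) h)

lemma symProd_form {n : ℕ} (ξ : Fin n → Nuc H) (ω : Fin n → CoNuc H) :
    (symProd ξ).form ω = (n.factorial : ℂ)⁻¹ * ∑ σ : Equiv.Perm (Fin n), ∏ j, ω j (ξ (σ j)) := by
  change (((n.factorial : ℂ)⁻¹) • ∑ σ : Equiv.Perm (Fin n), elemForm (ξ ∘ σ)) ω = _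
  simp only [smul_apply, sum_apply, elemForm_apply, smul_eq_mul]
  rfl

lemma symProd_form_diag {n : ℕ} (ξ : Fin n → Nuc H) (ω : CoNuc H) :
    (symProd ξ).form (fun _ => ω) = ∏ j, ω (ξ j) := by
  rw [symProd_form]
  have h : ∀ σ : Equiv.Perm (Fin n), ∏ j, ω (ξ (σ j)) = ∏ j, ω (ξ j) := fun σ =>
    Equiv.prod_comp σ fun j => ω (ξ j)
  simp only [h, Finset.sum_const, Finset.card_univ, Fintype.card_perm, Fintype.card_fin,
    nsmul_eq_mul]
  rw [← mul_assoc, inv_mul_cancel₀ (Nat.cast_ne_zero.2 n.factorial_ne_zero), one_mul]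

/-- The product `∏ⱼ ⟨ωⱼ, ξⱼ⟩` as a multilinear function of `ξ`. -/
def prodForm {n : ℕ} (ω : Fin n → CoNuc H) : MultilinearMap ℂ (fun _ : Fin n => Nuc H) ℂ :=
  (MultilinearMap.mkPiAlgebra ℂ (Fin n) ℂ).compLinearMap fun j => (ω j).toLinearMap

lemma prodForm_apply {n : ℕ} (ω : Fin n → CoNuc H) (ξ : Fin n → Nuc H) :
    prodForm ω ξ = ∏ j, ω j (ξ j) := by
  simp [prodForm]

/-- A symmetric product is a linear combination of tensor powers. -/
lemma symProd_eq_sum_tensorPow {n : ℕ} (ξ : Fin n → Nuc H) :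
    symProd ξ = ((n.factorial : ℂ)⁻¹) • ∑ u : Finset (Fin n),
      ((-1 : ℤ) ^ u.card) • tensorPow (∑ i ∈ uᶜ, ξ i) n := by
  refine SymPow.ext fun ω => ?_
  rw [symProd_form]
  have h := sum_perm_eq_sum_diag (prodForm ω) ξ
  simp only [prodForm_apply, Function.comp_apply] at h
  rw [h]
  simp only [map_smul, map_sum, map_zsmul, smul_apply, sum_apply, smul_eq_mul, tensorPow_form]

/-- The values of a linear map on symmetric products, from those on tensor powers. -/
lemma map_symProd {n : ℕ} {W : Type*} [AddCommGroup W] [Module ℂ W] (L : SymPow H n →ₗ[ℂ] W)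
    (M : MultilinearMap ℂ (fun _ : Fin n => Nuc H) W)
    (h : ∀ ξ, L (tensorPow ξ n) = M fun _ => ξ) (ξ : Fin n → Nuc H) :
    L (symProd ξ) = ((n.factorial : ℂ)⁻¹) • ∑ σ : Equiv.Perm (Fin n), M (ξ ∘ σ) := by
  rw [symProd_eq_sum_tensorPow, sum_perm_eq_sum_diag]
  simp only [map_smul, map_sum, map_zsmul, h]

/-- Extension of a functional given on the range of a linear map. -/
lemma exists_dual_extension {A E : Type*} [AddCommGroup A] [Module ℂ A] [SeminormedAddCommGroup E]
    [NormedSpace ℂ E] (c : A →ₗ[ℂ] E) (m : A →ₗ[ℂ] ℂ) {K : ℝ} (hK : 0 ≤ K)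
    (h : ∀ a, ‖m a‖ ≤ K * ‖c a‖) :
    ∃ F : StrongDual ℂ E, ‖F‖ ≤ K ∧ ∀ a, F (c a) = m a := by
  -- The bound forces `m` to vanish on the kernel of `c`. Hence `m` factors through the range of
  -- `c`, and the Hahn-Banach theorem applies there.
  have hker : LinearMap.ker c ≤ LinearMap.ker m := fun a ha => by
    have h1 := h a
    rw [LinearMap.mem_ker.1 ha, norm_zero, mul_zero] at h1
    exact norm_le_zero_iff.1 h1
  let f0 : LinearMap.range c →ₗ[ℂ] ℂ :=
    (LinearMap.ker c).liftQ m hker ∘ₗ c.quotKerEquivRange.symm.toLinearMap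
  have hf0 : ∀ a, f0 ⟨c a, ⟨a, rfl⟩⟩ = m a := fun a => by
    have h1 := c.quotKerEquivRange_symm_apply_image a ⟨a, rfl⟩
    change (LinearMap.ker c).liftQ m hker (c.quotKerEquivRange.symm ⟨c a, _⟩) = m a
    rw [h1]
    rfl
  have hb : ∀ x, ‖f0 x‖ ≤ K * ‖x‖ := by
    rintro ⟨_, a, rfl⟩
    rw [hf0]
    exact h a
  obtain ⟨F, hF, hn⟩ := exists_extension_norm_eq (LinearMap.range c) (f0.mkContinuous K hb)
  refine ⟨F, hn.le.trans (LinearMap.mkContinuous_norm_le _ hK _), fun a => ?_⟩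
  rw [hF ⟨c a, ⟨a, rfl⟩⟩]
  exact hf0 a

/-- The functional on `Φ^{⊙n}` given by a linear map bounded for one of the norms. -/
def ofBound {n : ℕ} (τ : T) (L : SymPow H n →ₗ[ℂ] ℂ) (K : ℝ)
    (h : ∀ φ, ‖L φ‖ ≤ K * symNorm H n τ φ) : SymDual H n :=
  (⟨L, continuous_of_le_seminorm (symNorm H n) τ L K h⟩ : StrongDual ℂ (SymPow H n))

/-- The linear map underlying an element of `Φ'^{⊙n}`. -/
def SymDual.lin {n : ℕ} (F : SymDual H n) : SymPow H n →ₗ[ℂ] ℂ :=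
  ContinuousLinearMap.toLinearMap (show StrongDual ℂ (SymPow H n) from F)

lemma SymDual.lin_apply {n : ℕ} (F : SymDual H n) (φ : SymPow H n) : F.lin φ = F φ := rfl

lemma SymDual.continuous {n : ℕ} (F : SymDual H n) : Continuous F :=
  ContinuousLinearMap.continuous (show StrongDual ℂ (SymPow H n) from F)

lemma SymDual.ext {n : ℕ} {F G : SymDual H n} (h : ∀ φ, F φ = G φ) : F = G :=
  ContinuousLinearMap.ext (f := (show StrongDual ℂ (SymPow H n) from F)) h

/-- A bounded `n`-linear form on `H_τ` defines a functional on `H_{τ'}^{⊙n}`, if the embedding of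
`H_{τ'}` into `H_τ` is a Hilbert-Schmidt operator. -/
lemma HSLE.exists_functional {τ τ' : T} {κ K : ℝ} (h : HSLE H τ τ' κ) {n : ℕ}
    (M : MultilinearMap ℂ (fun _ : Fin n => Nuc H) ℂ) (hK : 0 ≤ K)
    (hM : ∀ ξ, ‖M ξ‖ ≤ K * ∏ i, nucNorm H τ (ξ i)) :
    ∃ F : SymDual H n, (∀ ξ, F (tensorPow ξ n) = M fun _ => ξ) ∧
      ∀ φ, ‖F φ‖ ≤ K * κ ^ n * symNorm H n τ' φ := by
  have hκ : 0 ≤ κ := zero_le_one.trans h.1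
  -- Formal combinations of vectors are sent by `c` to combinations of tensor powers and by `m` to
  -- the prospective values. The estimate `hbd` shows at once that the functional is well defined on
  -- the span of the tensor powers and that it is bounded there.
  let c : (Nuc H →₀ ℂ) →ₗ[ℂ] SymLevel H n τ' :=
    Finsupp.linearCombination ℂ fun ξ => toSymLevel H n τ' (tensorPow ξ n)
  let m : (Nuc H →₀ ℂ) →ₗ[ℂ] ℂ := Finsupp.linearCombination ℂ fun ξ => M fun _ => ξ
  have hbd : ∀ a, ‖m a‖ ≤ K * κ ^ n * ‖c a‖ := by
    intro a
    obtain ⟨N, g, hg, hexp, -⟩ :=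
      exists_orthonormal_expansion fun ξ : a.support => toLevel H τ' ξ
    let f : Fin N → Nuc H := fun j => (toLevel H τ').symm (g j)
    have hf : Orthonormal ℂ fun j => toLevel H τ' (f j) := hg
    let e : OrthoFam H τ' := ⟨N, fun j => embed H τ' (f j),
      hg.comp_linearIsometry (UniformSpace.Completion.toComplₗᵢ (𝕜 := ℂ) (E := Level H τ'))⟩
    have hval : ∀ j ξ, e.dual j ξ = inner ℂ (g j) (toLevel H τ' ξ) := fun j ξ => by
      change InnerProductSpace.toDual ℂ (Hilb H τ') (embed H τ' (f j)) (embed H τ' ξ) = _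
      rw [InnerProductSpace.toDual_apply_apply]
      exact UniformSpace.Completion.inner_coe _ _
    have hexp' : ∀ ξ ∈ a.support, ξ = ∑ j, e.dual j ξ • f j := by
      intro ξ hξ
      have h1 := congrArg (toLevel H τ').symm (hexp ⟨ξ, hξ⟩)
      simp only [LinearEquiv.symm_apply_apply, map_sum, map_smul] at h1
      simp only [hval]
      exact h1
    -- Expanded in an orthonormal family of `H_{τ'}`, the value is a pairing of the coefficients of
    -- `c a` with the values of `M` on the family. Cauchy-Schwarz separates the two: the first
    -- factor is at most the norm of `c a`, and the second factorizes into the `n`-th power of a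
    -- Hilbert-Schmidt sum.
    have hma : m a = ∑ r : Fin n → Fin N, coeffs n e (c a : SymPow H n).form r * M (f ∘ r) := by
      have h1 : ∀ ξ ∈ a.support, (M fun _ => ξ) =
          ∑ r : Fin n → Fin N, (∏ i, e.dual (r i) ξ) * M (f ∘ r) := by
        intro ξ hξ
        conv_lhs => rw [hexp' ξ hξ]
        rw [MultilinearMap.map_sum]
        simp only [MultilinearMap.map_smul_univ, smul_eq_mul]
        rfl
      have h2 : ∀ r : Fin n → Fin N, coeffs n e (c a : SymPow H n).form r =
          ∑ ξ ∈ a.support, a ξ * ∏ i, e.dual (r i) ξ := by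
        intro r
        change SymPow.form (c a : SymPow H n) (fun i => e.dual (r i)) = _
        have h3 : (c a : SymPow H n) = ∑ ξ ∈ a.support, a ξ • tensorPow ξ n := rfl
        rw [h3]
        simp only [map_sum, map_smul, sum_apply, smul_apply, tensorPow_form, smul_eq_mul]
      simp only [h2]
      have h4 : m a = ∑ ξ ∈ a.support, a ξ * M fun _ => ξ := rfl
      rw [h4, Finset.sum_congr rfl fun ξ hξ => by rw [h1 ξ hξ]]
      simp only [Finset.mul_sum, Finset.sum_mul]
      rw [Finset.sum_comm]
      exact Finset.sum_congr rfl fun _ _ => Finset.sum_congr rfl fun _ _ => by ring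
    have hMf : ∑ r : Fin n → Fin N, ‖M (f ∘ r)‖ ^ 2 ≤ (K * κ ^ n) ^ 2 := by
      calc ∑ r : Fin n → Fin N, ‖M (f ∘ r)‖ ^ 2
          ≤ ∑ r : Fin n → Fin N, K ^ 2 * ∏ i, nucNorm H τ (f (r i)) ^ 2 := by
            refine Finset.sum_le_sum fun r _ => ?_
            rw [Finset.prod_pow, ← mul_pow]
            exact pow_le_pow_left₀ (norm_nonneg _) (hM _) 2
        _ = K ^ 2 * (∑ j, nucNorm H τ (f j) ^ 2) ^ n := by
            rw [← Finset.mul_sum]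
            congr 1
            have h2 := (Finset.prod_univ_sum (fun _ : Fin n => (Finset.univ : Finset (Fin N)))
              (fun _ k => nucNorm H τ (f k) ^ 2))
            rw [Fintype.piFinset_univ] at h2
            rw [← h2, Finset.prod_const, Finset.card_univ, Fintype.card_fin]
        _ ≤ K ^ 2 * (κ ^ 2) ^ n := by
            gcongr
            exact h.2 N f hf
        _ = _ := by ring
    have hca : ‖coeffs n e (c a : SymPow H n).form‖ ≤ ‖c a‖ :=
      coeffs_le_symNorm H n τ' (c a : SymPow H n) e
    rw [hma]
    refine abs_le_of_sq_le_sq' ?_ (by positivity) |>.2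
    calc ‖∑ r : Fin n → Fin N, coeffs n e (c a : SymPow H n).form r * M (f ∘ r)‖ ^ 2
        ≤ (∑ r : Fin n → Fin N, ‖coeffs n e (c a : SymPow H n).form r‖ * ‖M (f ∘ r)‖) ^ 2 := by
          refine pow_le_pow_left₀ (norm_nonneg _) ((norm_sum_le _ _).trans
            (Finset.sum_le_sum fun r _ => (norm_mul_le _ _))) 2
      _ ≤ (∑ r : Fin n → Fin N, ‖coeffs n e (c a : SymPow H n).form r‖ ^ 2) *
            ∑ r : Fin n → Fin N, ‖M (f ∘ r)‖ ^ 2 := Finset.sum_mul_sq_le_sq_mul_sq _ _ _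
      _ ≤ ‖c a‖ ^ 2 * (K * κ ^ n) ^ 2 := by
          rw [← EuclideanSpace.norm_sq_eq]
          gcongr
      _ = (K * κ ^ n * ‖c a‖) ^ 2 := by ring
  obtain ⟨F, hF1, hF2⟩ := exists_dual_extension c m (by positivity) hbd
  refine ⟨ofBound τ' (F.toLinearMap ∘ₗ (toSymLevel H n τ').toLinearMap) (K * κ ^ n) fun φ =>
    (F.le_opNorm _).trans (mul_le_mul_of_nonneg_right hF1 (norm_nonneg (toSymLevel H n τ' φ))),
    fun ξ => ?_, fun φ =>
    (F.le_opNorm _).trans (mul_le_mul_of_nonneg_right hF1 (norm_nonneg (toSymLevel H n τ' φ)))⟩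
  have h1 := hF2 (Finsupp.single ξ 1)
  simp only [c, m, Finsupp.linearCombination_single, one_smul] at h1
  exact h1

lemma DualLE.sub {τ : T} {C C' : ℝ} {ω ω' : CoNuc H} (h : DualLE H τ C ω)
    (h' : DualLE H τ C' ω') : DualLE H τ (C + C') (ω - ω') :=
  ⟨add_nonneg h.1 h'.1, fun ξ => (norm_sub_le _ _).trans (by
    rw [add_mul]; exact add_le_add (h.2 ξ) (h'.2 ξ))⟩

/-- Finite linear combinations of tensor powers are dense in `Φ^{⊙n}`. -/
lemma exists_span_tensorPow_near (hH : IsNuclear H) {n : ℕ} (φ : SymPow H n) (τ : T) {ε : ℝ}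
    (hε : 0 < ε) : ∃ ψ ∈ Submodule.span ℂ (Set.range fun ξ : Nuc H => tensorPow ξ n),
      symNorm H n τ (φ - ψ) ≤ ε := by
  classical
  obtain ⟨τ₁, κ₁, h1⟩ := hH τ
  obtain ⟨τ₂, κ₂, h2⟩ := hH τ₁
  have h1' : HSLE H τ τ₁ κ₁ := h1
  have h2' : HSLE H τ₁ τ₂ κ₂ := h2
  have hκ₁ : 0 ≤ κ₁ := zero_le_one.trans h1.1
  have hκ₂ : 0 ≤ κ₂ := zero_le_one.trans h2.1
  set K := symNorm H n τ₂ φ with hKdef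
  have hK : 0 ≤ K := apply_nonneg _ _
  -- The error bound below has at most `2 ^ n` terms, each with the bound `K` of `φ`, a factor at
  -- most `κ₂ + 1` for each argument, and one small factor `δ`. The power of `κ₁` comes from the
  -- return to the Hilbert-Schmidt norm.
  set D := (2 : ℝ) ^ n * (K * (κ₂ + 1) ^ n) * κ₁ ^ n with hD
  have hD0 : 0 ≤ D := by positivity
  obtain ⟨δ, hδ0, hδ1, hδ⟩ : ∃ δ : ℝ, 0 < δ ∧ δ ≤ 1 ∧ D * δ ≤ ε := by
    refine ⟨min 1 (ε / (D + 1)), lt_min one_pos (by positivity), min_le_left _ _, ?_⟩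
    calc D * min 1 (ε / (D + 1)) ≤ (D + 1) * (ε / (D + 1)) :=
          mul_le_mul (by linarith) (min_le_right _ _) (by positivity) (by positivity)
      _ = ε := by field_simp
  obtain ⟨N, ξ, ω, hP⟩ := h2'.exists_finite_rank hδ0
  -- The transpose of the finite rank approximation of the identity of `Φ`. Inserting `P` into every
  -- argument of `φ` produces a finite combination of symmetric products.
  let P : CoNuc H → CoNuc H := fun η => ∑ k, η (ξ k) • ω k
  have hPd : ∀ η C, DualLE H τ₁ C η → DualLE H τ₂ (C * δ) (η - P η) := by
    intro η C hη
    refine ⟨mul_nonneg hη.1 hδ0.le, fun ζ => ?_⟩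
    have e1 : (η - P η) ζ = η (ζ - ∑ k, ω k ζ • ξ k) := by
      rw [map_sub, map_sum]
      change η ζ - (∑ k, η (ξ k) • ω k) ζ = _
      congr 1
      simp only [sum_apply, smul_apply, map_smul, smul_eq_mul]
      exact Finset.sum_congr rfl fun _ _ => mul_comm _ _
    rw [e1, mul_assoc]
    exact (hη.2 _).trans (mul_le_mul_of_nonneg_left (hP ζ) hη.1)
  have hPb : ∀ η C, DualLE H τ₁ C η → DualLE H τ₂ (C * (κ₂ + 1)) (P η) := by
    intro η C hη
    have e2 := (h2'.dualLE hη).sub (hPd η C hη)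
    rw [sub_sub_cancel] at e2
    refine e2.mono ?_
    rw [← mul_add]
    exact mul_le_mul_of_nonneg_left (by linarith) hη.1
  let ψ : SymPow H n := ∑ r : Fin n → Fin N, (φ.form fun i => ω (r i)) • symProd (ξ ∘ r)
  have hψ : ∀ η : Fin n → CoNuc H, ψ.form η = φ.form fun i => P (η i) := by
    intro η
    have e1 : (φ.form fun i => P (η i)) =
        ∑ r : Fin n → Fin N, (∏ i, η i (ξ (r i))) * φ.form fun i => ω (r i) := by
      simp only [P, MultilinearMap.map_sum, MultilinearMap.map_smul_univ, smul_eq_mul]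
    have e2 : ∀ σ : Equiv.Perm (Fin n), ∑ r : Fin n → Fin N, (φ.form fun i => ω (r i)) *
        ∏ j, η j (ξ (r (σ j))) = φ.form fun i => P (η i) := by
      intro σ
      rw [e1]
      refine Fintype.sum_equiv (Equiv.arrowCongr σ.symm (Equiv.refl (Fin N))) _ _ fun r => ?_
      rw [mul_comm]
      congr 1
      exact (form_perm φ σ fun i => ω (r i)).symm
    simp only [ψ, map_sum, map_smul, sum_apply, smul_apply, symProd_form, smul_eq_mul,
      Function.comp_apply, Finset.mul_sum]
    rw [Finset.sum_comm]
    have e3 : ∀ σ : Equiv.Perm (Fin n), ∑ r : Fin n → Fin N, (φ.form fun i => ω (r i)) *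
        ((n.factorial : ℂ)⁻¹ * ∏ j, η j (ξ (r (σ j)))) =
        (n.factorial : ℂ)⁻¹ * φ.form fun i => P (η i) := by
      intro σ
      rw [← e2 σ, Finset.mul_sum]
      exact Finset.sum_congr rfl fun _ _ => by ring
    simp only [e3, Finset.sum_const, Finset.card_univ, Fintype.card_perm, Fintype.card_fin,
      nsmul_eq_mul]
    rw [← mul_assoc, mul_inv_cancel₀ (Nat.cast_ne_zero.2 n.factorial_ne_zero), one_mul]
  refine ⟨ψ, Submodule.sum_mem _ fun r _ => Submodule.smul_mem _ _ ?_, ?_⟩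
  · rw [symProd_eq_sum_tensorPow]
    exact Submodule.smul_mem _ _ (Submodule.sum_mem _ fun u _ => zsmul_mem
      (Submodule.subset_span (Set.mem_range_self (∑ i ∈ uᶜ, (ξ ∘ r) i))) _)
  · refine (symNorm_le (τ' := τ₁) (K := 2 ^ n * (K * (κ₂ + 1) ^ n) * δ) ?_ (by positivity)
      h1').trans (le_trans (le_of_eq (by rw [hD]; ring)) hδ)
    intro η C hC
    -- Multilinear expansion of `η = P η + (η - P η)`. Removing the pure `P` term leaves terms with
    -- at least one argument `η - P η`, which is small by the factor `δ`.
    have e1 : (φ - ψ).form η = ∑ s ∈ Finset.univ.erase (Finset.univ : Finset (Fin n)),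
        φ.form (s.piecewise (fun i => P (η i)) fun i => η i - P (η i)) := by
      rw [map_sub, sub_apply, hψ]
      have e2 : η = (fun i => P (η i)) + fun i => η i - P (η i) := by
        funext i; simp
      conv_lhs => rw [e2]
      rw [MultilinearMap.map_add_univ, ← Finset.add_sum_erase _ _ (Finset.mem_univ Finset.univ),
        Finset.piecewise_univ, ← e2]
      simp
    rw [e1]
    refine (norm_sum_le _ _).trans ?_
    have e3 : ∀ s ∈ Finset.univ.erase (Finset.univ : Finset (Fin n)),
        ‖φ.form (s.piecewise (fun i => P (η i)) fun i => η i - P (η i))‖ ≤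
          K * ((κ₂ + 1) ^ n * δ * ∏ i, C i) := by
      intro s hs
      have hs' : ∃ j, j ∉ s := by
        by_contra hcon
        push Not at hcon
        exact (Finset.mem_erase.1 hs).1 (Finset.eq_univ_iff_forall.2 hcon)
      obtain ⟨j, hj⟩ := hs'
      have e4 := opBound_form τ₂ φ (s.piecewise (fun i => P (η i)) fun i => η i - P (η i))
        (fun i => C i * if i = j then δ else κ₂ + 1) (by
          intro i
          by_cases hi : i ∈ s
          · have hij : i ≠ j := fun hij => hj (hij ▸ hi)
            rw [Finset.piecewise_eq_of_mem _ _ _ hi, if_neg hij]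
            exact hPb _ _ (hC i)
          · rw [Finset.piecewise_eq_of_notMem _ _ _ hi]
            refine (hPd _ _ (hC i)).mono (mul_le_mul_of_nonneg_left ?_ (hC i).1)
            split_ifs
            · exact le_rfl
            · linarith)
      refine e4.trans (mul_le_mul_of_nonneg_left ?_ hK)
      rw [Finset.prod_mul_distrib, mul_comm]
      refine mul_le_mul_of_nonneg_right ?_ (Finset.prod_nonneg fun i _ => (hC i).1)
      rw [← Finset.mul_prod_erase _ _ (Finset.mem_univ j), if_pos rfl, mul_comm]
      refine mul_le_mul_of_nonneg_right ?_ hδ0.le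
      rw [Finset.prod_congr rfl fun i hi => if_neg (Finset.ne_of_mem_erase hi), Finset.prod_const]
      exact pow_le_pow_right₀ (by linarith) ((Finset.card_le_univ _).trans (by simp))
    refine (Finset.sum_le_card_nsmul _ _ _ e3).trans ?_
    rw [nsmul_eq_mul]
    have hcard : ((Finset.univ.erase (Finset.univ : Finset (Fin n))).card : ℝ) ≤ 2 ^ n := by
      have := Finset.card_le_univ (Finset.univ.erase (Finset.univ : Finset (Fin n)))
      rw [Fintype.card_finset, Fintype.card_fin] at this
      exact_mod_cast this
    have hp : 0 ≤ ∏ i, C i := Finset.prod_nonneg fun i _ => (hC i).1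
    calc _ ≤ (2 : ℝ) ^ n * (K * ((κ₂ + 1) ^ n * δ * ∏ i, C i)) :=
          mul_le_mul_of_nonneg_right hcard (by positivity)
      _ = _ := by ring

/-- Bounds for forms transfer along a comparison of the norms on `Φ`, and one Hilbert-Schmidt
embedding turns them back into Hilbert-Schmidt norms. -/
lemma symNorm_directed (hH : IsNuclear H) (n : ℕ) (τ₁ τ₂ : T) : ∃ τ₃ : T, ∃ C : ℝ, 0 ≤ C ∧
    ∀ φ : SymPow H n, symNorm H n τ₁ φ ≤ C * symNorm H n τ₃ φ ∧
      symNorm H n τ₂ φ ≤ C * symNorm H n τ₃ φ := by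
  obtain ⟨τ₁', κ₁, h1⟩ := hH τ₁
  obtain ⟨τ₂', κ₂, h2⟩ := hH τ₂
  obtain ⟨τ₃, C, hC, h⟩ := nucNorm_directed H τ₁' τ₂'
  have key : ∀ (τ τ' : T) (κ : ℝ), HSLE H τ τ' κ →
      (∀ ξ, nucNorm H τ' ξ ≤ C * nucNorm H τ₃ ξ) → ∀ φ : SymPow H n,
      symNorm H n τ φ ≤ (C ^ n * κ ^ n) * symNorm H n τ₃ φ := by
    intro τ τ' κ hτ hle φ
    have h3 : OpBound τ' (C ^ n * symNorm H n τ₃ φ) φ.form := by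
      intro ω D hD
      refine (opBound_form τ₃ φ ω (fun i => D i * C) fun i => (hD i).of_le hC hle).trans (le_of_eq ?_)
      rw [Finset.prod_mul_distrib, Finset.prod_const, Finset.card_univ, Fintype.card_fin]
      ring
    refine (symNorm_le h3 (mul_nonneg (by positivity) (apply_nonneg _ _)) hτ).trans (le_of_eq ?_)
    ring
  have hκ₁ : 0 ≤ κ₁ := zero_le_one.trans h1.1
  have hκ₂ : 0 ≤ κ₂ := zero_le_one.trans h2.1
  refine ⟨τ₃, C ^ n * κ₁ ^ n + C ^ n * κ₂ ^ n, by positivity, fun φ => ⟨?_, ?_⟩⟩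
  · refine (key τ₁ τ₁' κ₁ h1 (fun ξ => (h ξ).1) φ).trans ?_
    exact mul_le_mul_of_nonneg_right (le_add_of_nonneg_right (by positivity)) (apply_nonneg _ _)
  · refine (key τ₂ τ₂' κ₂ h2 (fun ξ => (h ξ).2) φ).trans ?_
    exact mul_le_mul_of_nonneg_right (le_add_of_nonneg_left (by positivity)) (apply_nonneg _ _)

end Kernel

/-! ### Entire functions on normed spaces -/

section Entire

variable {V : Type*} [NormedAddCommGroup V] [NormedSpace ℂ V]

/-- Continuous and Gateaux holomorphic functions on the whole space. -/
def Entire (f : V → ℂ) : Prop :=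
  Continuous f ∧ ∀ x v : V, Differentiable ℂ fun z : ℂ => f (x + z • v)

/-- `HolomorphicOn` asks for analyticity only at the parameter value `0`, but at every base point.
Moving the base point along the line gives every parameter value. -/
lemma entire_iff {f : V → ℂ} : Entire f ↔ HolomorphicOn f Set.univ := by
  refine ⟨fun h => ⟨h.1.continuousOn, fun x _ v => (h.2 x v).analyticAt 0⟩,
    fun h => ⟨continuousOn_univ.1 h.1, fun x v z₀ => ?_⟩⟩
  have h1 := (h.2 (x + z₀ • v) (Set.mem_univ _) v).differentiableAt
  have h2 : (fun z : ℂ => f (x + z • v)) =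
      (fun z : ℂ => f (x + z₀ • v + z • v)) ∘ fun z => z - z₀ := by
    funext z
    simp only [Function.comp_apply, sub_smul]
    congr 1
    abel
  rw [h2]
  refine DifferentiableAt.comp z₀ ?_ (by fun_prop)
  simpa using h1

/-- The derivative of `f` at `x` in the direction `v`. -/
def dirDeriv {V : Type*} [AddCommGroup V] [Module ℂ V] (v : V) (f : V → ℂ) (x : V) : ℂ :=
  deriv (fun z : ℂ => f (x + z • v)) 0

lemma Entire.hasDerivAt {f : V → ℂ} (hf : Entire f) (x v : V) (z : ℂ) :
    HasDerivAt (fun z : ℂ => f (x + z • v)) (dirDeriv v f (x + z • v)) z := by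
  have h1 := (hf.2 (x + z • v) v 0).hasDerivAt
  have h2 : (fun w : ℂ => f (x + w • v)) = (fun w : ℂ => f (x + z • v + w • v)) ∘ fun w => w - z := by
    funext w
    simp only [Function.comp_apply, sub_smul]
    congr 1
    abel
  rw [h2]
  have h3 : HasDerivAt (fun w : ℂ => w - z) 1 z := (hasDerivAt_id z).sub_const z
  have h1' : HasDerivAt (fun w : ℂ => f (x + z • v + w • v)) (dirDeriv v f (x + z • v)) (z - z) := by
    rw [sub_self]
    exact h1
  have h4 := HasDerivAt.comp (h := fun w : ℂ => w - z) z h1' h3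
  rwa [mul_one] at h4

/-- Cauchy's estimate for the directional derivative. -/
lemma Entire.norm_dirDeriv_le {f : V → ℂ} (hf : Entire f) {x v : V} {ρ M : ℝ} (hρ : 0 < ρ)
    (hM : ∀ z : ℂ, ‖z‖ = ρ → ‖f (x + z • v)‖ ≤ M) : ‖dirDeriv v f x‖ ≤ M / ρ :=
  Complex.norm_deriv_le_of_forall_mem_sphere_norm_le hρ (hf.2 x v).diffContOnCl
    fun z hz => hM z (by simpa using hz)

/-- The Schwarz lemma of order two. After subtraction of the linear term the function differs from
its value at `0` by `o(z)`, and it maps the disc of radius `ρ` into a disc of radius `3 * M`: one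
`M` for `f (x + z • v)`, one for the linear term by Cauchy's estimate, one for `f x`. -/
lemma Entire.norm_remainder_le {f : V → ℂ} (hf : Entire f) {x v : V} {ρ M : ℝ} (hρ : 0 < ρ)
    (hM : ∀ z : ℂ, ‖z‖ ≤ ρ → ‖f (x + z • v)‖ ≤ M) {h : ℂ} (hh : ‖h‖ < ρ) :
    ‖f (x + h • v) - f x - h * dirDeriv v f x‖ ≤ 3 * M * (‖h‖ / ρ) ^ 2 := by
  set d := dirDeriv v f x with hd
  have hd1 : ‖d‖ ≤ M / ρ := hf.norm_dirDeriv_le hρ fun z hz => hM z hz.le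
  have hder : HasDerivAt (fun z : ℂ => f (x + z • v)) d 0 := by
    simpa using hf.hasDerivAt x v 0
  let g : ℂ → ℂ := fun z => f (x + z • v) - z * d
  have hg : Differentiable ℂ g := (hf.2 x v).sub (by fun_prop)
  have hg0 : g 0 = f x := by simp [g]
  have hmaps : Set.MapsTo g (Metric.ball 0 ρ) (Metric.closedBall (g 0) (3 * M)) := by
    intro z hz
    have hz' : ‖z‖ < ρ := by simpa using hz
    rw [mem_closedBall_iff_norm, hg0]
    have e0 : ‖f x‖ ≤ M := by simpa using hM 0 (by simpa using hρ.le)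
    have e1 := hM z hz'.le
    have e2 : ‖z * d‖ ≤ M := by
      rw [norm_mul]
      calc ‖z‖ * ‖d‖ ≤ ρ * (M / ρ) :=
            mul_le_mul hz'.le hd1 (norm_nonneg _) hρ.le
        _ = M := by field_simp
    calc ‖f (x + z • v) - z * d - f x‖ ≤ ‖f (x + z • v)‖ + ‖z * d‖ + ‖f x‖ :=
          (norm_sub_le _ _).trans (add_le_add_left (norm_sub_le _ _) _)
      _ ≤ 3 * M := by linarith
  have hlo : (fun z => g z - g 0) =o[𝓝 0] fun z => ‖z - 0‖ ^ 1 := by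
    have h1 := hder.isLittleO
    simp only [zero_smul, add_zero] at h1
    simp only [pow_one]
    refine Asymptotics.IsLittleO.norm_right (h1.congr_left fun z => ?_)
    simp only [g, zero_smul, add_zero, zero_mul, sub_zero, smul_eq_mul]
    ring
  have h1 := Complex.dist_le_mul_div_pow_of_mapsTo_ball_of_isLittleO (hg.differentiableOn) hmaps hlo
    (show h ∈ Metric.ball 0 ρ by simpa using hh)
  rw [dist_eq_norm, dist_zero_right, hg0] at h1
  refine le_trans (le_of_eq ?_) h1
  congr 1
  simp only [g]
  ring

lemma Entire.locallyBounded {f : V → ℂ} (hf : Entire f) (x : V) :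
    ∃ r > 0, ∃ M, ∀ y, ‖y - x‖ < r → ‖f y‖ ≤ M := by
  obtain ⟨r, hr, h⟩ := Metric.continuousAt_iff.1 hf.1.continuousAt 1 one_pos
  refine ⟨r, hr, ‖f x‖ + 1, fun y hy => ?_⟩
  have h1 := h (show dist y x < r by rwa [dist_eq_norm])
  rw [dist_eq_norm] at h1
  linarith [norm_le_norm_add_norm_sub (f x) (f y), norm_sub_rev (f x) (f y)]

/-- Continuity makes `f` bounded near each point, so the quadratic remainder estimate holds there
with one radius and one constant. Division by `h` leaves an error of order `‖h‖`. -/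
lemma Entire.tendstoLocallyUniformly {f : V → ℂ} (hf : Entire f) (v : V) :
    TendstoLocallyUniformly (fun (h : ℂ) x => h⁻¹ * (f (x + h • v) - f x)) (dirDeriv v f)
      (𝓝[≠] 0) := by
  rw [Metric.tendstoLocallyUniformly_iff]
  intro ε hε x₀
  obtain ⟨r, hr, M, hM⟩ := hf.locallyBounded x₀
  have hM0 : 0 ≤ M := (norm_nonneg _).trans (hM x₀ (by simpa using hr))
  -- With this radius the displacement `z • v` is at most `r / 2`, so discs centred in the ball of
  -- radius `r / 2` stay where `f` is bounded.
  set ρ := r / (2 * (‖v‖ + 1)) with hρdef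
  have hρ : 0 < ρ := by positivity
  refine ⟨Metric.ball x₀ (r / 2), Metric.ball_mem_nhds _ (by positivity), ?_⟩
  have hev : ∀ᶠ h : ℂ in 𝓝[≠] 0, ‖h‖ < min ρ (ε / (3 * M / ρ ^ 2 + 1)) :=
    nhdsWithin_le_nhds (by
      have := Metric.ball_mem_nhds (0 : ℂ) (ε := min ρ (ε / (3 * M / ρ ^ 2 + 1)))
        (lt_min hρ (by positivity))
      filter_upwards [this] with h hh
      simpa using hh)
  filter_upwards [hev, self_mem_nhdsWithin] with h hh hne y hy
  have hne' : h ≠ 0 := hne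
  have hh1 : ‖h‖ < ρ := hh.trans_le (min_le_left _ _)
  have hh2 : ‖h‖ < ε / (3 * M / ρ ^ 2 + 1) := hh.trans_le (min_le_right _ _)
  have hrem := hf.norm_remainder_le (x := y) (v := v) hρ (M := M) (fun z hz => by
    refine hM _ ?_
    have e1 : ‖y - x₀‖ < r / 2 := by simpa [dist_eq_norm] using hy
    have e2 : ‖z • v‖ ≤ r / 2 := by
      rw [norm_smul]
      calc ‖z‖ * ‖v‖ ≤ ρ * (‖v‖ + 1) :=
            mul_le_mul hz (by linarith) (norm_nonneg _) hρ.le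
        _ = r / 2 := by rw [hρdef]; field_simp
    calc ‖y + z • v - x₀‖ = ‖(y - x₀) + z • v‖ := by congr 1; abel
      _ < r := by linarith [norm_add_le (y - x₀) (z • v)]) hh1
  have hpos : 0 < ‖h‖ := norm_pos_iff.2 hne'
  rw [dist_eq_norm, norm_sub_rev]
  have e3 : h⁻¹ * (f (y + h • v) - f y) - dirDeriv v f y =
      h⁻¹ * (f (y + h • v) - f y - h * dirDeriv v f y) := by
    field_simp
  rw [e3, norm_mul, norm_inv]
  calc ‖h‖⁻¹ * ‖f (y + h • v) - f y - h * dirDeriv v f y‖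
      ≤ ‖h‖⁻¹ * (3 * M * (‖h‖ / ρ) ^ 2) := by gcongr
    _ = 3 * M / ρ ^ 2 * ‖h‖ := by field_simp
    _ ≤ (3 * M / ρ ^ 2 + 1) * ‖h‖ := by nlinarith
    _ < (3 * M / ρ ^ 2 + 1) * (ε / (3 * M / ρ ^ 2 + 1)) := by gcongr
    _ = ε := by field_simp

/-- A locally uniform limit of entire functions is entire. -/
lemma entire_of_tendstoLocallyUniformly {ι : Type*} {p : Filter ι} [p.NeBot] {F : ι → V → ℂ}
    {f : V → ℂ} (h : TendstoLocallyUniformly F f p) (hF : ∀ i, Entire (F i)) : Entire f := by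
  refine ⟨h.continuous (Filter.Frequently.of_forall fun i => (hF i).1), fun x v => ?_⟩
  have h1 := h.comp (fun z : ℂ => x + z • v) (by fun_prop)
  rw [← tendstoLocallyUniformlyOn_univ] at h1
  exact differentiableOn_univ.1 (h1.differentiableOn
    (Filter.Eventually.of_forall fun i => ((hF i).2 x v).differentiableOn) isOpen_univ)

/-- The difference quotients are entire and converge locally uniformly, so Weierstrass' theorem
applies. -/
lemma Entire.dirDeriv {f : V → ℂ} (hf : Entire f) (v : V) : Entire (dirDeriv v f) := by
  refine entire_of_tendstoLocallyUniformly (hf.tendstoLocallyUniformly v) fun h => ?_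
  refine ⟨continuous_const.mul ((hf.1.comp (by fun_prop)).sub hf.1), fun x w => ?_⟩
  refine Differentiable.const_mul (Differentiable.sub ?_ (hf.2 x w)) _
  have h1 := hf.2 (x + h • v) w
  refine (funext fun z => ?_ : (fun z : ℂ => f (x + z • w + h • v)) =
    fun z : ℂ => f (x + h • v + z • w)) ▸ h1
  congr 1
  abel

/-- The quotient in the direction `v + w` is the quotient along `v` at the moving point `x + h • w`
plus the quotient along `w` at `x`. Local uniformity of the convergence permits the moving base
point. -/
lemma Entire.dirDeriv_add {f : V → ℂ} (hf : Entire f) (v w x : V) :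
    Sheffer.dirDeriv (v + w) f x = Sheffer.dirDeriv v f x + Sheffer.dirDeriv w f x := by
  have h1 : Filter.Tendsto (fun h : ℂ => h⁻¹ * (f (x + h • (v + w)) - f x)) (𝓝[≠] 0)
      (𝓝 (Sheffer.dirDeriv (v + w) f x)) :=
    (hf.tendstoLocallyUniformly (v + w)).tendsto_comp (hf.dirDeriv _).1.continuousAt
      tendsto_const_nhds
  have h2 : Filter.Tendsto (fun h : ℂ => h⁻¹ * (f (x + h • w) - f x)) (𝓝[≠] 0)
      (𝓝 (Sheffer.dirDeriv w f x)) :=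
    (hf.tendstoLocallyUniformly w).tendsto_comp (hf.dirDeriv _).1.continuousAt
      tendsto_const_nhds
  have hg : Filter.Tendsto (fun h : ℂ => x + h • w) (𝓝[≠] 0) (𝓝 x) := by
    have : Continuous fun h : ℂ => x + h • w := by fun_prop
    have h3 := this.tendsto 0
    rw [zero_smul, add_zero] at h3
    exact h3.mono_left nhdsWithin_le_nhds
  have h3 : Filter.Tendsto (fun h : ℂ => h⁻¹ * (f (x + h • w + h • v) - f (x + h • w))) (𝓝[≠] 0)
      (𝓝 (Sheffer.dirDeriv v f x)) :=
    (hf.tendstoLocallyUniformly v).tendsto_comp (hf.dirDeriv _).1.continuousAt hg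
  refine tendsto_nhds_unique h1 ((h3.add h2).congr fun h => ?_)
  rw [← mul_add, show x + h • w + h • v = x + h • (v + w) by rw [smul_add]; abel]
  ring

lemma Entire.dirDeriv_smul {f : V → ℂ} (hf : Entire f) (c : ℂ) (v x : V) :
    Sheffer.dirDeriv (c • v) f x = c * Sheffer.dirDeriv v f x := by
  have h1 : HasDerivAt (fun z : ℂ => f (x + z • v)) (Sheffer.dirDeriv v f x) ((fun z => z * c) 0) := by
    simpa using hf.hasDerivAt x v 0
  have h2 : HasDerivAt (fun z : ℂ => z * c) c 0 := by simpa using (hasDerivAt_id (0 : ℂ)).mul_const c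
  have h3 := h1.comp 0 h2
  rw [mul_comm]
  refine HasDerivAt.deriv (h3.congr_of_eventuallyEq (Filter.Eventually.of_forall fun z => ?_))
  simp [smul_smul]

/-- Locally uniform convergence on the line in the direction `w` allows differentiating the
difference quotients along `v` term by term, which exchanges the two limits. -/
lemma Entire.dirDeriv_comm {f : V → ℂ} (hf : Entire f) (v w x : V) :
    Sheffer.dirDeriv w (Sheffer.dirDeriv v f) x = Sheffer.dirDeriv v (Sheffer.dirDeriv w f) x := by
  have h1 := (hf.tendstoLocallyUniformly v).comp (fun z : ℂ => x + z • w) (by fun_prop)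
  rw [← tendstoLocallyUniformlyOn_univ] at h1
  have hdiff : ∀ h : ℂ, Differentiable ℂ fun z : ℂ => f (x + z • w + h • v) := fun h =>
    by
      convert hf.2 (x + h • v) w using 3
      abel
  have h2 := (h1.deriv (Filter.Eventually.of_forall fun h =>
    (((hdiff h).sub (hf.2 x w)).const_mul h⁻¹).differentiableOn) isOpen_univ).tendsto_at
      (Set.mem_univ 0)
  have h3 : Filter.Tendsto (fun h : ℂ => h⁻¹ * (Sheffer.dirDeriv w f (x + h • v) -
      Sheffer.dirDeriv w f x)) (𝓝[≠] 0) (𝓝 (Sheffer.dirDeriv v (Sheffer.dirDeriv w f) x)) :=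
    ((hf.dirDeriv w).tendstoLocallyUniformly v).tendsto_comp ((hf.dirDeriv _).dirDeriv _).1.continuousAt
      tendsto_const_nhds
  refine tendsto_nhds_unique (h2.congr fun h => ?_) h3
  change deriv (fun z : ℂ => h⁻¹ * (f (x + z • w + h • v) - f (x + z • w))) 0 = _
  have e1 : HasDerivAt (fun z : ℂ => f (x + z • w + h • v)) (Sheffer.dirDeriv w f (x + h • v)) 0 := by
    have := hf.hasDerivAt (x + h • v) w 0
    rw [zero_smul, add_zero] at this
    exact this.congr_of_eventuallyEq (Filter.Eventually.of_forall fun z => by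
      change f _ = f _
      congr 1; abel)
  have e2 : HasDerivAt (fun z : ℂ => f (x + z • w)) (Sheffer.dirDeriv w f x) 0 := by
    simpa using hf.hasDerivAt x w 0
  exact ((e1.sub e2).const_mul h⁻¹).deriv

lemma Entire.comp_linear {V' : Type*} [NormedAddCommGroup V'] [NormedSpace ℂ V'] {f : V → ℂ}
    (hf : Entire f) (L : V' →L[ℂ] V) : Entire (f ∘ L) :=
  ⟨hf.1.comp L.continuous, fun x v => by simpa using hf.2 (L x) (L v)⟩

end Entire

/-! ### Taylor coefficients of entire functions on `Φ'` -/

section Taylor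

variable {T Φ : Type} [AddCommGroup Φ] [Module ℂ Φ] {H : HilbertScale T Φ}

lemma exists_hilbDual_map {τ τ' : T} {C : ℝ} (hC : 0 ≤ C)
    (h : ∀ ξ, nucNorm H τ ξ ≤ C * nucNorm H τ' ξ) :
    ∃ J : HilbDual H τ →L[ℂ] HilbDual H τ', ∀ ω, incl H τ' (J ω) = incl H τ ω := by
  choose J h1 h2 using fun ω : HilbDual H τ => ((dualLE_incl τ ω).of_le hC h).exists_incl
  let J' : HilbDual H τ →ₗ[ℂ] HilbDual H τ' :=
    { toFun := J
      map_add' := fun a b => incl_injective τ' (by rw [map_add, h1, h1, h1, map_add])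
      map_smul' := fun c a => incl_injective τ' (by rw [map_smul, h1, h1, map_smul]; rfl) }
  let J'' : HilbDual H τ →L[ℂ] HilbDual H τ' :=
    { toLinearMap := J'
      cont := AddMonoidHomClass.continuous_of_bound J'.toAddMonoidHom C fun ω =>
        (h2 ω).trans_eq (mul_comm _ _) }
  exact ⟨J'', h1⟩

lemma exists_hilbDual_map_of (H : HilbertScale T Φ) (τ₁ τ₂ : T) :
    ∃ (τ₃ : T) (J₁ : HilbDual H τ₁ →L[ℂ] HilbDual H τ₃) (J₂ : HilbDual H τ₂ →L[ℂ] HilbDual H τ₃),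
      (∀ ω, incl H τ₃ (J₁ ω) = incl H τ₁ ω) ∧ ∀ ω, incl H τ₃ (J₂ ω) = incl H τ₂ ω := by
  obtain ⟨τ₃, C, hC, h⟩ := nucNorm_directed H τ₁ τ₂
  obtain ⟨J₁, h1⟩ := exists_hilbDual_map hC fun ξ => (h ξ).1
  obtain ⟨J₂, h2⟩ := exists_hilbDual_map hC fun ξ => (h ξ).2
  exact ⟨τ₃, J₁, J₂, h1, h2⟩

/-- Finitely many functionals belong to a common `H_{-τ}`. -/
lemma exists_common_incl {n : ℕ} (ω : Fin n → CoNuc H) :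
    ∃ τ, ∃ ω' : Fin n → HilbDual H τ, ∀ i, incl H τ (ω' i) = ω i := by
  induction n with
  | zero => exact ⟨H.nonempty.some, fun i => i.elim0, fun i => i.elim0⟩
  | succ n ih =>
    obtain ⟨τ₁, ω₁, h1⟩ := ih fun i => ω i.succ
    obtain ⟨τ₂, ω₂, h2⟩ := exists_incl_eq H (ω 0)
    obtain ⟨τ₃, J₁, J₂, hJ₁, hJ₂⟩ := exists_hilbDual_map_of H τ₁ τ₂
    refine ⟨τ₃, Fin.cons (J₂ ω₂) fun i => J₁ (ω₁ i), fun i => ?_⟩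
    refine Fin.cases ?_ (fun i => ?_) i
    · rw [Fin.cons_zero, hJ₂, h2]
    · rw [Fin.cons_succ, hJ₁, h1]

lemma norm_smul_dual {E : Type*} [NormedAddCommGroup E] [InnerProductSpace ℂ E] (z : ℂ)
    (v : StrongDual ℂ E) : ‖z • v‖ = ‖z‖ * ‖v‖ := norm_smul z v

/-- The functions on `Φ'` that are entire on each `H_{-τ}`. -/
def entireFun (H : HilbertScale T Φ) : Submodule ℂ (CoNuc H → ℂ) where
  carrier := {f | ∀ τ, Entire fun ω => f (incl H τ ω)}
  add_mem' hf hg τ := ⟨(hf τ).1.add (hg τ).1, fun x v => ((hf τ).2 x v).add ((hg τ).2 x v)⟩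
  zero_mem' _ := ⟨continuous_const, fun _ _ => differentiable_const _⟩
  smul_mem' c _ hf τ := ⟨continuous_const.mul (hf τ).1, fun x v => ((hf τ).2 x v).const_mul c⟩

lemma dirDeriv_incl (τ : T) (f : CoNuc H → ℂ) (v x : HilbDual H τ) :
    dirDeriv (incl H τ v) f (incl H τ x) = dirDeriv v (fun ω => f (incl H τ ω)) x := by
  simp only [dirDeriv, map_add, map_smul]

/-- The direction `ω` need not lie in `H_{-τ}`. Both embed into a larger `H_{-τ₃}`, where the
derivative is entire, and the result is restricted back. -/
lemma dirDeriv_mem {f : CoNuc H → ℂ} (hf : f ∈ entireFun H) (ω : CoNuc H) :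
    dirDeriv ω f ∈ entireFun H := by
  intro τ
  obtain ⟨τ₂, ω, rfl⟩ := exists_incl_eq H ω
  obtain ⟨τ₃, J₁, J₂, hJ₁, hJ₂⟩ := exists_hilbDual_map_of H τ τ₂
  have h1 := Entire.comp_linear (V := HilbDual H τ₃) (V' := HilbDual H τ)
    ((hf τ₃).dirDeriv (J₂ ω)) J₁
  convert h1 using 1
  funext x
  simp only [Function.comp_apply]
  rw [← dirDeriv_incl, hJ₁, hJ₂]

/-- Directional differentiation of entire functions, as a linear function of the direction. -/
def dirDerivLin (H : HilbertScale T Φ) : CoNuc H →ₗ[ℂ] Module.End ℂ (entireFun H) where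
  toFun ω :=
    { toFun := fun f => ⟨dirDeriv ω f, dirDeriv_mem f.2 ω⟩
      map_add' := fun f g => by
        ext x
        obtain ⟨τ, y, hy⟩ := exists_common_incl ![x, ω]
        obtain rfl : incl H τ (y 0) = x := hy 0
        obtain rfl : incl H τ (y 1) = ω := hy 1
        exact deriv_fun_add ((f.2 τ).2 (y 0) (y 1) 0) ((g.2 τ).2 (y 0) (y 1) 0)
      map_smul' := fun c f => by
        ext x
        obtain ⟨τ, y, hy⟩ := exists_common_incl ![x, ω]
        obtain rfl : incl H τ (y 0) = x := hy 0
        obtain rfl : incl H τ (y 1) = ω := hy 1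
        exact deriv_const_mul c ((f.2 τ).2 (y 0) (y 1) 0) }
  map_add' ω₁ ω₂ := by
    ext f x
    obtain ⟨τ, y, hy⟩ := exists_common_incl ![x, ω₁, ω₂]
    obtain rfl : incl H τ (y 0) = x := hy 0
    obtain rfl : incl H τ (y 1) = ω₁ := hy 1
    obtain rfl : incl H τ (y 2) = ω₂ := hy 2
    change dirDeriv (incl H τ (y 1) + incl H τ (y 2)) f.1 (incl H τ (y 0)) =
      dirDeriv (incl H τ (y 1)) f.1 (incl H τ (y 0)) + dirDeriv (incl H τ (y 2)) f.1 (incl H τ (y 0))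
    rw [← map_add, dirDeriv_incl, dirDeriv_incl, dirDeriv_incl, (f.2 τ).dirDeriv_add]
  map_smul' c ω := by
    ext f x
    obtain ⟨τ, y, hy⟩ := exists_common_incl ![x, ω]
    obtain rfl : incl H τ (y 0) = x := hy 0
    obtain rfl : incl H τ (y 1) = ω := hy 1
    change dirDeriv (c • incl H τ (y 1)) f.1 (incl H τ (y 0)) =
      c * dirDeriv (incl H τ (y 1)) f.1 (incl H τ (y 0))
    rw [← map_smul, dirDeriv_incl, dirDeriv_incl, (f.2 τ).dirDeriv_smul]

/-- With directional derivatives viewed as endomorphisms of one space, commutation is what makes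
their products, and hence the Taylor forms, symmetric. -/
lemma dirDerivLin_commute (ω₁ ω₂ : CoNuc H) :
    Commute (dirDerivLin H ω₁) (dirDerivLin H ω₂) := by
  ext f x
  obtain ⟨τ, y, hy⟩ := exists_common_incl ![x, ω₁, ω₂]
  obtain rfl : incl H τ (y 0) = x := hy 0
  obtain rfl : incl H τ (y 1) = ω₁ := hy 1
  obtain rfl : incl H τ (y 2) = ω₂ := hy 2
  change dirDeriv (incl H τ (y 1)) (dirDeriv (incl H τ (y 2)) f.1) (incl H τ (y 0)) =
    dirDeriv (incl H τ (y 2)) (dirDeriv (incl H τ (y 1)) f.1) (incl H τ (y 0))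
  have h : ∀ v : HilbDual H τ, (fun ω => dirDeriv (incl H τ v) f.1 (incl H τ ω)) =
      dirDeriv v fun ω => f.1 (incl H τ ω) := fun v => funext fun x => dirDeriv_incl τ f.1 v x
  rw [dirDeriv_incl, dirDeriv_incl, h, h]
  exact (f.2 τ).dirDeriv_comm _ _ _

/-- Evaluation at zero of the image of `f` under an endomorphism. -/
def evalZero (f : entireFun H) : Module.End ℂ (entireFun H) →ₗ[ℂ] ℂ where
  toFun A := (A f : CoNuc H → ℂ) 0
  map_add' _ _ := rfl
  map_smul' _ _ := rfl

/-- The `n`-th Taylor coefficient at zero of an entire function on `Φ'`. -/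
def taylorForm (n : ℕ) (f : entireFun H) : MultilinearMap ℂ (fun _ : Fin n => CoNuc H) ℂ :=
  ((n.factorial : ℂ)⁻¹) • (evalZero f).compMultilinearMap
    ((MultilinearMap.mkPiAlgebraFin ℂ n (Module.End ℂ (entireFun H))).compLinearMap
      fun _ => dirDerivLin H)

lemma taylorForm_apply (n : ℕ) (f : entireFun H) (ω : Fin n → CoNuc H) :
    taylorForm n f ω = (n.factorial : ℂ)⁻¹ *
      ((List.ofFn fun i => dirDerivLin H (ω i)).prod f : CoNuc H → ℂ) 0 := by
  simp [taylorForm, evalZero]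

lemma taylorForm_perm (n : ℕ) (f : entireFun H) (σ : Equiv.Perm (Fin n)) (ω : Fin n → CoNuc H) :
    taylorForm n f (ω ∘ σ) = taylorForm n f ω := by
  rw [taylorForm_apply, taylorForm_apply]
  have h1 : (List.ofFn fun i => dirDerivLin H ((ω ∘ σ) i)).Perm
      (List.ofFn fun i => dirDerivLin H (ω i)) :=
    Equiv.Perm.ofFn_comp_perm σ fun i => dirDerivLin H (ω i)
  rw [h1.prod_eq']
  rw [List.pairwise_ofFn]
  exact fun i j _ => dirDerivLin_commute _ _

/-- Cauchy's estimate is applied once for each derivative, on a circle that moves the point by `δ`.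
Thus `n` derivatives on the ball of radius `R` use the values of `f` on the ball of radius `R + n *
δ`. -/
lemma norm_prod_dirDeriv_le (τ : T) (f : entireFun H) {M δ : ℝ} (hM0 : 0 ≤ M) (hδ : 0 < δ) {n : ℕ}
    {R : ℝ} (hM : ∀ ω : HilbDual H τ, ‖ω‖ ≤ R + n * δ → ‖(f : CoNuc H → ℂ) (incl H τ ω)‖ ≤ M)
    (ω : Fin n → CoNuc H) (C : Fin n → ℝ) (hC : ∀ i, DualLE H τ (C i) (ω i))
    (x : HilbDual H τ) (hx : ‖x‖ ≤ R) :
    ‖((List.ofFn fun i => dirDerivLin H (ω i)).prod f : CoNuc H → ℂ) (incl H τ x)‖ ≤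
      M * ∏ i, (C i / δ) := by
  induction n generalizing R x with
  | zero => simpa using hM x (by simpa using hx)
  | succ n ih =>
    have hp : 0 ≤ ∏ i : Fin n, (C i.succ / δ) :=
      Finset.prod_nonneg fun i _ => div_nonneg (hC _).1 hδ.le
    rw [List.ofFn_succ, List.prod_cons, Fin.prod_univ_succ]
    set g := (List.ofFn fun i : Fin n => dirDerivLin H (ω i.succ)).prod f with hg
    change ‖dirDeriv (ω 0) (g : CoNuc H → ℂ) (incl H τ x)‖ ≤ _
    obtain ⟨v, hv1, hv2⟩ := (hC 0).exists_incl
    rw [← hv1, dirDeriv_incl]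
    have hgb : ∀ y : HilbDual H τ, ‖y‖ ≤ R + δ → ‖(g : CoNuc H → ℂ) (incl H τ y)‖ ≤
        M * ∏ i : Fin n, (C i.succ / δ) := fun y hy =>
      ih (R := R + δ) (fun ω hω => hM ω (by push_cast; linarith)) (fun i => ω i.succ)
        (fun i => C i.succ) (fun i => hC _) y hy
    rcases eq_or_ne v 0 with rfl | hv
    · have : dirDeriv (0 : HilbDual H τ) (fun ω => (g : CoNuc H → ℂ) (incl H τ ω)) x = 0 := by
        simp [dirDeriv]
      rw [this, norm_zero]
      exact mul_nonneg hM0 (mul_nonneg (div_nonneg (hC _).1 hδ.le) hp)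
    · have hv' : 0 < ‖v‖ := (norm_pos_iff (a := v)).2 hv
      refine ((g.2 τ).norm_dirDeriv_le (ρ := δ / ‖v‖) (by positivity) fun z hz => hgb _ ?_).trans ?_
      · have : ‖z • v‖ = δ := by rw [norm_smul_dual, hz]; field_simp
        linarith [norm_add_le x (z • v)]
      · calc M * (∏ i : Fin n, (C i.succ / δ)) / (δ / ‖v‖)
            = M * (‖v‖ / δ * ∏ i : Fin n, (C i.succ / δ)) := by field_simp
          _ ≤ _ := by gcongr

/-- Dividing the radius into `n` steps of length `ρ / n`, the iterated Cauchy estimate yields `n ^ n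
/ (n! ρ ^ n)`, and `n ^ n / n! ≤ e ^ n`. The degree `n = 0` is separate because of the division by
`n`. -/
lemma taylorForm_opBound (τ : T) (f : entireFun H) {M ρ : ℝ} (hρ : 0 < ρ)
    (hM : ∀ ω : HilbDual H τ, ‖ω‖ ≤ ρ → ‖(f : CoNuc H → ℂ) (incl H τ ω)‖ ≤ M) (n : ℕ) :
    OpBound τ (M * (Real.exp 1 / ρ) ^ n) (taylorForm n f) := by
  intro ω C hC
  have hM0 : 0 ≤ M :=
      (norm_nonneg _).trans (hM 0 ((norm_zero (E := HilbDual H τ)).trans_le hρ.le))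
  have hp : 0 ≤ ∏ i, C i := Finset.prod_nonneg fun i _ => (hC i).1
  rcases Nat.eq_zero_or_pos n with rfl | hn
  · simp only [taylorForm_apply, Finset.univ_eq_empty, Finset.prod_empty, mul_one, pow_zero]
    simpa using hM 0 ((norm_zero (E := HilbDual H τ)).trans_le hρ.le)
  have hn' : (0 : ℝ) < n := by exact_mod_cast hn
  have h1 := norm_prod_dirDeriv_le τ f (δ := ρ / n) (R := 0) hM0 (by positivity) (n := n)
    (fun ω hω => hM ω (hω.trans (le_of_eq (by field_simp; ring)))) ω C hC 0 (norm_zero (E := HilbDual H τ)).le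
  rw [map_zero] at h1
  rw [taylorForm_apply, norm_mul, norm_inv, Complex.norm_natCast]
  have h2 : ∏ i, C i / (ρ / n) = (n / ρ) ^ n * ∏ i, C i := by
    have e : ∀ i, C i / (ρ / n) = (n / ρ) * C i := fun i => by field_simp
    simp only [e, Finset.prod_mul_distrib, Finset.prod_const, Finset.card_univ, Fintype.card_fin]
  rw [h2] at h1
  have h3 : (n : ℝ) ^ n / n.factorial ≤ Real.exp 1 ^ n := by
    rw [← Real.exp_nat_mul, mul_one]
    exact Real.pow_div_factorial_le_exp _ hn'.le n
  calc (n.factorial : ℝ)⁻¹ * _ ≤ (n.factorial : ℝ)⁻¹ * (M * ((n / ρ) ^ n * ∏ i, C i)) := by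
        gcongr
    _ = M * ((n : ℝ) ^ n / n.factorial / ρ ^ n) * ∏ i, C i := by
        rw [div_pow]; field_simp
    _ ≤ M * (Real.exp 1 ^ n / ρ ^ n) * ∏ i, C i := by gcongr
    _ = _ := by rw [div_pow]

lemma exists_bound_ball (f : entireFun H) (τ : T) : ∃ ρ M : ℝ, 0 < ρ ∧
    ∀ ω : HilbDual H τ, ‖ω‖ ≤ ρ → ‖(f : CoNuc H → ℂ) (incl H τ ω)‖ ≤ M := by
  obtain ⟨r, hr, M, hM⟩ := (f.2 τ).locallyBounded 0
  refine ⟨r / 2, M, by positivity, fun ω hω => hM ω ?_⟩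
  rw [sub_zero]
  linarith

/-- The `n`-th Taylor coefficient at zero, as an element of `Φ^{⊙n}`. -/
def taylorCoeff (hH : IsNuclear H) (n : ℕ) : entireFun H →ₗ[ℂ] SymPow H n where
  toFun f := ⟨taylorForm n f, mem_symPow hH (taylorForm_perm n f) fun τ => by
    obtain ⟨ρ, M, hρ, hM⟩ := exists_bound_ball f τ
    have hM0 : 0 ≤ M := (norm_nonneg _).trans (hM 0 ((norm_zero (E := HilbDual H τ)).trans_le hρ.le))
    exact ⟨_, by positivity, taylorForm_opBound τ f hρ hM n⟩⟩
  map_add' f g := by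
    refine SymPow.ext fun ω => ?_
    change taylorForm n (f + g) ω = taylorForm n f ω + taylorForm n g ω
    simp only [taylorForm_apply, map_add, Submodule.coe_add, Pi.add_apply, mul_add]
  map_smul' c f := by
    refine SymPow.ext fun ω => ?_
    change taylorForm n (c • f) ω = c * taylorForm n f ω
    simp only [taylorForm_apply, map_smul, Submodule.coe_smul, Pi.smul_apply, smul_eq_mul]
    ring

lemma taylorCoeff_form (hH : IsNuclear H) (n : ℕ) (f : entireFun H) :
    (taylorCoeff hH n f).form = taylorForm n f := rfl

lemma iteratedDeriv_line (f : entireFun H) (ω : CoNuc H) (n : ℕ) (z : ℂ) :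
    iteratedDeriv n (fun z : ℂ => (f : CoNuc H → ℂ) (z • ω)) z =
      ((dirDerivLin H ω ^ n) f : CoNuc H → ℂ) (z • ω) := by
  induction n generalizing z with
  | zero => simp
  | succ n ih =>
    rw [iteratedDeriv_succ, funext ih, pow_succ']
    change _ = dirDeriv ω ((dirDerivLin H ω ^ n) f : CoNuc H → ℂ) (z • ω)
    obtain ⟨τ, y, rfl⟩ := exists_incl_eq H ω
    have h1 := ((((dirDerivLin H (incl H τ y)) ^ n) f).2 τ).hasDerivAt 0 y z
    simp only [zero_add, map_smul] at h1
    rw [h1.deriv, ← dirDeriv_incl, map_smul]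

/-- On a complex line the function is entire in one variable, and its Taylor coefficients there are
the diagonal values of the Taylor forms. -/
lemma hasSum_taylor_line (f : entireFun H) (ω : CoNuc H) (z : ℂ) :
    HasSum (fun n => (taylorForm n f fun _ => ω) * z ^ n) ((f : CoNuc H → ℂ) (z • ω)) := by
  have hd : Differentiable ℂ fun z : ℂ => (f : CoNuc H → ℂ) (z • ω) := by
    obtain ⟨τ, y, rfl⟩ := exists_incl_eq H ω
    have := (f.2 τ).2 0 y
    simpa only [zero_add, map_smul] using this
  have h1 := Complex.hasSum_taylorSeries_of_entire hd 0 z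
  refine h1.congr_fun fun n => ?_
  rw [iteratedDeriv_line, taylorForm_apply, List.ofFn_const, List.prod_replicate, zero_smul ℂ ω,
    sub_zero, smul_eq_mul, smul_eq_mul]
  ring

lemma hasSum_taylor (hH : IsNuclear H) (f : entireFun H) (ω : CoNuc H) :
    HasSum (fun n => (taylorCoeff hH n f).form fun _ => ω) ((f : CoNuc H → ℂ) ω) := by
  simpa [taylorCoeff_form] using hasSum_taylor_line f ω 1

end Taylor

/-! ### Growth of Taylor coefficients and the main kernel estimate -/

section

section Generic

lemma continuous_seminormTopology {ι κ E F : Type*} [AddCommGroup E] [Module ℂ E] [AddCommGroup F]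
    [Module ℂ F] (p : ι → Seminorm ℂ E) (q : κ → Seminorm ℂ F) (f : E →ₗ[ℂ] F)
    (h : ∀ j, ∃ i C, ∀ x, q j (f x) ≤ C * p i x) :
    Continuous[seminormTopology p, seminormTopology q] f := by
  refine continuous_iInf_rng.2 fun j => ?_
  obtain ⟨i, C, hC⟩ := h j
  let := (q j).toSeminormedAddCommGroup
  exact continuous_of_le_seminorm p i f C hC

lemma topologicalAddGroup_seminormTopology {ι E : Type*} [AddCommGroup E] [Module ℂ E]
    (p : ι → Seminorm ℂ E) : @IsTopologicalAddGroup E (seminormTopology p) _ := by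
  refine topologicalAddGroup_iInf fun i => ?_
  exact @SeminormedAddCommGroup.toIsTopologicalAddGroup E (p i).toSeminormedAddCommGroup

lemma withSeminorms_seminormTopology {ι E : Type*} [AddCommGroup E] [Module ℂ E]
    (p : ι → Seminorm ℂ E) : @WithSeminorms ℂ E ι _ _ _ p (seminormTopology p) := by
  let := seminormTopology p
  have := topologicalAddGroup_seminormTopology p
  exact (SeminormFamily.withSeminorms_iff_topologicalSpace_eq_iInf p).2 rfl

/-- Uniqueness of power series coefficients. -/
lemma coeff_unique {a b : ℕ → ℂ} {g : ℂ → ℂ} (ha : ∀ z, HasSum (fun n => a n * z ^ n) (g z))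
    (hb : ∀ z, HasSum (fun n => b n * z ^ n) (g z)) : a = b := by
  have key : ∀ c : ℕ → ℂ, (∀ z, HasSum (fun n => c n * z ^ n) (g z)) →
      HasFPowerSeriesAt g (FormalMultilinearSeries.ofScalars ℂ c) 0 := by
    intro c hc
    refine hasFPowerSeriesAt_iff.2 (Filter.Eventually.of_forall fun z => ?_)
    simpa [FormalMultilinearSeries.coeff_ofScalars, mul_comm] using hc z
  have h := (key a ha).eq_formalMultilinearSeries (key b hb)
  funext n
  rw [← FormalMultilinearSeries.coeff_ofScalars (p := a),
    ← FormalMultilinearSeries.coeff_ofScalars (p := b), h]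

lemma entire_diag {V : Type*} [NormedAddCommGroup V] [NormedSpace ℂ V] {n : ℕ}
    (M : MultilinearMap ℂ (fun _ : Fin n => V) ℂ) (K : ℝ) (hM : ∀ v, ‖M v‖ ≤ K * ∏ i, ‖v i‖) :
    Entire fun v => M fun _ => v := by
  let M' := M.mkContinuous K hM
  have h1 : Differentiable ℂ M' := (M'.contDiff (n := 1)).differentiable one_ne_zero
  refine ⟨M'.cont.comp (continuous_pi fun _ => continuous_id), fun x v => ?_⟩
  have h2 : Differentiable ℂ fun z : ℂ => (fun _ : Fin n => x + z • v) :=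
    differentiable_pi.2 fun _ => (differentiable_id.smul_const v).const_add x
  exact h1.comp h2

end Generic

section Scalar

/-- With `x = t ^ β` the terms are `(x ^ k / k!) ^ (1/β)`. Since `β ≤ 1`, the factor with exponent
`1/β - 1 ≥ 0` can be bounded by `exp (x (1/β - 1))`. The remaining first powers sum to at most `exp
x`, and the exponents add up to `x / β`. -/
lemma sum_pow_div_factorial_rpow_le {t β : ℝ} (ht : 0 ≤ t) (hβ : 0 < β) (hβ1 : β ≤ 1) (N : ℕ) :
    ∑ k ∈ Finset.range N, t ^ k * (k.factorial : ℝ) ^ (-β⁻¹) ≤ Real.exp (t ^ β / β) := by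
  set x := t ^ β with hx
  have hx0 : 0 ≤ x := Real.rpow_nonneg ht β
  have h1 : ∀ k : ℕ, t ^ k * (k.factorial : ℝ) ^ (-β⁻¹) = (x ^ k / k.factorial) ^ β⁻¹ := by
    intro k
    rw [Real.div_rpow (by positivity) (by positivity), Real.rpow_neg (by positivity), hx,
      ← Real.rpow_natCast (t ^ β) k, ← Real.rpow_mul ht, ← Real.rpow_mul ht,
      mul_right_comm, mul_inv_cancel₀ hβ.ne', one_mul, Real.rpow_natCast, div_eq_mul_inv]
  have hp : 0 ≤ β⁻¹ - 1 := by
    have := (one_le_inv₀ hβ).2 hβ1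
    linarith
  have h2 : ∀ k : ℕ, (x ^ k / k.factorial) ^ β⁻¹ ≤
      (x ^ k / k.factorial) * Real.exp (x * (β⁻¹ - 1)) := by
    intro k
    have h0 : 0 ≤ x ^ k / k.factorial := by positivity
    have h3 : (x ^ k / k.factorial) ^ β⁻¹ = (x ^ k / k.factorial) * (x ^ k / k.factorial) ^ (β⁻¹ - 1) := by
      rcases h0.eq_or_lt with h0 | h0
      · rw [← h0, Real.zero_rpow (inv_pos.2 hβ).ne', zero_mul]
      · rw [Real.rpow_sub_one h0.ne', mul_div_cancel₀ _ h0.ne']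
    rw [h3, Real.exp_mul]
    exact mul_le_mul_of_nonneg_left
      (Real.rpow_le_rpow h0 (Real.pow_div_factorial_le_exp x hx0 k) hp) h0
  calc ∑ k ∈ Finset.range N, t ^ k * (k.factorial : ℝ) ^ (-β⁻¹)
      ≤ ∑ k ∈ Finset.range N, (x ^ k / k.factorial) * Real.exp (x * (β⁻¹ - 1)) :=
        Finset.sum_le_sum fun k _ => (h1 k).trans_le (h2 k)
    _ = (∑ k ∈ Finset.range N, x ^ k / k.factorial) * Real.exp (x * (β⁻¹ - 1)) := by
        rw [Finset.sum_mul]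
    _ ≤ Real.exp x * Real.exp (x * (β⁻¹ - 1)) :=
        mul_le_mul_of_nonneg_right (Real.sum_le_exp_of_nonneg hx0 N) (Real.exp_pos _).le
    _ = Real.exp (x / β) := by rw [← Real.exp_add]; congr 1; field_simp; ring

/-- For every positive `c` there is `l` with `2^{-l} ≤ c`. -/
lemma exists_inv_two_pow_le {c : ℝ} (hc : 0 < c) : ∃ l : ℕ, ((2 : ℝ) ^ l)⁻¹ ≤ c := by
  obtain ⟨l, hl⟩ := exists_pow_lt_of_lt_one hc (show (1 / 2 : ℝ) < 1 by norm_num)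
  exact ⟨l, by simpa using hl.le⟩

lemma exists_small_rpow {β c : ℝ} (hβ : 0 < β) (hc : 0 < c) : ∃ s : ℝ, 0 < s ∧ s ^ β / β ≤ c := by
  refine ⟨(c * β) ^ β⁻¹, by positivity, ?_⟩
  rw [← Real.rpow_mul (by positivity), inv_mul_cancel₀ hβ.ne', Real.rpow_one,
    mul_div_cancel_right₀ _ hβ.ne']

end Scalar

variable {T Φ : Type} [AddCommGroup Φ] [Module ℂ Φ] {H : HilbertScale T Φ}

/-- `|f(ω)| ≤ M exp(2^{-l} ‖ω‖_{-τ}^β)` for `ω ∈ H_{-τ}`. -/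
def GrowthLE (H : HilbertScale T Φ) (β : ℝ) (τ : T) (l : ℕ) (M : ℝ) (f : CoNuc H → ℂ) : Prop :=
  ∀ ω : HilbDual H τ, ‖f (incl H τ ω)‖ ≤ M * Real.exp (((2 : ℝ) ^ l)⁻¹ * ‖ω‖ ^ β)

lemma GrowthLE.nonneg {β : ℝ} {τ : T} {l : ℕ} {M : ℝ} {f : CoNuc H → ℂ} (h : GrowthLE H β τ l M f) :
    0 ≤ M := by
  have := (norm_nonneg _).trans (h 0)
  exact nonneg_of_mul_nonneg_left this (Real.exp_pos _)

/-- This uses `t ≤ 1 + t ^ β` for `t ≥ 0` and `β ≥ 1`. The summand `1` costs at most the factor `e`,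
as `2^{-l} ≤ 1`. -/
lemma growthLE_of_le_one {β : ℝ} {τ : T} {l : ℕ} {M : ℝ} {f : CoNuc H → ℂ}
    (h : GrowthLE H 1 τ l M f) (hβ : 1 ≤ β) : GrowthLE H β τ l (M * Real.exp 1) f := by
  intro ω
  refine (h ω).trans ?_
  rw [mul_assoc, ← Real.exp_add, Real.rpow_one]
  refine mul_le_mul_of_nonneg_left (Real.exp_le_exp.2 ?_) h.nonneg
  have h1 : ((2 : ℝ) ^ l)⁻¹ ≤ 1 := inv_le_one_of_one_le₀ (one_le_pow₀ (by norm_num))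
  have h2 : ‖ω‖ ≤ 1 + ‖ω‖ ^ β := by
    rcases le_total ‖ω‖ 1 with h | h
    · linarith [Real.rpow_nonneg (norm_nonneg ω) β]
    · have := Real.rpow_le_rpow_of_exponent_le h hβ
      rw [Real.rpow_one] at this
      linarith
  have h3 : 0 ≤ ((2 : ℝ) ^ l)⁻¹ := by positivity
  nlinarith

/-- Cauchy's estimate with the radius adapted to the degree: at `ρ = n ^ (1/β) / δ` the growth of
`f` costs at most `e ^ n`, while `ρ ^ (-n)` supplies `(n ^ n) ^ (-1/β)`, which is at most `(n!) ^
(-1/β)`. -/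
lemma taylorCoeff_growth (hH : IsNuclear H) {β : ℝ} (hβ : 0 < β) (τ : T) {ε : ℝ} (hε : 0 < ε) :
    ∃ (τ' : T) (l : ℕ), ∀ (f : entireFun H) (M : ℝ), GrowthLE H β τ' l M f → ∀ n : ℕ,
      symNorm H n τ (taylorCoeff hH n f) ≤
        M * Real.exp 1 * ε ^ n * (n.factorial : ℝ) ^ (-β⁻¹) := by
  obtain ⟨τ', κ, h⟩ := hH τ
  have hκ : 0 < κ := zero_lt_one.trans_le h.1
  -- One factor `e` compensates `n ^ n / n!`, the other the growth of `f` at the radius `ρ`, and `κ`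
  -- the passage to the Hilbert-Schmidt norm. The choice `2^{-l} ≤ δ ^ β` then gives `2^{-l} ρ ^ β ≤
  -- n`.
  set δ := ε / (Real.exp 1 ^ 2 * κ) with hδ
  have hδ0 : 0 < δ := by positivity
  obtain ⟨l, hl⟩ := exists_inv_two_pow_le (c := δ ^ β) (by positivity)
  have hl0 : 0 < ((2 : ℝ) ^ l)⁻¹ := by positivity
  have hl1 : ((2 : ℝ) ^ l)⁻¹ ≤ 1 := inv_le_one_of_one_le₀ (one_le_pow₀ (by norm_num))
  refine ⟨τ', l, fun f M hf n => ?_⟩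
  have hM := hf.nonneg
  have hball : ∀ ρ : ℝ, 0 < ρ → ∀ ω : HilbDual H τ', ‖ω‖ ≤ ρ →
      ‖(f : CoNuc H → ℂ) (incl H τ' ω)‖ ≤ M * Real.exp (((2 : ℝ) ^ l)⁻¹ * ρ ^ β) := by
    intro ρ hρ ω hω
    refine (hf ω).trans (mul_le_mul_of_nonneg_left (Real.exp_le_exp.2 ?_) hM)
    exact mul_le_mul_of_nonneg_left (Real.rpow_le_rpow (norm_nonneg ω) hω hβ.le) hl0.le
  rcases Nat.eq_zero_or_pos n with rfl | hn
  · have h1 := symNorm_le (φ := taylorCoeff hH 0 f)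
      (taylorForm_opBound τ' f one_pos (hball 1 one_pos) 0) (by positivity) h
    refine h1.trans ?_
    simp only [pow_zero, mul_one, Nat.factorial_zero, Nat.cast_one, Real.one_rpow]
    exact mul_le_mul_of_nonneg_left (Real.exp_le_exp.2 hl1) hM
  have hn' : (0 : ℝ) < n := by exact_mod_cast hn
  set ρ := (n : ℝ) ^ β⁻¹ / δ with hρ
  have hρ0 : 0 < ρ := by positivity
  have h1 := symNorm_le (φ := taylorCoeff hH n f)
      (taylorForm_opBound τ' f hρ0 (hball ρ hρ0) n) (by positivity) h
  refine h1.trans ?_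
  have h2 : ((2 : ℝ) ^ l)⁻¹ * ρ ^ β ≤ n := by
    rw [hρ, Real.div_rpow (by positivity) hδ0.le, ← Real.rpow_mul hn'.le, inv_mul_cancel₀ hβ.ne',
      Real.rpow_one, mul_div_assoc', div_le_iff₀ (by positivity), mul_comm]
    exact mul_le_mul_of_nonneg_left hl hn'.le
  have h3 : (Real.exp 1 / ρ) ^ n * κ ^ n =
      (ε / Real.exp 1) ^ n * ((n : ℝ) ^ n) ^ (-β⁻¹) := by
    have h : ((n : ℝ) ^ n) ^ β⁻¹ = ((n : ℝ) ^ β⁻¹) ^ n := by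
      rw [← Real.rpow_natCast, ← Real.rpow_natCast, ← Real.rpow_mul hn'.le, ← Real.rpow_mul hn'.le,
        mul_comm]
    rw [Real.rpow_neg (by positivity), h, ← inv_pow, ← mul_pow, ← mul_pow, hρ, hδ]
    congr 1
    field_simp
  have h4 : ((n : ℝ) ^ n) ^ (-β⁻¹) ≤ (n.factorial : ℝ) ^ (-β⁻¹) := by
    refine Real.rpow_le_rpow_of_nonpos (by positivity) ?_ (by
      have := inv_pos.2 hβ
      linarith)
    exact_mod_cast Nat.factorial_le_pow n
  have h5 : Real.exp (((2 : ℝ) ^ l)⁻¹ * ρ ^ β) ≤ Real.exp 1 ^ n := by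
    rw [← Real.exp_nat_mul, mul_one]
    exact Real.exp_le_exp.2 h2
  have h6 : (1 : ℝ) ≤ Real.exp 1 := Real.one_le_exp zero_le_one
  calc M * Real.exp (((2 : ℝ) ^ l)⁻¹ * ρ ^ β) * (Real.exp 1 / ρ) ^ n * κ ^ n
      = M * (Real.exp (((2 : ℝ) ^ l)⁻¹ * ρ ^ β) * ((ε / Real.exp 1) ^ n * ((n : ℝ) ^ n) ^ (-β⁻¹))) := by
        rw [← h3]; ring
    _ ≤ M * (Real.exp 1 ^ n * ((ε / Real.exp 1) ^ n * (n.factorial : ℝ) ^ (-β⁻¹))) := by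
        gcongr
    _ = M * 1 * ε ^ n * (n.factorial : ℝ) ^ (-β⁻¹) := by
        rw [div_pow]; field_simp
    _ ≤ M * Real.exp 1 * ε ^ n * (n.factorial : ℝ) ^ (-β⁻¹) := by
        gcongr

lemma monomialFun_apply {n : ℕ} (φ : SymPow H n) (ω : CoNuc H) :
    monomialFun φ ω = φ.form fun _ => ω := rfl

lemma monomialFun_mem {n : ℕ} (φ : SymPow H n) : monomialFun φ ∈ entireFun H := by
  intro τ
  refine entire_diag (V := HilbDual H τ) (φ.form.compLinearMap fun _ => incl H τ) (symNorm H n τ φ)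
    fun ω => ?_
  exact opBound_form τ φ _ _ fun i => dualLE_incl τ (ω i)

lemma polynomials_le : polynomials H ≤ entireFun H :=
  Submodule.span_le.2 (by rintro _ ⟨n, φ, rfl⟩; exact monomialFun_mem φ)

/-- On the line through `ω` the function is a multiple of `z ^ n`, and power series coefficients are
unique. -/
lemma taylorCoeff_monomialFun (hH : IsNuclear H) {n : ℕ} (φ : SymPow H n) :
    taylorCoeff hH n ⟨monomialFun φ, monomialFun_mem φ⟩ = φ ∧
      ∀ m ≠ n, taylorCoeff hH m ⟨monomialFun φ, monomialFun_mem φ⟩ = 0 := by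
  have key : ∀ ω, (fun m => (taylorCoeff hH m ⟨monomialFun φ, monomialFun_mem φ⟩).form fun _ => ω) =
      fun m => if m = n then φ.form fun _ => ω else 0 := by
    intro ω
    refine coeff_unique (g := fun z => monomialFun φ (z • ω)) (fun z => ?_) fun z => ?_
    · exact hasSum_taylor_line ⟨monomialFun φ, monomialFun_mem φ⟩ ω z
    · have h1 : monomialFun φ (z • ω) = (if n = n then φ.form fun _ => ω else 0) * z ^ n := by
        rw [monomialFun_apply, φ.form.map_smul_univ (fun _ => z) fun _ => ω]
        simp [mul_comm]
      rw [h1]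
      exact hasSum_single (f := fun m => (if m = n then φ.form fun _ => ω else 0) * z ^ m) n
        fun m hm => by simp [hm]
  refine ⟨SymPow.ext_diag fun ω => ?_, fun m hm => SymPow.ext_diag fun ω => ?_⟩
  · simpa using congrFun (key ω) n
  · simpa [hm] using congrFun (key ω) m

/-- The kernels `V_{n,k}` of an operator acting on entire functions of minimal type. -/
def KernelBound (V : (n k : ℕ) → SymPow H n →ₗ[ℂ] SymPow H k) : Prop :=
  ∀ τ, ∃ τ', ∀ s : ℝ, 0 < s → ∃ D : ℝ, 0 < D ∧ ∀ n k, k ≤ n → ∀ φ : SymPow H n,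
    OpBound τ (D ^ (n + 1) * (n.factorial / k.factorial) * s ^ k * symNorm H n τ' φ) (V n k φ).form

/-- The action of the kernels on the `n`-th Taylor coefficient. -/
def kernelTerm (hH : IsNuclear H) (V : (n k : ℕ) → SymPow H n →ₗ[ℂ] SymPow H k) (n : ℕ) :
    entireFun H →ₗ[ℂ] (CoNuc H → ℂ) where
  toFun f ω := ∑ k ∈ Finset.range (n + 1), (V n k (taylorCoeff hH n f)).form fun _ => ω
  map_add' f g := by
    funext ω
    simp [Finset.sum_add_distrib]
  map_smul' c f := by
    funext ω
    simp [Finset.mul_sum]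

lemma kernelTerm_apply (hH : IsNuclear H) (V : (n k : ℕ) → SymPow H n →ₗ[ℂ] SymPow H k) (n : ℕ)
    (f : entireFun H) (ω : CoNuc H) : kernelTerm hH V n f ω =
      ∑ k ∈ Finset.range (n + 1), (V n k (taylorCoeff hH n f)).form fun _ => ω := rfl

lemma kernelTerm_mem_polynomials (hH : IsNuclear H) (V : (n k : ℕ) → SymPow H n →ₗ[ℂ] SymPow H k)
    (n : ℕ) (f : entireFun H) : kernelTerm hH V n f ∈ polynomials H := by
  have h : kernelTerm hH V n f =
      ∑ k ∈ Finset.range (n + 1), monomialFun (V n k (taylorCoeff hH n f)) := by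
    funext ω
    simp [kernelTerm_apply, monomialFun_apply]
  rw [h]
  exact Submodule.sum_mem _ fun k _ => Submodule.subset_span ⟨k, _, rfl⟩

/-- The estimate behind continuity. The kernel contributes `D ^ (n+1) (n!/k!) s ^ k` and the Taylor
coefficient `ε ^ n (n!) ^ (-1/β)`; with `ε = 1 / (2 D)` their geometric parts combine to `2^{-n}`.
As `1 - 1/β ≤ 0` and `k ≤ n`, the factorials are at most `(k!) ^ (-1/β)`. The sum over `k` is then
at most `exp (s ^ β ‖ω‖ ^ β / β)`, and `s` is chosen with `s ^ β / β ≤ 2^{-l}`. -/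
lemma kernelTerm_growth (hH : IsNuclear H) {V : (n k : ℕ) → SymPow H n →ₗ[ℂ] SymPow H k}
    (hV : KernelBound V) {β : ℝ} (hβ : 0 < β) (hβ1 : β ≤ 1) (τ : T) (l : ℕ) :
    ∃ (τ' : T) (l' : ℕ) (A : ℝ), 0 ≤ A ∧ ∀ (f : entireFun H) (M : ℝ), GrowthLE H β τ' l' M f →
      ∀ n : ℕ, GrowthLE H β τ l (A * M * (1 / 2) ^ n) (kernelTerm hH V n f) := by
  obtain ⟨τ₁, h1⟩ := hV τ
  obtain ⟨s, hs, hsl⟩ := exists_small_rpow hβ (c := ((2 : ℝ) ^ l)⁻¹) (by positivity)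
  obtain ⟨D, hD, h2⟩ := h1 s hs
  obtain ⟨τ', l', h3⟩ := taylorCoeff_growth hH hβ τ₁ (ε := 1 / (2 * D)) (by positivity)
  refine ⟨τ', l', D * Real.exp 1, by positivity, fun f M hf n ω => ?_⟩
  have hM := hf.nonneg
  have h4 := h3 f M hf n
  have hω := norm_nonneg ω
  have h5 : ∀ k ∈ Finset.range (n + 1),
      ‖(V n k (taylorCoeff hH n f)).form fun _ => incl H τ ω‖ ≤
        D * Real.exp 1 * M * (1 / 2) ^ n * ((s * ‖ω‖) ^ k * (k.factorial : ℝ) ^ (-β⁻¹)) := by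
    intro k hk
    have hkn : k ≤ n := Nat.lt_succ_iff.1 (Finset.mem_range.1 hk)
    refine (h2 n k hkn (taylorCoeff hH n f) _ _ fun _ => dualLE_incl τ ω).trans ?_
    rw [Finset.prod_const, Finset.card_univ, Fintype.card_fin]
    have h6 : (n.factorial : ℝ) * (n.factorial : ℝ) ^ (-β⁻¹) / k.factorial ≤
        (k.factorial : ℝ) ^ (-β⁻¹) := by
      have hk0 : (0 : ℝ) < k.factorial := by exact_mod_cast k.factorial_pos
      have hn0 : (0 : ℝ) < n.factorial := by exact_mod_cast n.factorial_pos
      rw [div_le_iff₀ hk0, mul_comm, ← Real.rpow_add_one hn0.ne', ← Real.rpow_add_one hk0.ne']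
      refine Real.rpow_le_rpow_of_nonpos hk0 (by exact_mod_cast Nat.factorial_le hkn) ?_
      have := (one_le_inv₀ hβ).2 hβ1
      linarith
    calc D ^ (n + 1) * (n.factorial / k.factorial) * s ^ k * symNorm H n τ₁ (taylorCoeff hH n f) *
          ‖ω‖ ^ k
        ≤ D ^ (n + 1) * (n.factorial / k.factorial) * s ^ k *
          (M * Real.exp 1 * (1 / (2 * D)) ^ n * (n.factorial : ℝ) ^ (-β⁻¹)) * ‖ω‖ ^ k := by
          gcongr
      _ = D * Real.exp 1 * M * (1 / 2) ^ n * ((s * ‖ω‖) ^ k *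
          ((n.factorial : ℝ) * (n.factorial : ℝ) ^ (-β⁻¹) / k.factorial)) := by
          rw [show (1 / (2 * D)) ^ n = (1 / 2) ^ n / D ^ n by rw [← div_pow]; congr 1; field_simp]
          rw [mul_pow, pow_succ]
          field_simp
      _ ≤ _ := by gcongr
  rw [kernelTerm_apply]
  refine (norm_sum_le_of_le _ h5).trans ?_
  rw [← Finset.mul_sum]
  refine mul_le_mul_of_nonneg_left ((sum_pow_div_factorial_rpow_le (by positivity) hβ hβ1 _).trans
    (Real.exp_le_exp.2 ?_)) (by positivity)
  rw [Real.mul_rpow hs.le hω, mul_comm, mul_div_assoc, mul_comm]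
  exact mul_le_mul_of_nonneg_right hsl (Real.rpow_nonneg hω β)

end

/-! ### Operators on `E^α_min` and the density of polynomials -/

section

variable {T Φ : Type} [AddCommGroup Φ] [Module ℂ Φ] {H : HilbertScale T Φ} {α : ℝ}

lemma eminSubmodule_le (hα : 0 ≤ α) : eminSubmodule H α ≤ entireFun H := by
  intro f hf τ
  rcases hα.eq_or_lt with rfl | hα
  · exact entire_iff.2 (hf 1 ⟨one_pos, Or.inl rfl⟩ τ).1
  · exact entire_iff.2 (hf α ⟨hα, Or.inr rfl⟩ τ).1

/-- An element of `E^α_min(Φ')`, as an entire function. -/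
def Emin.toEntire (hα : 0 ≤ α) : Emin H α →ₗ[ℂ] entireFun H :=
  Submodule.inclusion (eminSubmodule_le hα)

lemma Emin.ext {f g : Emin H α} (h : Emin.toFun f = Emin.toFun g) : f = g := Subtype.ext h

lemma weighted_le_iff {a b M : ℝ} : Real.exp (-a) * b ≤ M ↔ b ≤ M * Real.exp a := by
  rw [Real.exp_neg, inv_mul_le_iff₀ (Real.exp_pos _), mul_comm]

lemma Emin.growthLE (f : Emin H α) (i : orders α × T × ℕ) :
    GrowthLE H i.1 i.2.1 i.2.2 (growthNorm H α i f) (Emin.toFun f) := by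
  intro ω
  rw [← weighted_le_iff, ← neg_mul, growthNorm_apply]
  exact le_ciSup ((f.2 i.1 i.1.2 i.2.1).2 i.2.2) ω

lemma growthNorm_le (f : Emin H α) (i : orders α × T × ℕ) {M : ℝ}
    (h : GrowthLE H i.1 i.2.1 i.2.2 M (Emin.toFun f)) : growthNorm H α i f ≤ M := by
  rw [growthNorm_apply]
  refine ciSup_le fun ω => ?_
  rw [neg_mul, weighted_le_iff]
  exact h ω

lemma mem_eminSubmodule {f : CoNuc H → ℂ} (hf : f ∈ entireFun H)
    (h : ∀ β ∈ orders α, ∀ τ l, ∃ M, GrowthLE H β τ l M f) : f ∈ eminSubmodule H α := by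
  intro β hβ τ
  refine ⟨entire_iff.1 (hf τ), fun l => ?_⟩
  obtain ⟨M, hM⟩ := h β hβ τ l
  refine ⟨M, ?_⟩
  rintro _ ⟨ω, rfl⟩
  simp only [neg_mul, weighted_le_iff]
  exact hM ω

/-- Orders greater than one only occur for `α = 0`, and follow from order one. -/
lemma exists_order_le_one (hα : α ∈ Set.Icc (0 : ℝ) 1) (β : orders α) :
    ∃ β' : orders α, (β' : ℝ) ≤ 1 ∧ ∀ τ l M (f : CoNuc H → ℂ), GrowthLE H β' τ l M f →
      GrowthLE H β τ l (M * Real.exp 1) f := by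
  obtain ⟨β, hβ⟩ := β
  rcases le_total β 1 with h | h
  · refine ⟨⟨β, hβ⟩, h, fun τ l M f hf ω => (hf ω).trans ?_⟩
    refine mul_le_mul_of_nonneg_right ?_ (Real.exp_pos _).le
    exact le_mul_of_one_le_right hf.nonneg (Real.one_le_exp zero_le_one)
  · rcases hβ.2 with h0 | h0
    · exact ⟨⟨1, one_pos, Or.inl h0⟩, le_rfl, fun τ l M f hf => growthLE_of_le_one hf h⟩
    · have : β = 1 := le_antisymm (h0.trans_le hα.2) h
      exact ⟨⟨1, one_pos, Or.inr (by rw [← h0, this])⟩, le_rfl, fun τ l M f hf => growthLE_of_le_one hf h⟩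

section Sum

variable (hH : IsNuclear H) {V : (n k : ℕ) → SymPow H n →ₗ[ℂ] SymPow H k}

/-- The operator with kernels `V_{n,k}`. -/
def kernelFun (V : (n k : ℕ) → SymPow H n →ₗ[ℂ] SymPow H k) (f : entireFun H) (ω : CoNuc H) : ℂ :=
  ∑' n, kernelTerm hH V n f ω

lemma summable_geometric_bound (A : ℝ) : Summable fun n : ℕ => A * (1 / 2 : ℝ) ^ n :=
  (summable_geometric_of_lt_one (by norm_num) (by norm_num)).mul_left A

/-- The main estimate in terms of the defining norms. Orders `β > 1` are outside its range; they
occur only for `α = 0`, where order one is also available. -/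
lemma kernelTerm_norm_le (hV : KernelBound V) {α : ℝ} (hα : α ∈ Set.Icc (0 : ℝ) 1) (i : orders α × T × ℕ) :
    ∃ (j : orders α × T × ℕ) (A : ℝ), 0 ≤ A ∧ ∀ (f : Emin H α) (n : ℕ),
      GrowthLE H i.1 i.2.1 i.2.2 (A * growthNorm H α j f * (1 / 2) ^ n)
        (kernelTerm hH V n (Emin.toEntire hα.1 f)) := by
  obtain ⟨β', hβ', hb⟩ := exists_order_le_one (H := H) hα i.1
  obtain ⟨τ', l', A, hA, h⟩ := kernelTerm_growth hH hV β'.2.1 hβ' i.2.1 i.2.2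
  refine ⟨(β', τ', l'), A * Real.exp 1, by positivity, fun f n => ?_⟩
  have h1 := hb _ _ _ _ (h (Emin.toEntire hα.1 f) _ (f.growthLE (β', τ', l')) n)
  convert h1 using 1
  ring

lemma exists_order (hα : 0 ≤ α) : Nonempty (orders α) := by
  rcases hα.eq_or_lt with rfl | hα
  · exact ⟨⟨1, one_pos, Or.inl rfl⟩⟩
  · exact ⟨⟨α, hα, Or.inr rfl⟩⟩

lemma summable_kernelTerm (hV : KernelBound V) (hα : α ∈ Set.Icc (0 : ℝ) 1) (f : Emin H α)
    (ω : CoNuc H) : Summable fun n => kernelTerm hH V n (Emin.toEntire hα.1 f) ω := by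
  obtain ⟨τ, ω, rfl⟩ := exists_incl_eq H ω
  obtain ⟨β⟩ := exists_order hα.1
  obtain ⟨j, A, -, h⟩ := kernelTerm_norm_le hH hV hα (β, τ, 0)
  refine Summable.of_norm_bounded (((summable_geometric_bound (A * growthNorm H α j f)).mul_right
    (Real.exp (((2 : ℝ) ^ 0)⁻¹ * ‖ω‖ ^ (β : ℝ))))) fun n => h f n ω

lemma norm_tsum_geometric_le {u : ℕ → ℂ} {A B : ℝ} (h : ∀ n, ‖u n‖ ≤ A * (1 / 2) ^ n * B) :
    ‖∑' n, u n‖ ≤ 2 * A * B := by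
  have h1 : HasSum (fun n : ℕ => A * (1 / 2 : ℝ) ^ n * B) (A * 2 * B) :=
    (hasSum_geometric_two.mul_left A).mul_right B
  exact (tsum_of_norm_bounded h1 h).trans_eq (by ring)

lemma kernelFun_growth (hV : KernelBound V) (hα : α ∈ Set.Icc (0 : ℝ) 1) (i : orders α × T × ℕ) :
    ∃ (j : orders α × T × ℕ) (A : ℝ), 0 ≤ A ∧ ∀ f : Emin H α,
      GrowthLE H i.1 i.2.1 i.2.2 (A * growthNorm H α j f) (kernelFun hH V (Emin.toEntire hα.1 f)) := by
  obtain ⟨j, A, hA, h⟩ := kernelTerm_norm_le hH hV hα i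
  refine ⟨j, 2 * A, by positivity, fun f ω => ?_⟩
  exact (norm_tsum_geometric_le fun n => h f n ω).trans_eq (by ring)

lemma entire_tsum {V : Type*} [NormedAddCommGroup V] [NormedSpace ℂ V] {F : ℕ → V → ℂ}
    (hF : ∀ n, Entire (F n)) (h : ∀ R : ℝ, ∃ u : ℕ → ℝ, Summable u ∧ ∀ n x, ‖x‖ ≤ R → ‖F n x‖ ≤ u n) :
    Entire fun x => ∑' n, F n x := by
  refine entire_of_tendstoLocallyUniformly (F := fun (N : ℕ) x => ∑ n ∈ Finset.range N, F n x)
    (p := Filter.atTop) (tendstoLocallyUniformly_of_forall_exists_nhds fun x => ?_) fun N => ?_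
  · obtain ⟨u, hu, hb⟩ := h (‖x‖ + 1)
    refine ⟨Metric.ball x 1, Metric.ball_mem_nhds x one_pos,
      tendstoUniformlyOn_tsum_nat hu fun n y hy => hb n y ?_⟩
    rw [mem_ball_iff_norm] at hy
    linarith [norm_le_norm_add_norm_sub' y x]
  · refine ⟨continuous_finsetSum _ fun n _ => (hF n).1, fun x v => ?_⟩
    exact Differentiable.fun_sum fun n _ => (hF n).2 x v

lemma kernelFun_mem (hV : KernelBound V) (hα : α ∈ Set.Icc (0 : ℝ) 1) (f : Emin H α) :
    kernelFun hH V (Emin.toEntire hα.1 f) ∈ eminSubmodule H α := by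
  refine mem_eminSubmodule (fun τ => ?_) fun β hβ τ l => ?_
  · obtain ⟨β⟩ := exists_order hα.1
    obtain ⟨j, A, hA, h⟩ := kernelTerm_norm_le hH hV hα (β, τ, 0)
    refine entire_tsum (V := HilbDual H τ)
      (fun n => polynomials_le (kernelTerm_mem_polynomials hH V n _) τ) fun R => ?_
    have hj := apply_nonneg (growthNorm H α j) f
    refine ⟨_, ((summable_geometric_bound (A * growthNorm H α j f)).mul_right
      (Real.exp (((2 : ℝ) ^ 0)⁻¹ * R ^ (β : ℝ)))), fun n x hx => (h f n x).trans ?_⟩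
    refine mul_le_mul_of_nonneg_left (Real.exp_le_exp.2 ?_) (by positivity)
    exact mul_le_mul_of_nonneg_left (Real.rpow_le_rpow (norm_nonneg x) hx β.2.1.le) (by positivity)
  · obtain ⟨j, A, -, h⟩ := kernelFun_growth hH hV hα (⟨β, hβ⟩, τ, l)
    exact ⟨_, h f⟩

/-- The operator on `E^α_min(Φ')` with kernels `V_{n,k}`, as a linear map. -/
def kernelLin (hV : KernelBound V) (hα : α ∈ Set.Icc (0 : ℝ) 1) : Emin H α →ₗ[ℂ] Emin H α where
  toFun f := ⟨kernelFun hH V (Emin.toEntire hα.1 f), kernelFun_mem hH hV hα f⟩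
  map_add' f g := by
    refine Emin.ext (funext fun ω => ?_)
    change kernelFun hH V (Emin.toEntire hα.1 (f + g)) ω = kernelFun hH V (Emin.toEntire hα.1 f) ω +
      kernelFun hH V (Emin.toEntire hα.1 g) ω
    simp only [kernelFun, map_add, Pi.add_apply]
    exact (summable_kernelTerm hH hV hα f ω).tsum_add (summable_kernelTerm hH hV hα g ω)
  map_smul' c f := by
    refine Emin.ext (funext fun ω => ?_)
    change kernelFun hH V (Emin.toEntire hα.1 (c • f)) ω = c * kernelFun hH V (Emin.toEntire hα.1 f) ω
    simp only [kernelFun, map_smul, Pi.smul_apply, smul_eq_mul]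
    exact tsum_mul_left

/-- The operator on `E^α_min(Φ')` with kernels `V_{n,k}`. -/
def kernelOp (hV : KernelBound V) (hα : α ∈ Set.Icc (0 : ℝ) 1) : Emin H α →L[ℂ] Emin H α where
  toLinearMap := kernelLin hH hV hα
  cont := by
    refine continuous_seminormTopology (growthNorm H α) (growthNorm H α) (kernelLin hH hV hα) fun i => ?_
    obtain ⟨j, A, -, h⟩ := kernelFun_growth hH hV hα i
    exact ⟨j, A, fun f => growthNorm_le _ i (h f)⟩

lemma kernelFun_monomialFun {n : ℕ} (φ : SymPow H n) (ω : CoNuc H) :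
    kernelFun hH V ⟨monomialFun φ, monomialFun_mem φ⟩ ω =
      ∑ k ∈ Finset.range (n + 1), (V n k φ).form fun _ => ω := by
  have h := taylorCoeff_monomialFun hH φ
  rw [kernelFun, tsum_eq_single n, kernelTerm_apply, h.1]
  intro m hm
  simp [kernelTerm_apply, h.2 m hm]

end Sum

/-- For `x ≥ 1` and `m ≥ n / β` one has `x ^ n ≤ (x ^ β) ^ m`, which a single term of the
exponential series dominates; for `x ≤ 1` the constant `1` suffices. -/
lemma exists_pow_le_exp {c β : ℝ} (hc : 0 < c) (hβ : 0 < β) (n : ℕ) :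
    ∃ M : ℝ, 0 ≤ M ∧ ∀ x : ℝ, 0 ≤ x → x ^ n ≤ M * Real.exp (c * x ^ β) := by
  obtain ⟨m, hm⟩ := exists_nat_ge (n / β)
  refine ⟨1 + m.factorial / c ^ m, by positivity, fun x hx => ?_⟩
  have he : 1 ≤ Real.exp (c * x ^ β) := Real.one_le_exp (by positivity)
  have h0 : 0 ≤ (m.factorial : ℝ) / c ^ m * Real.exp (c * x ^ β) := by positivity
  rcases le_total x 1 with h | h
  · have := pow_le_one₀ hx h (n := n)
    linarith
  · have h1 : x ^ n ≤ (x ^ β) ^ m := by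
      rw [← Real.rpow_natCast, ← Real.rpow_natCast, ← Real.rpow_mul hx]
      exact Real.rpow_le_rpow_of_exponent_le h (by rwa [div_le_iff₀ hβ, mul_comm] at hm)
    have h2 := Real.pow_div_factorial_le_exp (c * x ^ β) (by positivity) m
    have h3 : (x ^ β) ^ m = m.factorial / c ^ m * ((c * x ^ β) ^ m / m.factorial) := by
      rw [mul_pow]
      have : (m.factorial : ℝ) ≠ 0 := by exact_mod_cast m.factorial_ne_zero
      field_simp
    have h4 := mul_le_mul_of_nonneg_left h2 (show 0 ≤ (m.factorial : ℝ) / c ^ m by positivity)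
    rw [← h3] at h4
    linarith

lemma polynomials_le_emin (α : ℝ) : polynomials H ≤ eminSubmodule H α := by
  refine Submodule.span_le.2 ?_
  rintro _ ⟨n, φ, rfl⟩
  refine mem_eminSubmodule (monomialFun_mem φ) fun β hβ τ l => ?_
  obtain ⟨M, -, h⟩ := exists_pow_le_exp (c := ((2 : ℝ) ^ l)⁻¹) (by positivity) hβ.1 n
  refine ⟨symNorm H n τ φ * M, fun ω => (opBound_form τ φ _ _ fun _ => dualLE_incl τ ω).trans ?_⟩
  rw [Finset.prod_const, Finset.card_univ, Fintype.card_fin, mul_assoc]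
  exact mul_le_mul_of_nonneg_left (h _ (norm_nonneg ω)) (apply_nonneg _ _)

/-- Polynomials, as elements of `E^α_min(Φ')`. -/
def polyIncl (H : HilbertScale T Φ) (α : ℝ) : polynomials H →ₗ[ℂ] Emin H α :=
  Submodule.inclusion (polynomials_le_emin α)

lemma toFun_polyIncl (p : polynomials H) : Emin.toFun (polyIncl H α p) = (p : CoNuc H → ℂ) := rfl

/-- The kernels of the identity operator. -/
def idKernel (H : HilbertScale T Φ) (n k : ℕ) : SymPow H n →ₗ[ℂ] SymPow H k :=
  if h : k = n then h ▸ LinearMap.id else 0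

lemma idKernel_self (n : ℕ) : idKernel H n n = LinearMap.id := by simp [idKernel]

lemma idKernel_ne {n k : ℕ} (h : k ≠ n) : idKernel H n k = 0 := by simp [idKernel, h]

/-- Treating the identity as an operator with kernels makes the general estimates speak about the
convergence of Taylor series. -/
lemma kernelBound_id : KernelBound (idKernel H) := by
  intro τ
  -- This constant makes `D ^ (n + 1) * s ^ n` at least one, which is all that the diagonal kernels
  -- need.
  refine ⟨τ, fun s hs => ⟨max 1 s⁻¹, by positivity, fun n k _ φ => ?_⟩⟩
  rcases eq_or_ne k n with rfl | h
  · intro ω C hC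
    rw [idKernel_self]
    refine (opBound_form τ φ ω C hC).trans ?_
    refine mul_le_mul_of_nonneg_right ?_ (Finset.prod_nonneg fun i _ => (hC i).1)
    refine le_mul_of_one_le_left (apply_nonneg _ _) ?_
    rw [div_self (by exact_mod_cast k.factorial_ne_zero), mul_one, pow_succ', mul_assoc, ← mul_pow]
    refine one_le_mul_of_one_le_of_one_le (le_max_left _ _) (one_le_pow₀ ?_)
    calc 1 = s⁻¹ * s := (inv_mul_cancel₀ hs.ne').symm
      _ ≤ _ := mul_le_mul_of_nonneg_right (le_max_right _ _) hs.le
  · intro ω C hC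
    rw [idKernel_ne h]
    have h1 : 0 ≤ ∏ i, C i := Finset.prod_nonneg fun i _ => (hC i).1
    have h2 := apply_nonneg (symNorm H n τ) φ
    simp only [LinearMap.zero_apply, map_zero, zero_apply, norm_zero]
    positivity

lemma kernelTerm_id (hH : IsNuclear H) (n : ℕ) (f : entireFun H) (ω : CoNuc H) :
    kernelTerm hH (idKernel H) n f ω = (taylorCoeff hH n f).form fun _ => ω := by
  rw [kernelTerm_apply, Finset.sum_eq_single n]
  · rw [idKernel_self]; rfl
  · intro k _ hk
    simp [idKernel_ne hk]
  · simp

/-- The approximants are the Taylor polynomials. By the estimate for the identity kernels the terms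
of the Taylor series decay like `2^{-n}` in every defining norm, and so do the remainders. -/
lemma exists_polynomials_tendsto (hH : IsNuclear H) (hα : α ∈ Set.Icc (0 : ℝ) 1) (f : Emin H α) :
    ∃ p : ℕ → polynomials H, Filter.Tendsto (fun N => polyIncl H α (p N)) Filter.atTop (𝓝 f) := by
  refine ⟨fun N => ∑ n ∈ Finset.range N, ⟨kernelTerm hH (idKernel H) n (Emin.toEntire hα.1 f),
    kernelTerm_mem_polynomials _ _ _ _⟩, ?_⟩
  refine ((withSeminorms_seminormTopology (growthNorm H α)).tendsto_nhds _ f).2 fun i ε hε => ?_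
  obtain ⟨j, A, hA, h⟩ := kernelTerm_norm_le hH kernelBound_id hα i
  have hb : ∀ N : ℕ, growthNorm H α i (polyIncl H α (∑ n ∈ Finset.range N,
      ⟨kernelTerm hH (idKernel H) n (Emin.toEntire hα.1 f), kernelTerm_mem_polynomials _ _ _ _⟩) - f) ≤
      2 * (A * growthNorm H α j f) * (1 / 2) ^ N := by
    intro N
    refine growthNorm_le _ i fun ω => ?_
    have hs := summable_kernelTerm hH kernelBound_id hα f (incl H i.2.1 ω)
    have h1 : ∑' n, kernelTerm hH (idKernel H) n (Emin.toEntire hα.1 f) (incl H i.2.1 ω) =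
        Emin.toFun f (incl H i.2.1 ω) := by
      simp only [kernelTerm_id]
      exact (hasSum_taylor hH (Emin.toEntire hα.1 f) (incl H i.2.1 ω)).tsum_eq
    have h2 := hs.sum_add_tsum_nat_add N
    rw [h1] at h2
    rw [map_sub, toFun_polyIncl, Pi.sub_apply, ← h2, Submodule.coe_sum, Finset.sum_apply,
      sub_add_cancel_left, norm_neg]
    refine (norm_tsum_geometric_le (A := A * growthNorm H α j f * (1 / 2) ^ N)
      (B := Real.exp (((2 : ℝ) ^ i.2.2)⁻¹ * ‖ω‖ ^ (i.1 : ℝ))) fun n =>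
      (h f (n + N) ω).trans_eq ?_).trans_eq (by ring)
    rw [pow_add]
    ring
  have hlim : Filter.Tendsto (fun N : ℕ => 2 * (A * growthNorm H α j f) * (1 / 2 : ℝ) ^ N)
      Filter.atTop (𝓝 0) := by
    simpa using (tendsto_pow_atTop_nhds_zero_of_lt_one (r := (1 / 2 : ℝ)) (by norm_num)
      (by norm_num)).const_mul (2 * (A * growthNorm H α j f))
  filter_upwards [hlim.eventually_lt_const hε] with N hN
  exact (hb N).trans_lt hN

lemma t2Space_emin (hα : 0 ≤ α) : T2Space (Emin H α) := by
  have : IsTopologicalAddGroup (Emin H α) := topologicalAddGroup_seminormTopology (growthNorm H α)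
  have h1 : T1Space (Emin H α) := (withSeminorms_seminormTopology (growthNorm H α)).T1_of_separating
    fun f hf => by
      by_contra! h0
      refine hf (Emin.ext (funext fun ω => ?_))
      obtain ⟨τ, ω, rfl⟩ := exists_incl_eq H ω
      obtain ⟨β⟩ := exists_order hα
      have := f.growthLE (β, τ, 0) ω
      rw [h0, zero_mul] at this
      simpa using this
  infer_instance

lemma eq_of_eq_on_polynomials (hH : IsNuclear H) (hα : α ∈ Set.Icc (0 : ℝ) 1)
    {F G : Emin H α → Emin H α} (hF : Continuous F) (hG : Continuous G)
    (h : ∀ p, F (polyIncl H α p) = G (polyIncl H α p)) (f : Emin H α) : F f = G f := by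
  have := t2Space_emin (H := H) hα.1
  obtain ⟨p, hp⟩ := exists_polynomials_tendsto hH hα f
  refine tendsto_nhds_unique ((hF.tendsto f).comp hp) ?_
  simpa only [Function.comp_def, h] using (hG.tendsto f).comp hp

section Extension

variable (hH : IsNuclear H) {V W : (n k : ℕ) → SymPow H n →ₗ[ℂ] SymPow H k}

lemma kernelOp_mem_polynomials (hV : KernelBound V) (hα : α ∈ Set.Icc (0 : ℝ) 1)
    (p : polynomials H) : Emin.toFun (kernelOp hH hV hα (polyIncl H α p)) ∈ polynomials H := by
  obtain ⟨p, hp⟩ := p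
  induction hp using Submodule.span_induction with
  | mem x h =>
    obtain ⟨n, φ, rfl⟩ := h
    have h1 : Emin.toFun (kernelOp hH hV hα (polyIncl H α ⟨monomialFun φ, Submodule.subset_span ⟨n, φ, rfl⟩⟩)) =
        ∑ k ∈ Finset.range (n + 1), monomialFun (V n k φ) := by
      funext ω
      rw [Finset.sum_apply]
      exact kernelFun_monomialFun hH φ ω
    rw [h1]
    exact Submodule.sum_mem _ fun k _ => Submodule.subset_span ⟨k, _, rfl⟩
  | zero =>
    have h0 : polyIncl H α ⟨0, Submodule.zero_mem _⟩ = 0 := rfl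
    rw [h0, map_zero, map_zero]
    exact Submodule.zero_mem _
  | add x y hx hy h1 h2 =>
    have h0 : polyIncl H α ⟨x + y, Submodule.add_mem _ hx hy⟩ = polyIncl H α ⟨x, hx⟩ + polyIncl H α ⟨y, hy⟩ :=
      rfl
    rw [h0, map_add, map_add]
    exact Submodule.add_mem _ h1 h2
  | smul c x hx h1 =>
    have h0 : polyIncl H α ⟨c • x, Submodule.smul_mem _ c hx⟩ = c • polyIncl H α ⟨x, hx⟩ := rfl
    rw [h0, map_smul, map_smul]
    exact Submodule.smul_mem _ c h1

/-- The operator with kernels `V_{n,k}` on polynomials. -/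
def polyOp (hV : KernelBound V) : polynomials H →ₗ[ℂ] polynomials H :=
  LinearMap.codRestrict (polynomials H)
    -- On polynomials the operator is the same for all `α` in `[0, 1]`; the value `1` is an
    -- arbitrary choice.
    (Emin.toFun ∘ₗ (kernelOp hH hV (show (1 : ℝ) ∈ Set.Icc (0 : ℝ) 1 by simp)).toLinearMap ∘ₗ
      polyIncl H 1) fun p => kernelOp_mem_polynomials hH hV (by simp) p

lemma polyOp_apply (hV : KernelBound V) (p : polynomials H) :
    (polyOp hH hV p : CoNuc H → ℂ) = kernelFun hH V ⟨p, polynomials_le p.2⟩ := rfl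

lemma polynomials_hom_ext {W : Type*} [AddCommGroup W] [Module ℂ W] {F G : polynomials H →ₗ[ℂ] W}
    (h : ∀ (n : ℕ) (φ : SymPow H n), F ⟨monomialFun φ, Submodule.subset_span ⟨n, φ, rfl⟩⟩ =
      G ⟨monomialFun φ, Submodule.subset_span ⟨n, φ, rfl⟩⟩) : F = G := by
  ext ⟨p, hp⟩
  induction hp using Submodule.span_induction with
  | mem x h1 =>
    obtain ⟨n, φ, rfl⟩ := h1
    exact h n φ
  | zero => exact (map_zero F).trans (map_zero G).symm
  | add x y hx hy h1 h2 =>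
    have h0 : (⟨x + y, Submodule.add_mem _ hx hy⟩ : polynomials H) = ⟨x, hx⟩ + ⟨y, hy⟩ := rfl
    rw [h0, map_add, map_add, h1, h2]
  | smul c x hx h1 =>
    have h0 : (⟨c • x, Submodule.smul_mem _ c hx⟩ : polynomials H) = c • ⟨x, hx⟩ := rfl
    rw [h0, map_smul, map_smul, h1]

lemma polyOp_monomialFun (hV : KernelBound V) {n : ℕ} (φ : SymPow H n) :
    polyOp hH hV ⟨monomialFun φ, Submodule.subset_span ⟨n, φ, rfl⟩⟩ =
      ∑ k ∈ Finset.range (n + 1), ⟨monomialFun (V n k φ), Submodule.subset_span ⟨k, _, rfl⟩⟩ := by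
  ext ω
  rw [polyOp_apply, Submodule.coe_sum, Finset.sum_apply]
  exact kernelFun_monomialFun hH φ ω

/-- `W` is a left inverse of `V` on polynomials. -/
def KernelInverse (V W : (n k : ℕ) → SymPow H n →ₗ[ℂ] SymPow H k) : Prop :=
  ∀ (n : ℕ) (φ : SymPow H n) (ω : CoNuc H), ∑ k ∈ Finset.range (n + 1), ∑ j ∈ Finset.range (k + 1),
    ((W k j (V n k φ)).form fun _ => ω) = φ.form fun _ => ω

lemma polyOp_comp (hV : KernelBound V) (hW : KernelBound W) (h : KernelInverse V W)
    (p : polynomials H) : polyOp hH hW (polyOp hH hV p) = p := by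
  have : polyOp hH hW ∘ₗ polyOp hH hV = LinearMap.id := by
    refine polynomials_hom_ext fun n φ => ?_
    rw [LinearMap.comp_apply, polyOp_monomialFun, map_sum]
    ext ω
    simp only [polyOp_monomialFun, Submodule.coe_sum, Finset.sum_apply]
    exact h n φ ω
  exact LinearMap.congr_fun this p

/-- The operator with kernels `V_{n,k}`, as a bijection on polynomials. -/
def polyEquiv (hV : KernelBound V) (hW : KernelBound W) (h : KernelInverse V W)
    (h' : KernelInverse W V) : polynomials H ≃ₗ[ℂ] polynomials H :=
  LinearEquiv.ofLinearMap (polyOp hH hV) (polyOp hH hW)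
    (LinearMap.ext fun p => polyOp_comp hH hW hV h' p) (LinearMap.ext fun p => polyOp_comp hH hV hW h p)

lemma kernelOp_polyIncl (hV : KernelBound V) (hα : α ∈ Set.Icc (0 : ℝ) 1) (p : polynomials H) :
    kernelOp hH hV hα (polyIncl H α p) = polyIncl H α (polyOp hH hV p) := rfl

lemma kernelOp_comp (hV : KernelBound V) (hW : KernelBound W) (h : KernelInverse V W)
    (hα : α ∈ Set.Icc (0 : ℝ) 1) (f : Emin H α) : kernelOp hH hW hα (kernelOp hH hV hα f) = f :=
  eq_of_eq_on_polynomials hH hα (F := fun f => kernelOp hH hW hα (kernelOp hH hV hα f)) (G := id)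
    ((kernelOp hH hW hα).continuous.comp (kernelOp hH hV hα).continuous) continuous_id
    (fun p => by simp only [kernelOp_polyIncl, polyOp_comp hH hV hW h, id]) f

/-- The two kernel operators are continuous and inverse to each other on polynomials, hence
everywhere by density. Density also makes the extension unique. -/
lemma extends_polyEquiv (hV : KernelBound V) (hW : KernelBound W) (h : KernelInverse V W)
    (h' : KernelInverse W V) (hα : α ∈ Set.Icc (0 : ℝ) 1) :
    ExtendsToSelfHomeomorphism H α (polyEquiv hH hV hW h h') := by
  refine ⟨polynomials_le_emin α, ContinuousLinearEquiv.equivOfInverse (kernelOp hH hV hα)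
    (kernelOp hH hW hα) (kernelOp_comp hH hV hW h hα) (kernelOp_comp hH hW hV h' hα), fun p => rfl,
    fun Ψ hΨ => ?_⟩
  ext f
  refine eq_of_eq_on_polynomials hH hα (F := Ψ) (G := kernelOp hH hV hα) Ψ.continuous
    (kernelOp hH hV hα).continuous (fun p => ?_) f
  exact Emin.ext (hΨ p)

end Extension

end

/-! ### Formal power series: products, compositions, exponentials -/

section FormalSeries

/-- The `k`-tuples of natural numbers with sum `N`. -/
def tuples (k N : ℕ) : Finset (Fin k → ℕ) :=
  (Fintype.piFinset fun _ => Finset.range (N + 1)).filter fun f => ∑ i, f i = N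

lemma mem_tuples {k N : ℕ} {f : Fin k → ℕ} : f ∈ tuples k N ↔ ∑ i, f i = N := by
  simp only [tuples, Finset.mem_filter, Fintype.mem_piFinset, Finset.mem_range]
  refine ⟨fun h => h.2, fun h => ⟨fun i => ?_, h⟩⟩
  have := Finset.single_le_sum (f := f) (fun i _ => Nat.zero_le _) (Finset.mem_univ i)
  omega

lemma coeff_prod_fin {R : Type*} [CommRing R] {k : ℕ} (p : Fin k → PowerSeries R) (N : ℕ) :
    PowerSeries.coeff N (∏ i, p i) = ∑ f ∈ tuples k N, ∏ i, PowerSeries.coeff (f i) (p i) := by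
  rw [PowerSeries.coeff_prod]
  refine Finset.sum_nbij' (fun l i => l i) (fun f => Finsupp.equivFunOnFinite.symm f) ?_ ?_ ?_ ?_ ?_
  · intro l hl
    exact mem_tuples.2 (Finset.mem_finsuppAntidiag.1 hl).1
  · intro f hf
    exact Finset.mem_finsuppAntidiag.2 ⟨mem_tuples.1 hf, Finset.subset_univ _⟩
  · intro l _
    ext i
    rfl
  · intro f _
    rfl
  · intro l _
    rfl

lemma coeff_pow_fin {R : Type*} [CommRing R] (p : PowerSeries R) (k N : ℕ) :
    PowerSeries.coeff N (p ^ k) = ∑ f ∈ tuples k N, ∏ i, PowerSeries.coeff (f i) p := by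
  rw [← coeff_prod_fin fun _ : Fin k => p]
  simp

lemma coeff_prod_eq_zero {R : Type*} [CommRing R] {k N : ℕ} {p : Fin k → PowerSeries R}
    (hp : ∀ i, PowerSeries.coeff 0 (p i) = 0) (h : N < k) : PowerSeries.coeff N (∏ i, p i) = 0 := by
  rw [coeff_prod_fin]
  refine Finset.sum_eq_zero fun f hf => ?_
  obtain ⟨i, hi⟩ : ∃ i, f i = 0 := by
    by_contra! h0
    have h1 : ∑ i : Fin k, 1 ≤ ∑ i, f i := Finset.sum_le_sum fun i _ => Nat.one_le_iff_ne_zero.2 (h0 i)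
    rw [mem_tuples.1 hf] at h1
    simp at h1
    omega
  exact Finset.prod_eq_zero (Finset.mem_univ i) (by rw [hi, hp])

lemma coeff_pow_eq_zero {R : Type*} [CommRing R] {k N : ℕ} {p : PowerSeries R}
    (hp : PowerSeries.coeff 0 p = 0) (h : N < k) : PowerSeries.coeff N (p ^ k) = 0 := by
  rw [← Fin.prod_const]
  exact coeff_prod_eq_zero (fun _ => hp) h

lemma coeff_prod_self {R : Type*} [CommRing R] {k : ℕ} {p : Fin k → PowerSeries R}
    (hp : ∀ i, PowerSeries.coeff 0 (p i) = 0) :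
    PowerSeries.coeff k (∏ i, p i) = ∏ i, PowerSeries.coeff 1 (p i) := by
  rw [coeff_prod_fin, Finset.sum_eq_single fun _ => 1]
  · intro f hf hne
    obtain ⟨i, hi⟩ : ∃ i, f i = 0 := by
      by_contra! h0
      refine hne (funext fun i => ?_)
      have h1 : ∀ i ∈ Finset.univ, 1 ≤ f i := fun i _ => Nat.one_le_iff_ne_zero.2 (h0 i)
      have h2 := (Finset.sum_eq_sum_iff_of_le h1).1 (by rw [mem_tuples.1 hf]; simp)
      exact (h2 i (Finset.mem_univ i)).symm
    exact Finset.prod_eq_zero (Finset.mem_univ i) (by rw [hi, hp])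
  · intro h
    exact absurd (mem_tuples.2 (by simp)) h

/-- A sum over compositions is a sum over tuples of positive integers. -/
lemma sum_composition {M : Type*} [AddCommMonoid M] (F : (k : ℕ) → (Fin k → ℕ) → M) (N : ℕ) :
    ∑ c : Composition N, F c.length c.blocksFun =
      ∑ k ∈ Finset.range (N + 1), ∑ f ∈ (tuples k N).filter fun f => ∀ i, 0 < f i, F k f := by
  rw [Finset.sum_sigma']
  have hinj : Function.Injective fun s : (Σ k, Fin k → ℕ) => List.ofFn s.2 :=
    List.equivSigmaTuple.symm.injective
  have hb : ∀ c : Composition N, List.ofFn c.blocksFun = c.blocks := fun c => c.ofFn_blocksFun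
  refine Finset.sum_bij (fun c _ => ⟨c.length, c.blocksFun⟩) ?_ ?_ ?_ ?_
  · intro c _
    simp only [Finset.mem_sigma, Finset.mem_range, Finset.mem_filter, mem_tuples]
    exact ⟨Nat.lt_succ_of_le c.length_le, c.sum_blocksFun, fun i => c.one_le_blocksFun i⟩
  · intro c _ c' _ h
    have h1 := congrArg (fun s : (Σ k, Fin k → ℕ) => List.ofFn s.2) h
    simp only [hb] at h1
    exact Composition.ext h1
  · rintro ⟨k, f⟩ hf
    simp only [Finset.mem_sigma, Finset.mem_filter, mem_tuples] at hf
    let c : Composition N := ⟨List.ofFn f, fun {i} hi => by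
      obtain ⟨j, rfl⟩ := List.mem_ofFn.1 hi
      exact hf.2.2 j, by rw [List.sum_ofFn]; exact hf.2.1⟩
    exact ⟨c, Finset.mem_univ _, hinj (hb c)⟩
  · intro c _
    rfl

/-- A sum over compositions of a quantity that vanishes on tuples with a zero entry. -/
lemma sum_composition_of_zero {M : Type*} [AddCommMonoid M] (F : (k : ℕ) → (Fin k → ℕ) → M)
    (hF : ∀ k f i, f i = 0 → F k f = 0) (N : ℕ) :
    ∑ c : Composition N, F c.length c.blocksFun =
      ∑ k ∈ Finset.range (N + 1), ∑ f ∈ tuples k N, F k f := by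
  rw [sum_composition]
  refine Finset.sum_congr rfl fun k _ => Finset.sum_subset (Finset.filter_subset _ _) ?_
  intro f hf hf'
  simp only [Finset.mem_filter, hf, true_and, not_forall, not_lt, Nat.le_zero] at hf'
  obtain ⟨i, hi⟩ := hf'
  exact hF k f i hi

variable {p q : PowerSeries ℂ}

lemma hasSubst_of_coeff (hp : PowerSeries.coeff 0 p = 0) : PowerSeries.HasSubst p :=
  PowerSeries.HasSubst.of_constantCoeff_zero' (by simpa using hp)

/-- Without constant term, `p ^ n` starts in degree `n`, so powers above `N` do not contribute. The
sum may be cut at any `M ≥ N`. -/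
lemma coeff_subst_eq_sum (f : PowerSeries ℂ) (hp : PowerSeries.coeff 0 p = 0) {N M : ℕ}
    (h : N ≤ M) : PowerSeries.coeff N (f.subst p) =
      ∑ n ∈ Finset.range (M + 1), PowerSeries.coeff n f * PowerSeries.coeff N (p ^ n) := by
  rw [PowerSeries.coeff_subst' (hasSubst_of_coeff hp)]
  refine finsum_eq_sum_of_support_subset _ fun n hn => ?_
  by_contra h0
  refine hn ?_
  simp only [Finset.coe_range, Set.mem_Iio, not_lt] at h0
  simp only [coeff_pow_eq_zero hp (show N < n by omega), smul_zero]

lemma coeff_zero_subst (f : PowerSeries ℂ) (hp : PowerSeries.coeff 0 p = 0) :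
    PowerSeries.coeff 0 (f.subst p) = PowerSeries.coeff 0 f := by
  rw [coeff_subst_eq_sum f hp le_rfl]
  simp

lemma coeff_one_subst (f : PowerSeries ℂ) (hp : PowerSeries.coeff 0 p = 0) :
    PowerSeries.coeff 1 (f.subst p) = PowerSeries.coeff 1 f * PowerSeries.coeff 1 p := by
  rw [coeff_subst_eq_sum f hp le_rfl]
  simp [Finset.sum_range_succ]

lemma coeff_subst_composition (f : PowerSeries ℂ) (hp : PowerSeries.coeff 0 p = 0) (N : ℕ) :
    PowerSeries.coeff N (f.subst p) = ∑ c : Composition N,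
      PowerSeries.coeff c.length f * ∏ i, PowerSeries.coeff (c.blocksFun i) p := by
  rw [sum_composition_of_zero (fun k g => PowerSeries.coeff k f * ∏ i, PowerSeries.coeff (g i) p)
    (fun k g i hi => by rw [Finset.prod_eq_zero (Finset.mem_univ i) (by rw [hi, hp]), mul_zero]),
    coeff_subst_eq_sum f hp le_rfl]
  simp only [coeff_pow_fin, Finset.mul_sum]

lemma coeff_zero_mul (p q : PowerSeries ℂ) :
    PowerSeries.coeff 0 (p * q) = PowerSeries.coeff 0 p * PowerSeries.coeff 0 q := by
  simp [PowerSeries.coeff_mul]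

/-- `exp(p)`, for a formal power series `p` without constant term. -/
def expS (p : PowerSeries ℂ) : PowerSeries ℂ := (PowerSeries.exp ℂ).subst p

lemma coeff_expS (hp : PowerSeries.coeff 0 p = 0) {N M : ℕ} (h : N ≤ M) :
    PowerSeries.coeff N (expS p) =
      ∑ n ∈ Finset.range (M + 1), (n.factorial : ℂ)⁻¹ * PowerSeries.coeff N (p ^ n) := by
  rw [expS, coeff_subst_eq_sum _ hp h]
  refine Finset.sum_congr rfl fun n _ => ?_
  rw [PowerSeries.coeff_exp]
  simp

lemma coeff_zero_expS (hp : PowerSeries.coeff 0 p = 0) : PowerSeries.coeff 0 (expS p) = 1 := by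
  rw [expS, coeff_zero_subst _ hp]
  simp

/-- The equation `f' = u f` determines the coefficients recursively from the constant term. The
functional equation of the exponential and the identities for binomial series are obtained from this
uniqueness. -/
lemma eq_of_derivative_eq_mul {f g u : PowerSeries ℂ} (hf : PowerSeries.derivative ℂ f = u * f)
    (hg : PowerSeries.derivative ℂ g = u * g) (h0 : PowerSeries.coeff 0 f = PowerSeries.coeff 0 g) :
    f = g := by
  ext n
  induction n using Nat.strong_induction_on with
  | _ n ih =>
    rcases n with _ | n
    · exact h0
    have h1 := congrArg (PowerSeries.coeff n) hf
    have h2 := congrArg (PowerSeries.coeff n) hg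
    rw [PowerSeries.coeff_derivative, PowerSeries.coeff_mul] at h1 h2
    have h3 : ∑ x ∈ Finset.HasAntidiagonal.antidiagonal n, PowerSeries.coeff x.1 u * PowerSeries.coeff x.2 f =
        ∑ x ∈ Finset.HasAntidiagonal.antidiagonal n, PowerSeries.coeff x.1 u * PowerSeries.coeff x.2 g := by
      refine Finset.sum_congr rfl fun x hx => ?_
      rw [ih x.2 (by have := Finset.HasAntidiagonal.mem_antidiagonal.1 hx; omega)]
    rw [h3, ← h2] at h1
    exact mul_right_cancel₀ (by exact_mod_cast n.succ_ne_zero) h1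

lemma derivative_expS (hp : PowerSeries.coeff 0 p = 0) :
    PowerSeries.derivative ℂ (expS p) = PowerSeries.derivative ℂ p * expS p := by
  rw [expS, PowerSeries.derivative_subst (hasSubst_of_coeff hp), PowerSeries.derivative_exp, mul_comm]

lemma expS_add (hp : PowerSeries.coeff 0 p = 0) (hq : PowerSeries.coeff 0 q = 0) :
    expS (p + q) = expS p * expS q := by
  have hpq : PowerSeries.coeff 0 (p + q) = 0 := by rw [map_add, hp, hq, add_zero]
  refine eq_of_derivative_eq_mul (u := PowerSeries.derivative ℂ (p + q)) (derivative_expS hpq) ?_ ?_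
  · rw [Derivation.leibniz, derivative_expS hp, derivative_expS hq, map_add, smul_eq_mul, smul_eq_mul]
    ring
  · rw [coeff_zero_expS hpq, coeff_zero_mul,
      coeff_zero_expS hp, coeff_zero_expS hq, mul_one]

lemma expS_zero : expS 0 = 1 := by
  rw [expS, PowerSeries.subst_zero_eq_C_constantCoeff]
  simp

lemma expS_add_neg (hp : PowerSeries.coeff 0 p = 0) : expS p * expS (-p) = 1 := by
  rw [← expS_add hp (by rw [map_neg, hp, neg_zero]), add_neg_cancel, expS_zero]

end FormalSeries

/-! ### Series in `t` with coefficients in `ℂ[X]`, and the substitution `t = 1` -/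

section Diag

open Polynomial in
/-- The coefficients of `Q(t)` are divisible by the corresponding powers of the inner variable. -/
def Graded (Q : PowerSeries ℂ[X]) : Prop := ∀ j m, m < j → (PowerSeries.coeff j Q).coeff m = 0

open Polynomial in
/-- The value of `Q(t)` at `t = 1`. -/
def evalOne (Q : PowerSeries ℂ[X]) : PowerSeries ℂ :=
  PowerSeries.mk fun N => ∑ k ∈ Finset.range (N + 1), (PowerSeries.coeff k Q).coeff N

open Polynomial

variable {P Q : PowerSeries ℂ[X]}

lemma coeff_evalOne (hQ : Graded Q) {N M : ℕ} (h : N ≤ M) : PowerSeries.coeff N (evalOne Q) =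
    ∑ k ∈ Finset.range (M + 1), (PowerSeries.coeff k Q).coeff N := by
  rw [evalOne, PowerSeries.coeff_mk]
  refine Finset.sum_subset (Finset.range_mono (by omega)) fun k _ hk => hQ k N ?_
  simp at hk
  omega

lemma Graded.mul (hP : Graded P) (hQ : Graded Q) : Graded (P * Q) := by
  intro j m hm
  rw [PowerSeries.coeff_mul, finsetSum_coeff]
  refine Finset.sum_eq_zero fun x hx => ?_
  rw [coeff_mul]
  refine Finset.sum_eq_zero fun y hy => ?_
  have h1 := Finset.HasAntidiagonal.mem_antidiagonal.1 hx
  have h2 := Finset.HasAntidiagonal.mem_antidiagonal.1 hy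
  rcases lt_or_ge y.1 x.1 with h | h
  · rw [hP _ _ h, zero_mul]
  · rw [hQ x.2 y.2 (by omega), mul_zero]

/-- In a graded series the coefficient of `t ^ i` contains only powers `X ^ m` with `m ≥ i`. So for
a fixed power of `X` only finitely many `i` matter, and the sums over pairs `(i, j)` agree however
they are truncated. -/
lemma evalOne_mul (hP : Graded P) (hQ : Graded Q) : evalOne (P * Q) = evalOne P * evalOne Q := by
  ext N
  rw [PowerSeries.coeff_mul, coeff_evalOne (hP.mul hQ) (show N ≤ 2 * N by omega)]
  have h1 : ∀ y ∈ Finset.HasAntidiagonal.antidiagonal N,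
      PowerSeries.coeff y.1 (evalOne P) * PowerSeries.coeff y.2 (evalOne Q) =
      ∑ i ∈ Finset.range (N + 1), ∑ j ∈ Finset.range (N + 1),
        (PowerSeries.coeff i P).coeff y.1 * (PowerSeries.coeff j Q).coeff y.2 := by
    intro y hy
    have := Finset.HasAntidiagonal.mem_antidiagonal.1 hy
    rw [coeff_evalOne hP (show y.1 ≤ N by omega), coeff_evalOne hQ (show y.2 ≤ N by omega),
      Finset.sum_mul_sum]
  rw [Finset.sum_congr rfl h1]
  have h2 : ∀ k, (PowerSeries.coeff k (P * Q)).coeff N = ∑ y ∈ Finset.HasAntidiagonal.antidiagonal N,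
      ∑ x ∈ Finset.HasAntidiagonal.antidiagonal k, (PowerSeries.coeff x.1 P).coeff y.1 * (PowerSeries.coeff x.2 Q).coeff y.2 := by
    intro k
    rw [PowerSeries.coeff_mul, finsetSum_coeff, Finset.sum_comm]
    exact Finset.sum_congr rfl fun x _ => coeff_mul _ _ _
  simp only [h2]
  rw [Finset.sum_comm]
  refine Finset.sum_congr rfl fun y hy => ?_
  have hy := Finset.HasAntidiagonal.mem_antidiagonal.1 hy
  rw [← Finset.sum_product', Finset.sum_sigma']
  symm
  refine Finset.sum_of_injOn (fun x => ⟨x.1 + x.2, x⟩) ?_ ?_ ?_ ?_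
  · intro x _ x' _ h
    simp only [Sigma.mk.injEq] at h
    exact eq_of_heq h.2
  · intro x hx
    simp only [Finset.coe_product, Finset.coe_range, Set.mem_prod, Set.mem_Iio] at hx
    simp
    omega
  · rintro ⟨k, x⟩ hx hx'
    simp only [Finset.mem_sigma, Finset.mem_range, Finset.HasAntidiagonal.mem_antidiagonal] at hx
    have : N < x.1 ∨ N < x.2 := by
      by_contra! h
      refine hx' ⟨x, by simp; omega, ?_⟩
      obtain ⟨_, rfl⟩ := hx
      rfl
    rcases this with h | h
    · simp only [hP x.1 y.1 (by omega), zero_mul]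
    · simp only [hQ x.2 y.2 (by omega), mul_zero]
  · intro x _
    rfl

lemma graded_one : Graded 1 := by
  intro j m hm
  rw [PowerSeries.coeff_one, if_neg (by omega), coeff_zero]

lemma evalOne_one : evalOne 1 = 1 := by
  ext N
  rw [coeff_evalOne graded_one le_rfl, Finset.sum_eq_single 0]
  · simp [PowerSeries.coeff_one, Polynomial.coeff_one]
  · intro k _ hk
    rw [PowerSeries.coeff_one, if_neg hk, coeff_zero]
  · simp

lemma Graded.pow (hQ : Graded Q) (n : ℕ) : Graded (Q ^ n) := by
  induction n with
  | zero => exact pow_zero Q ▸ graded_one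
  | succ n ih => exact pow_succ Q n ▸ ih.mul hQ

lemma evalOne_pow (hQ : Graded Q) (n : ℕ) : evalOne (Q ^ n) = evalOne Q ^ n := by
  induction n with
  | zero => rw [pow_zero, pow_zero, evalOne_one]
  | succ n ih => rw [pow_succ, pow_succ, evalOne_mul (hQ.pow n) hQ, ih]

/-- The coefficients of `exp(Q)`. -/
def expCoeff (Q : PowerSeries ℂ[X]) (k : ℕ) : ℂ[X] :=
  ∑ n ∈ Finset.range (k + 1), C ((n.factorial : ℂ)⁻¹) * PowerSeries.coeff k (Q ^ n)

lemma eval_expCoeff (hQ : PowerSeries.coeff 0 Q = 0) (k : ℕ) (z : ℂ) :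
    (expCoeff Q k).eval z = PowerSeries.coeff k (expS (PowerSeries.map (evalRingHom z) Q)) := by
  have h0 : PowerSeries.coeff 0 (PowerSeries.map (evalRingHom z) Q) = 0 := by
    rw [PowerSeries.coeff_map, hQ, map_zero]
  rw [expCoeff, eval_finsetSum, coeff_expS h0 le_rfl]
  refine Finset.sum_congr rfl fun n _ => ?_
  rw [eval_mul, eval_C, ← map_pow, PowerSeries.coeff_map, coe_evalRingHom]

/-- The two variables exchange roles. In `eval_expCoeff` the polynomial variable takes a numerical
value and `t` is formal; here `t = 1` and `X` becomes the formal variable. Polynomial identities in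
a number `z` thereby become identities of formal power series. -/
lemma sum_coeff_expCoeff (hQ : Graded Q) (hQ0 : PowerSeries.coeff 0 Q = 0) (N : ℕ) :
    ∑ k ∈ Finset.range (N + 1), (expCoeff Q k).coeff N = PowerSeries.coeff N (expS (evalOne Q)) := by
  have h0 : PowerSeries.coeff 0 (evalOne Q) = 0 := by
    rw [coeff_evalOne hQ le_rfl]
    simp only [zero_add, Finset.range_one, Finset.sum_singleton, hQ0, coeff_zero]
  rw [coeff_expS h0 le_rfl]
  have h1 : ∀ k ∈ Finset.range (N + 1), (expCoeff Q k).coeff N =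
      ∑ n ∈ Finset.range (N + 1), (n.factorial : ℂ)⁻¹ * (PowerSeries.coeff k (Q ^ n)).coeff N := by
    intro k hk
    rw [expCoeff, finsetSum_coeff]
    simp only [coeff_C_mul]
    refine Finset.sum_subset (Finset.range_mono (by simp at hk; omega)) fun n _ hn => ?_
    rw [coeff_pow_eq_zero hQ0 (by simp at hn; omega), coeff_zero, mul_zero]
  rw [Finset.sum_congr rfl h1, Finset.sum_comm]
  refine Finset.sum_congr rfl fun n _ => ?_
  rw [← Finset.mul_sum, ← evalOne_pow hQ, coeff_evalOne (hQ.pow n) le_rfl]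

end Diag

/-! ### Convergent power series: substitution, inversion, logarithm -/

section Growth

/-- At most geometric growth of the coefficients. -/
def Growth (p : PowerSeries ℂ) : Prop :=
  ∃ K C : ℝ, 0 < K ∧ 0 < C ∧ ∀ n, ‖PowerSeries.coeff n p‖ ≤ K * C ^ n

/-- The formal multilinear series with the coefficients of a power series. -/
def toFMS (p : PowerSeries ℂ) : FormalMultilinearSeries ℂ ℂ ℂ :=
  FormalMultilinearSeries.ofScalars ℂ fun n => PowerSeries.coeff n p

lemma toFMS_apply (p : PowerSeries ℂ) (n : ℕ) (v : Fin n → ℂ) :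
    toFMS p n v = PowerSeries.coeff n p * ∏ i, v i := by
  simp [toFMS, FormalMultilinearSeries.ofScalars, List.prod_ofFn]

lemma coeff_toFMS (p : PowerSeries ℂ) (n : ℕ) : (toFMS p).coeff n = PowerSeries.coeff n p :=
  FormalMultilinearSeries.coeff_ofScalars

lemma norm_toFMS (p : PowerSeries ℂ) (n : ℕ) : ‖toFMS p n‖ = ‖PowerSeries.coeff n p‖ :=
  FormalMultilinearSeries.ofScalars_norm (E := ℂ) _ n

lemma Growth.radius_pos {p : PowerSeries ℂ} (h : Growth p) : 0 < (toFMS p).radius := by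
  obtain ⟨K, C, hK, hC, h⟩ := h
  have hC' : ((Real.toNNReal C⁻¹ : NNReal) : ℝ) = C⁻¹ := Real.coe_toNNReal _ (inv_pos.2 hC).le
  have h1 : ((Real.toNNReal C⁻¹ : NNReal) : ENNReal) ≤ (toFMS p).radius := by
    refine FormalMultilinearSeries.le_radius_of_bound _ K fun n => ?_
    rw [norm_toFMS, hC']
    refine (mul_le_mul_of_nonneg_right (h n) (pow_nonneg (inv_pos.2 hC).le n)).trans_eq ?_
    rw [inv_pow, mul_assoc, mul_inv_cancel₀ (pow_pos hC n).ne', mul_one]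
  refine lt_of_lt_of_le ?_ h1
  rw [ENNReal.coe_pos, Real.toNNReal_pos]
  exact inv_pos.2 hC

lemma growth_of_radius_pos {q : FormalMultilinearSeries ℂ ℂ ℂ} (h : 0 < q.radius) :
    Growth (PowerSeries.mk fun n => q n fun _ => 1) := by
  obtain ⟨K, C, hK, hC, h⟩ := q.le_mul_pow_of_radius_pos h
  refine ⟨K, C, hK, hC, fun n => ?_⟩
  rw [PowerSeries.coeff_mk]
  refine ((q n).le_opNorm _).trans ?_
  simpa using h n

/-- Composition of formal multilinear series is a sum over compositions of `n`, and so is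
substitution when the inner series has no constant term. -/
lemma comp_toFMS_apply (f : PowerSeries ℂ) {p : PowerSeries ℂ} (hp : PowerSeries.coeff 0 p = 0)
    (n : ℕ) : ((toFMS f).comp (toFMS p) n fun _ => 1) = PowerSeries.coeff n (f.subst p) := by
  rw [coeff_subst_composition f hp]
  simp only [FormalMultilinearSeries.comp, sum_apply,
    FormalMultilinearSeries.compAlongComposition_apply]
  refine Finset.sum_congr rfl fun c _ => ?_
  rw [toFMS_apply]
  congr 1
  refine Finset.prod_congr rfl fun i _ => ?_
  simp only [FormalMultilinearSeries.applyComposition, toFMS_apply, Function.comp_def,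
    Finset.prod_const_one, mul_one]

/-- Geometric growth is positivity of the radius of convergence. A composite of analytic functions
is analytic, with the substituted series as its expansion. -/
lemma Growth.subst {f p : PowerSeries ℂ} (hf : Growth f) (hp : Growth p)
    (hp0 : PowerSeries.coeff 0 p = 0) : Growth (f.subst p) := by
  have h1 := (toFMS f).hasFPowerSeriesOnBall hf.radius_pos
  have h2 := (toFMS p).hasFPowerSeriesOnBall hp.radius_pos
  have h3 : (toFMS p).sum 0 = 0 := by
    have := h2.coeff_zero fun _ => 1
    rw [toFMS_apply, hp0, zero_mul] at this
    exact this.symm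
  have h4 := (h3.symm ▸ h1.hasFPowerSeriesAt : HasFPowerSeriesAt (toFMS f).sum (toFMS f)
    ((toFMS p).sum 0)).comp h2.hasFPowerSeriesAt
  have h5 := growth_of_radius_pos h4.radius_pos
  convert h5 using 1
  ext n
  rw [PowerSeries.coeff_mk, comp_toFMS_apply f hp0]

/-- The compositional inverse of a power series `u + ⋯`. -/
lemma exists_growth_inverse {a : PowerSeries ℂ} (ha : Growth a) (h0 : PowerSeries.coeff 0 a = 0)
    (h1 : PowerSeries.coeff 1 a = 1) : ∃ b : PowerSeries ℂ, Growth b ∧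
      PowerSeries.coeff 0 b = 0 ∧ PowerSeries.coeff 1 b = 1 ∧ a.subst b = PowerSeries.X ∧
        b.subst a = PowerSeries.X := by
  have hu : IsUnit (PowerSeries.coeff 1 a) := by rw [h1]; exact isUnit_one
  have ha0 : PowerSeries.constantCoeff a = 0 := by simpa using h0
  set b := a.substInvOfIsUnit hu with hb
  have hb0 : PowerSeries.coeff 0 b = 0 := by simp [hb]
  have hab : a.subst b = PowerSeries.X := PowerSeries.subst_substInvOfIsUnit_right a ha0 hu
  have hba : b.subst a = PowerSeries.X := PowerSeries.subst_substInvOfIsUnit_left a ha0 hu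
  refine ⟨b, ?_, hb0, ?_, hab, hba⟩
  -- Algebra provides the formal inverse `b`, but no bound for it. The right inverse `q` as a
  -- multilinear series has positive radius of convergence, and its series `b'` equals `b`, since
  -- `b' = (b ∘ a) ∘ b' = b ∘ (a ∘ b') = b`.
  · set q := (toFMS a).rightInv (ContinuousLinearEquiv.refl ℂ ℂ) 0 with hq
    have hcomp : (toFMS a).comp q = FormalMultilinearSeries.id ℂ ℂ (toFMS a 0 0) := by
      refine FormalMultilinearSeries.comp_rightInv _ _ _ ?_
      ext
      simp [coeff_toFMS, h1]
    have hrad : 0 < q.radius := FormalMultilinearSeries.radius_rightInv_pos_of_radius_pos ha.radius_pos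
    have hg := growth_of_radius_pos hrad
    set b' := PowerSeries.mk fun n => q n fun _ => 1 with hb'
    have hq0 : PowerSeries.coeff 0 b' = 0 := by
      rw [hb', PowerSeries.coeff_mk, hq, FormalMultilinearSeries.rightInv_coeff_zero]
      rfl
    have hqb : q = toFMS b' := by
      ext n
      simp [coeff_toFMS, hb']
    have hab' : a.subst b' = PowerSeries.X := by
      ext n
      rw [← comp_toFMS_apply a hq0, ← hqb, hcomp, PowerSeries.coeff_X]
      rcases n with _ | _ | n
      · simp [FormalMultilinearSeries.id, coeff_toFMS, h0]
      · exact (FormalMultilinearSeries.id_apply_one ℂ ℂ _ _).trans (by simp)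
      · rw [FormalMultilinearSeries.id_apply_of_one_lt _ _ _ (by omega)]
        simp
    have : b' = b := by
      have h2 := PowerSeries.subst_comp_subst_apply (hasSubst_of_coeff h0) (hasSubst_of_coeff hq0) b
      rw [hba, hab', PowerSeries.subst_X (hasSubst_of_coeff hq0)] at h2
      rw [h2, PowerSeries.X_subst]
    rwa [← this]
  · have h2 := coeff_one_subst a hb0
    rw [hab, h1, one_mul, PowerSeries.coeff_one_X] at h2
    exact h2.symm

/-- The terms of the convergent series at the point `R / 2` are bounded. -/
lemma IsHolomorphicSeries.growth {p : PowerSeries ℂ} (h : IsHolomorphicSeries p) : Growth p := by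
  obtain ⟨R, hR, f, -, h⟩ := h
  have h1 := (h (R / 2 : ℝ) (by simp [abs_of_pos hR]; linarith)).summable.norm.tendsto_atTop_zero.bddAbove_range
  obtain ⟨K, hK⟩ := h1
  refine ⟨max K 1, 2 / R, by positivity, by positivity, fun n => ?_⟩
  have h2 := hK ⟨n, rfl⟩
  simp only [norm_mul, norm_pow, Complex.norm_real, Real.norm_eq_abs, abs_of_pos (half_pos hR)] at h2
  have h3 : ‖PowerSeries.coeff n p‖ = ‖PowerSeries.coeff n p‖ * (R / 2) ^ n * (2 / R) ^ n := by
    rw [mul_assoc, ← mul_pow]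
    field_simp
    simp
  rw [h3]
  exact mul_le_mul_of_nonneg_right (h2.trans (le_max_left _ _)) (by positivity)

lemma Growth.add {p q : PowerSeries ℂ} (hp : Growth p) (hq : Growth q) : Growth (p + q) := by
  obtain ⟨K, C, hK, hC, h⟩ := hp
  obtain ⟨K', C', hK', hC', h'⟩ := hq
  refine ⟨K + K', max C C', by positivity, by positivity, fun n => ?_⟩
  rw [map_add, add_mul]
  refine (norm_add_le _ _).trans (add_le_add ((h n).trans ?_) ((h' n).trans ?_))
  · gcongr; exact le_max_left _ _
  · gcongr; exact le_max_right _ _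

lemma Growth.neg {p : PowerSeries ℂ} (hp : Growth p) : Growth (-p) := by
  obtain ⟨K, C, hK, hC, h⟩ := hp
  exact ⟨K, C, hK, hC, fun n => by rw [map_neg, norm_neg]; exact h n⟩

lemma growth_one : Growth 1 := by
  refine ⟨1, 1, one_pos, one_pos, fun n => ?_⟩
  rw [PowerSeries.coeff_one]
  split_ifs <;> simp

lemma growth_log : Growth (PowerSeries.log ℂ) := by
  refine ⟨1, 1, one_pos, one_pos, fun n => ?_⟩
  rw [PowerSeries.coeff_log]
  split_ifs with h
  · simp
  · have : (1 : ℝ) ≤ n := by exact_mod_cast Nat.one_le_iff_ne_zero.2 h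
    simp only [map_div₀, map_pow, map_neg, map_one, map_natCast, norm_div, norm_pow, norm_neg, norm_one,
      one_pow, Complex.norm_natCast, mul_one]
    exact (div_le_one (by linarith)).2 this

lemma Growth.logOf {r : PowerSeries ℂ} (hr : Growth r) (h0 : PowerSeries.coeff 0 r = 1) :
    Growth r.logOf := by
  rw [PowerSeries.logOf_eq]
  refine growth_log.subst ?_ ?_
  · rw [sub_eq_add_neg]
    exact hr.add growth_one.neg
  · rw [map_sub, h0]
    simp

lemma coeff_zero_logOf {r : PowerSeries ℂ} (h0 : PowerSeries.coeff 0 r = 1) :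
    PowerSeries.coeff 0 r.logOf = 0 := by
  rw [PowerSeries.logOf_eq, coeff_zero_subst]
  · simp
  · rw [map_sub, h0]
    simp

end Growth

/-! ### Homogeneous polynomials on `Φ`, their majorants, and operators between symmetric powers -/

section

lemma exists_bound_of_continuous {ι E : Type*} [Nonempty ι] [AddCommGroup E] [Module ℂ E]
    {p : ι → Seminorm ℂ E} (hp : ∀ i j, ∃ k C, 0 ≤ C ∧ ∀ x, p i x ≤ C * p k x ∧ p j x ≤ C * p k x)
    (f : E →ₗ[ℂ] ℂ) (hf : Continuous[seminormTopology p, _] f) :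
    ∃ i C, 0 ≤ C ∧ ∀ x, ‖f x‖ ≤ C * p i x := by
  classical
  let := seminormTopology p
  obtain ⟨s, C, -, hC⟩ := Seminorm.bound_of_continuous (withSeminorms_seminormTopology p)
    ((normSeminorm ℂ ℂ).comp f) (continuous_norm.comp hf)
  have aux : ∀ t : Finset ι, ∃ i D, 0 ≤ D ∧ ∀ x, t.sup p x ≤ D * p i x := by
    intro t
    induction t using Finset.induction_on with
    | empty => exact ⟨Classical.arbitrary ι, 0, le_rfl, fun x => by simp⟩
    | insert b t _ iht =>
      obtain ⟨i, D, hD, h⟩ := iht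
      obtain ⟨k, E, hE, h3⟩ := hp b i
      refine ⟨k, E + D * E, by positivity, fun x => ?_⟩
      have h0 := apply_nonneg (p k) x
      rw [Finset.sup_insert, Seminorm.sup_apply]
      refine sup_le ((h3 x).1.trans ?_) ((h x).trans ?_)
      · nlinarith [mul_nonneg (mul_nonneg hD hE) h0]
      · nlinarith [mul_le_mul_of_nonneg_left (h3 x).2 hD, mul_nonneg hE h0]
  obtain ⟨i, D, hD, h⟩ := aux s
  refine ⟨i, C * D, by positivity, fun x => (hC x).trans ?_⟩
  rw [mul_assoc]
  exact mul_le_mul_of_nonneg_left (h x) C.2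

variable {T Φ : Type} [AddCommGroup Φ] [Module ℂ Φ] {H : HilbertScale T Φ}

lemma SymDual.exists_bound (hH : IsNuclear H) {n : ℕ} (F : SymDual H n) :
    ∃ τ K, 0 ≤ K ∧ ∀ φ, ‖F φ‖ ≤ K * symNorm H n τ φ :=
  have := H.nonempty
  exists_bound_of_continuous (symNorm_directed hH n) F.lin F.continuous

/-- Functionals that agree on tensor powers coincide. -/
lemma SymDual.ext_tensorPow (hH : IsNuclear H) {n : ℕ} {F G : SymDual H n}
    (h : ∀ ξ, F (tensorPow ξ n) = G (tensorPow ξ n)) : F = G := by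
  refine SymDual.ext fun φ => ?_
  suffices h0 : (F - G) φ = 0 from sub_eq_zero.1 h0
  obtain ⟨τ, K, hK, hb⟩ := (F - G).exists_bound hH
  have hspan : ∀ ψ ∈ Submodule.span ℂ (Set.range fun ξ : Nuc H => tensorPow ξ n), (F - G).lin ψ = 0 := by
    intro ψ hψ
    refine (Submodule.span_le (p := LinearMap.ker (F - G).lin)).2 ?_ hψ
    rintro _ ⟨ξ, rfl⟩
    exact sub_eq_zero.2 (h ξ)
  refine norm_le_zero_iff.1 (le_of_forall_pos_le_add fun ε hε => ?_)
  obtain ⟨ψ, hψ, hle⟩ := exists_span_tensorPow_near hH φ τ (ε := ε / (K + 1)) (by positivity)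
  have h1 : (F - G).lin φ = (F - G).lin (φ - ψ) := by rw [map_sub, hspan ψ hψ, sub_zero]
  rw [← SymDual.lin_apply, h1, zero_add]
  calc ‖(F - G).lin (φ - ψ)‖ ≤ K * symNorm H n τ (φ - ψ) := hb _
    _ ≤ K * (ε / (K + 1)) := mul_le_mul_of_nonneg_left hle hK
    _ ≤ (K + 1) * (ε / (K + 1)) := by gcongr; linarith
    _ = ε := by field_simp

section PolyBound

/-- `P` is the restriction to the diagonal of an `n`-linear form bounded by `K` in the norm of
index `τ`. -/
def PolyBound (H : HilbertScale T Φ) (τ : T) (n : ℕ) (K : ℝ) (P : Nuc H → ℂ) : Prop :=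
  0 ≤ K ∧ ∃ M : MultilinearMap ℂ (fun _ : Fin n => Nuc H) ℂ, (∀ ξ, (M fun _ => ξ) = P ξ) ∧
    ∀ ξ, ‖M ξ‖ ≤ K * ∏ i, nucNorm H τ (ξ i)

variable {τ : T} {n m : ℕ} {K K' : ℝ} {P Q : Nuc H → ℂ}

lemma prod_nucNorm_nonneg (τ : T) (ξ : Fin n → Nuc H) : 0 ≤ ∏ i, nucNorm H τ (ξ i) :=
  Finset.prod_nonneg fun _ _ => apply_nonneg _ _

lemma PolyBound.mono (h : PolyBound H τ n K P) (hK : K ≤ K') : PolyBound H τ n K' P := by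
  obtain ⟨h0, M, h1, h2⟩ := h
  exact ⟨h0.trans hK, M, h1, fun ξ => (h2 ξ).trans
    (mul_le_mul_of_nonneg_right hK (prod_nucNorm_nonneg τ ξ))⟩

lemma polyBound_zero : PolyBound H τ n 0 (fun _ => 0) := ⟨le_rfl, 0, fun _ => rfl, fun ξ => by simp⟩

lemma PolyBound.add (h : PolyBound H τ n K P) (h' : PolyBound H τ n K' Q) :
    PolyBound H τ n (K + K') (fun ξ => P ξ + Q ξ) := by
  obtain ⟨h0, M, h1, h2⟩ := h
  obtain ⟨h0', M', h1', h2'⟩ := h'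
  refine ⟨add_nonneg h0 h0', M + M', fun ξ => by rw [add_apply, h1, h1'], fun ξ => ?_⟩
  rw [add_mul]
  exact (norm_add_le _ _).trans (add_le_add (h2 ξ) (h2' ξ))

lemma PolyBound.const_mul (h : PolyBound H τ n K P) (c : ℂ) :
    PolyBound H τ n (‖c‖ * K) (fun ξ => c * P ξ) := by
  obtain ⟨h0, M, h1, h2⟩ := h
  refine ⟨by positivity, c • M, fun ξ => by rw [smul_apply, h1, smul_eq_mul], fun ξ => ?_⟩
  rw [smul_apply, norm_smul, mul_assoc]
  exact mul_le_mul_of_nonneg_left (h2 ξ) (norm_nonneg c)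

lemma PolyBound.sum {ι : Type*} (s : Finset ι) {K : ι → ℝ} {P : ι → Nuc H → ℂ}
    (h : ∀ i ∈ s, PolyBound H τ n (K i) (P i)) :
    PolyBound H τ n (∑ i ∈ s, K i) (fun ξ => ∑ i ∈ s, P i ξ) := by
  classical
  induction s using Finset.induction_on with
  | empty => simpa using polyBound_zero
  | insert a s ha ih =>
    simp only [Finset.sum_insert ha]
    exact (h a (Finset.mem_insert_self a s)).add (ih fun i hi => h i (Finset.mem_insert_of_mem hi))

lemma polyBound_const (c : ℂ) : PolyBound H τ 0 ‖c‖ (fun _ => c) :=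
  ⟨norm_nonneg c, MultilinearMap.constOfIsEmpty ℂ _ c, fun _ => rfl, fun ξ => by simp⟩

/-- The product of two multilinear forms in disjoint sets of variables. -/
def mulForm {E : Type*} [AddCommGroup E] [Module ℂ E] (M : MultilinearMap ℂ (fun _ : Fin n => E) ℂ)
    (N : MultilinearMap ℂ (fun _ : Fin m => E) ℂ) : MultilinearMap ℂ (fun _ : Fin (n + m) => E) ℂ :=
  MultilinearMap.mk' (fun v => M (fun i => v (Fin.castAdd m i)) * N fun i => v (Fin.natAdd n i))
    (fun v i x y => by
      have h1 : ∀ (j : Fin n) (z : E), (fun k => Function.update v (Fin.castAdd m j) z (Fin.castAdd m k)) =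
          Function.update (fun k => v (Fin.castAdd m k)) j z := fun j z =>
        Function.update_comp_eq_of_injective v (Fin.castAdd_injective n m) j z
      have h2 : ∀ (j : Fin n) (z : E), (fun k => Function.update v (Fin.castAdd m j) z (Fin.natAdd n k)) =
          fun k => v (Fin.natAdd n k) := fun j z => by
        funext k
        rw [Function.update_of_ne]
        exact fun h => absurd (congrArg Fin.val h) (by simp; omega)
      have h3 : ∀ (j : Fin m) (z : E), (fun k => Function.update v (Fin.natAdd n j) z (Fin.natAdd n k)) =
          Function.update (fun k => v (Fin.natAdd n k)) j z := fun j z =>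
        Function.update_comp_eq_of_injective v (Fin.natAdd_injective m n) j z
      have h4 : ∀ (j : Fin m) (z : E), (fun k => Function.update v (Fin.natAdd n j) z (Fin.castAdd m k)) =
          fun k => v (Fin.castAdd m k) := fun j z => by
        funext k
        rw [Function.update_of_ne]
        exact fun h => absurd (congrArg Fin.val h) (by simp; omega)
      induction i using Fin.addCases with
      | left j => simp only [h1, h2, M.map_update_add, add_mul]
      | right j => simp only [h3, h4, N.map_update_add, mul_add])
    (fun v i c x => by
      have h1 : ∀ (j : Fin n) (z : E), (fun k => Function.update v (Fin.castAdd m j) z (Fin.castAdd m k)) =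
          Function.update (fun k => v (Fin.castAdd m k)) j z := fun j z =>
        Function.update_comp_eq_of_injective v (Fin.castAdd_injective n m) j z
      have h2 : ∀ (j : Fin n) (z : E), (fun k => Function.update v (Fin.castAdd m j) z (Fin.natAdd n k)) =
          fun k => v (Fin.natAdd n k) := fun j z => by
        funext k
        rw [Function.update_of_ne]
        exact fun h => absurd (congrArg Fin.val h) (by simp; omega)
      have h3 : ∀ (j : Fin m) (z : E), (fun k => Function.update v (Fin.natAdd n j) z (Fin.natAdd n k)) =
          Function.update (fun k => v (Fin.natAdd n k)) j z := fun j z =>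
        Function.update_comp_eq_of_injective v (Fin.natAdd_injective m n) j z
      have h4 : ∀ (j : Fin m) (z : E), (fun k => Function.update v (Fin.natAdd n j) z (Fin.castAdd m k)) =
          fun k => v (Fin.castAdd m k) := fun j z => by
        funext k
        rw [Function.update_of_ne]
        exact fun h => absurd (congrArg Fin.val h) (by simp; omega)
      induction i using Fin.addCases with
      | left j => simp only [h1, h2, M.map_update_smul, smul_eq_mul, mul_assoc]
      | right j => simp only [h3, h4, N.map_update_smul, smul_eq_mul, mul_left_comm])

lemma PolyBound.mul (h : PolyBound H τ n K P) (h' : PolyBound H τ m K' Q) :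
    PolyBound H τ (n + m) (K * K') (fun ξ => P ξ * Q ξ) := by
  obtain ⟨h0, M, h1, h2⟩ := h
  obtain ⟨h0', M', h1', h2'⟩ := h'
  refine ⟨by positivity, mulForm M M', fun ξ => ?_, fun ξ => ?_⟩
  · exact congrArg₂ (· * ·) (h1 ξ) (h1' ξ)
  · change ‖(M fun i => ξ (Fin.castAdd m i)) * M' fun i => ξ (Fin.natAdd n i)‖ ≤ _
    rw [norm_mul, Fin.prod_univ_add, mul_mul_mul_comm]
    exact mul_le_mul (h2 _) (h2' _) (norm_nonneg _) (mul_nonneg h0 (prod_nucNorm_nonneg τ _))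

end PolyBound

section PolySeries

/-- `P` is a series of polynomials whose coefficients have the majorant series `∑ Kₙ Rⁿ ≤ B`. -/
def PolySeries (H : HilbertScale T Φ) (τ : T) (R B : ℝ) (P : Nuc H → PowerSeries ℂ) : Prop :=
  ∃ K : ℕ → ℝ, (∀ n, PolyBound H τ n (K n) fun ξ => PowerSeries.coeff n (P ξ)) ∧
    ∀ N, ∑ n ∈ Finset.range N, K n * R ^ n ≤ B

variable {τ : T} {R B B' : ℝ} {P Q : Nuc H → PowerSeries ℂ}

lemma PolySeries.polyBound (h : PolySeries H τ R B P) (hR : 0 < R) (n : ℕ) :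
    PolyBound H τ n (B / R ^ n) fun ξ => PowerSeries.coeff n (P ξ) := by
  obtain ⟨K, h1, h2⟩ := h
  refine (h1 n).mono ?_
  rw [le_div_iff₀ (by positivity)]
  exact (Finset.single_le_sum (f := fun n => K n * R ^ n)
    (fun i _ => mul_nonneg (h1 i).1 (by positivity)) (Finset.mem_range.2 n.lt_succ_self)).trans (h2 _)

lemma PolySeries.nonneg (h : PolySeries H τ R B P) : 0 ≤ B := by
  obtain ⟨K, h1, h2⟩ := h
  simpa using h2 0

lemma polySeries_one : PolySeries H τ R 1 fun _ => 1 := by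
  refine ⟨fun n => if n = 0 then 1 else 0, fun n => ?_, fun N => ?_⟩
  · rcases n with _ | n
    · simpa using polyBound_const (H := H) (τ := τ) 1
    · simpa [PowerSeries.coeff_one] using polyBound_zero (H := H) (τ := τ) (n := n + 1)
  · rcases N with _ | N
    · simp
    · rw [Finset.sum_range_succ']
      simp

/-- The Cauchy product of the majorants is again a majorant, and its partial sums lie below the
product of the partial sums over the square `N × N`. -/
lemma PolySeries.mul (hR : 0 ≤ R) (h : PolySeries H τ R B P) (h' : PolySeries H τ R B' Q) :
    PolySeries H τ R (B * B') fun ξ => P ξ * Q ξ := by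
  have hB := h.nonneg
  obtain ⟨K, h1, h2⟩ := h
  obtain ⟨K', h1', h2'⟩ := h'
  refine ⟨fun n => ∑ x ∈ Finset.HasAntidiagonal.antidiagonal n, K x.1 * K' x.2, fun n => ?_, fun N => ?_⟩
  · simp only [PowerSeries.coeff_mul]
    refine PolyBound.sum _ fun x hx => ?_
    have := (h1 x.1).mul (h1' x.2)
    rwa [Finset.HasAntidiagonal.mem_antidiagonal.1 hx] at this
  · have h3 : ∀ n, (∑ x ∈ Finset.HasAntidiagonal.antidiagonal n, K x.1 * K' x.2) * R ^ n =
        ∑ x ∈ Finset.HasAntidiagonal.antidiagonal n, (K x.1 * R ^ x.1) * (K' x.2 * R ^ x.2) := by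
      intro n
      rw [Finset.sum_mul]
      refine Finset.sum_congr rfl fun x hx => ?_
      rw [← Finset.HasAntidiagonal.mem_antidiagonal.1 hx, pow_add]
      ring
    simp only [h3]
    have hn : ∀ i, 0 ≤ K i * R ^ i := fun i => mul_nonneg (h1 i).1 (pow_nonneg hR i)
    have hn' : ∀ i, 0 ≤ K' i * R ^ i := fun i => mul_nonneg (h1' i).1 (pow_nonneg hR i)
    calc ∑ n ∈ Finset.range N, ∑ x ∈ Finset.HasAntidiagonal.antidiagonal n, (K x.1 * R ^ x.1) * (K' x.2 * R ^ x.2)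
        ≤ ∑ x ∈ Finset.range N ×ˢ Finset.range N, (K x.1 * R ^ x.1) * (K' x.2 * R ^ x.2) := by
          rw [Finset.sum_sigma']
          have hinj : Set.InjOn (fun s : (Σ _ : ℕ, ℕ × ℕ) => s.2)
              ((Finset.range N).sigma fun n => Finset.HasAntidiagonal.antidiagonal n : Finset _) := by
            rintro ⟨a, x⟩ hs ⟨b, y⟩ ht hst
            simp only [Finset.coe_sigma, Set.mem_sigma_iff, Finset.mem_coe,
              Finset.HasAntidiagonal.mem_antidiagonal] at hs ht
            simp only at hst
            subst hst
            obtain rfl : a = b := hs.2.symm.trans ht.2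
            rfl
          rw [← Finset.sum_image (f := fun x : ℕ × ℕ => (K x.1 * R ^ x.1) * (K' x.2 * R ^ x.2)) hinj]
          refine Finset.sum_le_sum_of_subset_of_nonneg ?_ fun x _ _ => mul_nonneg (hn _) (hn' _)
          intro x hx
          obtain ⟨s, hs, rfl⟩ := Finset.mem_image.1 hx
          simp only [Finset.mem_sigma, Finset.mem_range, Finset.HasAntidiagonal.mem_antidiagonal,
            Finset.mem_product] at hs ⊢
          omega
      _ = (∑ i ∈ Finset.range N, K i * R ^ i) * ∑ j ∈ Finset.range N, K' j * R ^ j := by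
          rw [Finset.sum_mul_sum, Finset.sum_product]
      _ ≤ B * B' := mul_le_mul (h2 N) (h2' N) (Finset.sum_nonneg fun i _ => hn' i) hB

lemma PolySeries.prod (hR : 0 ≤ R) {k : ℕ} {B : Fin k → ℝ} {P : Fin k → Nuc H → PowerSeries ℂ}
    (h : ∀ i, PolySeries H τ R (B i) (P i)) :
    PolySeries H τ R (∏ i, B i) fun ξ => ∏ i, P i ξ := by
  induction k with
  | zero => simpa using polySeries_one
  | succ k ih =>
    simp only [Fin.prod_univ_succ]
    exact (h 0).mul hR (ih fun i => h i.succ)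

/-- Summing the majorants `B ^ k / k!` of the powers gives `e ^ B`. The missing constant term keeps
each coefficient a finite sum. -/
lemma PolySeries.expS (hR : 0 ≤ R) (h : PolySeries H τ R B P)
    (h0 : ∀ ξ, PowerSeries.coeff 0 (P ξ) = 0) :
    PolySeries H τ R (Real.exp B) fun ξ => Sheffer.expS (P ξ) := by
  have hpow : ∀ k : ℕ, PolySeries H τ R (B ^ k) fun ξ => P ξ ^ k := fun k => by
    simpa using PolySeries.prod hR (k := k) fun _ => h
  choose K h1 h2 using hpow
  refine ⟨fun n => ∑ k ∈ Finset.range (n + 1), ‖((k.factorial : ℂ)⁻¹)‖ * K k n, fun n => ?_, fun N => ?_⟩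
  · simp only [coeff_expS (h0 _) le_rfl]
    exact PolyBound.sum _ fun k _ => (h1 k n).const_mul _
  · have hn : ∀ k n, 0 ≤ K k n * R ^ n := fun k n => mul_nonneg (h1 k n).1 (pow_nonneg hR n)
    calc ∑ n ∈ Finset.range N, (∑ k ∈ Finset.range (n + 1), ‖((k.factorial : ℂ)⁻¹)‖ * K k n) * R ^ n
        ≤ ∑ n ∈ Finset.range N, ∑ k ∈ Finset.range N, ‖((k.factorial : ℂ)⁻¹)‖ * (K k n * R ^ n) := by
          refine Finset.sum_le_sum fun n hn' => ?_
          rw [Finset.sum_mul]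
          simp only [mul_assoc]
          exact Finset.sum_le_sum_of_subset_of_nonneg
            (Finset.range_mono (by have := Finset.mem_range.1 hn'; omega))
            fun k _ _ => mul_nonneg (norm_nonneg _) (hn k n)
      _ = ∑ k ∈ Finset.range N, ‖((k.factorial : ℂ)⁻¹)‖ * ∑ n ∈ Finset.range N, K k n * R ^ n := by
          rw [Finset.sum_comm]
          simp only [Finset.mul_sum]
      _ ≤ ∑ k ∈ Finset.range N, B ^ k / k.factorial := by
          refine Finset.sum_le_sum fun k _ => ?_
          rw [norm_inv, Complex.norm_natCast, div_eq_inv_mul]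
          exact mul_le_mul_of_nonneg_left (h2 k N) (by positivity)
      _ ≤ Real.exp B := Real.sum_le_exp_of_nonneg h.nonneg N

end PolySeries

section Kernels

variable {n k : ℕ}

lemma exists_common_dualLE (ω : Fin k → CoNuc H) : ∃ (τ : T) (C : Fin k → ℝ), ∀ i, DualLE H τ (C i) (ω i) := by
  obtain ⟨τ, ω', h⟩ := exists_common_incl ω
  exact ⟨τ, fun i => ‖ω' i‖, fun i => h i ▸ dualLE_incl τ (ω' i)⟩

/-- A family of bounded `n`-homogeneous polynomials on `Φ` depending on `k` functionals in a
multilinear and symmetric way defines an operator `Φ^{⊙n} → Φ^{⊙k}`. -/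
lemma exists_kernel (hH : IsNuclear H) (P : Nuc H → MultilinearMap ℂ (fun _ : Fin k => CoNuc H) ℂ)
    (hs : ∀ ξ (σ : Equiv.Perm (Fin k)) ω, P ξ (ω ∘ σ) = P ξ ω)
    (hb : ∀ τ, ∃ τ' K, 0 ≤ K ∧ ∀ ω (C : Fin k → ℝ), (∀ i, DualLE H τ (C i) (ω i)) →
      PolyBound H τ' n (K * ∏ i, C i) fun ξ => P ξ ω) :
    ∃ V : SymPow H n →ₗ[ℂ] SymPow H k, (∀ ξ, (V (tensorPow ξ n)).form = P ξ) ∧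
      ∀ τ τ' K, 0 ≤ K → (∀ ω (C : Fin k → ℝ), (∀ i, DualLE H τ (C i) (ω i)) →
        PolyBound H τ' n (K * ∏ i, C i) fun ξ => P ξ ω) →
      ∀ τ'' κ, HSLE H τ' τ'' κ → ∀ φ, OpBound τ (K * κ ^ n * symNorm H n τ'' φ) (V φ).form := by
  -- For fixed functionals `ω` the kernel theorem yields a functional on `Φ^{⊙n}`. It is determined
  -- by its values on tensor powers, and this uniqueness makes its dependence on `ω` multilinear and
  -- symmetric.
  have hex : ∀ ω, ∃ F : SymDual H n, ∀ ξ, F (tensorPow ξ n) = P ξ ω := by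
    intro ω
    obtain ⟨τ, C, hC⟩ := exists_common_dualLE ω
    obtain ⟨τ', K, -, h⟩ := hb τ
    obtain ⟨h0, M, h1, h2⟩ := h ω C hC
    obtain ⟨τ'', κ, hκ⟩ := hH τ'
    obtain ⟨F, hF, -⟩ := HSLE.exists_functional hκ M h0 h2
    exact ⟨F, fun ξ => (hF ξ).trans (h1 ξ)⟩
  choose F hF using hex
  have hbound : ∀ τ τ' K, 0 ≤ K → (∀ ω (C : Fin k → ℝ), (∀ i, DualLE H τ (C i) (ω i)) →
        PolyBound H τ' n (K * ∏ i, C i) fun ξ => P ξ ω) →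
      ∀ τ'' κ, HSLE H τ' τ'' κ → ∀ φ ω (C : Fin k → ℝ), (∀ i, DualLE H τ (C i) (ω i)) →
        ‖F ω φ‖ ≤ K * κ ^ n * symNorm H n τ'' φ * ∏ i, C i := by
    intro τ τ' K hK h τ'' κ hκ φ ω C hC
    obtain ⟨h0, M, h1, h2⟩ := h ω C hC
    obtain ⟨F', hF', hb'⟩ := HSLE.exists_functional hκ M h0 h2
    -- By uniqueness the functional chosen once inherits every bound that the kernel theorem can
    -- provide.
    have : F ω = F' := SymDual.ext_tensorPow hH fun ξ => by rw [hF, hF', h1]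
    rw [this]
    exact (hb' φ).trans_eq (by ring)
  have hadd : ∀ ω i x y, F (Function.update ω i (x + y)) = F (Function.update ω i x) + F (Function.update ω i y) := by
    intro ω i x y
    refine SymDual.ext_tensorPow hH fun ξ => ?_
    change _ = F _ (tensorPow ξ n) + F _ (tensorPow ξ n)
    rw [hF, hF, hF, (P ξ).map_update_add]
  have hsmul : ∀ ω i (c : ℂ) x, F (Function.update ω i (c • x)) = c • F (Function.update ω i x) := by
    intro ω i c x
    refine SymDual.ext_tensorPow hH fun ξ => ?_
    change _ = c • F _ (tensorPow ξ n)
    rw [hF, hF, (P ξ).map_update_smul]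
  let G : SymPow H n → MultilinearMap ℂ (fun _ : Fin k => CoNuc H) ℂ := fun φ =>
    MultilinearMap.mk' (fun ω => F ω φ) (fun ω i x y => by rw [hadd]; rfl)
      (fun ω i c x => by rw [hsmul]; rfl)
  have hG : ∀ φ, G φ ∈ symPowSubmodule H k := by
    intro φ
    refine mem_symPow hH (fun σ ω => ?_) fun τ => ?_
    · change F (ω ∘ σ) φ = F ω φ
      congr 1
      exact SymDual.ext_tensorPow hH fun ξ => by rw [hF, hF, hs]
    · obtain ⟨τ', K, hK, h⟩ := hb τ
      obtain ⟨τ'', κ, hκ⟩ := hH τ'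
      have hκ0 : 0 ≤ κ := zero_le_one.trans hκ.1
      exact ⟨K * κ ^ n * symNorm H n τ'' φ, by positivity, fun ω C hC =>
        hbound τ τ' K hK h τ'' κ hκ φ ω C hC⟩
  refine ⟨{ toFun := fun φ => ⟨G φ, hG φ⟩
            map_add' := fun φ ψ => SymPow.ext fun ω => (F ω).lin.map_add φ ψ
            map_smul' := fun c φ => SymPow.ext fun ω => (F ω).lin.map_smul c φ }, fun ξ => ?_, ?_⟩
  · ext ω
    exact hF ω ξ
  · intro τ τ' K hK h τ'' κ hκ φ ω C hC
    exact hbound τ τ' K hK h τ'' κ hκ φ ω C hC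

end Kernels

end

/-! ### Scales of functions and substitution into pointwise powers -/

section

variable {T Φ : Type} [AddCommGroup Φ] [Module ℂ Φ] {H : HilbertScale T Φ} {d : ℕ}

/-- The properties of a scale of functions on `ℝ^d` on which the lifting of Sheffer sequences
rests: it is nuclear, closed under products, with good bounds for products with many factors,
consists of integrable functions, and is reflexive. -/
structure FunScale (H : HilbertScale T Φ) (κ : Φ →ₗ[ℂ] (RSpace d → ℂ)) where
  injective : Function.Injective κ
  nuclear : IsNuclear H
  mul : (n : ℕ) → MultilinearMap ℂ (fun _ : Fin n => Nuc H) (Nuc H)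
  -- The empty product would be the constant function `1`, which need not belong to `Φ`. The value
  -- `0` suits series without constant term.
  mul_nil : mul 0 = 0
  mul_apply : ∀ n, n ≠ 0 → ∀ ξ x, κ (mul n ξ).val x = ∏ i, κ (ξ i).val x
  mul_bound : ∀ τ, ∃ τ' C, 0 < C ∧ ∀ n ξ,
    nucNorm H τ (mul n ξ) ≤ C ^ n * ∏ i, nucNorm H τ' (ξ i)
  integral : CoNuc H
  integral_apply : ∀ ξ, integral ξ = ∫ x, κ ξ.val x
  -- Reflexivity is what brings the operators `A_k` into `Φ` itself: duality alone constructs their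
  -- values only as functionals on `Φ'`.
  reflexive : ∀ L : CoNuc H →ₗ[ℂ] ℂ, (∀ τ, ∃ K, ∀ ω C, DualLE H τ C ω → ‖L ω‖ ≤ K * C) →
    ∃ ξ, ∀ ω, L ω = ω ξ

namespace FunScale

variable {κ : Φ →ₗ[ℂ] (RSpace d → ℂ)} (𝓕 : FunScale H κ)

/-- The pointwise power `ξ^n`, with the convention `ξ^0 = 0`. -/
def npow (ξ : Nuc H) (n : ℕ) : Nuc H := 𝓕.mul n fun _ => ξ

include 𝓕 in
lemma ext {ξ η : Nuc H} (h : ∀ x, κ ξ.val x = κ η.val x) : ξ = η := 𝓕.injective (funext h)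

lemma npow_zero (ξ : Nuc H) : 𝓕.npow ξ 0 = 0 := by rw [npow, 𝓕.mul_nil]; rfl

lemma npow_apply (ξ : Nuc H) {n : ℕ} (hn : n ≠ 0) (x : RSpace d) :
    κ (𝓕.npow ξ n).val x = κ ξ.val x ^ n := by
  rw [npow, 𝓕.mul_apply n hn, Finset.prod_const, Finset.card_univ, Fintype.card_fin]

lemma npow_one (ξ : Nuc H) : 𝓕.npow ξ 1 = ξ := 𝓕.ext fun x => by
  rw [𝓕.npow_apply ξ one_ne_zero, pow_one]

lemma val_smul (c : ℂ) (ξ : Nuc H) (x : RSpace d) : κ (c • ξ).val x = c * κ ξ.val x :=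
  congrFun (map_smul κ c ξ.val) x

lemma val_sum {ι : Type*} (s : Finset ι) (ξ : ι → Nuc H) (x : RSpace d) :
    κ (∑ i ∈ s, ξ i).val x = ∑ i ∈ s, κ (ξ i).val x := by
  have h : κ (∑ i ∈ s, ξ i).val = ∑ i ∈ s, κ (ξ i).val := map_sum κ (fun i => (ξ i).val) s
  rw [h, Finset.sum_apply]

/-- The power series `∑ pⱼ ⟨ω, ξ^j⟩ z^j`, as a linear function of `ω`. -/
def ser (p : PowerSeries ℂ) (ξ : Nuc H) : CoNuc H →ₗ[ℂ] PowerSeries ℂ where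
  toFun ω := PowerSeries.mk fun j => PowerSeries.coeff j p * ω (𝓕.npow ξ j)
  map_add' ω ω' := by ext j; simp [mul_add]
  map_smul' c ω := by ext j; simp [mul_left_comm]

lemma coeff_ser (p : PowerSeries ℂ) (ξ : Nuc H) (ω : CoNuc H) (j : ℕ) :
    PowerSeries.coeff j (𝓕.ser p ξ ω) = PowerSeries.coeff j p * ω (𝓕.npow ξ j) :=
  PowerSeries.coeff_mk j fun j => PowerSeries.coeff j p * ω (𝓕.npow ξ j)

lemma coeff_zero_ser (p : PowerSeries ℂ) (ξ : Nuc H) (ω : CoNuc H) :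
    PowerSeries.coeff 0 (𝓕.ser p ξ ω) = 0 := by
  rw [coeff_ser, npow_zero, map_zero, mul_zero]

lemma ser_neg (p : PowerSeries ℂ) (ξ : Nuc H) (ω : CoNuc H) :
    𝓕.ser (-p) ξ ω = -𝓕.ser p ξ ω := by
  ext j
  rw [coeff_ser, map_neg, map_neg, coeff_ser, neg_mul]

lemma ser_X (ξ : Nuc H) (ω : CoNuc H) :
    𝓕.ser PowerSeries.X ξ ω = PowerSeries.C (ω ξ) * PowerSeries.X := by
  ext j
  rw [coeff_ser, PowerSeries.coeff_C_mul, PowerSeries.coeff_X]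
  split_ifs with h
  · rw [h, npow_one, one_mul, mul_one]
  · rw [zero_mul, mul_zero]

lemma coeff_expS_ser_X (ξ : Nuc H) (ω : CoNuc H) (n : ℕ) :
    PowerSeries.coeff n (expS (𝓕.ser PowerSeries.X ξ ω)) = (n.factorial : ℂ)⁻¹ * ω ξ ^ n := by
  rw [coeff_expS (𝓕.coeff_zero_ser _ ξ ω) le_rfl, Finset.sum_eq_single n]
  · rw [ser_X, mul_pow, ← map_pow, PowerSeries.coeff_C_mul, PowerSeries.coeff_X_pow_self, mul_one]
  · intro k _ hk
    rw [ser_X, mul_pow, ← map_pow, PowerSeries.coeff_C_mul, PowerSeries.coeff_X_pow,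
      if_neg (Ne.symm hk), mul_zero, mul_zero]
  · simp

/-! ### Substitution into the powers of a function -/

/-- The curve `z ↦ ∑_{l ≤ N} p_l z^l ξ^l`. -/
def curve (p : PowerSeries ℂ) (N : ℕ) (ξ : Nuc H) (z : ℂ) : Nuc H :=
  ∑ l ∈ Finset.range (N + 1), (z ^ l * PowerSeries.coeff l p) • 𝓕.npow ξ l

lemma coeff_trunc_pow {p : PowerSeries ℂ} {N m : ℕ} (h : m ≤ N) (j : ℕ) :
    ((PowerSeries.trunc (N + 1) p) ^ j).coeff m = PowerSeries.coeff m (p ^ j) := by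
  rw [← Polynomial.coeff_coe, Polynomial.coe_pow, coeff_pow_fin, coeff_pow_fin]
  refine Finset.sum_congr rfl fun f hf => Finset.prod_congr rfl fun i _ => ?_
  have h1 := Finset.single_le_sum (f := f) (fun i _ => Nat.zero_le _) (Finset.mem_univ i)
  rw [mem_tuples.1 hf] at h1
  rw [Polynomial.coeff_coe, PowerSeries.coeff_trunc, if_pos (by omega)]

lemma natDegree_trunc_pow (p : PowerSeries ℂ) (N j : ℕ) :
    ((PowerSeries.trunc (N + 1) p) ^ j).natDegree < j * N + 1 := by
  refine Nat.lt_succ_of_le (Polynomial.natDegree_pow_le.trans (Nat.mul_le_mul_left j ?_))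
  exact Nat.lt_succ_iff.1 (PowerSeries.natDegree_trunc_lt p N)

/-- At a point `x` the curve is the truncation of `p` evaluated at `z ξ(x)`, and its `j`-th power is
expanded in powers of `z ξ(x)`. The convention `ξ^0 = 0` does no harm for `j ≥ 1`, because `p` has
no constant term. -/
lemma npow_curve {p : PowerSeries ℂ} (hp : PowerSeries.coeff 0 p = 0) (N : ℕ) (ξ : Nuc H) (z : ℂ)
    (j : ℕ) : 𝓕.npow (𝓕.curve p N ξ z) j = ∑ m ∈ Finset.range (j * N + 1),
      (((PowerSeries.trunc (N + 1) p) ^ j).coeff m * z ^ m) • 𝓕.npow ξ m := by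
  rcases Nat.eq_zero_or_pos j with rfl | hj
  · simp [npow_zero]
  refine 𝓕.ext fun x => ?_
  have h1 : κ (𝓕.curve p N ξ z).val x = (PowerSeries.trunc (N + 1) p).eval (z * κ ξ.val x) := by
    rw [curve, val_sum, Polynomial.eval_eq_sum_range' (PowerSeries.natDegree_trunc_lt p N)]
    refine Finset.sum_congr rfl fun l hl => ?_
    rw [val_smul, PowerSeries.coeff_trunc, if_pos (Finset.mem_range.1 hl)]
    rcases Nat.eq_zero_or_pos l with rfl | hl
    · rw [hp]; ring
    · rw [𝓕.npow_apply ξ hl.ne', mul_pow]; ring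
  rw [𝓕.npow_apply _ hj.ne', h1, ← Polynomial.eval_pow,
    Polynomial.eval_eq_sum_range' (natDegree_trunc_pow p N j), val_sum]
  refine Finset.sum_congr rfl fun m _ => ?_
  rw [val_smul]
  rcases Nat.eq_zero_or_pos m with rfl | hm
  · rw [coeff_trunc_pow (Nat.zero_le N), coeff_pow_eq_zero hp hj]; ring
  · rw [𝓕.npow_apply ξ hm.ne', mul_pow]; ring

/-- Multilinear expansion exhibits a polynomial in `z`, in which the tuples with sum `N` form the
coefficient of `z ^ N`. -/
lemma map_tensorPow_curve (p : PowerSeries ℂ) (N : ℕ) (ξ : Nuc H) (z : ℂ) {k : ℕ}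
    (F : SymPow H k →ₗ[ℂ] ℂ) :
    F (tensorPow (𝓕.curve p N ξ z) k) = ∑ f ∈ Fintype.piFinset fun _ : Fin k => Finset.range (N + 1),
      F (symProd fun i => PowerSeries.coeff (f i) p • 𝓕.npow ξ (f i)) * z ^ ∑ i, f i := by
  have h : tensorPow (𝓕.curve p N ξ z) k =
      ∑ f ∈ Fintype.piFinset fun _ : Fin k => Finset.range (N + 1),
        (z ^ ∑ i, f i) • symProd fun i => PowerSeries.coeff (f i) p • 𝓕.npow ξ (f i) := by
    refine SymPow.ext_diag fun ω => ?_
    rw [tensorPow_form, map_sum, sum_apply, curve]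
    simp only [map_sum, Finset.prod_univ_sum]
    refine Finset.sum_congr rfl fun f _ => ?_
    rw [map_smul, smul_apply, symProd_form_diag, ← Finset.prod_pow_eq_pow_sum, smul_eq_mul,
      ← Finset.prod_mul_distrib]
    refine Finset.prod_congr rfl fun i _ => ?_
    rw [map_smul, map_smul, smul_eq_mul, smul_eq_mul, mul_assoc]
  rw [h, map_sum]
  exact Finset.sum_congr rfl fun f _ => by rw [map_smul, smul_eq_mul, mul_comm]

lemma coeff_expS_congr {P P' : PowerSeries ℂ} (h0 : PowerSeries.coeff 0 P = 0)
    (h0' : PowerSeries.coeff 0 P' = 0) {N : ℕ}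
    (h : ∀ m ≤ N, PowerSeries.coeff m P = PowerSeries.coeff m P') :
    PowerSeries.coeff N (expS P) = PowerSeries.coeff N (expS P') := by
  rw [coeff_expS h0 le_rfl, coeff_expS h0' le_rfl]
  refine Finset.sum_congr rfl fun n _ => ?_
  rw [coeff_pow_fin, coeff_pow_fin]
  congr 1
  refine Finset.sum_congr rfl fun f hf => Finset.prod_congr rfl fun i _ => h _ ?_
  have h1 := Finset.single_le_sum (f := f) (fun i _ => Nat.zero_le _) (Finset.mem_univ i)
  rwa [mem_tuples.1 hf] at h1

open Polynomial in
/-- If functionals `F_k` on `Φ^{⊙k}` have the exponential generating function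
`∑_k F_k(η^{⊗k}) z^k = exp(∑_j ⟨w_j, η^j⟩ z^j)`, then substitution of `∑ p_l ξ^l` for `η` is possible
in this equality. -/
lemma sum_map_symProd {p : PowerSeries ℂ} (hp : PowerSeries.coeff 0 p = 0) (w : ℕ → CoNuc H)
    (F : (k : ℕ) → SymPow H k →ₗ[ℂ] ℂ)
    (hF : ∀ k η, F k (tensorPow η k) =
      PowerSeries.coeff k (expS (PowerSeries.mk fun j => w j (𝓕.npow η j))))
    (ξ : Nuc H) (N : ℕ) :
    ∑ k ∈ Finset.range (N + 1), ∑ f ∈ tuples k N,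
      F k (symProd fun i => PowerSeries.coeff (f i) p • 𝓕.npow ξ (f i)) =
    PowerSeries.coeff N (expS (PowerSeries.mk fun m =>
      ∑ j ∈ Finset.range (m + 1), PowerSeries.coeff m (p ^ j) * w j (𝓕.npow ξ m))) := by
  -- `Q` is the exponent `∑ⱼ ⟨wⱼ, ηʲ⟩ tʲ` along the curve `η = ∑_{l ≤ N} p_l Xˡ ξˡ`, with `X` as the
  -- parameter of the curve. At `X = z` the hypothesis `hF` is an identity between polynomials in
  -- `z`; its coefficient of `z ^ N`, summed over the powers of `t`, is the claim.
  let Q : PowerSeries ℂ[X] := PowerSeries.mk fun j => ∑ m ∈ Finset.range (j * N + 1),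
    C (((PowerSeries.trunc (N + 1) p) ^ j).coeff m * w j (𝓕.npow ξ m)) * X ^ m
  have hQc : ∀ j m, (PowerSeries.coeff j Q).coeff m = if m < j * N + 1 then
      ((PowerSeries.trunc (N + 1) p) ^ j).coeff m * w j (𝓕.npow ξ m) else 0 := by
    intro j m
    rw [PowerSeries.coeff_mk, finsetSum_coeff]
    simp only [coeff_C_mul_X_pow, Finset.sum_ite_eq, Finset.mem_range]
  have hQ0 : PowerSeries.coeff 0 Q = 0 := by
    rw [PowerSeries.coeff_mk]
    simp [npow_zero]
  have htr0 : PowerSeries.coeff 0 (PowerSeries.trunc (N + 1) p : PowerSeries ℂ) = 0 := by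
    rw [Polynomial.coeff_coe, PowerSeries.coeff_trunc, if_pos (Nat.succ_pos N), hp]
  have hQg : Graded Q := by
    intro j m hm
    rw [hQc]
    split_ifs
    · rw [← Polynomial.coeff_coe, Polynomial.coe_pow, coeff_pow_eq_zero htr0 hm, zero_mul]
    · rfl
  have hpoly : ∀ k, expCoeff Q k = ∑ f ∈ Fintype.piFinset fun _ : Fin k => Finset.range (N + 1),
      C (F k (symProd fun i => PowerSeries.coeff (f i) p • 𝓕.npow ξ (f i))) * X ^ ∑ i, f i := by
    intro k
    refine Polynomial.funext fun z => ?_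
    rw [eval_expCoeff hQ0, eval_finsetSum]
    simp only [eval_mul, eval_C, eval_pow, eval_X]
    rw [← map_tensorPow_curve, hF]
    congr 2
    ext j
    rw [PowerSeries.coeff_map, PowerSeries.coeff_mk, PowerSeries.coeff_mk, coe_evalRingHom,
      eval_finsetSum, 𝓕.npow_curve hp, map_sum]
    refine Finset.sum_congr rfl fun m _ => ?_
    rw [map_smul, smul_eq_mul, eval_mul, eval_C, eval_pow, eval_X]
    ring
  have h1 : ∀ k, ∑ f ∈ tuples k N,
      F k (symProd fun i => PowerSeries.coeff (f i) p • 𝓕.npow ξ (f i)) = (expCoeff Q k).coeff N := by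
    intro k
    rw [hpoly, finsetSum_coeff, tuples, Finset.sum_filter]
    refine Finset.sum_congr rfl fun f _ => ?_
    rw [coeff_C_mul_X_pow]
    simp only [eq_comm]
  rw [Finset.sum_congr rfl fun k _ => h1 k, sum_coeff_expCoeff hQg hQ0]
  refine coeff_expS_congr ?_ ?_ fun m hm => ?_
  · rw [coeff_evalOne hQg le_rfl]
    simp [hQ0]
  · rw [PowerSeries.coeff_mk]
    simp [npow_zero]
  · rw [coeff_evalOne hQg le_rfl, PowerSeries.coeff_mk]
    refine Finset.sum_congr rfl fun j _ => ?_
    rw [hQc, coeff_trunc_pow hm]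
    split_ifs with h
    · rfl
    -- The range of `m` in `Q` excludes a degree `m ≤ N` only for `j = 0` and `m > 0`, where `p ^ 0
    -- = 1` has coefficient zero.
    · have hj : j = 0 := by
        by_contra h0
        have := Nat.le_mul_of_pos_left N (Nat.pos_of_ne_zero h0)
        omega
      subst hj
      rw [pow_zero, PowerSeries.coeff_one, if_neg (by omega), zero_mul]

/-! ### Bounds -/

/-- The bounds for the series `∑ pⱼ ⟨ω, ξ^j⟩`. -/
lemma exists_polySeries_ser (τ : T) : ∃ τ', ∀ p : PowerSeries ℂ, Growth p → ∀ s : ℝ, 0 < s →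
    ∃ R₀ : ℝ, 0 < R₀ ∧ ∀ R, 0 < R → R ≤ R₀ → ∀ ω C, DualLE H τ C ω →
      PolySeries H τ' R (C * s) fun ξ => 𝓕.ser p ξ ω := by
  obtain ⟨τ', C₀, hC₀, hb⟩ := 𝓕.mul_bound τ
  refine ⟨τ', fun p hp s hs => ?_⟩
  obtain ⟨K, A, hK, hA, hKA⟩ := hp
  -- The majorant is geometric with ratio `A * C₀ * R` and starts in degree one. The first bound
  -- makes the ratio at most `1 / 2`, so that the sum is at most `2 * (A * C₀ * R) * K` times `C`,
  -- and the second makes this at most `C * s`. The absence of a term of degree zero is what allows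
  -- arbitrarily small `s`.
  refine ⟨min (1 / (2 * (A * C₀))) (s / (2 * (A * C₀) * K)), by positivity, fun R hR hR₀ ω C hω => ?_⟩
  have h1 : A * C₀ * R ≤ 1 / 2 := by
    have := hR₀.trans (min_le_left _ _)
    rw [le_div_iff₀ (by positivity)] at this
    linarith
  have h2 : 2 * (A * C₀ * R) * K ≤ s := by
    have := hR₀.trans (min_le_right _ _)
    rw [le_div_iff₀ (by positivity)] at this
    linarith
  refine ⟨fun j => if j = 0 then 0 else C * K * (A * C₀) ^ j, fun j => ?_, fun N => ?_⟩
  · simp only [coeff_ser]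
    split_ifs with hj
    · subst hj
      simpa [npow_zero] using polyBound_zero (H := H) (τ := τ') (n := 0)
    · have hbd := mul_nonneg (mul_nonneg hω.1 hK.le) (pow_nonneg (mul_nonneg hA.le hC₀.le) j)
      refine ⟨hbd, PowerSeries.coeff j p • ω.toLinearMap.compMultilinearMap (𝓕.mul j), fun ξ => rfl,
        fun ξ => ?_⟩
      change ‖PowerSeries.coeff j p * ω (𝓕.mul j ξ)‖ ≤ _
      have h0 := prod_nucNorm_nonneg (H := H) τ' ξ
      calc ‖PowerSeries.coeff j p * ω (𝓕.mul j ξ)‖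
          ≤ (K * A ^ j) * (C * (C₀ ^ j * ∏ i, nucNorm H τ' (ξ i))) := by
            rw [norm_mul]
            exact mul_le_mul (hKA j) ((hω.2 _).trans (mul_le_mul_of_nonneg_left (hb j ξ) hω.1))
              (norm_nonneg _) (by positivity)
        _ = _ := by rw [mul_pow]; ring
  · have hC := hω.1
    rcases N with _ | N
    · simpa using mul_nonneg hC hs.le
    rw [Finset.sum_range_succ']
    simp only [Nat.add_eq_zero_iff, one_ne_zero, and_false, if_false, if_true, zero_mul, add_zero]
    have h3 : ∀ k, C * K * (A * C₀) ^ (k + 1) * R ^ (k + 1) ≤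
        C * (A * C₀ * R * K) * (1 / 2) ^ k := by
      intro k
      have : (A * C₀ * R) ^ k ≤ (1 / 2) ^ k := pow_le_pow_left₀ (by positivity) h1 k
      calc C * K * (A * C₀) ^ (k + 1) * R ^ (k + 1) = C * (A * C₀ * R * K) * (A * C₀ * R) ^ k := by
            rw [mul_pow (A * C₀) R, pow_succ, pow_succ]; ring
        _ ≤ _ := mul_le_mul_of_nonneg_left this (by positivity)
    refine (Finset.sum_le_sum fun k _ => h3 k).trans ?_
    rw [← Finset.mul_sum]
    have h4 : ∑ k ∈ Finset.range N, (1 / 2 : ℝ) ^ k ≤ 2 :=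
      (summable_geometric_two.sum_le_tsum _ fun k _ => by positivity).trans_eq tsum_geometric_two
    calc C * (A * C₀ * R * K) * ∑ k ∈ Finset.range N, (1 / 2 : ℝ) ^ k
        ≤ C * (A * C₀ * R * K) * 2 := mul_le_mul_of_nonneg_left h4 (by positivity)
      _ = C * (2 * (A * C₀ * R) * K) := by ring
      _ ≤ C * s := mul_le_mul_of_nonneg_left h2 hC

/-- The joint bounds for `ω ∈ H_{-τ}` and the integral. -/
lemma exists_level (τ : T) : ∃ τ' D B, 0 < D ∧ DualLE H τ' B 𝓕.integral ∧
    ∀ ω C, DualLE H τ C ω → DualLE H τ' (C * D) ω := by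
  obtain ⟨τ₁, B, hB⟩ := exists_dualLE 𝓕.integral
  obtain ⟨τ', D, hD, hle⟩ := nucNorm_directed H τ τ₁
  refine ⟨τ', D + 1, B * D, by positivity, hB.of_le hD fun ξ => (hle ξ).2, fun ω C hω => ?_⟩
  exact (hω.of_le hD fun ξ => (hle ξ).1).mono
    (mul_le_mul_of_nonneg_left (by linarith) hω.1)

end FunScale

end

/-! ### The kernels of the Sheffer operator and of its inverse -/

section

variable {T Φ : Type} [AddCommGroup Φ] [Module ℂ Φ] {H : HilbertScale T Φ} {d : ℕ}

namespace FunScale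

variable {κ : Φ →ₗ[ℂ] (RSpace d → ℂ)} (𝓕 : FunScale H κ)

/-! ### The kernels -/

/-- The `k`-linear form
`(ω₁, …, ω_k) ↦ (n!/k!) [z^n] ∏ᵢ (∑ⱼ pⱼ ⟨ωᵢ, ξ^j⟩ z^j) exp(∑ⱼ gⱼ z^j ∫ ξ(x)^j dx)`. -/
def kernelForm (p g : PowerSeries ℂ) (n k : ℕ) (ξ : Nuc H) :
    MultilinearMap ℂ (fun _ : Fin k => CoNuc H) ℂ :=
  (((n.factorial / k.factorial : ℂ)) • (PowerSeries.coeff n ∘ₗ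
    LinearMap.mulRight ℂ (expS (𝓕.ser g ξ 𝓕.integral)))).compMultilinearMap
      ((MultilinearMap.mkPiAlgebra ℂ (Fin k) (PowerSeries ℂ)).compLinearMap fun _ => 𝓕.ser p ξ)

lemma kernelForm_apply (p g : PowerSeries ℂ) (n k : ℕ) (ξ : Nuc H) (ω : Fin k → CoNuc H) :
    𝓕.kernelForm p g n k ξ ω = (n.factorial / k.factorial : ℂ) *
      PowerSeries.coeff n ((∏ i, 𝓕.ser p ξ (ω i)) * expS (𝓕.ser g ξ 𝓕.integral)) := by
  simp [kernelForm]

/-- In the majorant on radius `R` each of the `k` factors contributes `s * C i` and the exponential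
contributes `e ^ B`; extracting the coefficient of degree `n` divides by `R ^ n`. A smaller `s` only
requires a smaller `R`, with the same `τ'` and `B`. -/
lemma kernelForm_polyBound {p g : PowerSeries ℂ} (hp : Growth p) (hg : Growth g) (τ : T) :
    ∃ τ' B, ∀ s : ℝ, 0 < s → ∃ R : ℝ, 0 < R ∧ ∀ (n k : ℕ) (ω : Fin k → CoNuc H) (C : Fin k → ℝ),
      (∀ i, DualLE H τ (C i) (ω i)) →
      PolyBound H τ' n (n.factorial / k.factorial * s ^ k * Real.exp B / R ^ n * ∏ i, C i)
        fun ξ => 𝓕.kernelForm p g n k ξ ω := by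
  obtain ⟨τ₁, D, B, hD, hI, hle⟩ := 𝓕.exists_level τ
  obtain ⟨τ', h⟩ := 𝓕.exists_polySeries_ser τ₁
  refine ⟨τ', B, fun s hs => ?_⟩
  -- The division by `D` compensates the change of index from `τ` to `τ₁`, which multiplies dual
  -- norms by `D`.
  obtain ⟨R₁, hR₁, h1⟩ := h p hp (s / D) (by positivity)
  obtain ⟨R₂, hR₂, h2⟩ := h g hg 1 one_pos
  refine ⟨min R₁ R₂, lt_min hR₁ hR₂, fun n k ω C hC => ?_⟩
  have hR : 0 < min R₁ R₂ := lt_min hR₁ hR₂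
  have h3 := (PolySeries.prod hR.le fun i =>
    h1 _ hR (min_le_left _ _) (ω i) (C i * D) (hle _ _ (hC i))).mul hR.le
      ((h2 _ hR (min_le_right _ _) _ _ hI).expS hR.le fun ξ => 𝓕.coeff_zero_ser g ξ _)
  have h4 := (h3.polyBound hR n).const_mul (n.factorial / k.factorial : ℂ)
  simp only [← kernelForm_apply] at h4
  refine h4.mono (le_of_eq ?_)
  have h5 : ∏ i, C i * D * (s / D) = s ^ k * ∏ i, C i := by
    have : ∀ i, C i * D * (s / D) = s * C i := fun i => by field_simp
    simp only [this, Finset.prod_mul_distrib, Finset.prod_const, Finset.card_univ, Fintype.card_fin]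
  rw [h5, norm_div, Complex.norm_natCast, Complex.norm_natCast, mul_one]
  ring

lemma exists_kernels {p g : PowerSeries ℂ} (hp : Growth p) (hg : Growth g) :
    ∃ V : (n k : ℕ) → SymPow H n →ₗ[ℂ] SymPow H k, KernelBound V ∧
      ∀ n k ξ, (V n k (tensorPow ξ n)).form = 𝓕.kernelForm p g n k ξ := by
  have hk : ∀ n k, _ := fun n k => exists_kernel 𝓕.nuclear (𝓕.kernelForm p g n k)
    (fun ξ σ ω => by
      rw [kernelForm_apply, kernelForm_apply]
      congr 3
      exact Equiv.prod_comp σ fun i => 𝓕.ser p ξ (ω i))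
    (fun τ => by
      obtain ⟨τ', B, h⟩ := 𝓕.kernelForm_polyBound hp hg τ
      obtain ⟨R, hR, h⟩ := h 1 one_pos
      exact ⟨τ', n.factorial / k.factorial * 1 ^ k * Real.exp B / R ^ n, by positivity, h n k⟩)
  choose V hV hb using hk
  refine ⟨V, fun τ => ?_, hV⟩
  obtain ⟨τ', B, h⟩ := 𝓕.kernelForm_polyBound hp hg τ
  obtain ⟨τ'', C, hC⟩ := 𝓕.nuclear τ'
  refine ⟨τ'', fun s hs => ?_⟩
  obtain ⟨R, hR, h⟩ := h s hs
  have hC0 : 0 < C := zero_lt_one.trans_le hC.1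
  -- The power `n + 1` of this sum absorbs both the constant `e ^ B` and the geometric factor `(C /
  -- R) ^ n`.
  refine ⟨Real.exp B + C / R, by positivity, fun n k _ φ ω K hK => ?_⟩
  refine (hb n k τ τ' _ (by positivity) (h n k) τ'' C hC φ ω K hK).trans ?_
  refine mul_le_mul_of_nonneg_right ?_ (Finset.prod_nonneg fun i _ => (hK i).1)
  refine mul_le_mul_of_nonneg_right ?_ (apply_nonneg (symNorm H n τ'') φ)
  have h1 : Real.exp B * (C / R) ^ n ≤ (Real.exp B + C / R) ^ (n + 1) := by
    rw [pow_succ']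
    have h2 : 0 ≤ C / R := by positivity
    have h3 := (Real.exp_pos B).le
    exact mul_le_mul (by linarith) (pow_le_pow_left₀ h2 (by linarith) n) (by positivity)
      (by positivity)
  calc n.factorial / k.factorial * s ^ k * Real.exp B / R ^ n * C ^ n
      = Real.exp B * (C / R) ^ n * (n.factorial / k.factorial * s ^ k) := by
        rw [div_pow]; ring
    _ ≤ (Real.exp B + C / R) ^ (n + 1) * (n.factorial / k.factorial * s ^ k) :=
        mul_le_mul_of_nonneg_right h1 (by positivity)
    _ = _ := by ring

end FunScale

lemma KernelBound.exists_symNorm_le (hH : IsNuclear H)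
    {V : (n k : ℕ) → SymPow H n →ₗ[ℂ] SymPow H k} (hV : KernelBound V) {n k : ℕ} (hk : k ≤ n)
    (τ : T) : ∃ τ' K, 0 ≤ K ∧ ∀ φ, symNorm H k τ (V n k φ) ≤ K * symNorm H n τ' φ := by
  obtain ⟨τ₁, C, hC⟩ := hH τ
  obtain ⟨τ', h⟩ := hV τ₁
  obtain ⟨D, hD, h⟩ := h 1 one_pos
  have hC0 : 0 < C := zero_lt_one.trans_le hC.1
  refine ⟨τ', D ^ (n + 1) * (n.factorial / k.factorial) * 1 ^ k * C ^ k, by positivity, fun φ => ?_⟩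
  have h0 : 0 ≤ symNorm H n τ' φ := apply_nonneg _ _
  exact (symNorm_le (h n k hk φ) (by positivity) hC).trans_eq (by ring)

lemma KernelBound.continuous (hH : IsNuclear H)
    {V : (n k : ℕ) → SymPow H n →ₗ[ℂ] SymPow H k} (hV : KernelBound V) {n k : ℕ} (hk : k ≤ n) :
    Continuous (V n k) :=
  continuous_seminormTopology (symNorm H n) (symNorm H k) (V n k) fun τ => by
    obtain ⟨τ', K, -, h⟩ := hV.exists_symNorm_le hH hk τ
    exact ⟨τ', K, h⟩

/-- A continuous linear functional on `Φ^{⊙n}`, as an element of `Φ'^{⊙n}`. -/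
def SymDual.of {n : ℕ} (L : SymPow H n →ₗ[ℂ] ℂ) (hL : Continuous L) : SymDual H n :=
  (⟨L, hL⟩ : StrongDual ℂ (SymPow H n))

lemma SymDual.of_apply {n : ℕ} (L : SymPow H n →ₗ[ℂ] ℂ) (hL : Continuous L) (φ : SymPow H n) :
    SymDual.of L hL φ = L φ := rfl

lemma dualPow_apply {n : ℕ} (ω : CoNuc H) (φ : SymPow H n) : dualPow ω n φ = φ.form fun _ => ω := rfl

lemma continuous_form_diag {n : ℕ} (ω : CoNuc H) :
    Continuous fun φ : SymPow H n => φ.form fun _ => ω := (dualPow ω n).continuous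

lemma coeff_expS_mul {P : PowerSeries ℂ} (hP : PowerSeries.coeff 0 P = 0) (E : PowerSeries ℂ) (N : ℕ) :
    PowerSeries.coeff N (expS P * E) = ∑ n ∈ Finset.range (N + 1),
      (n.factorial : ℂ)⁻¹ * PowerSeries.coeff N (P ^ n * E) := by
  simp only [PowerSeries.coeff_mul, Finset.mul_sum]
  rw [Finset.sum_comm]
  refine Finset.sum_congr rfl fun x hx => ?_
  have hx' : x.1 ≤ N := by
    have := Finset.HasAntidiagonal.mem_antidiagonal.1 hx
    omega
  rw [coeff_expS hP hx', Finset.sum_mul]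
  exact Finset.sum_congr rfl fun n _ => mul_assoc _ _ _

lemma symProd_eq_zero {n : ℕ} {ξ : Fin n → Nuc H} {i : Fin n} (h : ξ i = 0) : symProd ξ = 0 :=
  SymPow.ext_diag fun ω => by
    rw [symProd_form_diag, Finset.prod_eq_zero (Finset.mem_univ i) (by rw [h, map_zero]),
      map_zero, zero_apply]

namespace FunScale

variable {κ : Φ →ₗ[ℂ] (RSpace d → ℂ)} (𝓕 : FunScale H κ)

lemma kernelForm_diag (p g : PowerSeries ℂ) (n k : ℕ) (ξ : Nuc H) (ω : CoNuc H) :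
    (𝓕.kernelForm p g n k ξ fun _ => ω) = (n.factorial / k.factorial : ℂ) *
      PowerSeries.coeff n (𝓕.ser p ξ ω ^ k * expS (𝓕.ser g ξ 𝓕.integral)) := by
  rw [kernelForm_apply, Finset.prod_const, Finset.card_univ, Fintype.card_fin]

/-- Makes the image of a tensor power explicit as a combination of symmetric products of powers of
`ξ`, the form to which `sum_map_symProd` applies. -/
lemma kernel_tensorPow {p g : PowerSeries ℂ} {n k : ℕ} {V : SymPow H n →ₗ[ℂ] SymPow H k}
    (hV : ∀ ξ, (V (tensorPow ξ n)).form = 𝓕.kernelForm p g n k ξ) (ξ : Nuc H) :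
    V (tensorPow ξ n) = (n.factorial / k.factorial : ℂ) •
      ∑ x ∈ Finset.HasAntidiagonal.antidiagonal n,
        PowerSeries.coeff x.2 (expS (𝓕.ser g ξ 𝓕.integral)) •
          ∑ f ∈ tuples k x.1, symProd fun i => PowerSeries.coeff (f i) p • 𝓕.npow ξ (f i) := by
  refine SymPow.ext_diag fun ω => ?_
  rw [hV, kernelForm_diag, PowerSeries.coeff_mul]
  simp only [map_smul, map_sum, smul_apply, sum_apply, symProd_form_diag, smul_eq_mul]
  congr 1
  refine Finset.sum_congr rfl fun x _ => ?_
  rw [coeff_pow_fin, mul_comm]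
  simp only [coeff_ser]

include 𝓕 in
lemma sum_tuples_eq_zero {p : PowerSeries ℂ} {k m : ℕ} (h : m < k) (ξ : Nuc H) :
    ∀ f ∈ tuples k m, (symProd fun i => PowerSeries.coeff (f i) p • 𝓕.npow ξ (f i)) = 0 := by
  intro f hf
  obtain ⟨i, hi⟩ : ∃ i, f i = 0 := by
    by_contra! h0
    have h1 : ∑ i : Fin k, 1 ≤ ∑ i, f i :=
      Finset.sum_le_sum fun i _ => Nat.one_le_iff_ne_zero.2 (h0 i)
    rw [mem_tuples.1 hf] at h1
    simp at h1
    omega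
  exact symProd_eq_zero (i := i) (by rw [hi, npow_zero, smul_zero])

lemma mk_sum_coeff_pow (p q : PowerSeries ℂ) (hp : PowerSeries.coeff 0 p = 0) (ω : CoNuc H)
    (ξ : Nuc H) : (PowerSeries.mk fun m => ∑ j ∈ Finset.range (m + 1), PowerSeries.coeff m (p ^ j) *
      (PowerSeries.coeff j q • ω) (𝓕.npow ξ m)) = 𝓕.ser (q.subst p) ξ ω := by
  ext m
  rw [coeff_ser, PowerSeries.coeff_mk, coeff_subst_eq_sum q hp le_rfl, Finset.sum_mul]
  refine Finset.sum_congr rfl fun j _ => ?_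
  rw [smul_apply, smul_eq_mul]
  ring

/-- For fixed `ω` the functionals `F_k = (1/k!) ∑ⱼ ⟨ω^{⊗j}, W_{k,j} ·⟩` have the generating function
`exp (⟨ω, q(η)⟩ + ∫ h(η))`. Substituting `η = p(ξ)` turns the exponent into `⟨ω, ξ⟩ - ∫ g(ξ)`, and
the factor `exp ∫ g(ξ)` of the kernels `V` cancels the second term. What is left is the generating
function of `ω^{⊗n}`. -/
lemma kernelInverse {p g q h : PowerSeries ℂ} (hp : PowerSeries.coeff 0 p = 0)
    (hqp : q.subst p = PowerSeries.X) (hhp : h.subst p = -g)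
    {V W : (n k : ℕ) → SymPow H n →ₗ[ℂ] SymPow H k} (hV : KernelBound V) (hW : KernelBound W)
    (hVf : ∀ n k ξ, (V n k (tensorPow ξ n)).form = 𝓕.kernelForm p g n k ξ)
    (hWf : ∀ n k ξ, (W n k (tensorPow ξ n)).form = 𝓕.kernelForm q h n k ξ) :
    KernelInverse V W := by
  intro n φ ω
  let F : (k : ℕ) → SymPow H k →ₗ[ℂ] ℂ := fun k => (k.factorial : ℂ)⁻¹ •
    ∑ j ∈ Finset.range (k + 1), (dualPow ω j).lin ∘ₗ W k j
  have hFa : ∀ k ψ, F k ψ = (k.factorial : ℂ)⁻¹ *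
      ∑ j ∈ Finset.range (k + 1), (W k j ψ).form fun _ => ω := by
    intro k ψ
    refine congrArg ((k.factorial : ℂ)⁻¹ * ·) ?_
    rw [LinearMap.sum_apply]
    rfl
  let L : SymPow H n →ₗ[ℂ] ℂ := ∑ k ∈ Finset.range (n + 1), ∑ j ∈ Finset.range (k + 1),
    (dualPow ω j).lin ∘ₗ W k j ∘ₗ V n k
  have hLa : ∀ ψ, L ψ = ∑ k ∈ Finset.range (n + 1), ∑ j ∈ Finset.range (k + 1),
      (W k j (V n k ψ)).form fun _ => ω := by
    intro ψ
    simp only [L, LinearMap.sum_apply]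
    rfl
  have hL : Continuous L := by
    have : (L : SymPow H n → ℂ) = fun ψ => ∑ k ∈ Finset.range (n + 1), ∑ j ∈ Finset.range (k + 1),
      (W k j (V n k ψ)).form fun _ => ω := funext hLa
    rw [this]
    refine continuous_finsetSum _ fun k hk => continuous_finsetSum _ fun j hj => ?_
    exact (continuous_form_diag ω).comp ((hW.continuous 𝓕.nuclear
      (by have := Finset.mem_range.1 hj; omega)).comp
        (hV.continuous 𝓕.nuclear (by have := Finset.mem_range.1 hk; omega)))
  -- Both sides are continuous in `φ`, so it is enough to compare them on tensor powers.
  suffices h0 : SymDual.of L hL = dualPow ω n by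
    rw [← hLa, ← SymDual.of_apply L hL, h0, dualPow_apply]
  refine SymDual.ext_tensorPow 𝓕.nuclear fun ξ => ?_
  rw [SymDual.of_apply, hLa, dualPow_apply, tensorPow_form, Finset.prod_const, Finset.card_univ,
    Fintype.card_fin]
  let w : ℕ → CoNuc H := fun j => PowerSeries.coeff j q • ω + PowerSeries.coeff j h • 𝓕.integral
  have hF : ∀ k η, F k (tensorPow η k) =
      PowerSeries.coeff k (expS (PowerSeries.mk fun j => w j (𝓕.npow η j))) := by
    intro k η
    have h1 : (PowerSeries.mk fun j => w j (𝓕.npow η j)) = 𝓕.ser q η ω + 𝓕.ser h η 𝓕.integral := by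
      ext j
      rw [PowerSeries.coeff_mk, map_add, coeff_ser, coeff_ser]
      rfl
    rw [h1, expS_add (𝓕.coeff_zero_ser _ _ _) (𝓕.coeff_zero_ser _ _ _),
      coeff_expS_mul (𝓕.coeff_zero_ser _ _ _), hFa, Finset.mul_sum]
    refine Finset.sum_congr rfl fun j _ => ?_
    rw [hWf, kernelForm_diag, ← mul_assoc]
    congr 1
    have := k.factorial_ne_zero
    field_simp
  have hS := 𝓕.sum_map_symProd hp w F hF ξ
  have h2 : (PowerSeries.mk fun m => ∑ j ∈ Finset.range (m + 1), PowerSeries.coeff m (p ^ j) *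
      w j (𝓕.npow ξ m)) = 𝓕.ser PowerSeries.X ξ ω + -𝓕.ser g ξ 𝓕.integral := by
    rw [← hqp, ← ser_neg, ← hhp, ← 𝓕.mk_sum_coeff_pow p q hp, ← 𝓕.mk_sum_coeff_pow p h hp]
    ext m
    simp only [PowerSeries.coeff_mk, map_add, ← Finset.sum_add_distrib, ← mul_add]
    rfl
  have hneg : PowerSeries.coeff 0 (-𝓕.ser g ξ 𝓕.integral) = 0 := by
    rw [map_neg, coeff_zero_ser, neg_zero]
  rw [h2, expS_add (𝓕.coeff_zero_ser _ _ _) hneg] at hS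
  have h3 : ∀ k ∈ Finset.range (n + 1), (∑ j ∈ Finset.range (k + 1),
      (W k j (V n k (tensorPow ξ n))).form fun _ => ω) =
      (n.factorial : ℂ) * ∑ x ∈ Finset.HasAntidiagonal.antidiagonal n,
        PowerSeries.coeff x.2 (expS (𝓕.ser g ξ 𝓕.integral)) * ∑ f ∈ tuples k x.1,
          F k (symProd fun i => PowerSeries.coeff (f i) p • 𝓕.npow ξ (f i)) := by
    intro k _
    have hk : (k.factorial : ℂ) ≠ 0 := by exact_mod_cast k.factorial_ne_zero
    have h4 := hFa k (V n k (tensorPow ξ n))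
    rw [eq_inv_mul_iff_mul_eq₀ hk] at h4
    rw [← h4, 𝓕.kernel_tensorPow (hVf n k)]
    simp only [map_smul, map_sum, smul_eq_mul]
    rw [← mul_assoc, mul_div_cancel₀ _ hk]
  rw [Finset.sum_congr rfl h3, ← Finset.mul_sum, Finset.sum_comm]
  have h5 : ∀ x ∈ Finset.HasAntidiagonal.antidiagonal n, ∑ k ∈ Finset.range (n + 1),
      PowerSeries.coeff x.2 (expS (𝓕.ser g ξ 𝓕.integral)) * ∑ f ∈ tuples k x.1,
          F k (symProd fun i => PowerSeries.coeff (f i) p • 𝓕.npow ξ (f i)) =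
      PowerSeries.coeff x.1 (expS (𝓕.ser PowerSeries.X ξ ω) * expS (-𝓕.ser g ξ 𝓕.integral)) *
        PowerSeries.coeff x.2 (expS (𝓕.ser g ξ 𝓕.integral)) := by
    intro x hx
    rw [← Finset.mul_sum, mul_comm, ← hS]
    congr 1
    symm
    have := Finset.HasAntidiagonal.mem_antidiagonal.1 hx
    refine Finset.sum_subset (Finset.range_mono (by omega)) fun k _ hk => ?_
    refine Finset.sum_eq_zero fun f hf => ?_
    rw [𝓕.sum_tuples_eq_zero (by simpa using hk) ξ f hf, map_zero]
  rw [Finset.sum_congr rfl h5, ← PowerSeries.coeff_mul, mul_assoc, mul_comm (expS (-_)),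
    expS_add_neg (𝓕.coeff_zero_ser _ _ _), mul_one, coeff_expS_ser_X,
    mul_inv_cancel_left₀ (by exact_mod_cast n.factorial_ne_zero)]

end FunScale

end

/-! ### Holomorphy of `ρ`, the operators `A_n`, and adjoints -/

section

/-- Locally uniformly convergent series of entire functions. -/
lemma hasSum_entire_ball {V : Type*} [NormedAddCommGroup V] [NormedSpace ℂ V] {f : ℕ → V → ℂ}
    (hf : ∀ n, Entire (f n)) {B R : ℝ} (hR : 0 < R) (hB : ∀ n v, ‖f n v‖ ≤ B * (‖v‖ / R) ^ n) :
    ContinuousOn (fun v => ∑' n, f n v) (Metric.ball 0 (R / 2)) ∧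
    (∀ v ∈ Metric.ball (0 : V) (R / 2), ∀ u, AnalyticAt ℂ (fun z : ℂ => ∑' n, f n (v + z • u)) 0) ∧
    ∀ v ∈ Metric.ball (0 : V) (R / 2), HasSum (fun n => f n v) (∑' n, f n v) := by
  have hB0 : 0 ≤ B := by simpa using (norm_nonneg _).trans (hB 0 0)
  have hbd : ∀ n, ∀ v ∈ Metric.ball (0 : V) (R / 2), ‖f n v‖ ≤ B * (1 / 2) ^ n := by
    intro n v hv
    refine (hB n v).trans (mul_le_mul_of_nonneg_left (pow_le_pow_left₀ (by positivity) ?_ n) hB0)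
    rw [mem_ball_zero_iff] at hv
    rw [div_le_iff₀ hR]
    linarith
  have hs : Summable fun n : ℕ => B * (1 / 2 : ℝ) ^ n := summable_geometric_bound B
  refine ⟨continuousOn_tsum (fun n => (hf n).1.continuousOn) hs hbd, fun v hv u => ?_, fun v hv =>
    (Summable.of_norm_bounded hs fun n => hbd n v hv).hasSum⟩
  have hc : Continuous fun z : ℂ => v + z • u := by fun_prop
  have ho : IsOpen ((fun z : ℂ => v + z • u) ⁻¹' Metric.ball 0 (R / 2)) :=
    Metric.isOpen_ball.preimage hc
  have hd : DifferentiableOn ℂ (fun z : ℂ => ∑' n, f n (v + z • u))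
      ((fun z : ℂ => v + z • u) ⁻¹' Metric.ball 0 (R / 2)) :=
    Complex.differentiableOn_tsum_of_summable_norm hs (fun n => ((hf n).2 v u).differentiableOn) ho
      fun n z hz => hbd n _ hz
  exact hd.analyticAt (ho.mem_nhds (by simpa using hv))

variable {T Φ : Type} [AddCommGroup Φ] [Module ℂ Φ] {H : HilbertScale T Φ} {d : ℕ}

lemma continuous_toLevel (τ : T) : Continuous (toLevel H τ) :=
  continuous_of_le_seminorm (nucNorm H) τ (toLevel H τ).toLinearMap 1 fun x => by
    rw [one_mul]; exact le_rfl

/-- The bounds `B / R ^ n` refer to one norm `‖·‖_τ`, so the series converges normally on the ball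
of radius `R / 2` in this norm, which is open in `Φ`. -/
lemma holomorphicNearZero {ρ : (n : ℕ) → SymDual H n} {τ : T} {R B : ℝ} (hR : 0 < R)
    (h : ∀ n, PolyBound H τ n (B / R ^ n) fun ξ => ρ n (tensorPow ξ n)) :
    HolomorphicNearZero H ρ := by
  choose hB M hM hb using h
  let f : ℕ → Level H τ → ℂ := fun n v => ρ n (tensorPow ((toLevel H τ).symm v) n)
  have hfb : ∀ n v, ‖f n v‖ ≤ B * (‖v‖ / R) ^ n := by
    intro n v
    have h1 := hb n fun _ => (toLevel H τ).symm v
    rw [hM, Finset.prod_const, Finset.card_univ, Fintype.card_fin] at h1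
    refine h1.trans_eq ?_
    rw [nucNorm_eq_norm, LinearEquiv.apply_symm_apply, div_pow]
    ring
  have hfe : ∀ n, Entire (f n) := by
    intro n
    have h1 := entire_diag (V := Level H τ)
      ((M n).compLinearMap fun _ => (toLevel H τ).symm.toLinearMap) (B / R ^ n) (fun v => hb n _)
    have h2 : f n = fun v => ((M n).compLinearMap fun _ => (toLevel H τ).symm.toLinearMap) fun _ => v :=
      funext fun v => (hM n ((toLevel H τ).symm v)).symm
    rw [h2]
    exact h1
  obtain ⟨h1, h2, h3⟩ := hasSum_entire_ball hfe hR hfb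
  refine ⟨toLevel H τ ⁻¹' Metric.ball 0 (R / 2), Metric.isOpen_ball.preimage (continuous_toLevel τ),
    by simp [hR], fun ξ => ∑' n, f n (toLevel H τ ξ), ⟨?_, fun ξ hξ η => ?_⟩, fun ξ hξ => h3 _ hξ⟩
  · exact h1.comp (continuous_toLevel τ).continuousOn fun _ h => h
  · exact h2 _ hξ (toLevel H τ η)

lemma eq_of_dual {ξ η : Nuc H} (h : ∀ ω : CoNuc H, ω ξ = ω η) : ξ = η := by
  refine sub_eq_zero.1 (eq_zero_of_nucNorm_eq_zero (τ := H.nonempty.some)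
    (le_antisymm (nucNorm_le_of_dual le_rfl fun ω _ => ?_) (apply_nonneg _ _)))
  rw [map_sub, h, sub_self, norm_zero]

namespace FunScale

variable {κ : Φ →ₗ[ℂ] (RSpace d → ℂ)} (𝓕 : FunScale H κ)

/-- The restriction to the diagonal. -/
lemma exists_diag (n : ℕ) : ∃ D : SymPow H n →ₗ[ℂ] Nuc H, (∀ ξ, D (tensorPow ξ n) = 𝓕.npow ξ n) ∧
    ∀ τ τ' τ'' C₀ K, 0 < C₀ → (∀ ξ, nucNorm H τ (𝓕.mul n ξ) ≤ C₀ ^ n * ∏ i, nucNorm H τ' (ξ i)) →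
      HSLE H τ' τ'' K → ∀ φ, nucNorm H τ (D φ) ≤ (C₀ * K) ^ n * symNorm H n τ'' φ := by
  have key : ∀ ω τ C τ' τ'' C₀ K, DualLE H τ C ω → 0 < C₀ →
      (∀ ξ, nucNorm H τ (𝓕.mul n ξ) ≤ C₀ ^ n * ∏ i, nucNorm H τ' (ξ i)) → HSLE H τ' τ'' K →
      ∃ F : SymDual H n, (∀ ξ, F (tensorPow ξ n) = ω (𝓕.npow ξ n)) ∧
        ∀ φ, ‖F φ‖ ≤ C * ((C₀ * K) ^ n * symNorm H n τ'' φ) := by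
    intro ω τ C τ' τ'' C₀ K hω hC₀ hb hK
    obtain ⟨F, h1, h2⟩ := hK.exists_functional (ω.toLinearMap.compMultilinearMap (𝓕.mul n))
      (mul_nonneg hω.1 (pow_nonneg hC₀.le n)) fun ξ => (hω.2 _).trans
        ((mul_le_mul_of_nonneg_left (hb ξ) hω.1).trans_eq (mul_assoc _ _ _).symm)
    exact ⟨F, h1, fun φ => (h2 φ).trans_eq (by rw [mul_pow]; ring)⟩
  have hex : ∀ ω : CoNuc H, ∃ F : SymDual H n, ∀ ξ, F (tensorPow ξ n) = ω (𝓕.npow ξ n) := by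
    intro ω
    obtain ⟨τ, C, hω⟩ := exists_dualLE ω
    obtain ⟨τ', C₀, hC₀, hb⟩ := 𝓕.mul_bound τ
    obtain ⟨τ'', K, hK⟩ := 𝓕.nuclear τ'
    obtain ⟨F, hF, -⟩ := key ω τ C τ' τ'' C₀ K hω hC₀ (hb n) hK
    exact ⟨F, hF⟩
  choose F hF using hex
  have hb : ∀ ω τ C τ' τ'' C₀ K, DualLE H τ C ω → 0 < C₀ →
      (∀ ξ, nucNorm H τ (𝓕.mul n ξ) ≤ C₀ ^ n * ∏ i, nucNorm H τ' (ξ i)) → HSLE H τ' τ'' K →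
      ∀ φ, ‖F ω φ‖ ≤ C * ((C₀ * K) ^ n * symNorm H n τ'' φ) := by
    intro ω τ C τ' τ'' C₀ K hω hC₀ hb hK φ
    obtain ⟨F', h1, h2⟩ := key ω τ C τ' τ'' C₀ K hω hC₀ hb hK
    rw [show F ω = F' from SymDual.ext_tensorPow 𝓕.nuclear fun ξ => by rw [hF, h1]]
    exact h2 φ
  have hadd : ∀ ω ω', F (ω + ω') = F ω + F ω' := fun ω ω' =>
    SymDual.ext_tensorPow 𝓕.nuclear fun ξ => by
      change _ = F ω (tensorPow ξ n) + F ω' (tensorPow ξ n)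
      rw [hF, hF, hF]
      rfl
  have hsmul : ∀ (c : ℂ) ω, F (c • ω) = c • F ω := fun c ω =>
    SymDual.ext_tensorPow 𝓕.nuclear fun ξ => by
      change _ = c • F ω (tensorPow ξ n)
      rw [hF, hF]
      rfl
  -- For fixed `φ` the value `F ω φ` is linear in `ω` and bounded on each `H_{-τ}`, so reflexivity
  -- represents it by an element of `Φ`, the restriction of `φ` to the diagonal.
  have hr : ∀ φ, ∃ ξ, ∀ ω, F ω φ = ω ξ := fun φ =>
    𝓕.reflexive { toFun := fun ω => F ω φ
                  map_add' := fun ω ω' => by rw [hadd]; rfl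
                  map_smul' := fun c ω => by rw [hsmul]; rfl } fun τ => by
      obtain ⟨τ', C₀, hC₀, hm⟩ := 𝓕.mul_bound τ
      obtain ⟨τ'', K, hK⟩ := 𝓕.nuclear τ'
      exact ⟨(C₀ * K) ^ n * symNorm H n τ'' φ, fun ω C hω =>
        (hb ω τ C τ' τ'' C₀ K hω hC₀ (hm n) hK φ).trans_eq (mul_comm _ _)⟩
  choose D hD using hr
  refine ⟨{ toFun := D
            map_add' := fun φ ψ => eq_of_dual fun ω => by
              rw [map_add, ← hD, ← hD, ← hD]; exact (F ω).lin.map_add φ ψ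
            map_smul' := fun c φ => eq_of_dual fun ω => by
              rw [map_smul, ← hD, ← hD]; exact (F ω).lin.map_smul c φ }, fun ξ => ?_, ?_⟩
  · exact eq_of_dual fun ω => by rw [← hF]; exact (hD _ ω).symm
  · intro τ τ' τ'' C₀ K hC₀ hm hK φ
    have hK0 := hK.1
    refine nucNorm_le_of_dual (mul_nonneg (by positivity) (apply_nonneg _ _)) fun ω hω => ?_
    refine (congrArg norm (hD φ ω)).symm.trans_le ?_
    exact (hb ω τ 1 τ' τ'' C₀ K hω hC₀ hm hK φ).trans_eq (one_mul _)

lemma mul_perm (n : ℕ) (σ : Equiv.Perm (Fin n)) (ξ : Fin n → Nuc H) : 𝓕.mul n (ξ ∘ σ) = 𝓕.mul n ξ := by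
  rcases Nat.eq_zero_or_pos n with rfl | hn
  · rw [Subsingleton.elim (ξ ∘ σ) ξ]
  · refine 𝓕.ext fun x => ?_
    rw [𝓕.mul_apply n hn.ne', 𝓕.mul_apply n hn.ne']
    exact Equiv.prod_comp σ fun i => κ (ξ i).val x

/-- The operators are the restrictions to the diagonal multiplied by the coefficients of `p`.
Polarization extends their description from tensor powers to symmetric products. -/
lemma exists_ops {p : PowerSeries ℂ} (hp : Growth p) :
    ∃ A : (n : ℕ) → SymPow H n →L[ℂ] Nuc H,
      (∀ n ξ, A n (symProd ξ) = PowerSeries.coeff n p • 𝓕.mul n ξ) ∧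
      (PowerSeries.coeff 0 p = 0 → A 0 = 0) ∧ QuasiHolomorphic H A := by
  choose D hD hb using 𝓕.exists_diag
  have hc : ∀ n, Continuous (PowerSeries.coeff n p • D n) := fun n =>
    continuous_seminormTopology (symNorm H n) (nucNorm H) _ fun τ => by
      obtain ⟨τ', C₀, hC₀, hm⟩ := 𝓕.mul_bound τ
      obtain ⟨τ'', K, hK⟩ := 𝓕.nuclear τ'
      refine ⟨τ'', ‖PowerSeries.coeff n p‖ * (C₀ * K) ^ n, fun φ => ?_⟩
      change nucNorm H τ (PowerSeries.coeff n p • D n φ) ≤ _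
      rw [map_smul_eq_mul, mul_assoc]
      exact mul_le_mul_of_nonneg_left (hb n τ τ' τ'' C₀ K hC₀ (hm n) hK φ) (norm_nonneg _)
  refine ⟨fun n => ⟨PowerSeries.coeff n p • D n, hc n⟩, fun n ξ => ?_, fun h0 => ?_, fun τ => ?_⟩
  · change (PowerSeries.coeff n p • D n) (symProd ξ) = _
    rw [map_symProd (PowerSeries.coeff n p • D n) (PowerSeries.coeff n p • 𝓕.mul n) fun ξ => by
      change PowerSeries.coeff n p • D n (tensorPow ξ n) = _
      rw [hD]; rfl]
    simp only [smul_apply, mul_perm, Finset.sum_const, Finset.card_univ, Fintype.card_perm,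
      Fintype.card_fin]
    rw [← Nat.cast_smul_eq_nsmul ℂ, smul_smul,
      inv_mul_cancel₀ (by exact_mod_cast n.factorial_ne_zero), one_smul]
  · ext φ
    change PowerSeries.coeff 0 p • D 0 φ = 0
    rw [h0, zero_smul]
  · obtain ⟨τ', C₀, hC₀, hm⟩ := 𝓕.mul_bound τ
    obtain ⟨τ'', K, hK⟩ := 𝓕.nuclear τ'
    obtain ⟨L, A, hL, hA, hLA⟩ := hp
    have hK0 := hK.1
    refine ⟨τ'', (L + 1) * A * (C₀ * K), by positivity, fun n hn φ => ?_⟩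
    change nucNorm H τ (PowerSeries.coeff n p • D n φ) ≤ _
    rw [map_smul_eq_mul]
    -- Quasi-holomorphy admits no constant in front of `C ^ n`; for `n ≥ 1` the factor `L` is
    -- absorbed by `(L + 1) ^ n`.
    have h1 : L * A ^ n ≤ ((L + 1) * A) ^ n := by
      rw [mul_pow]
      refine mul_le_mul_of_nonneg_right ?_ (by positivity)
      exact (by linarith : L ≤ L + 1).trans (le_self_pow₀ (by linarith) (by omega))
    calc ‖PowerSeries.coeff n p‖ * nucNorm H τ (D n φ)
        ≤ ((L + 1) * A) ^ n * ((C₀ * K) ^ n * symNorm H n τ'' φ) :=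
          mul_le_mul ((hLA n).trans h1) (hb n τ τ' τ'' C₀ K hC₀ (hm n) hK φ) (apply_nonneg _ _)
            (by positivity)
      _ = _ := by rw [mul_pow _ (C₀ * K), mul_assoc]

/-- Every composition of `N` contributes a multiple of the same function `ξ ^ N`, so composition of
the operator series reduces to substitution of scalar series. -/
lemma compCoeff_ops {p q : PowerSeries ℂ} (hp : PowerSeries.coeff 0 p = 0)
    (hq : PowerSeries.coeff 0 q = 0) (hpq : p.subst q = PowerSeries.X)
    {A B : (n : ℕ) → SymPow H n →L[ℂ] Nuc H}
    (hA : ∀ n ξ, A n (symProd ξ) = PowerSeries.coeff n p • 𝓕.mul n ξ)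
    (hB : ∀ n ξ, B n (symProd ξ) = PowerSeries.coeff n q • 𝓕.mul n ξ) (N : ℕ) (ξ : Nuc H) :
    compCoeff (fun n => A n) B N ξ = if N = 1 then ξ else 0 := by
  have h1 : ∀ c : Composition N,
      A c.length (symProd fun i => B (c.blocksFun i) (tensorPow ξ (c.blocksFun i))) =
      (PowerSeries.coeff c.length p * ∏ i, PowerSeries.coeff (c.blocksFun i) q) • 𝓕.npow ξ N := by
    intro c
    have h2 : ∀ n, B n (tensorPow ξ n) = PowerSeries.coeff n q • 𝓕.npow ξ n := fun n => hB n _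
    simp only [hA, h2]
    rcases Nat.eq_zero_or_pos c.length with h0 | h0
    · have hp' : PowerSeries.coeff c.length p = 0 := by rw [h0, hp]
      rw [hp', zero_smul, zero_mul, zero_smul]
    · rw [mul_smul]
      congr 1
      have hN : N ≠ 0 := by
        have := c.length_le
        omega
      refine 𝓕.ext fun x => ?_
      rw [𝓕.mul_apply _ h0.ne', val_smul, 𝓕.npow_apply ξ hN]
      simp only [val_smul]
      rw [Finset.prod_mul_distrib]
      congr 1
      have h3 := Finset.prod_pow_eq_pow_sum Finset.univ c.blocksFun (κ ξ.val x)
      rw [c.sum_blocksFun] at h3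
      rw [← h3]
      exact Finset.prod_congr rfl fun i _ =>
        𝓕.npow_apply ξ (Nat.one_le_iff_ne_zero.1 (c.one_le_blocksFun i)) x
  unfold compCoeff
  rw [Finset.sum_congr rfl fun c _ => h1 c, ← Finset.sum_smul, ← coeff_subst_composition p hq, hpq,
    PowerSeries.coeff_X]
  split_ifs with h
  · rw [h, npow_one, one_smul]
  · rw [zero_smul]

/-! ### The Sheffer sequence -/

lemma polySeries_expS_integral {c : PowerSeries ℂ} (hc : Growth c) : ∃ τ R B, 0 < R ∧
    PolySeries H τ R B fun ξ => expS (𝓕.ser c ξ 𝓕.integral) := by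
  obtain ⟨τ₁, B, hI⟩ := exists_dualLE 𝓕.integral
  obtain ⟨τ', h⟩ := 𝓕.exists_polySeries_ser τ₁
  obtain ⟨R, hR, h⟩ := h c hc 1 one_pos
  exact ⟨τ', R, _, hR, (h R hR le_rfl _ _ hI).expS hR.le fun ξ => 𝓕.coeff_zero_ser c ξ _⟩

lemma exists_rho {c : PowerSeries ℂ} (hc : Growth c) : ∃ ρ : (n : ℕ) → SymDual H n,
    (∀ n ξ, ρ n (tensorPow ξ n) = PowerSeries.coeff n (expS (𝓕.ser c ξ 𝓕.integral))) ∧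
      HolomorphicNearZero H ρ := by
  obtain ⟨τ, R, B, hR, h⟩ := 𝓕.polySeries_expS_integral hc
  obtain ⟨τ', K, hK⟩ := 𝓕.nuclear τ
  have hex : ∀ n, ∃ F : SymDual H n, ∀ ξ,
      F (tensorPow ξ n) = PowerSeries.coeff n (expS (𝓕.ser c ξ 𝓕.integral)) := by
    intro n
    obtain ⟨h0, M, h1, h2⟩ := h.polyBound hR n
    obtain ⟨F, hF, -⟩ := HSLE.exists_functional hK M h0 h2
    exact ⟨F, fun ξ => (hF ξ).trans (h1 ξ)⟩
  choose ρ hρ using hex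
  refine ⟨ρ, hρ, holomorphicNearZero (τ := τ) (B := B) hR fun n => ?_⟩
  simp only [hρ]
  exact h.polyBound hR n

/-- An application of `sum_map_symProd` with `w_j = c_j ∫`. Passing from compositions to all tuples
adds only terms with a factor `ξ^0 = 0`. -/
lemma compCoeff_rho {a c : PowerSeries ℂ} (ha : PowerSeries.coeff 0 a = 0)
    {A : (n : ℕ) → SymPow H n →L[ℂ] Nuc H} {ρ : (n : ℕ) → SymDual H n}
    (hA : ∀ n ξ, A n (tensorPow ξ n) = PowerSeries.coeff n a • 𝓕.npow ξ n)
    (hρ : ∀ n ξ, ρ n (tensorPow ξ n) = PowerSeries.coeff n (expS (𝓕.ser c ξ 𝓕.integral)))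
    (N : ℕ) (ξ : Nuc H) : compCoeff (fun n => ρ n) A N ξ =
      PowerSeries.coeff N (expS (𝓕.ser (c.subst a) ξ 𝓕.integral)) := by
  rw [← 𝓕.mk_sum_coeff_pow a c ha, ← 𝓕.sum_map_symProd ha (fun j => PowerSeries.coeff j c • 𝓕.integral)
    (fun k => (ρ k).lin) (fun k η => hρ k η)]
  unfold compCoeff
  simp only [hA]
  refine sum_composition_of_zero (fun k f => ρ k (symProd fun i =>
    PowerSeries.coeff (f i) a • 𝓕.npow ξ (f i))) (fun k f i hi => ?_) N
  rw [symProd_eq_zero (i := i) (by rw [hi, npow_zero, smul_zero])]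
  exact (ρ k).lin.map_zero

end FunScale

/-- The adjoint of a bounded operator between symmetric tensor powers. -/
lemma exists_adjoint {n k : ℕ} (V : SymPow H n →ₗ[ℂ] SymPow H k)
    (hV : ∀ τ, ∃ τ' K, 0 ≤ K ∧ ∀ φ, symNorm H k τ (V φ) ≤ K * symNorm H n τ' φ) :
    ∃ U : SymDual H k →L[ℂ] SymDual H n, ∀ F φ, U F φ = F (V φ) := by
  have hc : Continuous V := continuous_seminormTopology (symNorm H n) (symNorm H k) V fun τ => by
    obtain ⟨τ', K, -, h⟩ := hV τ
    exact ⟨τ', K, h⟩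
  let U : SymDual H k →ₗ[ℂ] SymDual H n :=
    { toFun := fun F => SymDual.of (F.lin ∘ₗ V) (F.continuous.comp hc)
      map_add' := fun F G => rfl
      map_smul' := fun c F => rfl }
  refine ⟨⟨U, ?_⟩, fun F φ => rfl⟩
  refine continuous_seminormTopology _ _ U fun q => ?_
  -- The pulled back seminorm is itself one of those defining the inductive limit topology, because
  -- the transpose of `V` maps `H_{-τ}^{⊙k}` continuously into `H_{-τ'}^{⊙n}`.
  refine ⟨⟨q.1.comp U, fun τ => ?_⟩, 1, fun F => by rw [one_mul]; exact le_rfl⟩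
  obtain ⟨τ', K, hK, h⟩ := hV τ
  let V' : SymLevel H n τ' →L[ℂ] SymLevel H k τ :=
    LinearMap.mkContinuous (σ := RingHom.id ℂ) (E := SymLevel H n τ') (F := SymLevel H k τ) V K h
  exact (q.2 τ').comp (ContinuousLinearMap.precomp ℂ V').continuous

end

/-! ### Existence, uniqueness and regularity of the lifting -/

section

variable {T Φ : Type} [AddCommGroup Φ] [Module ℂ Φ] {H : HilbertScale T Φ} {d : ℕ}

namespace FunScale

variable {κ : Φ →ₗ[ℂ] (RSpace d → ℂ)} (𝓕 : FunScale H κ)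

/-- The generating function of a lifting, in terms of the series. -/
lemma series_of_isLifting {a r : PowerSeries ℂ} (ha : PowerSeries.coeff 0 a = 0)
    (hr : PowerSeries.coeff 0 r = 1)
    {S : (n : ℕ) → CoNuc H → SymDual H n} (h : IsLifting H κ a r S) (ω : CoNuc H) (ξ : Nuc H) :
    PowerSeries.mk (fun n => S n ω (tensorPow ξ n) / (n.factorial : ℂ)) =
      expS (𝓕.ser a ξ ω) * expS (𝓕.ser (-((PowerSeries.logOf r).subst a)) ξ 𝓕.integral) := by
  obtain ⟨A, ρ, hS, hA, hρ⟩ := h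
  have hA' : ∀ n ξ, A n (tensorPow ξ n) = PowerSeries.coeff n a • 𝓕.npow ξ n := by
    intro n ξ
    refine 𝓕.ext fun x => ?_
    rw [hA, val_smul]
    rcases Nat.eq_zero_or_pos n with rfl | hn
    · rw [ha, zero_mul, zero_mul]
    · rw [𝓕.npow_apply ξ hn.ne']
  have hρ' : ∀ n ξ, ρ n (tensorPow ξ n) =
      PowerSeries.coeff n (expS (𝓕.ser (PowerSeries.logOf r) ξ 𝓕.integral)) := by
    intro n ξ
    rw [← PowerSeries.coeff_mk n fun n => ρ n (tensorPow ξ n), hρ, expS]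
    congr 2
    ext k
    rw [PowerSeries.coeff_mk, coeff_ser]
    rcases Nat.eq_zero_or_pos k with rfl | hk
    · rw [coeff_zero_logOf hr, zero_mul, zero_mul]
    · rw [𝓕.integral_apply]
      simp only [𝓕.npow_apply ξ hk.ne']
  have h1 := hS.generating ω ξ
  have h2 : PowerSeries.mk (fun N => compCoeff (fun n => ρ n) A N ξ) =
      expS (𝓕.ser ((PowerSeries.logOf r).subst a) ξ 𝓕.integral) := by
    ext N
    rw [PowerSeries.coeff_mk, 𝓕.compCoeff_rho ha hA' hρ']
  have h3 : PowerSeries.mk (fun k => ω (A k (tensorPow ξ k))) = 𝓕.ser a ξ ω := by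
    ext k
    rw [PowerSeries.coeff_mk, coeff_ser, hA', map_smul, smul_eq_mul]
  rw [h2, h3] at h1
  change _ = expS (𝓕.ser a ξ ω) at h1
  rw [← h1, mul_assoc, ser_neg, expS_add_neg (𝓕.coeff_zero_ser _ _ _), mul_one]

include 𝓕 in
-- Whatever `A` and `ρ` witness the lifting, the generating function fixes `S⁽ⁿ⁾(ω)` on tensor
-- powers, which are total.
lemma isLifting_unique {a r : PowerSeries ℂ} (ha : PowerSeries.coeff 0 a = 0)
    (hr : PowerSeries.coeff 0 r = 1)
    {S S' : (n : ℕ) → CoNuc H → SymDual H n} (h : IsLifting H κ a r S) (h' : IsLifting H κ a r S') :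
    S = S' := by
  funext n ω
  refine SymDual.ext_tensorPow 𝓕.nuclear fun ξ => ?_
  have h1 := congrArg (PowerSeries.coeff n)
    ((𝓕.series_of_isLifting ha hr h ω ξ).trans (𝓕.series_of_isLifting ha hr h' ω ξ).symm)
  rw [PowerSeries.coeff_mk, PowerSeries.coeff_mk,
    div_left_inj' (by exact_mod_cast n.factorial_ne_zero)] at h1
  exact h1

/-- In the coefficient of degree `n` of a product of `n` series without constant term, only the
linear terms survive, together with the constant term `1` of the exponential. -/
lemma kernel_self {a g : PowerSeries ℂ} (ha1 : PowerSeries.coeff 1 a = 1)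
    {n : ℕ} {V : SymPow H n →ₗ[ℂ] SymPow H n}
    (hV : ∀ ξ, (V (tensorPow ξ n)).form = 𝓕.kernelForm a g n n ξ) (ξ : Nuc H) :
    V (tensorPow ξ n) = tensorPow ξ n := by
  refine SymPow.ext_diag fun ω => ?_
  rw [hV, kernelForm_diag, div_self (by exact_mod_cast n.factorial_ne_zero), one_mul,
    tensorPow_form, Finset.prod_const, Finset.card_univ, Fintype.card_fin, PowerSeries.coeff_mul,
    Finset.sum_eq_single (n, 0)]
  · rw [coeff_zero_expS (𝓕.coeff_zero_ser _ _ _), mul_one]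
    have h := coeff_prod_self (k := n) (p := fun _ => 𝓕.ser a ξ ω) fun _ => 𝓕.coeff_zero_ser a ξ ω
    rw [Finset.prod_const, Finset.prod_const, Finset.card_univ, Fintype.card_fin] at h
    rw [h, coeff_ser, ha1, one_mul, npow_one]
  · intro x hx hne
    have h1 := Finset.HasAntidiagonal.mem_antidiagonal.1 hx
    have h2 : x.1 < n := by
      rcases Nat.eq_zero_or_pos x.2 with h0 | h0
      · exact absurd (Prod.ext (by simp only; omega) h0) hne
      · omega
    rw [coeff_pow_eq_zero (𝓕.coeff_zero_ser a ξ ω) h2, zero_mul]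
  · intro h
    exact absurd (Finset.HasAntidiagonal.mem_antidiagonal.2 (add_zero n)) h

include 𝓕 in
/-- The lifting of a Sheffer sequence with convergent series. -/
theorem liftsRegularly {a r : PowerSeries ℂ} (ha : Growth a) (hr : Growth r)
    (ha0 : PowerSeries.coeff 0 a = 0) (ha1 : PowerSeries.coeff 1 a = 1)
    (hr0 : PowerSeries.coeff 0 r = 1) : LiftsRegularly H κ a r := by
  obtain ⟨b, hb, hb0, hb1, hab, hba⟩ := exists_growth_inverse ha ha0 ha1
  have hc : Growth (PowerSeries.logOf r) := hr.logOf hr0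
  have hc0 := coeff_zero_logOf hr0
  set c := PowerSeries.logOf r
  -- The factor `1 / ρ(A(ξ))` is the exponential of `∫ g(ξ)`. The operator comes from the pair `(a,
  -- g)` and its inverse from `(b, c)`, as `c ∘ a = -g` and `g ∘ b = -c`.
  set g : PowerSeries ℂ := -(c.subst a) with hg_def
  have hg : Growth g := (hc.subst ha ha0).neg
  have hgb : g.subst b = -c := by
    have h1 : PowerSeries.subst b (PowerSeries.subst a c) = c := by
      rw [PowerSeries.subst_comp_subst_apply (hasSubst_of_coeff ha0) (hasSubst_of_coeff hb0), hab]
      exact PowerSeries.X_subst c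
    ext N
    have h2 := congrArg (PowerSeries.coeff N) h1
    rw [coeff_subst_eq_sum _ hb0 le_rfl] at h2
    simp only [hg_def, coeff_subst_eq_sum _ hb0 le_rfl, map_neg, neg_mul, Finset.sum_neg_distrib, h2]
  obtain ⟨V, hV, hVf⟩ := 𝓕.exists_kernels ha hg
  obtain ⟨W, hW, hWf⟩ := 𝓕.exists_kernels hb hc
  have hVW : KernelInverse V W :=
    𝓕.kernelInverse ha0 hba (by rw [hg_def, neg_neg]) hV hW hVf hWf
  have hWV : KernelInverse W V := 𝓕.kernelInverse hb0 hab hgb hW hV hWf hVf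
  obtain ⟨A, hA, hA0, hAq⟩ := 𝓕.exists_ops ha
  obtain ⟨B, hB, hB0, hBq⟩ := 𝓕.exists_ops hb
  obtain ⟨ρ, hρ, hρh⟩ := 𝓕.exists_rho hc
  have hAt : ∀ n ξ, A n (tensorPow ξ n) = PowerSeries.coeff n a • 𝓕.npow ξ n := fun n ξ => hA n _
  have hUex : ∀ n k, k ≤ n → ∃ U : SymDual H k →L[ℂ] SymDual H n, ∀ F φ, U F φ = F (V n k φ) :=
    fun n k hk => exists_adjoint (V n k) fun τ => hV.exists_symNorm_le 𝓕.nuclear hk τ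
  -- `U n k` is the adjoint of `V n k`. The kernel bounds cover only `k ≤ n`; the other operators do
  -- not occur in `S` and are set to zero.
  let U : (n k : ℕ) → SymDual H k →L[ℂ] SymDual H n := fun n k =>
    if hk : k ≤ n then (hUex n k hk).choose else 0
  have hU : ∀ n k, k ≤ n → ∀ F φ, U n k F φ = F (V n k φ) := by
    intro n k hk F φ
    simp only [U, dif_pos hk]
    exact (hUex n k hk).choose_spec F φ
  let S : (n : ℕ) → CoNuc H → SymDual H n := fun n ω =>
    ∑ k ∈ Finset.range (n + 1), U n k (dualPow ω k)
  have hS : ∀ n ω φ, S n ω φ = ∑ k ∈ Finset.range (n + 1), (V n k φ).form fun _ => ω := by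
    intro n ω φ
    have h1 : S n ω φ = ∑ k ∈ Finset.range (n + 1), U n k (dualPow ω k) φ :=
      sum_apply (F := StrongDual ℂ (SymPow H n)) _ _ _
    rw [h1]
    refine Finset.sum_congr rfl fun k hk => ?_
    rw [hU n k (Nat.lt_succ_iff.1 (Finset.mem_range.1 hk)), dualPow_apply]
  have hsh : IsShefferWith H A ρ S :=
    { monic := by
        refine ⟨U, fun n F => SymDual.ext_tensorPow 𝓕.nuclear fun ξ => ?_, fun n ω => rfl⟩
        rw [hU n n le_rfl, 𝓕.kernel_self ha1 (hVf n n)]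
      zero_coeff := hA0 ha0
      one_coeff := fun ξ => by rw [hAt, ha1, one_smul, npow_one]
      rho_zero := by rw [hρ, coeff_zero_expS (𝓕.coeff_zero_ser _ _ _)]
      generating := fun ω ξ => by
        have h1 : PowerSeries.mk (fun n => S n ω (tensorPow ξ n) / (n.factorial : ℂ)) =
            expS (𝓕.ser a ξ ω) * expS (𝓕.ser g ξ 𝓕.integral) := by
          ext n
          rw [PowerSeries.coeff_mk, coeff_expS_mul (𝓕.coeff_zero_ser _ _ _), hS, Finset.sum_div]
          refine Finset.sum_congr rfl fun k _ => ?_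
          rw [hVf, kernelForm_diag]
          have := n.factorial_ne_zero
          field_simp
        have h2 : PowerSeries.mk (fun N => compCoeff (fun n => ρ n) A N ξ) =
            expS (𝓕.ser (c.subst a) ξ 𝓕.integral) := by
          ext N
          rw [PowerSeries.coeff_mk, 𝓕.compCoeff_rho ha0 hAt hρ]
        have h3 : PowerSeries.mk (fun k => ω (A k (tensorPow ξ k))) = 𝓕.ser a ξ ω := by
          ext k
          rw [PowerSeries.coeff_mk, coeff_ser, hAt, map_smul, smul_eq_mul]
        rw [h1, h2, h3, mul_assoc, hg_def, ser_neg, mul_comm (expS (-_)),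
          expS_add_neg (𝓕.coeff_zero_ser _ _ _), mul_one]
        rfl }
  have hL : IsLifting H κ a r S := by
    refine ⟨A, ρ, hsh, fun k ξ x => ?_, fun ξ => ?_⟩
    · rw [hAt, val_smul]
      rcases Nat.eq_zero_or_pos k with rfl | hk
      · rw [ha0, zero_mul, zero_mul]
      · rw [𝓕.npow_apply ξ hk.ne']
    · have h1 : (PowerSeries.mk fun k => PowerSeries.coeff k c * ∫ x, κ ξ.val x ^ k) =
          𝓕.ser c ξ 𝓕.integral := by
        ext k
        rw [PowerSeries.coeff_mk, coeff_ser]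
        rcases Nat.eq_zero_or_pos k with rfl | hk
        · rw [hc0, zero_mul, zero_mul]
        · rw [𝓕.integral_apply]
          simp only [𝓕.npow_apply ξ hk.ne']
      rw [h1]
      ext n
      rw [PowerSeries.coeff_mk, hρ]
      rfl
  refine ⟨⟨S, hL, fun S' hS' => 𝓕.isLifting_unique ha0 hr0 hS' hL⟩, fun S' hS' => ?_⟩
  obtain rfl := 𝓕.isLifting_unique ha0 hr0 hS' hL
  refine ⟨⟨A, B, ρ, hsh, hρh, ⟨hA0 ha0, hB0 hb0, 𝓕.compCoeff_ops ha0 hb0 hab hA hB,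
    𝓕.compCoeff_ops hb0 ha0 hba hB hA⟩, hAq, hBq⟩, polyEquiv 𝓕.nuclear hV hW hVW hWV, ?_,
    fun α hα => extends_polyEquiv 𝓕.nuclear hV hW hVW hWV hα⟩
  intro n φ ω
  rw [hS]
  exact (congrFun (polyOp_apply 𝓕.nuclear hV _) ω).trans (kernelFun_monomialFun 𝓕.nuclear φ ω)

end FunScale

end

/-! ### The classical polynomial sequences -/

section Examples

lemma Growth.isHolomorphicSeries {p : PowerSeries ℂ} (h : Growth p) : IsHolomorphicSeries p := by
  obtain ⟨K, C, hK, hC, hp⟩ := h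
  have hbd : ∀ n, ∀ u ∈ Metric.ball (0 : ℂ) (1 / (2 * C)),
      ‖PowerSeries.coeff n p * u ^ n‖ ≤ K * (1 / 2) ^ n := by
    intro n u hu
    rw [mem_ball_zero_iff, lt_div_iff₀ (by positivity)] at hu
    rw [norm_mul, norm_pow]
    calc ‖PowerSeries.coeff n p‖ * ‖u‖ ^ n ≤ K * C ^ n * ‖u‖ ^ n :=
          mul_le_mul_of_nonneg_right (hp n) (by positivity)
      _ = K * (C * ‖u‖) ^ n := by rw [mul_pow, mul_assoc]
      _ ≤ K * (1 / 2) ^ n := mul_le_mul_of_nonneg_left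
          (pow_le_pow_left₀ (by positivity) (by linarith) n) hK.le
  refine ⟨1 / (2 * C), by positivity, fun u => ∑' n, PowerSeries.coeff n p * u ^ n,
    Complex.differentiableOn_tsum_of_summable_norm (summable_geometric_bound K)
      (fun n => (by fun_prop : Differentiable ℂ _).differentiableOn) Metric.isOpen_ball hbd,
    fun u hu => (Summable.of_norm_bounded (summable_geometric_bound K) fun n => hbd n u hu).hasSum⟩

lemma growth_exp : Growth (PowerSeries.exp ℂ) := by
  refine ⟨1, 1, one_pos, one_pos, fun n => ?_⟩
  rw [PowerSeries.coeff_exp, one_pow, mul_one, map_div₀, map_one, map_natCast, norm_div, norm_one,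
    Complex.norm_natCast]
  exact div_le_one_of_le₀ (by exact_mod_cast n.factorial_pos) (by positivity)

lemma Growth.smul {p : PowerSeries ℂ} (h : Growth p) (c : ℂ) : Growth (c • p) := by
  obtain ⟨K, C, hK, hC, hp⟩ := h
  refine ⟨(‖c‖ + 1) * K, C, by positivity, hC, fun n => ?_⟩
  rw [map_smul, norm_smul, mul_assoc]
  exact mul_le_mul (by linarith) (hp n) (norm_nonneg _) (by positivity)

/-- The series of `1/(1 - εu)`. -/
def geomSeries (ε : ℂ) : PowerSeries ℂ := PowerSeries.mk fun n => ε ^ n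

/-- The series of `-log(1 - εu)/ε`. -/
def logSeries (ε : ℂ) : PowerSeries ℂ := PowerSeries.mk fun n => ε ^ (n - 1) / n

/-- The series `∑ₙ z(z+ε)⋯(z+(n-1)ε) uⁿ/n!` of `(1 - εu)^(-z/ε)`. -/
def risingSeries (ε z : ℂ) : PowerSeries ℂ :=
  PowerSeries.mk fun n => (∏ i ∈ Finset.range n, (z + ε * i)) / n.factorial

lemma derivative_logSeries (ε : ℂ) : PowerSeries.derivative ℂ (logSeries ε) = geomSeries ε := by
  ext n
  rw [PowerSeries.coeff_derivative, logSeries, geomSeries, PowerSeries.coeff_mk, PowerSeries.coeff_mk,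
    Nat.add_sub_cancel]
  have : (n : ℂ) + 1 ≠ 0 := by exact_mod_cast n.succ_ne_zero
  push_cast
  field_simp

lemma coeff_zero_logSeries (ε : ℂ) : PowerSeries.coeff 0 (logSeries ε) = 0 := by
  simp [logSeries]

lemma coeff_one_logSeries (ε : ℂ) : PowerSeries.coeff 1 (logSeries ε) = 1 := by
  simp [logSeries]

lemma geomSeries_mul (ε : ℂ) : geomSeries ε * (1 - PowerSeries.C ε * PowerSeries.X) = 1 := by
  ext n
  rw [mul_sub, mul_one, map_sub, mul_left_comm, PowerSeries.coeff_C_mul]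
  rcases n with _ | n
  · simp [geomSeries]
  · rw [PowerSeries.coeff_succ_mul_X, geomSeries, PowerSeries.coeff_mk, PowerSeries.coeff_mk,
      PowerSeries.coeff_one, if_neg n.succ_ne_zero, pow_succ']
    ring

/-- The ratio `(z + ε n) / (n + 1)` of consecutive coefficients encodes the equation `(1 - ε u) F' =
z F`, which is then multiplied by the geometric series. -/
lemma derivative_risingSeries (ε z : ℂ) : PowerSeries.derivative ℂ (risingSeries ε z) =
    z • geomSeries ε * risingSeries ε z := by
  have h : (1 - PowerSeries.C ε * PowerSeries.X) * PowerSeries.derivative ℂ (risingSeries ε z) =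
      z • risingSeries ε z := by
    ext n
    rw [sub_mul, one_mul, map_sub, PowerSeries.coeff_derivative, mul_assoc, PowerSeries.coeff_C_mul,
      map_smul, smul_eq_mul]
    have h1 : PowerSeries.coeff n (PowerSeries.X * PowerSeries.derivative ℂ (risingSeries ε z)) =
        n * PowerSeries.coeff n (risingSeries ε z) := by
      rcases n with _ | n
      · simp
      · rw [mul_comm, PowerSeries.coeff_succ_mul_X, PowerSeries.coeff_derivative]
        push_cast
        ring
    have h2 : PowerSeries.coeff (n + 1) (risingSeries ε z) * ((n : ℂ) + 1) =
        (z + ε * n) * PowerSeries.coeff n (risingSeries ε z) := by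
      rw [risingSeries, PowerSeries.coeff_mk, PowerSeries.coeff_mk, Finset.prod_range_succ,
        Nat.factorial_succ]
      have h3 : (n : ℂ) + 1 ≠ 0 := by exact_mod_cast n.succ_ne_zero
      have h4 : (n.factorial : ℂ) ≠ 0 := by exact_mod_cast n.factorial_ne_zero
      push_cast
      field_simp
    rw [h1, h2]
    ring
  calc _ = geomSeries ε * (1 - PowerSeries.C ε * PowerSeries.X) *
      PowerSeries.derivative ℂ (risingSeries ε z) := by rw [geomSeries_mul, one_mul]
    _ = _ := by rw [mul_assoc, h, mul_smul_comm, smul_mul_assoc]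

lemma coeff_zero_risingSeries (ε z : ℂ) : PowerSeries.coeff 0 (risingSeries ε z) = 1 := by
  simp [risingSeries]

lemma coeff_zero_smul {p : PowerSeries ℂ} (hp : PowerSeries.coeff 0 p = 0) (z : ℂ) :
    PowerSeries.coeff 0 (z • p) = 0 := by rw [map_smul, hp, smul_zero]

/-- Both sides solve `F' = z F / (1 - ε u)` with constant term `1`. The values `ε = -1` and `ε = 1`
give the falling and the rising factorials. -/
lemma expS_smul_logSeries (ε z : ℂ) : expS (z • logSeries ε) = risingSeries ε z := by
  have h0 := coeff_zero_smul (coeff_zero_logSeries ε) z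
  refine eq_of_derivative_eq_mul (u := z • geomSeries ε) ?_ (derivative_risingSeries ε z) ?_
  · rw [derivative_expS h0, Derivation.map_smul, derivative_logSeries]
  · rw [coeff_zero_expS h0, coeff_zero_risingSeries]

lemma risingSeries_add (ε z z' : ℂ) :
    risingSeries ε (z + z') = risingSeries ε z * risingSeries ε z' := by
  rw [← expS_smul_logSeries, ← expS_smul_logSeries, ← expS_smul_logSeries, add_smul,
    expS_add (coeff_zero_smul (coeff_zero_logSeries ε) z)
      (coeff_zero_smul (coeff_zero_logSeries ε) z')]

lemma risingSeries_self (ε : ℂ) : risingSeries ε ε = geomSeries ε := by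
  refine PowerSeries.ext fun n => ?_
  rw [risingSeries, geomSeries, PowerSeries.coeff_mk, PowerSeries.coeff_mk]
  have h : ∀ i : ℕ, ε + ε * i = ε * (i + 1 : ℕ) := fun i => by push_cast; ring
  simp only [h, Finset.prod_mul_distrib, Finset.prod_const, Finset.card_range]
  rw [← Nat.cast_prod, Finset.prod_range_add_one_eq_factorial,
    mul_div_cancel_right₀ _ (by exact_mod_cast n.factorial_ne_zero)]

lemma risingSeries_add_mul (ε z : ℂ) (j : ℕ) :
    risingSeries ε (z + j * ε) = risingSeries ε z * geomSeries ε ^ j := by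
  induction j with
  | zero => simp
  | succ j ih =>
    rw [Nat.cast_succ, add_mul, one_mul, ← add_assoc, risingSeries_add, ih, risingSeries_self, pow_succ,
      mul_assoc]

lemma growth_logSeries {ε : ℂ} (hε : ‖ε‖ = 1) : Growth (logSeries ε) := by
  refine ⟨1, 1, one_pos, one_pos, fun n => ?_⟩
  rw [logSeries, PowerSeries.coeff_mk, norm_div, norm_pow, hε, one_pow, Complex.norm_natCast, one_pow,
    mul_one]
  rcases n with _ | n
  · simp
  · exact div_le_one_of_le₀ (by push_cast; linarith [(Nat.cast_nonneg n : (0 : ℝ) ≤ n)]) (by positivity)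

lemma eval_ascPochhammer (z : ℂ) (n : ℕ) :
    (ascPochhammer ℂ n).eval z = ∏ i ∈ Finset.range n, (z + 1 * i) := by
  induction n with
  | zero => simp
  | succ n ih => rw [ascPochhammer_succ_eval, ih, Finset.prod_range_succ, one_mul]

lemma eval_descPochhammer (z : ℂ) (n : ℕ) :
    (descPochhammer ℂ n).eval z = ∏ i ∈ Finset.range n, (z + -1 * i) := by
  induction n with
  | zero => simp
  | succ n ih => rw [descPochhammer_succ_eval, ih, Finset.prod_range_succ, neg_one_mul, sub_eq_add_neg]

lemma subst_one (a : PowerSeries ℂ) (ha : PowerSeries.coeff 0 a = 0) :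
    PowerSeries.subst a (1 : PowerSeries ℂ) = 1 := by
  rw [← PowerSeries.coe_substAlgHom (hasSubst_of_coeff ha), map_one]

lemma isScalarSheffer_descPochhammer : IsScalarSheffer (logSeries (-1)) 1 (descPochhammer ℂ) where
  monic n := ⟨monic_descPochhammer ℂ n, descPochhammer_natDegree ℂ n⟩
  a_zero := coeff_zero_logSeries _
  a_one := coeff_one_logSeries _
  r_zero := by simp
  generating z := by
    rw [subst_one _ (coeff_zero_logSeries _), mul_one]
    refine Eq.trans ?_ (expS_smul_logSeries (-1) z).symm
    simp only [eval_descPochhammer]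
    rfl

lemma isScalarSheffer_ascPochhammer : IsScalarSheffer (logSeries 1) 1 (ascPochhammer ℂ) where
  monic n := ⟨monic_ascPochhammer ℂ n, ascPochhammer_natDegree ℂ n⟩
  a_zero := coeff_zero_logSeries _
  a_one := coeff_one_logSeries _
  r_zero := by simp
  generating z := by
    rw [subst_one _ (coeff_zero_logSeries _), mul_one]
    refine Eq.trans ?_ (expS_smul_logSeries 1 z).symm
    simp only [eval_ascPochhammer]
    rfl

open Polynomial in
lemma monic_sum_C_mul {q : ℕ → ℂ[X]} (hq : ∀ n, (q n).Monic ∧ (q n).natDegree = n) (c : ℕ → ℂ) {n : ℕ}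
    (hc : c n = 1) : (∑ k ∈ Finset.range (n + 1), C (c k) * q k).Monic ∧
      (∑ k ∈ Finset.range (n + 1), C (c k) * q k).natDegree = n := by
  have h1 : (∑ k ∈ Finset.range n, C (c k) * q k).degree < (q n).degree := by
    rw [degree_eq_natDegree (hq n).1.ne_zero, (hq n).2, ← mem_degreeLT]
    refine Submodule.sum_mem _ fun k hk => ?_
    rw [C_mul']
    refine Submodule.smul_mem _ _ (mem_degreeLT.2 ?_)
    rw [degree_eq_natDegree (hq k).1.ne_zero, (hq k).2]
    exact_mod_cast Finset.mem_range.1 hk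
  rw [Finset.sum_range_succ, hc, C_1, one_mul]
  exact ⟨(hq n).1.add_of_right h1, (natDegree_add_eq_right_of_degree_lt h1).trans (hq n).2⟩

lemma coeff_expS_smul_X (z : ℂ) (n : ℕ) :
    PowerSeries.coeff n (expS (z • PowerSeries.X)) = z ^ n / n.factorial := by
  have h0 := coeff_zero_smul (p := PowerSeries.X) (by simp) z
  rw [coeff_expS h0 le_rfl, Finset.sum_eq_single n]
  · rw [smul_pow, map_smul, PowerSeries.coeff_X_pow_self, smul_eq_mul, mul_one, inv_mul_eq_div]
  · intro k _ hk
    rw [smul_pow, map_smul, PowerSeries.coeff_X_pow, if_neg (Ne.symm hk), smul_zero, mul_zero]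
  · simp

/-- The generating function requires `r(a(u)) = e ^ u` with `a(u) = log (1 + u)`, so `r` is the
exponential of the compositional inverse of `a`. -/
lemma exists_isScalarSheffer_charlier : ∃ a r, IsScalarSheffer a r charlier ∧ Growth a ∧ Growth r := by
  have ha := growth_logSeries (ε := -1) (by simp)
  obtain ⟨b, hb, hb0, -, -, hba⟩ := exists_growth_inverse ha (coeff_zero_logSeries _) (coeff_one_logSeries _)
  refine ⟨logSeries (-1), expS b, ⟨fun n => ?_, coeff_zero_logSeries _, coeff_one_logSeries _,
    coeff_zero_expS hb0, fun z => ?_⟩, ha, growth_exp.subst hb hb0⟩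
  · exact monic_sum_C_mul (fun k => ⟨monic_descPochhammer ℂ k, descPochhammer_natDegree ℂ k⟩)
      (fun k => (n.choose k : ℂ) * (-1) ^ (n - k)) (by simp)
  · have h1 : PowerSeries.subst (logSeries (-1)) (expS b) = expS PowerSeries.X := by
      rw [expS, PowerSeries.subst_comp_subst_apply (hasSubst_of_coeff hb0)
        (hasSubst_of_coeff (coeff_zero_logSeries _)), hba]
      rfl
    -- The binomial sum defining the polynomials is the Cauchy product of `(1 + u) ^ z` and `e ^
    -- (-u)`.
    have h2 : PowerSeries.mk (fun n => (charlier n).eval z / (n.factorial : ℂ)) =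
        risingSeries (-1) z * expS (-PowerSeries.X) := by
      ext n
      rw [PowerSeries.coeff_mk, PowerSeries.coeff_mul, Finset.Nat.sum_antidiagonal_eq_sum_range_succ_mk,
        charlier, Polynomial.eval_finsetSum, Finset.sum_div]
      refine Finset.sum_congr rfl fun k hk => ?_
      have hk' : k ≤ n := Nat.lt_succ_iff.1 (Finset.mem_range.1 hk)
      rw [← neg_one_smul ℂ PowerSeries.X, coeff_expS_smul_X, risingSeries, PowerSeries.coeff_mk,
        ← eval_descPochhammer, Polynomial.eval_mul, Polynomial.eval_C, Nat.cast_choose ℂ hk']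
      have h3 : (n.factorial : ℂ) ≠ 0 := by exact_mod_cast n.factorial_ne_zero
      field_simp
    rw [h1, h2, mul_assoc, mul_comm (expS (-_)), expS_add_neg (by simp), mul_one]
    exact (expS_smul_logSeries (-1) z).symm

/-- For `a = u / (1 + u)` one has `1 - a = 1 / (1 + u)`. Hence `r(u) = (1 - u) ^ (-(κ + 1))`
satisfies `r(a(u)) = (1 + u) ^ (κ + 1)`. -/
lemma isScalarSheffer_laguerre (κ : ℝ) : IsScalarSheffer (PowerSeries.X * geomSeries (-1))
    (risingSeries 1 (κ + 1)) (laguerre κ) := by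
  have ha0 : PowerSeries.coeff 0 (PowerSeries.X * geomSeries (-1)) = 0 := by simp
  refine ⟨fun n => ?_, ha0, ?_, coeff_zero_risingSeries _ _, fun z => ?_⟩
  · exact monic_sum_C_mul (fun k => ⟨Polynomial.monic_X_pow k, Polynomial.natDegree_X_pow k⟩)
      (fun j => (n.choose j : ℂ) * (-1) ^ (n - j) *
        (ascPochhammer ℂ (n - j)).eval ((κ : ℂ) + 1 + j)) (by simp)
  · rw [mul_comm, show (1 : ℕ) = 0 + 1 from rfl, PowerSeries.coeff_succ_mul_X]
    simp [geomSeries]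
  set c : ℂ := κ + 1
  set v := geomSeries (-1)
  set a := PowerSeries.X * v
  have hv : v * (1 + PowerSeries.X) = 1 := by
    have := geomSeries_mul (-1)
    rwa [map_neg, map_one, neg_one_mul, sub_neg_eq_add] at this
  have h1 : PowerSeries.mk (fun n => (laguerre κ n).eval z / (n.factorial : ℂ)) =
      expS (z • a) * risingSeries (-1) (-c) := by
    ext n
    rw [coeff_expS_mul (coeff_zero_smul ha0 z), PowerSeries.coeff_mk, laguerre,
      Polynomial.eval_finsetSum, Finset.sum_div]
    refine Finset.sum_congr rfl fun j hj => ?_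
    have hj' : j ≤ n := Nat.lt_succ_iff.1 (Finset.mem_range.1 hj)
    obtain ⟨m, rfl⟩ := Nat.exists_eq_add_of_le' hj'
    -- The denominator of `a ^ j` shifts the exponent `-c` to `-(c + j)`, which produces the
    -- parameter `κ + 1 + j` in the polynomials.
    have h2 : (z • a) ^ j * risingSeries (-1) (-c) =
        z ^ j • (risingSeries (-1) (-(c + j)) * PowerSeries.X ^ j) := by
      rw [show -(c + j) = -c + j * (-1) by ring, risingSeries_add_mul, smul_pow, smul_mul_assoc, mul_pow]
      congr 1
      ring
    rw [h2, map_smul, PowerSeries.coeff_mul_X_pow, risingSeries, PowerSeries.coeff_mk,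
      Nat.add_sub_cancel, Polynomial.eval_mul, Polynomial.eval_C, Polynomial.eval_pow, Polynomial.eval_X,
      Nat.cast_choose ℂ hj', Nat.add_sub_cancel, eval_ascPochhammer]
    have h3 : ∀ i : ℕ, -(c + j) + -1 * i = -1 * (c + j + 1 * i) := fun i => by ring
    simp only [h3, Finset.prod_mul_distrib, Finset.prod_const, Finset.card_range]
    have h4 : ((m + j).factorial : ℂ) ≠ 0 := by exact_mod_cast (m + j).factorial_ne_zero
    rw [smul_eq_mul, show (κ : ℂ) + 1 = c from rfl]
    field_simp
  -- The product `(1 + u) ^ (-c) r(a(u))` has derivative zero and constant term one.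
  have h2 : risingSeries (-1) (-c) * (risingSeries 1 c).subst a = 1 := by
    have hs := hasSubst_of_coeff ha0
    have hv' : 1 - a = v := by rw [← hv]; ring
    have hgv : (geomSeries 1).subst a * v = 1 := by
      have := congrArg (PowerSeries.substAlgHom hs) (geomSeries_mul 1)
      rw [map_one PowerSeries.C, one_mul, map_mul, map_sub, map_one,
        PowerSeries.coe_substAlgHom, PowerSeries.subst_X hs] at this
      rw [← hv']
      exact this
    have hdv : PowerSeries.derivative ℂ v = -v * v := by
      have h3 := congrArg (PowerSeries.derivative ℂ) hv
      rw [Derivation.leibniz, map_add, Derivation.map_one_eq_zero, PowerSeries.derivative_X,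
        smul_eq_mul, smul_eq_mul] at h3
      calc PowerSeries.derivative ℂ v = v * (1 + PowerSeries.X) * PowerSeries.derivative ℂ v := by
            rw [hv, one_mul]
        _ = v * (v * (0 + 1) + (1 + PowerSeries.X) * PowerSeries.derivative ℂ v) - v * v := by ring
        _ = -v * v := by rw [h3]; ring
    have hda : PowerSeries.derivative ℂ a = v * v := by
      rw [Derivation.leibniz, PowerSeries.derivative_X, hdv, smul_eq_mul, smul_eq_mul]
      calc PowerSeries.X * (-v * v) + v * 1 = v * (1 - a) := by ring
        _ = v * v := by rw [hv']
    have hd : PowerSeries.derivative ℂ ((risingSeries 1 c).subst a) =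
        c • (v * (risingSeries 1 c).subst a) := by
      rw [PowerSeries.derivative_subst hs, derivative_risingSeries, hda, ← PowerSeries.coe_substAlgHom hs,
        map_mul, map_smul, PowerSeries.coe_substAlgHom, smul_mul_assoc, smul_mul_assoc]
      congr 1
      calc _ = ((geomSeries 1).subst a * v) * (v * (risingSeries 1 c).subst a) := by ring
        _ = _ := by rw [hgv, one_mul]
    refine eq_of_derivative_eq_mul (u := 0) ?_ ?_ ?_
    · rw [Derivation.leibniz, hd, derivative_risingSeries, smul_eq_mul, smul_eq_mul, zero_mul, neg_smul,
        neg_mul, mul_neg, mul_smul_comm, smul_mul_assoc, mul_smul_comm, ← sub_eq_add_neg, ← smul_sub]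
      rw [show risingSeries (-1) (-c) * (v * (risingSeries 1 c).subst a) -
        (risingSeries 1 c).subst a * (v * risingSeries (-1) (-c)) = 0 by ring, smul_zero]
    · simp
    · rw [coeff_zero_mul, coeff_zero_risingSeries, coeff_zero_subst _ ha0, coeff_zero_risingSeries]
      simp
  rw [h1, mul_assoc, h2, mul_one]
  rfl

lemma growth_geomSeries {ε : ℂ} (hε : ‖ε‖ = 1) : Growth (PowerSeries.X * geomSeries ε) := by
  refine ⟨1, 1, one_pos, one_pos, fun n => ?_⟩
  rw [mul_comm, one_pow, mul_one]
  rcases n with _ | n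
  · simp
  · rw [PowerSeries.coeff_succ_mul_X, geomSeries, PowerSeries.coeff_mk, norm_pow, hε, one_pow]

lemma growth_risingSeries {ε : ℂ} (hε : ‖ε‖ = 1) (z : ℂ) : Growth (risingSeries ε z) := by
  rw [← expS_smul_logSeries]
  exact growth_exp.subst ((growth_logSeries hε).smul z) (coeff_zero_smul (coeff_zero_logSeries ε) z)

/-- The classical sequences are Sheffer sequences with holomorphic series. -/
lemma exists_isScalarSheffer {s : ℕ → Polynomial ℂ}
    (hs : s = descPochhammer ℂ ∨ s = ascPochhammer ℂ ∨ s = charlier ∨ ∃ κ : ℝ, -1 ≤ κ ∧ s = laguerre κ) :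
    ∃ a r : PowerSeries ℂ, IsScalarSheffer a r s ∧ IsHolomorphicSeries a ∧ IsHolomorphicSeries r := by
  have h1 : ‖(-1 : ℂ)‖ = 1 := by simp
  have h2 : ‖(1 : ℂ)‖ = 1 := by simp
  rcases hs with rfl | rfl | rfl | ⟨κ, -, rfl⟩
  · exact ⟨_, _, isScalarSheffer_descPochhammer, (growth_logSeries h1).isHolomorphicSeries,
      growth_one.isHolomorphicSeries⟩
  · exact ⟨_, _, isScalarSheffer_ascPochhammer, (growth_logSeries h2).isHolomorphicSeries,
      growth_one.isHolomorphicSeries⟩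
  · obtain ⟨a, r, h, ha, hr⟩ := exists_isScalarSheffer_charlier
    exact ⟨a, r, h, ha.isHolomorphicSeries, hr.isHolomorphicSeries⟩
  · exact ⟨_, _, isScalarSheffer_laguerre κ, (growth_geomSeries h1).isHolomorphicSeries,
      (growth_risingSeries h2 _).isHolomorphicSeries⟩

end Examples

/-! ### A Sobolev inequality and bounds for partial derivatives -/

section Analysis

open MeasureTheory FourierTransform

variable {d : ℕ}

/-- A pointwise Sobolev inequality. -/
lemma exists_sobolev_bound (d : ℕ) : ∃ C : ℝ, 0 ≤ C ∧ ∀ f : RSpace d → ℂ, ContDiff ℝ (⊤ : ℕ∞) f →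
    (∀ l ≤ d + 1, Integrable fun x => ‖iteratedFDeriv ℝ l f x‖) → ∀ x,
    ‖f x‖ ≤ C * ∑ l ∈ Finset.range (d + 2), ∫ y, ‖iteratedFDeriv ℝ l f y‖ := by
  refine ⟨2 ^ (d + 1) * (1 + 2 ^ (d + 1)) * ∫ w : RSpace d, (1 + ‖w‖) ^ (-((d : ℝ) + 1)),
    mul_nonneg (by positivity) (integral_nonneg fun w => by positivity), fun f hf hi x => ?_⟩
  set S := ∑ l ∈ Finset.range (d + 2), ∫ y, ‖iteratedFDeriv ℝ l f y‖
  have hS : ∀ l ∈ Finset.range (d + 2), 0 ≤ ∫ y, ‖iteratedFDeriv ℝ l f y‖ := fun l _ =>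
    integral_nonneg fun y => norm_nonneg _
  have hfi : Integrable f := by
    have := hi 0 (by omega)
    simp only [norm_iteratedFDeriv_zero] at this
    exact (integrable_norm_iff hf.continuous.aestronglyMeasurable).1 this
  have hbound : ∀ n ≤ d + 1, ∀ w, ‖w‖ ^ n * ‖𝓕 f w‖ ≤ 2 ^ n * S := by
    intro n hn w
    have h := Real.pow_mul_norm_iteratedFDeriv_fourier_le (K := 0) (N := ((d + 1 : ℕ) : ℕ∞)) (f := f)
      (hf.of_le (by exact_mod_cast le_top)) (fun k l hk hl => by
        have hk0 : k = 0 := by simpa using hk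
        subst hk0
        simpa using hi l (by exact_mod_cast hl)) (k := 0) (n := n) le_rfl (by exact_mod_cast hn) w
    rw [norm_iteratedFDeriv_zero] at h
    refine h.trans ?_
    simp only [pow_zero, one_mul, Nat.cast_zero, mul_zero, zero_add, Finset.range_one,
      Finset.singleton_product, Finset.sum_map, Function.Embedding.coeFn_mk]
    exact mul_le_mul_of_nonneg_left (Finset.sum_le_sum_of_subset_of_nonneg
      (Finset.range_mono (by omega)) fun l hl _ => hS l hl) (by positivity)
  have hS0 : 0 ≤ S := Finset.sum_nonneg hS
  -- With `d + 1` integrable derivatives the Fourier transform decays like `(1 + ‖w‖) ^ (-(d + 1))`.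
  -- It is therefore integrable, and Fourier inversion bounds `f` pointwise.
  have hF : ∀ w, ‖𝓕 f w‖ ≤ 2 ^ (d + 1) * (1 + 2 ^ (d + 1)) * S * (1 + ‖w‖) ^ (-((d : ℝ) + 1)) := by
    intro w
    have h0 := hbound 0 (by omega) w
    have h1 := hbound (d + 1) le_rfl w
    have h2 : (1 + ‖w‖) ^ (d + 1) ≤ 2 ^ (d + 1) * (1 + ‖w‖ ^ (d + 1)) := by
      have h := add_pow_le (zero_le_one (α := ℝ)) (norm_nonneg w) (d + 1)
      rw [one_pow] at h
      refine h.trans (mul_le_mul_of_nonneg_right ?_ (by positivity))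
      exact pow_le_pow_right₀ (by norm_num) (by omega)
    rw [Real.rpow_neg (by positivity), show ((d : ℝ) + 1) = ((d + 1 : ℕ) : ℝ) by push_cast; rfl,
      Real.rpow_natCast, ← div_eq_mul_inv, le_div_iff₀ (by positivity)]
    calc ‖𝓕 f w‖ * (1 + ‖w‖) ^ (d + 1) ≤ ‖𝓕 f w‖ * (2 ^ (d + 1) * (1 + ‖w‖ ^ (d + 1))) :=
          mul_le_mul_of_nonneg_left h2 (norm_nonneg _)
      _ = 2 ^ (d + 1) * (‖w‖ ^ 0 * ‖𝓕 f w‖ + ‖w‖ ^ (d + 1) * ‖𝓕 f w‖) := by ring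
      _ ≤ 2 ^ (d + 1) * (2 ^ 0 * S + 2 ^ (d + 1) * S) := by gcongr
      _ = _ := by ring
  have hint : Integrable fun w : RSpace d => (1 + ‖w‖) ^ (-((d : ℝ) + 1)) :=
    integrable_one_add_norm (by simp)
  have hFc : Continuous (𝓕 f) :=
    VectorFourier.fourierIntegral_continuous Real.continuous_fourierChar continuous_inner hfi
  have hFi : Integrable (𝓕 f) := (hint.const_mul _).mono' hFc.aestronglyMeasurable
    (Filter.Eventually.of_forall hF)
  have hinv := congrFun (hf.continuous.fourierInv_fourier_eq hfi hFi) x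
  rw [← hinv, Real.fourierInv_eq]
  calc _ ≤ ∫ w, ‖𝓕 f w‖ := by
        refine (norm_integral_le_integral_norm _).trans_eq ?_
        simp only [Circle.norm_smul]
    _ ≤ ∫ w, 2 ^ (d + 1) * (1 + 2 ^ (d + 1)) * S * (1 + ‖w‖) ^ (-((d : ℝ) + 1)) :=
        integral_mono hFi.norm (hint.const_mul _) hF
    _ = _ := by rw [integral_const_mul]; ring

/-- The value of a multilinear form on the standard basis. -/
def applyBasis {j : ℕ} (i : Fin j → Fin d) :
    ContinuousMultilinearMap ℝ (fun _ : Fin j => RSpace d) ℂ →L[ℝ] ℂ :=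
  ContinuousMultilinearMap.apply ℝ (fun _ : Fin j => RSpace d) ℂ fun l => EuclideanSpace.single (i l) 1

lemma partialD_contDiff {f : RSpace d → ℂ} (hf : ContDiff ℝ (⊤ : ℕ∞) f) (j : ℕ) (i : Fin j → Fin d) :
    ContDiff ℝ (⊤ : ℕ∞) (partialD f j i) :=
  (applyBasis i).contDiff.comp (hf.iteratedFDeriv_right (by exact_mod_cast le_top))

lemma partialD_succ {f : RSpace d → ℂ} (hf : ContDiff ℝ (⊤ : ℕ∞) f) (j : ℕ) (i : Fin (j + 1) → Fin d) :
    partialD f (j + 1) i = partialD (fun y => fderiv ℝ f y (EuclideanSpace.single (i (Fin.last j)) 1)) j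
      (Fin.init i) := by
  funext x
  have hf' : ContDiff ℝ (⊤ : ℕ∞) (fderiv ℝ f) := hf.fderiv_right (by exact_mod_cast le_top)
  have h := (ContinuousLinearMap.apply ℝ ℂ
    (EuclideanSpace.single (i (Fin.last j)) (1 : ℝ) : RSpace d)).iteratedFDeriv_comp_left
    hf'.contDiffAt (x := x) (i := j) (by exact_mod_cast le_top)
  rw [partialD, iteratedFDeriv_succ_apply_right]
  exact (congrArg (fun M => M fun l => EuclideanSpace.single (Fin.init i l) 1) h).symm

/-- Evaluation at a unit vector has norm at most one, so each partial derivative costs no more than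
one full derivative. -/
lemma norm_iteratedFDeriv_partialD_le {f : RSpace d → ℂ} (hf : ContDiff ℝ (⊤ : ℕ∞) f) (l j : ℕ)
    (i : Fin j → Fin d) (x : RSpace d) :
    ‖iteratedFDeriv ℝ l (partialD f j i) x‖ ≤ ‖iteratedFDeriv ℝ (l + j) f x‖ := by
  induction j generalizing f with
  | zero => rfl
  | succ j ih =>
    have hf' : ContDiff ℝ (⊤ : ℕ∞) (fderiv ℝ f) := hf.fderiv_right (by exact_mod_cast le_top)
    let L := ContinuousLinearMap.apply ℝ ℂ (EuclideanSpace.single (i (Fin.last j)) (1 : ℝ) : RSpace d)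
    have hL : ‖L‖ ≤ 1 := ContinuousLinearMap.opNorm_le_bound _ zero_le_one fun M => by
      rw [one_mul]
      exact (M.le_opNorm _).trans (by simp)
    rw [partialD_succ hf, ← add_assoc, ← norm_iteratedFDeriv_fderiv]
    refine (ih (L.contDiff.comp hf') (Fin.init i)).trans ?_
    refine (L.norm_iteratedFDeriv_comp_left hf'.contDiffAt (by exact_mod_cast le_top)).trans ?_
    exact mul_le_of_le_one_left (norm_nonneg _) hL

/-- The norm of a derivative in terms of partial derivatives. -/
lemma norm_iteratedFDeriv_le_sum (f : RSpace d → ℂ) (j : ℕ) (x : RSpace d) :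
    ‖iteratedFDeriv ℝ j f x‖ ≤ ∑ i : Fin j → Fin d, ‖partialD f j i x‖ := by
  refine ContinuousMultilinearMap.opNorm_le_bound
    (Finset.sum_nonneg fun i _ => norm_nonneg _) fun u => ?_
  have hu : u = fun l => ∑ k : Fin d, u l k • (EuclideanSpace.single k (1 : ℝ) : RSpace d) := by
    funext l
    have := (EuclideanSpace.basisFun (Fin d) ℝ).sum_repr (u l)
    simpa using this.symm
  have h1 : iteratedFDeriv ℝ j f x u =
      ∑ i : Fin j → Fin d, (∏ l, u l (i l)) • partialD f j i x := by
    conv_lhs => rw [hu]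
    have h2 := (iteratedFDeriv ℝ j f x).toMultilinearMap.map_sum
      (fun (l : Fin j) (k : Fin d) => u l k • (EuclideanSpace.single k (1 : ℝ) : RSpace d))
    refine h2.trans (Finset.sum_congr rfl fun i _ => ?_)
    exact (iteratedFDeriv ℝ j f x).toMultilinearMap.map_smul_univ (fun l => u l (i l))
      fun l => EuclideanSpace.single (i l) 1
  rw [h1, Finset.sum_mul]
  refine (norm_sum_le _ _).trans (Finset.sum_le_sum fun i _ => ?_)
  rw [norm_smul, mul_comm, norm_prod]
  refine mul_le_mul_of_nonneg_left (Finset.prod_le_prod (fun l _ => norm_nonneg _) fun l _ => ?_)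
    (norm_nonneg _)
  exact PiLp.norm_apply_le (u l) (i l)

end Analysis

/-! ### Weighted pointwise bounds, nuclearity and the integral -/

section

open MeasureTheory

variable {T Φ : Type} [AddCommGroup Φ] [Module ℂ Φ] {H : HilbertScale T Φ} {d : ℕ}

/-- A weight on `ℝ^d` with integrable inverse. -/
def polyWeight (x : RSpace d) : ℝ := (1 + ‖x‖ ^ 2) ^ (d + 1)

lemma one_le_polyWeight (x : RSpace d) : 1 ≤ polyWeight x :=
  one_le_pow₀ (by nlinarith [sq_nonneg ‖x‖])

lemma polyWeight_pos (x : RSpace d) : 0 < polyWeight x := zero_lt_one.trans_le (one_le_polyWeight x)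

lemma integrable_inv_polyWeight : Integrable fun x : RSpace d => (polyWeight x)⁻¹ := by
  have h := integrable_rpow_neg_one_add_norm_sq (E := RSpace d) (μ := volume)
    (r := 2 * ((d + 1 : ℕ) : ℝ)) (by
      rw [finrank_euclideanSpace, Fintype.card_fin]; push_cast; linarith)
  refine h.congr (Filter.Eventually.of_forall fun x => ?_)
  simp only [polyWeight]
  rw [neg_div, mul_div_cancel_left₀ _ (two_ne_zero), Real.rpow_neg (by positivity), Real.rpow_natCast]

/-- A scale of weighted Sobolev spaces whose projective limit consists of smooth functions and is
determined by the decay of the derivatives. -/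
structure SobolevScale (H : HilbertScale T Φ) (κ : Φ →ₗ[ℂ] (RSpace d → ℂ)) where
  ord : T → ℕ
  wt : T → RSpace d → ℝ
  one_le_wt : ∀ τ x, 1 ≤ wt τ x
  injective : Function.Injective κ
  smooth : ∀ ξ : Nuc H, ContDiff ℝ (⊤ : ℕ∞) (κ ξ.val)
  norm_sq : ∀ τ (ξ : Nuc H), nucNorm H τ ξ ^ 2 = ∑ j ∈ Finset.range (ord τ + 1),
    ∑ i : Fin j → Fin d, ∫ x, ‖partialD (κ ξ.val) j i x‖ ^ 2 * wt τ x
  integrable : ∀ τ (ξ : Nuc H) (j : ℕ) (i : Fin j → Fin d),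
    Integrable fun x => ‖partialD (κ ξ.val) j i x‖ ^ 2 * wt τ x
  -- The smooth function `v` multiplies a test function before the Sobolev inequality is applied: it
  -- dominates the weight that the pointwise bound should contain, and another weight of the scale
  -- controls its derivatives.
  exists_weight : ∀ τ n, ∃ v : RSpace d → ℝ, ContDiff ℝ (⊤ : ℕ∞) v ∧
    (∀ x, wt τ x * polyWeight x ^ 2 ≤ v x ^ 2) ∧ ∃ τ' K, n ≤ ord τ' ∧ 0 ≤ K ∧
      ∀ l ≤ n, ∀ x, ‖iteratedFDeriv ℝ l v x‖ ^ 2 * polyWeight x ≤ K * wt τ' x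
  complete : ∀ F : RSpace d → ℂ, ContDiff ℝ (⊤ : ℕ∞) F →
    (∀ τ, ∃ K, ∀ j ≤ ord τ, ∀ (i : Fin j → Fin d) x, wt τ x * ‖partialD F j i x‖ ^ 2 ≤ K) →
    ∃ ξ : Nuc H, κ ξ.val = F

namespace SobolevScale

variable {κ : Φ →ₗ[ℂ] (RSpace d → ℂ)} (𝓢 : SobolevScale H κ)

/-- The square root of the weight of index `τ`, with some additional decay. -/
def root (τ : T) (x : RSpace d) : ℝ := √(𝓢.wt τ x) * polyWeight x

lemma polyWeight_le_root (τ : T) (x : RSpace d) : polyWeight x ≤ 𝓢.root τ x :=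
  le_mul_of_one_le_left (polyWeight_pos x).le (Real.one_le_sqrt.2 (𝓢.one_le_wt τ x))

lemma one_le_root (τ : T) (x : RSpace d) : 1 ≤ 𝓢.root τ x :=
  (one_le_polyWeight x).trans (𝓢.polyWeight_le_root τ x)

lemma root_pos (τ : T) (x : RSpace d) : 0 < 𝓢.root τ x := zero_lt_one.trans_le (𝓢.one_le_root τ x)

lemma root_sq (τ : T) (x : RSpace d) : 𝓢.root τ x ^ 2 = 𝓢.wt τ x * polyWeight x ^ 2 := by
  rw [root, mul_pow, Real.sq_sqrt (zero_le_one.trans (𝓢.one_le_wt τ x))]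

/-- The sum of the squares of the derivatives, times the weight. -/
def density (τ : T) (ξ : Nuc H) (x : RSpace d) : ℝ := ∑ j ∈ Finset.range (𝓢.ord τ + 1),
    ∑ i : Fin j → Fin d, ‖partialD (κ ξ.val) j i x‖ ^ 2 * 𝓢.wt τ x

lemma integrable_density (τ : T) (ξ : Nuc H) : Integrable (𝓢.density τ ξ) :=
  integrable_finsetSum _ fun j _ => integrable_finsetSum _ fun i _ => 𝓢.integrable τ ξ j i

lemma integral_density (τ : T) (ξ : Nuc H) : ∫ x, 𝓢.density τ ξ x = nucNorm H τ ξ ^ 2 := by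
  rw [𝓢.norm_sq]
  unfold density
  rw [integral_finsetSum _ fun j _ => integrable_finsetSum _ fun i _ => 𝓢.integrable τ ξ j i]
  exact Finset.sum_congr rfl fun j _ => integral_finsetSum _ fun i _ => 𝓢.integrable τ ξ j i

lemma sq_norm_iteratedFDeriv_le (τ : T) (ξ : Nuc H) {j : ℕ} (hj : j ≤ 𝓢.ord τ) (x : RSpace d) :
    ‖iteratedFDeriv ℝ j (κ ξ.val) x‖ ^ 2 * 𝓢.wt τ x ≤ (d + 1) ^ 𝓢.ord τ * 𝓢.density τ ξ x := by
  have hw := zero_le_one.trans (𝓢.one_le_wt τ x)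
  have h1 := pow_le_pow_left₀ (norm_nonneg _) (norm_iteratedFDeriv_le_sum (κ ξ.val) j x) 2
  have h2 : (∑ i : Fin j → Fin d, ‖partialD (κ ξ.val) j i x‖) ^ 2 ≤
      (d : ℝ) ^ j * ∑ i : Fin j → Fin d, ‖partialD (κ ξ.val) j i x‖ ^ 2 := by
    have := sq_sum_le_card_mul_sum_sq (s := (Finset.univ : Finset (Fin j → Fin d)))
      (f := fun i => ‖partialD (κ ξ.val) j i x‖)
    simpa using this
  have h3 : ∑ i : Fin j → Fin d, ‖partialD (κ ξ.val) j i x‖ ^ 2 * 𝓢.wt τ x ≤ 𝓢.density τ ξ x :=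
    Finset.single_le_sum (f := fun j => ∑ i : Fin j → Fin d, ‖partialD (κ ξ.val) j i x‖ ^ 2 * 𝓢.wt τ x)
      (fun j _ => Finset.sum_nonneg fun i _ => mul_nonneg (sq_nonneg _) hw)
      (Finset.mem_range.2 (by omega))
  have h4 : (d : ℝ) ^ j ≤ (d + 1) ^ 𝓢.ord τ :=
    (pow_le_pow_left₀ (by positivity) (by linarith) j).trans
      (pow_le_pow_right₀ (by linarith [Nat.cast_nonneg (α := ℝ) d]) hj)
  calc _ ≤ (d : ℝ) ^ j * (∑ i : Fin j → Fin d, ‖partialD (κ ξ.val) j i x‖ ^ 2) * 𝓢.wt τ x :=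
        mul_le_mul_of_nonneg_right (h1.trans h2) hw
    _ = (d : ℝ) ^ j * ∑ i : Fin j → Fin d, ‖partialD (κ ξ.val) j i x‖ ^ 2 * 𝓢.wt τ x := by
        rw [mul_assoc, Finset.sum_mul]
    _ ≤ _ := mul_le_mul h4 h3 (Finset.sum_nonneg fun i _ => mul_nonneg (sq_nonneg _) hw)
        (by positivity)

/-- Splits an integrand into a fixed integrable function and a square controlled by a Sobolev norm.
-/
lemma le_add_sq_div {s y : ℝ} (hs : 0 ≤ s) (hy : 0 < y) : s ≤ y + s ^ 2 / y := by
  rw [← sub_le_iff_le_add', le_div_iff₀ hy]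
  nlinarith [sq_nonneg (s - y), mul_nonneg hs hy.le]

/-- Elements of `Φ` and their derivatives are bounded pointwise, with weights, by the Sobolev norms. -/
lemma exists_partialD_bound (τ : T) (n : ℕ) : ∃ τ' K, 0 ≤ K ∧ ∀ (ξ : Nuc H), ∀ j ≤ n,
    ∀ (i : Fin j → Fin d) x, 𝓢.root τ x * ‖partialD (κ ξ.val) j i x‖ ≤ K * nucNorm H τ' ξ := by
  obtain ⟨C, hC, hsob⟩ := exists_sobolev_bound d
  -- The order covers the `n` derivatives to be bounded and the `d + 1` further ones that the
  -- Sobolev inequality consumes.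
  obtain ⟨v, hv, hvw, τ', K, hord, hK, hvK⟩ := 𝓢.exists_weight τ (n + (d + 1))
  set J := ∫ x : RSpace d, (polyWeight x)⁻¹
  have hJ : 0 ≤ J := integral_nonneg fun x => inv_nonneg.2 (polyWeight_pos x).le
  set B := K * (d + 1) ^ 𝓢.ord τ' with hB
  refine ⟨τ', C * ∑ l ∈ Finset.range (d + 2), 2 ^ l * (J + B), by positivity,
    fun ξ j hj i x => ?_⟩
  rcases (apply_nonneg (nucNorm H τ') ξ).eq_or_lt with h0 | hN
  · have hξ : ξ = 0 := eq_zero_of_nucNorm_eq_zero h0.symm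
    have : partialD (κ ξ.val) j i x = 0 := by
      have h := partialD_smul (𝓢.smooth ξ) 0 j i x
      rw [zero_smul, zero_mul] at h
      rw [hξ]
      refine (congrArg (fun f => partialD f j i x) ?_).trans h
      exact map_zero κ
    rw [this, norm_zero, mul_zero, ← h0, mul_zero]
  set N := nucNorm H τ' ξ
  set f := κ ξ.val
  set g : RSpace d → ℂ := fun y => v y • partialD f j i y with hg
  have hpd := partialD_contDiff (𝓢.smooth ξ) j i
  have hgs : ContDiff ℝ (⊤ : ℕ∞) g := hv.smul hpd
  -- Leibniz' rule and `le_add_sq_div` with the splitting point `N / polyWeight y`. Scaling by the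
  -- norm `N` makes both integrals proportional to `N`: the first is `N * J`, the second `N⁻¹ * (B *
  -- N ^ 2)`.
  have hD : ∀ l ≤ d + 1, ∀ y, ‖iteratedFDeriv ℝ l g y‖ ≤
      2 ^ l * (N * (polyWeight y)⁻¹ + N⁻¹ * (B * 𝓢.density τ' ξ y)) := by
    intro l hl y
    have h1 := norm_iteratedFDeriv_smul_le (𝕜 := ℝ) (n := l) (N := ((⊤ : ℕ∞) : WithTop ℕ∞))
      hv hpd (x := y) (by exact_mod_cast le_top)
    refine h1.trans ?_
    have h2 : (2 : ℝ) ^ l = ∑ a ∈ Finset.range (l + 1), (l.choose a : ℝ) := by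
      exact_mod_cast (Nat.sum_range_choose l).symm
    rw [h2, Finset.sum_mul]
    refine Finset.sum_le_sum fun a ha => ?_
    rw [mul_assoc]
    refine mul_le_mul_of_nonneg_left ?_ (Nat.cast_nonneg _)
    have ha' : a ≤ l := by simpa [Nat.lt_succ_iff] using ha
    have hy := polyWeight_pos y
    have h3 : ‖iteratedFDeriv ℝ a v y‖ * ‖iteratedFDeriv ℝ (l - a) (partialD f j i) y‖ ≤
        ‖iteratedFDeriv ℝ a v y‖ * ‖iteratedFDeriv ℝ (l - a + j) f y‖ :=
      mul_le_mul_of_nonneg_left (norm_iteratedFDeriv_partialD_le (𝓢.smooth ξ) _ _ _ _)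
        (norm_nonneg _)
    refine h3.trans ((le_add_sq_div (by positivity)
      (mul_pos hN (inv_pos.2 hy))).trans (add_le_add le_rfl ?_))
    rw [div_eq_inv_mul, mul_inv, inv_inv, mul_assoc]
    refine mul_le_mul_of_nonneg_left ?_ (inv_nonneg.2 hN.le)
    calc _ = (‖iteratedFDeriv ℝ a v y‖ ^ 2 * polyWeight y) *
          ‖iteratedFDeriv ℝ (l - a + j) f y‖ ^ 2 := by ring
      _ ≤ (K * 𝓢.wt τ' y) * ‖iteratedFDeriv ℝ (l - a + j) f y‖ ^ 2 :=
          mul_le_mul_of_nonneg_right (hvK a (by omega) y) (sq_nonneg _)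
      _ = K * (‖iteratedFDeriv ℝ (l - a + j) f y‖ ^ 2 * 𝓢.wt τ' y) := by ring
      _ ≤ K * ((d + 1) ^ 𝓢.ord τ' * 𝓢.density τ' ξ y) :=
          mul_le_mul_of_nonneg_left (𝓢.sq_norm_iteratedFDeriv_le τ' ξ (by omega) y) hK
      _ = _ := by rw [hB]; ring
  have hi1 : ∀ l : ℕ, Integrable fun y : RSpace d =>
      (2 : ℝ) ^ l * (N * (polyWeight y)⁻¹ + N⁻¹ * (B * 𝓢.density τ' ξ y)) := fun l =>
    ((integrable_inv_polyWeight.const_mul N).add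
      (((𝓢.integrable_density τ' ξ).const_mul B).const_mul N⁻¹)).const_mul _
  have hi2 : ∀ l ≤ d + 1, Integrable fun y => ‖iteratedFDeriv ℝ l g y‖ := fun l hl =>
    (hi1 l).mono' (hgs.continuous_iteratedFDeriv (by exact_mod_cast le_top)).norm.aestronglyMeasurable
      (Filter.Eventually.of_forall fun y => by rw [norm_norm]; exact hD l hl y)
  have hi3 : ∀ l : ℕ, ∫ y : RSpace d,
      (2 : ℝ) ^ l * (N * (polyWeight y)⁻¹ + N⁻¹ * (B * 𝓢.density τ' ξ y)) = 2 ^ l * (J + B) * N := by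
    intro l
    rw [integral_const_mul, integral_add (integrable_inv_polyWeight.const_mul N)
      (((𝓢.integrable_density τ' ξ).const_mul B).const_mul N⁻¹), integral_const_mul,
      integral_const_mul, integral_const_mul, 𝓢.integral_density]
    have h6 : N⁻¹ * (B * N ^ 2) = B * N := by field_simp
    change 2 ^ l * (N * J + N⁻¹ * (B * N ^ 2)) = _
    rw [h6]
    ring
  have h4 := hsob g hgs hi2 x
  have h5 : 𝓢.root τ x ≤ ‖v x‖ := by
    rw [Real.norm_eq_abs]
    refine (le_abs_self _).trans (sq_le_sq.1 ?_)
    rw [𝓢.root_sq]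
    exact hvw x
  calc _ ≤ ‖v x‖ * ‖partialD f j i x‖ := mul_le_mul_of_nonneg_right h5 (norm_nonneg _)
    _ = ‖g x‖ := by rw [hg, norm_smul]
    _ ≤ _ := h4
    _ ≤ C * ∑ l ∈ Finset.range (d + 2), 2 ^ l * (J + B) * N := by
        refine mul_le_mul_of_nonneg_left (Finset.sum_le_sum fun l hl => ?_) hC
        have hl' : l ≤ d + 1 := by simpa [Nat.lt_succ_iff] using hl
        rw [← hi3 l]
        exact integral_mono (hi2 l hl') (hi1 l) (hD l hl')
    _ = _ := by rw [← Finset.sum_mul, mul_assoc]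

lemma exists_iteratedFDeriv_bound (τ : T) (n : ℕ) : ∃ τ' K, 0 ≤ K ∧ ∀ (ξ : Nuc H), ∀ j ≤ n,
    ∀ x, 𝓢.root τ x * ‖iteratedFDeriv ℝ j (κ ξ.val) x‖ ≤ K * nucNorm H τ' ξ := by
  obtain ⟨τ', K, hK, h⟩ := 𝓢.exists_partialD_bound τ n
  refine ⟨τ', (d + 1) ^ n * K, by positivity, fun ξ j hj x => ?_⟩
  have h4 : (d : ℝ) ^ j ≤ (d + 1) ^ n :=
    (pow_le_pow_left₀ (by positivity) (by linarith) j).trans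
      (pow_le_pow_right₀ (by linarith [Nat.cast_nonneg (α := ℝ) d]) hj)
  calc _ ≤ 𝓢.root τ x * ∑ i : Fin j → Fin d, ‖partialD (κ ξ.val) j i x‖ :=
        mul_le_mul_of_nonneg_left (norm_iteratedFDeriv_le_sum _ j x) (𝓢.root_pos τ x).le
    _ = ∑ i : Fin j → Fin d, 𝓢.root τ x * ‖partialD (κ ξ.val) j i x‖ := Finset.mul_sum _ _ _
    _ ≤ ∑ i : Fin j → Fin d, K * nucNorm H τ' ξ := Finset.sum_le_sum fun i _ => h ξ j hj i x
    _ = (d : ℝ) ^ j * (K * nucNorm H τ' ξ) := by simp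
    _ ≤ _ := by
        rw [mul_assoc]
        exact mul_le_mul_of_nonneg_right h4 (mul_nonneg hK (apply_nonneg _ _))

/-- The number of derivatives times the integral of the inverse weight. -/
def total (τ : T) : ℝ := ∑ j ∈ Finset.range (𝓢.ord τ + 1), ∑ _i : Fin j → Fin d,
  ∫ x : RSpace d, (polyWeight x)⁻¹

lemma total_nonneg (τ : T) : 0 ≤ 𝓢.total τ := Finset.sum_nonneg fun _ _ =>
  Finset.sum_nonneg fun _ _ => integral_nonneg fun x => inv_nonneg.2 (polyWeight_pos x).le

/-- The extra factor `polyWeight` in `root` leaves the integrable function `1 / polyWeight` after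
division. Keeping the sum over `k` inside the pointwise bound is what Hilbert-Schmidt sums require.
-/
lemma sum_integral_le {ι : Type*} (τ : T) (s : Finset ι) (ξ : ι → Nuc H) {M : ℝ}
    (h : ∀ j ≤ 𝓢.ord τ, ∀ (i : Fin j → Fin d) x,
      𝓢.root τ x ^ 2 * ∑ k ∈ s, ‖partialD (κ (ξ k).val) j i x‖ ^ 2 ≤ M) :
    ∑ k ∈ s, nucNorm H τ (ξ k) ^ 2 ≤ 𝓢.total τ * M := by
  simp only [𝓢.norm_sq]
  rw [Finset.sum_comm, total, Finset.sum_mul]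
  refine Finset.sum_le_sum fun j hj => ?_
  rw [Finset.sum_comm, Finset.sum_mul]
  refine Finset.sum_le_sum fun i _ => ?_
  rw [← integral_finsetSum _ fun k _ => 𝓢.integrable τ (ξ k) j i, ← integral_mul_const]
  refine integral_mono (integrable_finsetSum _ fun k _ => 𝓢.integrable τ (ξ k) j i)
    (integrable_inv_polyWeight.mul_const M) fun x => ?_
  have hj' : j ≤ 𝓢.ord τ := by simpa [Nat.lt_succ_iff] using hj
  have h1 := h j hj' i x
  have hE := one_le_polyWeight x
  have hw := zero_le_one.trans (𝓢.one_le_wt τ x)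
  rw [𝓢.root_sq] at h1
  change ∑ k ∈ s, ‖partialD (κ (ξ k).val) j i x‖ ^ 2 * 𝓢.wt τ x ≤ (polyWeight x)⁻¹ * M
  rw [← Finset.sum_mul, inv_mul_eq_div, le_div_iff₀ (polyWeight_pos x)]
  refine le_trans ?_ h1
  have hS : 0 ≤ ∑ k ∈ s, ‖partialD (κ (ξ k).val) j i x‖ ^ 2 := Finset.sum_nonneg fun _ _ => sq_nonneg _
  nlinarith [mul_nonneg (mul_nonneg hS hw) (mul_nonneg (polyWeight_pos x).le (sub_nonneg.2 hE))]

lemma nucNorm_le {τ : T} {ξ : Nuc H} {M : ℝ} (hM : 0 ≤ M)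
    (h : ∀ j ≤ 𝓢.ord τ, ∀ (i : Fin j → Fin d) x, 𝓢.root τ x * ‖partialD (κ ξ.val) j i x‖ ≤ M) :
    nucNorm H τ ξ ≤ √(𝓢.total τ) * M := by
  have h1 := 𝓢.sum_integral_le τ {()} (fun _ => ξ) (M := M ^ 2) fun j hj i x => by
    rw [Finset.sum_singleton, ← mul_pow]
    exact pow_le_pow_left₀ (mul_nonneg (𝓢.root_pos τ x).le (norm_nonneg _)) (h j hj i x) 2
  rw [Finset.sum_singleton] at h1
  refine abs_le_of_sq_le_sq' ?_ (by positivity) |>.2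
  rwa [mul_pow, Real.sq_sqrt (𝓢.total_nonneg τ)]

include 𝓢 in
lemma val_partialD_add (ξ η : Nuc H) (j : ℕ) (i : Fin j → Fin d) (x : RSpace d) :
    partialD (κ (ξ + η).val) j i x = partialD (κ ξ.val) j i x + partialD (κ η.val) j i x := by
  rw [← partialD_add (𝓢.smooth ξ) (𝓢.smooth η)]
  exact congrArg (fun f => partialD f j i x) (map_add κ ξ.val η.val)

include 𝓢 in
lemma val_partialD_smul (c : ℂ) (ξ : Nuc H) (j : ℕ) (i : Fin j → Fin d) (x : RSpace d) :
    partialD (κ (c • ξ).val) j i x = c * partialD (κ ξ.val) j i x := by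
  rw [← partialD_smul (𝓢.smooth ξ)]
  exact congrArg (fun f => partialD f j i x) (map_smul κ c ξ.val)

/-- The derivative of the delta function at `x`. -/
def delta (j : ℕ) (i : Fin j → Fin d) (x : RSpace d) : CoNuc H :=
  let L : Nuc H →ₗ[ℂ] ℂ :=
    { toFun := fun ξ => partialD (κ ξ.val) j i x
      map_add' := fun ξ η => 𝓢.val_partialD_add ξ η j i x
      map_smul' := fun c ξ => 𝓢.val_partialD_smul c ξ j i x }
  ⟨L, by
    have := H.nonempty
    obtain ⟨τ', K, hK, h⟩ := 𝓢.exists_partialD_bound this.some j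
    refine continuous_of_bound τ' L K fun ξ => (h ξ j le_rfl i x).trans' ?_
    exact le_mul_of_one_le_left (norm_nonneg _) (𝓢.one_le_root _ x)⟩

lemma delta_apply (j : ℕ) (i : Fin j → Fin d) (x : RSpace d) (ξ : Nuc H) :
    𝓢.delta j i x ξ = partialD (κ ξ.val) j i x := rfl

lemma exists_dualLE_delta (τ : T) (n : ℕ) : ∃ τ' K, 0 ≤ K ∧ ∀ j ≤ n, ∀ (i : Fin j → Fin d) x,
    DualLE H τ' (K / 𝓢.root τ x) (𝓢.delta j i x) := by
  obtain ⟨τ', K, hK, h⟩ := 𝓢.exists_partialD_bound τ n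
  refine ⟨τ', K, hK, fun j hj i x => ⟨div_nonneg hK (𝓢.root_pos τ x).le, fun ξ => ?_⟩⟩
  rw [div_mul_eq_mul_div, le_div_iff₀ (𝓢.root_pos τ x), mul_comm ‖_‖]
  exact h ξ j hj i x

/-- Bessel's inequality for a bounded functional. -/
lemma DualLE.sum_sq_le {τ : T} {B : ℝ} {ω : CoNuc H} (h : DualLE H τ B ω) {N : ℕ}
    (f : Fin N → Nuc H) (hf : Orthonormal ℂ fun k => toLevel H τ (f k)) :
    ∑ k, ‖ω (f k)‖ ^ 2 ≤ B ^ 2 := by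
  set S := ∑ k, ‖ω (f k)‖ ^ 2
  have hS : 0 ≤ S := Finset.sum_nonneg fun _ _ => sq_nonneg _
  -- For this test vector both `ω η` and the square of the norm of `η` equal `S`.
  set η : Nuc H := ∑ k, starRingEnd ℂ (ω (f k)) • f k with hη
  have h1 : ω η = (S : ℂ) := by
    rw [hη, map_sum]
    simp only [S]
    push_cast
    refine Finset.sum_congr rfl fun k _ => ?_
    rw [map_smul, smul_eq_mul, Complex.conj_mul']
  have h2 : nucNorm H τ η ^ 2 = S := by
    have h3 : toLevel H τ η = ∑ k, starRingEnd ℂ (ω (f k)) • toLevel H τ (f k) := by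
      rw [hη, map_sum]
      exact Finset.sum_congr rfl fun k _ => map_smul _ _ _
    have h4 := hf.inner_sum (fun k => starRingEnd ℂ (ω (f k))) (fun k => starRingEnd ℂ (ω (f k)))
      Finset.univ
    have h5 : ‖toLevel H τ η‖ ^ 2 = S := by
      have h6 := inner_self_eq_norm_sq_to_K (𝕜 := ℂ) (toLevel H τ η)
      rw [h3, h4] at h6
      rw [h3]
      have h7 : ((S : ℝ) : ℂ) = ((‖∑ k, starRingEnd ℂ (ω (f k)) • toLevel H τ (f k)‖ ^ 2 : ℝ) : ℂ) := by
        push_cast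
        refine Eq.trans ?_ h6
        simp only [S]
        push_cast
        refine Finset.sum_congr rfl fun k _ => ?_
        rw [Complex.conj_conj, mul_comm, Complex.conj_mul']
      exact_mod_cast h7.symm
    exact h5
  have h3 := h.2 η
  rw [h1, Complex.norm_real, Real.norm_of_nonneg hS] at h3
  have h4 := pow_le_pow_left₀ hS h3 2
  rw [mul_pow, h2] at h4
  rcases hS.eq_or_lt with h0 | h0
  · rw [← h0]; positivity
  · nlinarith

include 𝓢 in
-- Evaluation of a derivative at `x` is a functional of norm at most `K / root x` on some `H_{τ'}`.
-- Bessel's inequality bounds the squares of the derivatives of an orthonormal family, summed at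
-- `x`, by `(K / root x) ^ 2`; integration over `x` gives the Hilbert-Schmidt sum.
lemma isNuclear : IsNuclear H := by
  intro τ
  obtain ⟨τ', K, hK, h⟩ := 𝓢.exists_dualLE_delta τ (𝓢.ord τ)
  refine ⟨τ', 1 + √(𝓢.total τ) * K, le_add_of_nonneg_right (by positivity), fun N f hf => ?_⟩
  refine (𝓢.sum_integral_le τ Finset.univ f (M := K ^ 2) fun j hj i x => ?_).trans ?_
  · have h1 := DualLE.sum_sq_le (h j hj i x) f hf
    rw [div_pow, le_div_iff₀ (pow_pos (𝓢.root_pos τ x) 2), mul_comm] at h1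
    exact h1
  · rw [← Real.sq_sqrt (𝓢.total_nonneg τ), ← mul_pow,
      Real.sqrt_sq (Real.sqrt_nonneg _)]
    exact pow_le_pow_left₀ (by positivity) (by linarith) 2

lemma norm_le_of_root {τ τ' : T} {K : ℝ} {ξ : Nuc H} {x : RSpace d}
    (h : 𝓢.root τ x * ‖iteratedFDeriv ℝ 0 (κ ξ.val) x‖ ≤ K * nucNorm H τ' ξ) :
    ‖κ ξ.val x‖ ≤ K * nucNorm H τ' ξ * (polyWeight x)⁻¹ := by
  rw [norm_iteratedFDeriv_zero] at h
  rw [← div_eq_mul_inv, le_div_iff₀ (polyWeight_pos x), mul_comm]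
  exact (mul_le_mul_of_nonneg_right (𝓢.polyWeight_le_root τ x) (norm_nonneg _)).trans h

include 𝓢 in
lemma exists_integral : ∃ I : CoNuc H, ∀ ξ, I ξ = ∫ x, κ ξ.val x := by
  have := H.nonempty
  obtain ⟨τ', K, hK, h⟩ := 𝓢.exists_iteratedFDeriv_bound this.some 0
  have hb : ∀ (ξ : Nuc H) x, ‖κ ξ.val x‖ ≤ K * nucNorm H τ' ξ * (polyWeight x)⁻¹ := fun ξ x =>
    𝓢.norm_le_of_root (h ξ 0 le_rfl x)
  have hi : ∀ ξ : Nuc H, Integrable (κ ξ.val) := fun ξ =>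
    (integrable_inv_polyWeight.const_mul _).mono' (𝓢.smooth ξ).continuous.aestronglyMeasurable
      (Filter.Eventually.of_forall (hb ξ))
  let L : Nuc H →ₗ[ℂ] ℂ :=
    { toFun := fun ξ => ∫ x, κ ξ.val x
      map_add' := fun ξ η => by
        rw [← integral_add (hi ξ) (hi η)]
        exact congrArg (fun f : RSpace d → ℂ => ∫ x, f x) (map_add κ ξ.val η.val)
      map_smul' := fun c ξ => by
        rw [RingHom.id_apply, smul_eq_mul, ← integral_const_mul]
        exact congrArg (fun f : RSpace d → ℂ => ∫ x, f x) (map_smul κ c ξ.val) }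
  refine ⟨⟨L, continuous_of_bound τ' L (K * ∫ x : RSpace d, (polyWeight x)⁻¹) fun ξ => ?_⟩, fun ξ => rfl⟩
  refine (norm_integral_le_integral_norm _).trans ((integral_mono (hi ξ).norm
    (integrable_inv_polyWeight.const_mul (K * nucNorm H τ' ξ)) (hb ξ)).trans_eq ?_)
  rw [integral_const_mul]
  ring

end SobolevScale

end

/-! ### Pointwise products and reflexivity -/

section

open MeasureTheory

variable {T Φ : Type} [AddCommGroup Φ] [Module ℂ Φ] {H : HilbertScale T Φ} {d : ℕ}

/-- A submultiplicative measure of the size of the derivatives of order at most `m` at `x`. -/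
def jetSize (m : ℕ) (f : RSpace d → ℂ) (x : RSpace d) : ℝ :=
  2 ^ m * ∑ j ∈ Finset.range (m + 1), ‖iteratedFDeriv ℝ j f x‖

lemma jetSize_nonneg (m : ℕ) (f : RSpace d → ℂ) (x : RSpace d) : 0 ≤ jetSize m f x :=
  mul_nonneg (by positivity) (Finset.sum_nonneg fun _ _ => norm_nonneg _)

lemma norm_le_jetSize {m j : ℕ} (hj : j ≤ m) (f : RSpace d → ℂ) (x : RSpace d) :
    ‖iteratedFDeriv ℝ j f x‖ ≤ jetSize m f x := by
  refine (Finset.single_le_sum (f := fun j => ‖iteratedFDeriv ℝ j f x‖) (fun _ _ => norm_nonneg _)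
    (Finset.mem_range.2 (Nat.lt_succ_of_le hj))).trans ?_
  exact le_mul_of_one_le_left (Finset.sum_nonneg fun _ _ => norm_nonneg _)
    (one_le_pow₀ one_le_two)

/-- By Leibniz' rule each derivative of the product is at most `2 ^ m` times the product of the two
sums of derivatives. The normalization of `jetSize` absorbs this power, and `m + 1` counts the
orders. -/
lemma jetSize_mul_le (m : ℕ) {f g : RSpace d → ℂ} (hf : ContDiff ℝ (⊤ : ℕ∞) f)
    (hg : ContDiff ℝ (⊤ : ℕ∞) g) (x : RSpace d) :
    jetSize m (fun y => f y * g y) x ≤ (m + 1) * (jetSize m f x * jetSize m g x) := by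
  set P := ∑ j ∈ Finset.range (m + 1), ‖iteratedFDeriv ℝ j f x‖
  set Q := ∑ j ∈ Finset.range (m + 1), ‖iteratedFDeriv ℝ j g x‖
  have hP : ∀ j ≤ m, ‖iteratedFDeriv ℝ j f x‖ ≤ P := fun j hj =>
    Finset.single_le_sum (f := fun j => ‖iteratedFDeriv ℝ j f x‖) (fun _ _ => norm_nonneg _)
      (Finset.mem_range.2 (Nat.lt_succ_of_le hj))
  have hQ : ∀ j ≤ m, ‖iteratedFDeriv ℝ j g x‖ ≤ Q := fun j hj =>
    Finset.single_le_sum (f := fun j => ‖iteratedFDeriv ℝ j g x‖) (fun _ _ => norm_nonneg _)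
      (Finset.mem_range.2 (Nat.lt_succ_of_le hj))
  have hP0 : 0 ≤ P := Finset.sum_nonneg fun _ _ => norm_nonneg _
  have h : ∀ j ∈ Finset.range (m + 1), ‖iteratedFDeriv ℝ j (fun y => f y * g y) x‖ ≤
      2 ^ m * (P * Q) := by
    intro j hj
    have hj' : j ≤ m := by simpa [Nat.lt_succ_iff] using hj
    refine (norm_iteratedFDeriv_mul_le hf hg x (n := j) (by exact_mod_cast le_top)).trans ?_
    calc _ ≤ ∑ i ∈ Finset.range (j + 1), (j.choose i : ℝ) * (P * Q) := by
          refine Finset.sum_le_sum fun i hi => ?_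
          have hi' : i ≤ j := by simpa [Nat.lt_succ_iff] using hi
          rw [mul_assoc]
          exact mul_le_mul_of_nonneg_left (mul_le_mul (hP i (by omega)) (hQ _ (by omega))
            (norm_nonneg _) hP0) (Nat.cast_nonneg _)
      _ = 2 ^ j * (P * Q) := by
          rw [← Finset.sum_mul]
          congr 1
          exact_mod_cast Nat.sum_range_choose j
      _ ≤ _ := mul_le_mul_of_nonneg_right (pow_le_pow_right₀ one_le_two hj')
          (mul_nonneg hP0 (Finset.sum_nonneg fun _ _ => norm_nonneg _))
  have h2 := Finset.sum_le_card_nsmul _ _ _ h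
  rw [Finset.card_range, nsmul_eq_mul] at h2
  calc _ ≤ 2 ^ m * (((m + 1 : ℕ) : ℝ) * (2 ^ m * (P * Q))) :=
        mul_le_mul_of_nonneg_left h2 (by positivity)
    _ = _ := by
        change _ = (m + 1) * (2 ^ m * P * (2 ^ m * Q))
        push_cast
        ring

lemma jetSize_prod_le (m : ℕ) {n : ℕ} (f : Fin (n + 1) → RSpace d → ℂ)
    (hf : ∀ i, ContDiff ℝ (⊤ : ℕ∞) (f i)) (x : RSpace d) :
    jetSize m (fun y => ∏ i, f i y) x ≤ ∏ i, (m + 1) * jetSize m (f i) x := by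
  induction n with
  | zero =>
    simp only [Fin.prod_univ_succ, Fin.prod_univ_zero, mul_one]
    exact le_mul_of_one_le_left (jetSize_nonneg _ _ _) (by linarith [Nat.cast_nonneg (α := ℝ) m])
  | succ n ih =>
    rw [Fin.prod_univ_succ]
    simp only [Fin.prod_univ_succ (n := n + 1)]
    refine (jetSize_mul_le m (hf 0) (contDiff_prod fun i _ => hf i.succ) x).trans ?_
    rw [← mul_assoc]
    exact mul_le_mul_of_nonneg_left (ih _ fun i => hf i.succ)
      (mul_nonneg (by positivity) (jetSize_nonneg _ _ _))

namespace SobolevScale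

variable {κ : Φ →ₗ[ℂ] (RSpace d → ℂ)} (𝓢 : SobolevScale H κ)

/-- Submultiplicativity of `(m + 1) * jetSize` reduces the product to its factors, so the constant
is only geometric in their number. As `root ≥ 1`, the single weight may be replaced by one weight
for each factor. -/
lemma exists_prod_bound (τ : T) : ∃ τ' K, 1 ≤ K ∧ ∀ (n : ℕ) (ξ : Fin (n + 1) → Nuc H),
    ∀ j ≤ 𝓢.ord τ, ∀ (i : Fin j → Fin d) x,
      𝓢.root τ x * ‖partialD (fun y => ∏ l, κ (ξ l).val y) j i x‖ ≤
        ∏ l, K * nucNorm H τ' (ξ l) := by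
  set m := 𝓢.ord τ
  obtain ⟨τ', K, hK, h⟩ := 𝓢.exists_iteratedFDeriv_bound τ m
  set B := (m + 1) * (2 ^ m * ((m + 1) * K)) with hB
  have hB0 : 0 ≤ B := by positivity
  have h1 : ∀ (ξ : Nuc H) x, 𝓢.root τ x * ((m + 1) * jetSize m (κ ξ.val) x) ≤
      (B + 1) * nucNorm H τ' ξ := by
    intro ξ x
    have h2 : ∑ j ∈ Finset.range (m + 1), 𝓢.root τ x * ‖iteratedFDeriv ℝ j (κ ξ.val) x‖ ≤
        ((m + 1 : ℕ) : ℝ) * (K * nucNorm H τ' ξ) := by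
      refine (Finset.sum_le_card_nsmul _ _ _ fun j hj => h ξ j (by
        simpa [Nat.lt_succ_iff] using hj) x).trans_eq ?_
      rw [Finset.card_range, nsmul_eq_mul]
    calc _ = (m + 1) * (2 ^ m * ∑ j ∈ Finset.range (m + 1),
          𝓢.root τ x * ‖iteratedFDeriv ℝ j (κ ξ.val) x‖) := by
          rw [jetSize, ← Finset.mul_sum]; ring
      _ ≤ (m + 1) * (2 ^ m * (((m + 1 : ℕ) : ℝ) * (K * nucNorm H τ' ξ))) := by gcongr
      _ = B * nucNorm H τ' ξ := by rw [hB]; push_cast; ring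
      _ ≤ _ := mul_le_mul_of_nonneg_right (by linarith) (apply_nonneg _ _)
  refine ⟨τ', B + 1, by linarith, fun n ξ j hj i x => ?_⟩
  have hr := 𝓢.one_le_root τ x
  calc _ ≤ 𝓢.root τ x * ∏ l, (m + 1) * jetSize m (κ (ξ l).val) x :=
        mul_le_mul_of_nonneg_left (((partialD_norm_le _ _ _ _).trans (norm_le_jetSize hj _ _)).trans
          (jetSize_prod_le m _ (fun l => 𝓢.smooth (ξ l)) x)) (𝓢.root_pos τ x).le
    _ ≤ 𝓢.root τ x ^ (n + 1) * ∏ l, (m + 1) * jetSize m (κ (ξ l).val) x :=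
        mul_le_mul_of_nonneg_right (le_self_pow₀ hr (Nat.succ_ne_zero n))
          (Finset.prod_nonneg fun l _ => mul_nonneg (by positivity) (jetSize_nonneg _ _ _))
    _ = ∏ l, 𝓢.root τ x * ((m + 1) * jetSize m (κ (ξ l).val) x) := by
        rw [Finset.prod_mul_distrib (f := fun _ => 𝓢.root τ x), Finset.prod_const, Finset.card_univ,
          Fintype.card_fin]
    _ ≤ _ := Finset.prod_le_prod (fun l _ => mul_nonneg (𝓢.root_pos τ x).le
        (mul_nonneg (by positivity) (jetSize_nonneg _ _ _))) fun l _ => h1 (ξ l) x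

lemma wt_mul_sq_le {τ : T} {x : RSpace d} {z : ℂ} {M : ℝ} (h : 𝓢.root τ x * ‖z‖ ≤ M) :
    𝓢.wt τ x * ‖z‖ ^ 2 ≤ M ^ 2 := by
  have h1 := pow_le_pow_left₀ (mul_nonneg (𝓢.root_pos τ x).le (norm_nonneg _)) h 2
  rw [mul_pow, 𝓢.root_sq] at h1
  refine le_trans (mul_le_mul_of_nonneg_right ?_ (sq_nonneg _)) h1
  exact le_mul_of_one_le_right (zero_le_one.trans (𝓢.one_le_wt τ x))
    (one_le_pow₀ (one_le_polyWeight x))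

include 𝓢 in
lemma exists_prod {n : ℕ} (hn : n ≠ 0) (ξ : Fin n → Nuc H) :
    ∃ η : Nuc H, ∀ x, κ η.val x = ∏ l, κ (ξ l).val x := by
  obtain ⟨n, rfl⟩ := Nat.exists_eq_succ_of_ne_zero hn
  obtain ⟨η, hη⟩ := 𝓢.complete (fun y => ∏ l, κ (ξ l).val y)
    (contDiff_prod fun l _ => 𝓢.smooth (ξ l)) fun τ => by
      obtain ⟨τ', K, -, h⟩ := 𝓢.exists_prod_bound τ
      exact ⟨_, fun j hj i x => 𝓢.wt_mul_sq_le (h n ξ j hj i x)⟩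
  exact ⟨η, fun x => congrFun hη x⟩

include 𝓢 in
lemma ext {ξ η : Nuc H} (h : ∀ x, κ ξ.val x = κ η.val x) : ξ = η := 𝓢.injective (funext h)

/-- Evaluation at a point. -/
def evalPt (κ : Φ →ₗ[ℂ] (RSpace d → ℂ)) (H : HilbertScale T Φ) (x : RSpace d) : Nuc H →ₗ[ℂ] ℂ :=
  (LinearMap.proj x : (RSpace d → ℂ) →ₗ[ℂ] ℂ) ∘ₗ κ

/-- The pointwise product of several functions. -/
def prod (n : ℕ) (hn : n ≠ 0) : MultilinearMap ℂ (fun _ : Fin n => Nuc H) (Nuc H) where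
  toFun ξ := (𝓢.exists_prod hn ξ).choose
  map_update_add' ξ i η ζ := by
    refine 𝓢.ext fun x => ?_
    have h := ((MultilinearMap.mkPiAlgebra ℂ (Fin n) ℂ).compLinearMap
      fun _ => evalPt κ H x).map_update_add ξ i η ζ
    refine ((𝓢.exists_prod hn _).choose_spec x).trans (h.trans ?_)
    refine (congrArg₂ (· + ·) ((𝓢.exists_prod hn _).choose_spec x).symm
      ((𝓢.exists_prod hn _).choose_spec x).symm).trans ?_
    exact (map_add (evalPt κ H x) _ _).symm
  map_update_smul' ξ i c η := by
    refine 𝓢.ext fun x => ?_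
    have h := ((MultilinearMap.mkPiAlgebra ℂ (Fin n) ℂ).compLinearMap
      fun _ => evalPt κ H x).map_update_smul ξ i c η
    refine ((𝓢.exists_prod hn _).choose_spec x).trans (h.trans ?_)
    refine (congrArg (c • ·) ((𝓢.exists_prod hn _).choose_spec x).symm).trans ?_
    exact (map_smul (evalPt κ H x) _ _).symm

lemma prod_apply (n : ℕ) (hn : n ≠ 0) (ξ : Fin n → Nuc H) (x : RSpace d) :
    κ (𝓢.prod n hn ξ).val x = ∏ l, κ (ξ l).val x := (𝓢.exists_prod hn ξ).choose_spec x

lemma exists_nucNorm_prod_le (τ : T) : ∃ τ' C, 0 < C ∧ ∀ n hn ξ,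
    nucNorm H τ (𝓢.prod n hn ξ) ≤ C ^ n * ∏ i, nucNorm H τ' (ξ i) := by
  obtain ⟨τ', K, hK, h⟩ := 𝓢.exists_prod_bound τ
  refine ⟨τ', (√(𝓢.total τ) + 1) * K, by positivity, fun n hn ξ => ?_⟩
  obtain ⟨n, rfl⟩ := Nat.exists_eq_succ_of_ne_zero hn
  have h0 : 0 ≤ ∏ l, K * nucNorm H τ' (ξ l) :=
    Finset.prod_nonneg fun l _ => mul_nonneg (zero_le_one.trans hK) (apply_nonneg _ _)
  have h1 := 𝓢.nucNorm_le (τ := τ) (ξ := 𝓢.prod _ hn ξ) h0 fun j hj i x => by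
    rw [show κ (𝓢.prod _ hn ξ).val = fun y => ∏ l, κ (ξ l).val y from
      funext (𝓢.prod_apply _ hn ξ)]
    exact h n ξ j hj i x
  refine h1.trans ?_
  rw [mul_pow, mul_assoc, ← Fin.prod_const (n + 1) K, ← Finset.prod_mul_distrib]
  refine mul_le_mul_of_nonneg_right ?_ h0
  exact (le_add_of_nonneg_right zero_le_one).trans
    (le_self_pow₀ (le_add_of_nonneg_left (Real.sqrt_nonneg _)) (Nat.succ_ne_zero n))

end SobolevScale

/-- A functional on `Φ'` that is bounded on bounded sets is approximately the evaluation at an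
element of `Φ`. -/
lemma IsNuclear.exists_approx (hH : IsNuclear H) {L : CoNuc H →ₗ[ℂ] ℂ}
    (hL : ∀ τ, ∃ K, ∀ ω C, DualLE H τ C ω → ‖L ω‖ ≤ K * C) (τ : T) {ε : ℝ} (hε : 0 < ε) :
    ∃ ξ : Nuc H, ∀ ω C, DualLE H τ C ω → ‖L ω - ω ξ‖ ≤ ε * C := by
  obtain ⟨τ', k, hk⟩ := hH τ
  obtain ⟨K, hK⟩ := hL τ'
  obtain ⟨N, ξ, ω, h⟩ := HSLE.exists_finite_rank (H := H) (τ := τ) (τ' := τ') (κ := k) hk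
    (ε := ε / (|K| + 1)) (by positivity)
  -- The identity of `Φ` is approximated by the finite rank operator `∑ₖ ωₖ ⊗ ξₖ`; applying `L` to
  -- its transpose yields the evaluation at this vector.
  refine ⟨∑ k, L (ω k) • ξ k, fun η C hη => ?_⟩
  have h1 : DualLE H τ' (C * (ε / (|K| + 1))) (η - ∑ k, η (ξ k) • ω k) := by
    refine ⟨mul_nonneg hη.1 (by positivity), fun ζ => ?_⟩
    have e : (η - ∑ k, η (ξ k) • ω k) ζ = η (ζ - ∑ k, ω k ζ • ξ k) := by
      rw [map_sub, map_sum, sub_apply, sum_apply]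
      congr 1
      exact Finset.sum_congr rfl fun k _ => by rw [map_smul, smul_apply, smul_eq_mul, smul_eq_mul, mul_comm]
    rw [e, mul_assoc]
    exact (hη.2 _).trans (mul_le_mul_of_nonneg_left (h ζ) hη.1)
  have e : L η - η (∑ k, L (ω k) • ξ k) = L (η - ∑ k, η (ξ k) • ω k) := by
    rw [map_sub, map_sum, map_sum]
    congr 1
    exact Finset.sum_congr rfl fun k _ => by rw [map_smul, map_smul, smul_eq_mul, smul_eq_mul, mul_comm]
  rw [e]
  refine (hK _ _ h1).trans ?_
  have h2 : K * (C * (ε / (|K| + 1))) ≤ |K| * (C * (ε / (|K| + 1))) :=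
    mul_le_mul_of_nonneg_right (le_abs_self K) h1.1
  refine h2.trans ?_
  have h3 : |K| / (|K| + 1) ≤ 1 := (div_le_one (by positivity)).2 (by linarith)
  calc _ = (|K| / (|K| + 1)) * (ε * C) := by ring
    _ ≤ _ := mul_le_of_le_one_left (mul_nonneg hε.le hη.1) h3

lemma partialD_sub {f g : RSpace d → ℂ} (hf : ContDiff ℝ (⊤ : ℕ∞) f) (hg : ContDiff ℝ (⊤ : ℕ∞) g)
    (j : ℕ) (i : Fin j → Fin d) (x : RSpace d) :
    partialD (f - g) j i x = partialD f j i x - partialD g j i x := by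
  have h := partialD_add (hf.sub hg) hg j i x
  have e : (fun y => f y - g y) + g = f := by funext y; simp
  rw [e] at h
  exact eq_sub_of_add_eq h.symm

/-- A function all of whose candidate derivatives are uniform limits of derivatives is smooth. -/
lemma contDiff_of_approx {f : ℕ → RSpace d → ℂ} (hf : ∀ n, ContDiff ℝ (⊤ : ℕ∞) (f n))
    {G : (j : ℕ) → (Fin j → Fin d) → RSpace d → ℂ}
    (h : ∀ n, ∀ j ≤ n, ∀ i x, ‖G j i x - partialD (f n) j i x‖ ≤ (1 / 2) ^ n) :
    ContDiff ℝ (⊤ : ℕ∞) (G 0 Fin.elim0) ∧ ∀ j i x, partialD (G 0 Fin.elim0) j i x = G j i x := by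
  have hsum : ∀ N, ∀ j ≤ N, ∀ (i : Fin j → Fin d) x,
      (∀ n, ‖partialD (f (N + (n + 1)) - f (N + n)) j i x‖ ≤ 2 * (1 / 2) ^ n) ∧
      HasSum (fun n => partialD (f (N + (n + 1)) - f (N + n)) j i x)
        (G j i x - partialD (f N) j i x) := by
    intro N j hj i x
    have hb : ∀ n, ‖G j i x - partialD (f (N + n)) j i x‖ ≤ (1 / 2) ^ n := fun n =>
      (h _ j (by omega) i x).trans (pow_le_pow_of_le_one (by norm_num) (by norm_num) (by omega))
    have h1 : ∀ n, ‖partialD (f (N + (n + 1)) - f (N + n)) j i x‖ ≤ 2 * (1 / 2) ^ n := by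
      intro n
      rw [partialD_sub (hf _) (hf _)]
      have e : partialD (f (N + (n + 1))) j i x - partialD (f (N + n)) j i x =
          (G j i x - partialD (f (N + n)) j i x) - (G j i x - partialD (f (N + (n + 1))) j i x) := by
        ring
      rw [e, two_mul]
      exact (norm_sub_le _ _).trans (add_le_add (hb n) ((hb (n + 1)).trans
        (pow_le_pow_of_le_one (by norm_num) (by norm_num) (by omega))))
    refine ⟨h1, ?_⟩
    have hs : Summable fun n => partialD (f (N + (n + 1)) - f (N + n)) j i x :=
      Summable.of_norm_bounded ((summable_geometric_of_lt_one (by norm_num) (by norm_num)).mul_left 2) h1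
    rw [hs.hasSum_iff_tendsto_nat]
    have e : ∀ n, ∑ k ∈ Finset.range n, partialD (f (N + (k + 1)) - f (N + k)) j i x =
        partialD (f (N + n)) j i x - partialD (f N) j i x := by
      intro n
      simp only [partialD_sub (hf _) (hf _)]
      exact Finset.sum_range_sub (fun k => partialD (f (N + k)) j i x) n
    simp only [e]
    refine Filter.Tendsto.sub_const ?_ _
    rw [tendsto_iff_norm_sub_tendsto_zero]
    refine squeeze_zero (fun _ => norm_nonneg _) (fun n => (norm_sub_rev _ _).trans_le (hb n)) ?_
    exact tendsto_pow_atTop_nhds_zero_of_lt_one (by norm_num) (by norm_num)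
  have hg : ∀ N n, ContDiff ℝ (⊤ : ℕ∞) (f (N + (n + 1)) - f (N + n)) := fun N n =>
    (hf _).sub (hf _)
  -- The hypothesis controls derivatives of order `j` only from the index `j` on. Therefore the
  -- telescoping series starts at `N`; its derivatives up to order `N` converge uniformly.
  have hF : ∀ N, G 0 Fin.elim0 =
      f N + fun x => ∑' n, (f (N + (n + 1)) - f (N + n)) x := by
    intro N
    funext x
    have h1 := (hsum N 0 (by omega) Fin.elim0 x).2.tsum_eq
    have h2 : ∀ g : RSpace d → ℂ, partialD g 0 Fin.elim0 x = g x := fun g => rfl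
    simp only [h2] at h1
    rw [Pi.add_apply, h1]
    ring
  have hv : ∀ k : ℕ, Summable fun n : ℕ => (d : ℝ) ^ k * (2 * (1 / 2) ^ n) := fun k =>
    ((summable_geometric_of_lt_one (by norm_num) (by norm_num)).mul_left 2).mul_left _
  have hD : ∀ (N k n : ℕ) (x : RSpace d), (k : ℕ∞) ≤ N →
      ‖iteratedFDeriv ℝ k (f (N + (n + 1)) - f (N + n)) x‖ ≤ (d : ℝ) ^ k * (2 * (1 / 2) ^ n) := by
    intro N k n x hk
    have hk' : k ≤ N := by exact_mod_cast hk
    refine (norm_iteratedFDeriv_le_sum _ k x).trans ?_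
    refine (Finset.sum_le_card_nsmul _ _ _ fun i _ => (hsum N k hk' i x).1 n).trans_eq ?_
    simp
  have hS : ∀ N : ℕ, ContDiff ℝ N (fun x => ∑' n, (f (N + (n + 1)) - f (N + n)) x) := fun N =>
    contDiff_tsum (N := (N : ℕ∞)) (fun n => (hg N n).of_le (by exact_mod_cast le_top))
      (fun k _ => hv k) (fun k n x hk => hD N k n x (by exact_mod_cast hk))
  refine ⟨contDiff_infty.2 fun N => ?_, fun j i x => ?_⟩
  · rw [hF N]
    exact ((hf N).of_le (by exact_mod_cast le_top)).add (hS N)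
  · have h1 := iteratedFDeriv_add_apply (𝕜 := ℝ) (i := j) (x := x)
      ((hf j).of_le (by exact_mod_cast le_top)).contDiffAt (hS j).contDiffAt
    have h2 := iteratedFDeriv_tsum_apply (𝕜 := ℝ) (N := (j : ℕ∞))
      (f := fun n => f (j + (n + 1)) - f (j + n))
      (fun n => (hg j n).of_le (by exact_mod_cast le_top))
      (fun k _ => hv k) (fun k n x hk => hD j k n x (by exact_mod_cast hk)) (k := j) le_rfl x
    have h3 : Summable fun n => iteratedFDeriv ℝ j (f (j + (n + 1)) - f (j + n)) x :=
      Summable.of_norm_bounded (hv j) fun n => hD j j n x le_rfl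
    have h4 := (applyBasis i).map_tsum h3
    have h5 := (hsum j j le_rfl i x).2.tsum_eq
    have h6 : partialD (G 0 Fin.elim0) j i x = applyBasis i (iteratedFDeriv ℝ j (G 0 Fin.elim0) x) := rfl
    rw [h6, hF j, h1, map_add, h2, h4]
    change partialD (f j) j i x + ∑' n, partialD (f (j + (n + 1)) - f (j + n)) j i x = _
    rw [h5]
    ring

namespace SobolevScale

variable {κ : Φ →ₗ[ℂ] (RSpace d → ℂ)} (𝓢 : SobolevScale H κ)

include 𝓢 in
-- The candidate is `x ↦ L(δ_x)`. It is a uniform limit, with all derivatives, of elements of `Φ`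
-- that approximate `L`, hence smooth with derivatives `L` of the derivatives of `δ_x`. The bounds
-- of `L` on these functionals give the decay that places the candidate in `Φ`.
lemma reflexive {L : CoNuc H →ₗ[ℂ] ℂ}
    (hL : ∀ τ, ∃ K, ∀ ω C, DualLE H τ C ω → ‖L ω‖ ≤ K * C) : ∃ ξ, ∀ ω, L ω = ω ξ := by
  have := H.nonempty
  set σ := this.some
  choose τ K hK hd using 𝓢.exists_dualLE_delta σ
  have hε : ∀ n, 0 < (1 / 2) ^ n / (K n + 1) := fun n => by
    have := hK n
    positivity
  choose ζ hζ using fun n => 𝓢.isNuclear.exists_approx hL (τ n) (hε n)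
  obtain ⟨hF, hder⟩ := contDiff_of_approx (f := fun n => κ (ζ n).val)
    (G := fun j i x => L (𝓢.delta j i x)) (fun n => 𝓢.smooth (ζ n)) fun n j hj i x => by
      have hr := 𝓢.one_le_root σ x
      refine (hζ n _ _ (hd n j hj i x)).trans ?_
      have h1 : K n / 𝓢.root σ x ≤ K n + 1 := (div_le_self (hK n) hr).trans (by linarith)
      calc _ ≤ (1 / 2) ^ n / (K n + 1) * (K n + 1) := mul_le_mul_of_nonneg_left h1 (hε n).le
        _ = _ := div_mul_cancel₀ _ (by linarith [hK n])
  obtain ⟨ξ, hξ⟩ := 𝓢.complete _ hF fun τ => by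
    obtain ⟨τ', B, hB, h⟩ := 𝓢.exists_dualLE_delta τ (𝓢.ord τ)
    obtain ⟨M, hM⟩ := hL τ'
    refine ⟨(M * B) ^ 2, fun j hj i x => ?_⟩
    rw [hder]
    refine 𝓢.wt_mul_sq_le (?_ : _ ≤ M * B)
    have h1 := hM _ _ (h j hj i x)
    have hr := 𝓢.root_pos τ x
    rw [← mul_div_assoc, le_div_iff₀ hr] at h1
    linarith
  refine ⟨ξ, fun ω => ?_⟩
  obtain ⟨τ, C, hω⟩ := exists_dualLE ω
  obtain ⟨τ', B, hB, h⟩ := 𝓢.exists_dualLE_delta τ (𝓢.ord τ)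
  obtain ⟨τ₁, D, hD, hle⟩ := nucNorm_directed H τ τ'
  have hωτ := hω.of_le hD fun ξ => (hle ξ).1
  -- For a general `ω` an element `η` approximating `L` is inserted. The norm of `ξ - η` is
  -- controlled by its derivatives at points, which are the differences of `L` and evaluation at `η`
  -- on derivatives of delta functions.
  have key : ∀ ε > 0, ‖L ω - ω ξ‖ ≤ ε * (C * D + C * (√(𝓢.total τ) * (B * D))) := by
    intro ε hε
    obtain ⟨η, hη⟩ := 𝓢.isNuclear.exists_approx hL τ₁ hε
    have h1 : nucNorm H τ (ξ - η) ≤ √(𝓢.total τ) * (ε * (B * D)) := by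
      refine 𝓢.nucNorm_le (by positivity) fun j hj i x => ?_
      have h2 := hη _ _ ((h j hj i x).of_le hD fun ξ => (hle ξ).2)
      have h3 : L (𝓢.delta j i x) = partialD (κ ξ.val) j i x := by rw [hξ]; exact (hder j i x).symm
      have h4 : partialD (κ (ξ - η).val) j i x = L (𝓢.delta j i x) - 𝓢.delta j i x η := by
        rw [h3, ← 𝓢.delta_apply, map_sub, 𝓢.delta_apply j i x ξ]
      rw [h4]
      refine (mul_le_mul_of_nonneg_left h2 (𝓢.root_pos τ x).le).trans_eq ?_
      have := (𝓢.root_pos τ x).ne'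
      field_simp
    have e : L ω - ω ξ = (L ω - ω η) - ω (ξ - η) := by rw [map_sub]; ring
    rw [e, mul_add]
    refine (norm_sub_le _ _).trans (add_le_add (hη _ _ hωτ) ((hω.2 _).trans ?_))
    refine (mul_le_mul_of_nonneg_left h1 hω.1).trans_eq ?_
    ring
  have h0 : ‖L ω - ω ξ‖ ≤ 0 := by
    have ht : Filter.Tendsto (fun ε : ℝ => ε * (C * D + C * (√(𝓢.total τ) * (B * D))))
        (𝓝[>] 0) (𝓝 (0 * (C * D + C * (√(𝓢.total τ) * (B * D))))) :=
      (tendsto_nhdsWithin_of_tendsto_nhds Filter.tendsto_id).mul_const _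
    rw [zero_mul] at ht
    exact ge_of_tendsto ht (Filter.eventually_of_mem self_mem_nhdsWithin fun ε hε => key ε hε)
  exact sub_eq_zero.1 (norm_le_zero_iff.1 h0)

/-- A scale of Sobolev spaces has all the properties needed for lifting. -/
def funScale : FunScale H κ where
  injective := 𝓢.injective
  nuclear := 𝓢.isNuclear
  mul n := if hn : n = 0 then 0 else 𝓢.prod n hn
  mul_nil := dif_pos rfl
  mul_apply n hn ξ x := by
    rw [dif_neg hn]
    exact 𝓢.prod_apply n hn ξ x
  mul_bound τ := by
    obtain ⟨τ', C, hC, h⟩ := 𝓢.exists_nucNorm_prod_le τ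
    refine ⟨τ', C, hC, fun n ξ => ?_⟩
    split_ifs with hn
    · rw [zero_apply, map_zero]
      exact mul_nonneg (by positivity) (Finset.prod_nonneg fun i _ => apply_nonneg _ _)
    · exact h n hn ξ
  integral := 𝓢.exists_integral.choose
  integral_apply := 𝓢.exists_integral.choose_spec
  reflexive _ hL := 𝓢.reflexive hL

end SobolevScale

end

/-! ### The Schwartz space and the space of test functions -/

section

open MeasureTheory

variable {d : ℕ}

/-- The Schwartz space as a scale of Sobolev spaces. -/
def schwartzSobolev (d : ℕ) : SobolevScale (schwartzScale d) (schwartzCoe d) where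
  ord m := m
  wt m x := (1 + ‖x‖ ^ 2) ^ m
  one_le_wt m x := one_le_pow₀ (by nlinarith [sq_nonneg ‖x‖])
  injective := DFunLike.coe_injective
  smooth ξ := ξ.val.smooth ⊤
  norm_sq m ξ := by
    rw [nucNorm_eq]
    refine (Real.sq_sqrt (((schwartzScale d).core m).re_inner_nonneg ξ.val)).trans ?_
    change (sobolevInner m _ (schwartzCoe d ξ.val) (schwartzCoe d ξ.val)).re = _
    rw [sobolevInner_self, Complex.ofReal_re]
  integrable m ξ j i := integrable_sq (schwartz_integrable m ξ.val ξ.val j i)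
  exists_weight m n := by
    have hv : (fun x : RSpace d => (1 + ‖x‖ ^ 2) ^ (m + (d + 1))).HasTemperateGrowth :=
      ((Function.HasTemperateGrowth.const 1).add
        (Function.hasTemperateGrowth_norm_sq (RSpace d))).pow _
    obtain ⟨k, C, hC, h⟩ := hv.norm_iteratedFDeriv_le_uniform n
    -- In this scale the index is both the order and the exponent of the weight. It must reach `n`
    -- for the order, and `k + (d + 1)` to dominate the square of a derivative of growth `(1 + ‖x‖)
    -- ^ k` times `polyWeight`.
    refine ⟨_, hv.1, fun x => ?_, max n (k + (d + 1)), C ^ 2 * 2 ^ k, le_max_left _ _, by positivity,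
      fun l hl x => ?_⟩
    · have h1 : (1 : ℝ) ≤ 1 + ‖x‖ ^ 2 := by nlinarith [sq_nonneg ‖x‖]
      rw [polyWeight, ← pow_mul, ← pow_mul, ← pow_add]
      exact pow_le_pow_right₀ h1 (by omega)
    · have h1 : (1 : ℝ) ≤ 1 + ‖x‖ ^ 2 := by nlinarith [sq_nonneg ‖x‖]
      have h2 : (1 + ‖x‖) ^ 2 ≤ 2 * (1 + ‖x‖ ^ 2) := by nlinarith [sq_nonneg (1 - ‖x‖)]
      calc _ ≤ (C * (1 + ‖x‖) ^ k) ^ 2 * polyWeight x :=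
            mul_le_mul_of_nonneg_right (pow_le_pow_left₀ (norm_nonneg _) (h l hl x) 2)
              (polyWeight_pos x).le
        _ = C ^ 2 * ((1 + ‖x‖) ^ 2) ^ k * polyWeight x := by rw [mul_pow, pow_right_comm]
        _ ≤ C ^ 2 * (2 * (1 + ‖x‖ ^ 2)) ^ k * polyWeight x := by
            have := (polyWeight_pos x).le
            gcongr
        _ = C ^ 2 * 2 ^ k * (1 + ‖x‖ ^ 2) ^ (k + (d + 1)) := by
            rw [polyWeight, mul_pow, pow_add]; ring
        _ ≤ _ := mul_le_mul_of_nonneg_left (pow_le_pow_right₀ h1 (le_max_right _ _)) (by positivity)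
  complete F hF h := by
    refine ⟨(⟨F, hF, fun k n => ?_⟩ : 𝓢(RSpace d, ℂ)), rfl⟩
    obtain ⟨K, hK⟩ := h (max k n)
    refine ⟨(d : ℝ) ^ n * √K, fun x => ?_⟩
    have h1 : ∀ i : Fin n → Fin d, ‖x‖ ^ k * ‖partialD F n i x‖ ≤ √K := by
      intro i
      refine Real.le_sqrt_of_sq_le ((hK n (le_max_right _ _) i x).trans' ?_)
      rw [mul_pow]
      refine mul_le_mul_of_nonneg_right ?_ (sq_nonneg _)
      have h2 : (1 : ℝ) ≤ 1 + ‖x‖ ^ 2 := by nlinarith [sq_nonneg ‖x‖]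
      rw [← pow_mul, mul_comm k, pow_mul]
      exact (pow_le_pow_left₀ (sq_nonneg _) (by linarith) k).trans
        (pow_le_pow_right₀ h2 (le_max_left _ _))
    calc _ ≤ ‖x‖ ^ k * ∑ i : Fin n → Fin d, ‖partialD F n i x‖ :=
          mul_le_mul_of_nonneg_left (norm_iteratedFDeriv_le_sum F n x) (by positivity)
      _ = ∑ i : Fin n → Fin d, ‖x‖ ^ k * ‖partialD F n i x‖ := Finset.mul_sum _ _ _
      _ ≤ ∑ _i : Fin n → Fin d, √K := Finset.sum_le_sum fun i _ => h1 i
      _ = _ := by simp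

/-- A locally bounded function has a smooth majorant. -/
lemma exists_contDiff_majorant (g : RSpace d → ℝ) (hg : ∀ x, ∃ c, ∀ᶠ y in 𝓝 x, g y ≤ c) :
    ∃ w : RSpace d → ℝ, ContDiff ℝ (⊤ : ℕ∞) w ∧ ∀ x, g x ≤ w x := by
  obtain ⟨w, hw⟩ := exists_contMDiffMap_forall_mem_convex_of_local_const
    (n := (⊤ : ℕ∞)) (modelWithCornersSelf ℝ (RSpace d)) (t := fun x => Set.Ici (g x))
    (fun x => convex_Ici _) hg
  exact ⟨w, contMDiff_iff_contDiff.1 w.contMDiff, hw⟩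

lemma polyWeight_contDiff : ContDiff ℝ (⊤ : ℕ∞) (polyWeight (d := d)) :=
  (contDiff_const.add (contDiff_norm_sq ℝ)).pow _

/-- A function that remains bounded when multiplied by any weight vanishes far from the origin. -/
lemma exists_forall_eq_zero {F : RSpace d → ℂ} (h : ∀ w : RSpace d → ℝ, ContDiff ℝ (⊤ : ℕ∞) w →
    (∀ x, 1 ≤ w x) → ∃ K, ∀ x, w x * ‖F x‖ ^ 2 ≤ K) : ∃ R : ℝ, ∀ x, R < ‖x‖ → F x = 0 := by
  by_contra hcon
  push Not at hcon
  choose x hx hF using fun n : ℕ => hcon n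
  -- If `F` is nonzero at points `x n` of norm greater than `n`, a weight of size at least `n / ‖F
  -- (x n)‖ ^ 2` at `x n` makes the product unbounded. The step function `s ⌈‖y‖⌉₊` contains this
  -- term as soon as `‖y‖ > n` and is locally bounded, so it has a smooth majorant.
  let s : ℕ → ℝ := fun N => 1 + ∑ n ∈ Finset.range N, (n : ℝ) / ‖F (x n)‖ ^ 2
  have hs : Monotone s := fun M N hMN => add_le_add le_rfl
    (Finset.sum_le_sum_of_subset_of_nonneg (Finset.range_mono hMN) fun n _ _ => by positivity)
  obtain ⟨w, hw, hle⟩ := exists_contDiff_majorant (fun y : RSpace d => s ⌈‖y‖⌉₊) fun y => by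
    refine ⟨s ⌈‖y‖ + 1⌉₊, ?_⟩
    filter_upwards [continuous_norm.continuousAt.eventually_lt_const (lt_add_one ‖y‖)] with z hz
    exact hs (Nat.ceil_mono hz.le)
  have h1 : ∀ y, 1 ≤ w y := fun y => (hle y).trans' (le_add_of_nonneg_right
    (Finset.sum_nonneg fun n _ => by positivity))
  obtain ⟨K, hK⟩ := h w hw h1
  obtain ⟨n, hn⟩ := exists_nat_gt K
  have hpos : 0 < ‖F (x n)‖ ^ 2 := pow_pos (norm_pos_iff.2 (hF n)) 2
  have h2 : (n : ℝ) / ‖F (x n)‖ ^ 2 ≤ w (x n) := by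
    refine le_trans ?_ (hle (x n))
    have h3 := Finset.single_le_sum (f := fun n : ℕ => (n : ℝ) / ‖F (x n)‖ ^ 2)
      (s := Finset.range ⌈‖x n‖⌉₊) (fun n _ => by positivity)
      (Finset.mem_range.2 (Nat.lt_ceil.2 (hx n)))
    exact h3.trans (le_add_of_nonneg_left zero_le_one)
  rw [div_le_iff₀ hpos] at h2
  linarith [hK (x n)]

/-- The space of test functions as a scale of Sobolev spaces. -/
def testSobolev (d : ℕ) : SobolevScale (testScale d) (testCoe d) where
  ord τ := τ.1.1
  wt τ := τ.1.2
  one_le_wt τ := τ.2.2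
  injective := DFunLike.coe_injective
  smooth ξ := ξ.val.contDiff
  norm_sq τ ξ := by
    rw [nucNorm_eq]
    refine (Real.sq_sqrt (((testScale d).core τ).re_inner_nonneg ξ.val)).trans ?_
    change (sobolevInner τ.1.1 τ.1.2 (testCoe d ξ.val) (testCoe d ξ.val)).re = _
    rw [sobolevInner_self, Complex.ofReal_re]
  integrable τ ξ j i := integrable_sq (test_integrable τ.2.1.continuous ξ.val ξ.val j i)
  exists_weight τ n := by
    have hv : ContDiff ℝ (⊤ : ℕ∞) fun x => τ.1.2 x * polyWeight x ^ 2 :=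
      τ.2.1.mul (polyWeight_contDiff.pow 2)
    set v : RSpace d → ℝ := fun x => τ.1.2 x * polyWeight x ^ 2
    -- Every continuous function lies below some weight of this scale, so the derivatives of `v`
    -- need no estimate.
    let g : RSpace d → ℝ := fun x =>
      1 + ∑ l ∈ Finset.range (n + 1), ‖iteratedFDeriv ℝ l v x‖ ^ 2 * polyWeight x
    have hg : Continuous g := continuous_const.add (continuous_finsetSum _ fun l _ =>
      ((hv.continuous_iteratedFDeriv (by exact_mod_cast le_top)).norm.pow 2).mul
        polyWeight_contDiff.continuous)
    obtain ⟨w, hw, hle⟩ := exists_contDiff_majorant g fun x => ⟨g x + 1,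
      (hg.continuousAt.eventually_lt_const (lt_add_one (g x))).mono fun y hy => hy.le⟩
    have hterm : ∀ (x : RSpace d) (l : ℕ), 0 ≤ ‖iteratedFDeriv ℝ l v x‖ ^ 2 * polyWeight x := fun x l =>
      mul_nonneg (sq_nonneg _) (polyWeight_pos x).le
    refine ⟨v, hv, fun x => ?_, ⟨(n, w), hw, fun x => (hle x).trans' (le_add_of_nonneg_right
      (Finset.sum_nonneg fun l _ => hterm x l))⟩, 1, le_rfl, zero_le_one, fun l hl x => ?_⟩
    · refine le_self_pow₀ ?_ two_ne_zero
      exact one_le_mul_of_one_le_of_one_le (τ.2.2 x) (one_le_pow₀ (one_le_polyWeight x))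
    · rw [one_mul]
      refine le_trans ?_ (hle x)
      exact (Finset.single_le_sum (f := fun l => ‖iteratedFDeriv ℝ l v x‖ ^ 2 * polyWeight x)
        (fun l _ => hterm x l) (Finset.mem_range.2 (Nat.lt_succ_of_le hl))).trans
        (le_add_of_nonneg_left zero_le_one)
  complete F hF h := by
    -- Already the bounds of order zero, taken for all weights, force compact support.
    obtain ⟨R, hR⟩ := exists_forall_eq_zero (F := F) fun w hw h1 => by
      obtain ⟨K, hK⟩ := h ⟨(0, w), hw, h1⟩
      exact ⟨K, fun x => hK 0 le_rfl Fin.elim0 x⟩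
    have hc : HasCompactSupport F := HasCompactSupport.intro (isCompact_closedBall 0 R) fun x hx =>
      hR x (by simpa using hx)
    exact ⟨(⟨F, hF, hc, fun _ _ => trivial⟩ : TestSpace d), rfl⟩

end

end Sheffer

end

theorem proposition4p1 (d : ℕ) (hd : 1 ≤ d) :
    (∀ (a r : PowerSeries ℂ) (s : ℕ → Polynomial ℂ), Sheffer.IsScalarSheffer a r s →
      Sheffer.IsHolomorphicSeries a → Sheffer.IsHolomorphicSeries r →
        Sheffer.LiftsRegularly (Sheffer.testScale d) (Sheffer.testCoe d) a r ∧
        Sheffer.LiftsRegularly (Sheffer.schwartzScale d) (Sheffer.schwartzCoe d) a r) ∧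
    (∀ s : ℕ → Polynomial ℂ,
      (s = descPochhammer ℂ ∨ s = ascPochhammer ℂ ∨ s = Sheffer.charlier ∨
        ∃ κ : ℝ, -1 ≤ κ ∧ s = Sheffer.laguerre κ) →
      ∃ a r : PowerSeries ℂ, Sheffer.IsScalarSheffer a r s ∧
        Sheffer.IsHolomorphicSeries a ∧ Sheffer.IsHolomorphicSeries r) :=
  ⟨fun _ _ _ hs ha hr =>
    ⟨(Sheffer.testSobolev d).funScale.liftsRegularly ha.growth hr.growth hs.a_zero hs.a_one hs.r_zero,
      (Sheffer.schwartzSobolev d).funScale.liftsRegularly ha.growth hr.growth hs.a_zero hs.a_one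
        hs.r_zero⟩,
    fun _ hs => Sheffer.exists_isScalarSheffer hs⟩
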